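/- Let $\Phi$ be an irreducible reduced crystallographic finite root system in a real vector space $V$, with positive roots $\Phi^+$, simple roots $\alpha_1,\dots,\alpha_r$, Weyl group $W$ with length function $\ell$, reflections $s_\alpha$, and let $\lambda$ be a dominant integral weight. Let $\theta^\vee$ be the highest coroot, $\alpha_0:=-\theta$, let $s_{\alpha,k}(x)=s_\alpha(x)+k\alpha$ be the affine reflection in $H_{\alpha,k}=\{x:\langle x,\alpha^\vee\rangle=k\}$, and let $s_0=s_{\alpha_0,-1}$, $s_i=s_{\alpha_i}$ ($1\le i\le r$) be the generators of the affine Weyl group $W_{\rm aff}$; write $v\mapsto\bar v$ for the linear part. Let $A_\circ=\{x: 0<\langle x,\alpha^\vee\rangle<1\ \forall\alpha\in\Phi^+\}$, and let $v_{-\lambda}\in W_{\rm aff}$ be the element with $v_{-\lambda}(A_\circ)=A_\circ-\lambda$. A *$\lambda$-chain* $\Gamma=(\beta_1,\dots,\beta_n)$ is the sequence $\beta_k=\bar s_{i_1}\cdots\bar s_{i_{k-1}}(\alpha_{i_k})$ given by a reduced decomposition $v_{-\lambda}=s_{i_1}\cdots s_{i_n}$; put $\hat r_k=s_{i_1}\cdots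 s_{i_{k-1}}s_{i_k}s_{i_{k-1}}\cdots s_{i_1}$ and $r_k=s_{\beta_k}$. Write $u\lessdot w$ if $w=us_\beta$ with $\beta\in\Phi^+$ and $\ell(w)=\ell(u)+1$. For $J=\{j_1<\dots<j_s\}\subseteq\{1,\dots,n\}$ put $w(J)=r_{j_1}\cdots r_{j_s}$ and $\mu(J)=-\hat r_{j_1}\cdots\hat r_{j_s}(-\lambda)$; $J$ is *admissible* if $1\lessdot r_{j_1}\lessdot r_{j_1}r_{j_2}\lessdot\cdots\lessdot w(J)$, and $\mathcal A(\Gamma)$ is the set of admissible $J$. *Root operators.* For $J\in\mathcal A(\Gamma)$ and a position $k$, let $j_1<\dots<j_m$ be the elements of $J$ smaller than $k$. Put $\gamma_k=r_{j_1}\cdots r_{j_m}(\beta_k)$, let $|\gamma_k|$ be the positive one of $\pm\gamma_k$, and let $l_k$ be the integer such that $\hat r_{j_1}\cdots\hat r_{j_m}$ maps the fixed hyperplane of $\hat r_k$ onto $H_{-|\gamma_k|,l_k}$. For a simple root $\alpha_p$ let $I(J,p)=\{k:\gamma_k=\pm\alpha_p\}$ and let $M$ be the maximum of $\langle\mu(J),\alpha_p^\vee\rangle$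 and of all $l_k$, $k\in I(J,p)$. The operator $F_p$ is defined on $J$ if $M>0$; then $F_p(J)=(J\setminus\{m\})\cup\{k\}$, where $m$ is the least element of $I(J,p)$ with $l_m=M$ if one exists and $m=\infty$ otherwise, and $k$ is the predecessor of $m$ in $I(J,p)\cup\{\infty\}$. The colored directed graph on $\mathcal A(\Gamma)$ has an arrow of color $p$ from $J$ to $F_p(J)$ whenever the latter is defined. *Yang–Baxter moves.* Suppose that the entries $\beta_{t+1},\dots,\beta_{t+q}$ of a $\lambda$-chain $\Gamma$ are, without repetition, the positive roots of a rank two root system $\overline\Phi\subseteq\Phi$, and that reversing this segment gives the $\lambda$-chain $\Gamma'$. Let $\overline W$ be generated by the reflections in $\overline\Phi$, with simple generators $s_{\beta_{t+1}},s_{\beta_{t+q}}$. Each $x\in W$ is $x=\lfloor x\rfloor\bar x$ with $\lfloor x\rfloor$ the minimal length element of $x\overline W$ and $\bar x\in\overline W$. For $J\in\mathcal A(\Gamma)$ let $a$ and $b$ be the lengths in $\overline W$ of $\bar u$ and $\bar w$, where $u=w(J\cap\{1,\dots,t\})$, $w=w(J\cap\{1,\dots,t+q\})$. The Yang–Baxter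 move $J\mapsto Y(J)$ leaves $J$ unchanged outside $\{t+1,\dots,t+q\}$ and applies to the part of $J$ in the segment (renumbered $1,\dots,q$) the involution $Y_{q,a,b}$: $\emptyset\leftrightarrow\emptyset$ if $a=b$; $\{1\}\leftrightarrow\{q\}$ if $b=a+1$; $\{q-a\}\leftrightarrow\{a+1\}$ if $0<a=b-1<q-1$; $\{1,a+2,\dots,b\}\leftrightarrow\{a+1,\dots,b-1,q\}$ if $0\le a<a+2\le b<q$; $\{1,a+2,\dots,b-1,q\}\leftrightarrow\{a+1,\dots,b\}$ if $0<a<a+2\le b\le q$; $\{1,\dots,q\}\leftrightarrow\{1,\dots,q\}$ if $a=0$, $b=q$. **Statement.** Let $\Gamma$ and $\Gamma'$ be any two $\lambda$-chains. There is exactly one isomorphism of colored directed graphs $\mathcal A(\Gamma)\to\mathcal A(\Gamma')$. Moreover $\Gamma$ and $\Gamma'$ can be related by a sequence of $\lambda$-chains $\Gamma=\Gamma_0,\Gamma_1,\dots,\Gamma_m=\Gamma'$ in which each $\Gamma_i$ arises from $\Gamma_{i-1}$ by reversing a segment as above, and for every such sequence the isomorphism equals the composite $Y_m\circ\cdots\circ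 Y_1$ of the corresponding Yang–Baxter moves. -/

import Mathlib

/-!
Conventions. `P` is a finite irreducible reduced crystallographic real root system with base `b`.
Roots are referred to by their index in `ι`; `P.root i : V` is the root and `P.coroot' i x` is
the pairing of `x` with its coroot. The Weyl group is `P.weylGroup`, acting on `ι` through
`P.weylGroupToPerm`. Positions in a chain of length `n` are numbered `0, 1, …, n - 1`.
-/

namespace AlcovePath

noncomputable section

/-- The length of `g` with respect to a set `T` of generators: the least length of a word in `T`
with product `g` (used only for elements that are products of elements of `T`). -/
def wordLength {G : Type*} [Monoid G] (T : Set G) (g : G) : ℕ :=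
  sInf {n | ∃ l : List G, (∀ x ∈ l, x ∈ T) ∧ l.prod = g ∧ l.length = n}

section RootSystem

variable {ι V V' : Type*} [AddCommGroup V] [Module ℝ V] [AddCommGroup V'] [Module ℝ V']
  {P : RootPairing ι ℝ V V'}

/-- The index of the root `-α`, where `α` has index `i`. -/
def negRoot (P : RootPairing ι ℝ V V') (i : ι) : ι := P.reflectionPerm i i

open scoped Classical in
/-- The index of `|α|`, the positive one of the two roots `α` and `-α`. -/
def absRoot (b : P.Base) (i : ι) : ι := if b.IsPos i then i else negRoot P i

/-- Dominant integral weights. -/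
def IsDominantWeight (b : P.Base) (lam : V) : Prop :=
  (∀ i, ∃ k : ℤ, P.coroot' i lam = k) ∧ ∀ i, b.IsPos i → 0 ≤ P.coroot' i lam

/-- The reflection `s_α` as an element of the Weyl group. -/
def refl (P : RootPairing ι ℝ V V') (i : ι) : P.weylGroup := RootPairing.weylGroup.ofIdx P i

/-- The set of simple reflections. -/
def simpleReflections (b : P.Base) : Set P.weylGroup := refl P '' (b.support : Set ι)

/-- The length function of the Weyl group. -/
def weylLength (b : P.Base) (w : P.weylGroup) : ℕ := wordLength (simpleReflections b) w

/-- `Covers b u w` means that `u` covers `w` in the Bruhat order. -/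
def Covers (b : P.Base) (u w : P.weylGroup) : Prop :=
  (∃ i, b.IsPos i ∧ u = w * refl P i) ∧ weylLength b u = weylLength b w + 1

/-! ### The affine Weyl group and alcoves -/

/-- The affine reflection `s_{α,k} : x ↦ s_α(x) + k α`. -/
def affineReflection (P : RootPairing ι ℝ V V') (i : ι) (k : ℤ) : V ≃ᵃ[ℝ] V :=
  AffineEquiv.constVAdd ℝ V ((k : ℝ) • P.root i) * (P.reflection i).toAffineEquiv

theorem affineReflection_apply (P : RootPairing ι ℝ V V') (i : ι) (k : ℤ) (x : V) :
    affineReflection P i k x = x - (P.coroot' i x - k) • P.root i := by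
  simp [affineReflection, AffineEquiv.mul_def, RootPairing.reflection_apply, sub_smul]
  abel

/-- The affine hyperplane `H_{α,k}`. -/
def hyperplane (P : RootPairing ι ℝ V V') (i : ι) (k : ℝ) : Set V := {x | P.coroot' i x = k}

/-- The fundamental alcove. -/
def fundamentalAlcove (b : P.Base) : Set V :=
  {x | ∀ i, b.IsPos i → 0 < P.coroot' i x ∧ P.coroot' i x < 1}

/-- `w` is the linear part of the affine map `g`. -/
def IsLinearPart (w : P.weylGroup) (g : V ≃ᵃ[ℝ] V) : Prop := ∀ x, g x = w • x + g 0

theorem IsLinearPart.mul {w w' : P.weylGroup} {g g' : V ≃ᵃ[ℝ] V} (h : IsLinearPart w g)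
    (h' : IsLinearPart w' g') : IsLinearPart (w * w') (g * g') := by
  intro x
  rw [AffineEquiv.mul_def, AffineEquiv.trans_apply, AffineEquiv.trans_apply, h' x, h, h (g' 0),
    mul_smul, smul_add, add_assoc]

theorem isLinearPart_one : IsLinearPart (1 : P.weylGroup) (1 : V ≃ᵃ[ℝ] V) := by
  intro x; simp

theorem isLinearPart_affineReflection (i : ι) (k : ℤ) :
    IsLinearPart (refl P i) (affineReflection P i k) := by
  intro x
  have : refl P i • x = P.reflection i x := rfl
  rw [this, affineReflection_apply, affineReflection_apply, RootPairing.reflection_apply]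
  simp only [map_zero, zero_sub, neg_smul, sub_neg_eq_add, sub_smul]
  abel

theorem coroot'_weylGroup_smul (w : P.weylGroup) (i : ι) (x : V) :
    P.coroot' (P.weylGroupToPerm w i) (w • x) = P.coroot' i x := by
  obtain ⟨w, hw⟩ := w
  induction hw using RootPairing.weylGroup.induction generalizing i x with
  | mem j =>
    change P.coroot' (P.reflectionPerm j i) (P.reflection j x) = _
    rw [P.coroot'_reflectionPerm, LinearMap.comp_apply]
    simp
  | one => simp [← Submonoid.one_def]
  | mul w w' hw hw' h h' =>
    have h1 := h (P.weylGroupToPerm ⟨w', hw'⟩ i) ((⟨w', hw'⟩ : P.weylGroup) • x)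
    rw [h' i x] at h1
    exact h1

theorem weylGroup_smul_smul (w : P.weylGroup) (c : ℝ) (x : V) : w • c • x = c • w • x :=
  (P.weylGroupRootRep w).map_smul c x

theorem coroot'_negRoot (i : ι) (x : V) : P.coroot' (negRoot P i) x = -P.coroot' i x := by
  simp [negRoot, RootPairing.coroot_reflectionPerm]

theorem IsLinearPart.conj {w : P.weylGroup} {g : V ≃ᵃ[ℝ] V} (h : IsLinearPart w g) (i : ι)
    (k : ℤ) : ∃ c : ℝ, ∀ x, (g * affineReflection P i k * g⁻¹) x =
      x - (P.coroot' (P.weylGroupToPerm w i) x - c) • P.root (P.weylGroupToPerm w i) := by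
  refine ⟨k + P.coroot' (P.weylGroupToPerm w i) (g 0), fun x => ?_⟩
  obtain ⟨y, rfl⟩ := g.surjective x
  have h1 : (g * affineReflection P i k * g⁻¹) (g y) = g (affineReflection P i k y) := by
    simp [AffineEquiv.mul_def, AffineEquiv.inv_def]
  rw [h1, h, affineReflection_apply, h y, smul_sub, weylGroup_smul_smul, P.weylGroup_apply_root,
    map_add, coroot'_weylGroup_smul]
  simp only [sub_smul, add_smul]
  abel

section Chains

variable [Finite ι] [P.IsRootSystem] [P.IsIrreducible]

theorem exists_highestCoroot (b : P.Base) : ∃ i, ∀ j, b.flip.height j ≤ b.flip.height i := by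
  have : Nonempty ι := by
    by_contra h
    rw [not_nonempty_iff] at h
    have hM := RootPairing.IsIrreducible.nontrivial P
    have hs := RootPairing.IsRootSystem.span_root_eq_top (P := P)
    rw [Set.range_eq_empty, Submodule.span_empty] at hs
    exact bot_ne_top hs
  exact Finite.exists_max _

/-- The index of the root `θ` whose coroot is the highest coroot. -/
def theta (b : P.Base) : ι := (exists_highestCoroot b).choose

/-- The roots `α₀ = -θ, α₁, …, α_r`; the label `none` stands for `0`. -/
def affineSimpleRoot (b : P.Base) : Option b.support → ι
  | none => negRoot P (theta b)
  | some i => i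

/-- The generators `s₀ = s_{α₀,-1}, s₁, …, s_r` of the affine Weyl group. -/
def affineSimple (b : P.Base) : Option b.support → (V ≃ᵃ[ℝ] V)
  | none => affineReflection P (affineSimpleRoot b none) (-1)
  | some i => affineReflection P i 0

/-- The product `s_{i₁} ⋯ s_{iₘ}` in the affine Weyl group. -/
def affineProd (b : P.Base) (word : List (Option b.support)) : V ≃ᵃ[ℝ] V :=
  (word.map (affineSimple b)).prod

/-- The product `s̄_{i₁} ⋯ s̄_{iₘ}` in the Weyl group. -/
def linearProd (b : P.Base) (word : List (Option b.support)) : P.weylGroup :=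
  (word.map fun x => refl P (affineSimpleRoot b x)).prod

/-- A `lam`-chain, presented by the reduced decomposition `s_{i₁} ⋯ s_{iₙ}` of `v_{-lam}` that
determines it; `v_{-lam}` is the element of the affine Weyl group which maps the fundamental
alcove `A` to `A - lam`. The roots and the affine reflections of the chain are `LambdaChain.root`
and `LambdaChain.affineRefl`. -/
structure LambdaChain (b : P.Base) (lam : V) where
  /-- The labels `i₁, …, iₙ`. -/
  word : List (Option b.support)
  maps_alcove : affineProd b word '' fundamentalAlcove b = (fun x => x - lam) '' fundamentalAlcove b
  reduced : word.length = wordLength (Set.range (affineSimple b)) (affineProd b word)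

theorem exists_affineSimple_eq (b : P.Base) (x : Option b.support) :
    ∃ k : ℤ, affineSimple b x = affineReflection P (affineSimpleRoot b x) k := by
  cases x
  · exact ⟨-1, rfl⟩
  · exact ⟨0, rfl⟩

theorem isLinearPart_affineProd (b : P.Base) (word : List (Option b.support)) :
    IsLinearPart (linearProd b word) (affineProd b word) := by
  induction word with
  | nil => exact isLinearPart_one
  | cons x l ih =>
    obtain ⟨k, hk⟩ := exists_affineSimple_eq b x
    have : IsLinearPart (refl P (affineSimpleRoot b x)) (affineSimple b x) :=
      hk ▸ isLinearPart_affineReflection _ _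
    simpa [linearProd, affineProd] using this.mul ih

namespace LambdaChain

variable {b : P.Base} {lam : V}

/-- The number `n` of roots in the chain. -/
def length (Γ : LambdaChain b lam) : ℕ := Γ.word.length

/-- The label in position `k` (meaningful for `k < n`). -/
def label (Γ : LambdaChain b lam) (k : ℕ) : Option b.support := Γ.word.getD k none

/-- The root `β = s̄_{i₁} ⋯ s̄_{iₖ₋₁}(α_{iₖ})` in a given position (meaningful for `k < n`). -/
def root (Γ : LambdaChain b lam) (k : ℕ) : ι :=
  P.weylGroupToPerm (linearProd b (Γ.word.take k)) (affineSimpleRoot b (Γ.label k))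

/-- The affine reflection `r̂ = s_{i₁} ⋯ s_{iₖ₋₁} s_{iₖ} s_{iₖ₋₁} ⋯ s_{i₁}` in a given position
(meaningful for `k < n`). -/
def affineRefl (Γ : LambdaChain b lam) (k : ℕ) : V ≃ᵃ[ℝ] V :=
  affineProd b (Γ.word.take k) * affineSimple b (Γ.label k) * (affineProd b (Γ.word.take k))⁻¹

/-- The product `w(J) = r_{j₁} ⋯ r_{jₛ}` for `J = {j₁ < ⋯ < jₛ}`. -/
def weyl (Γ : LambdaChain b lam) (J : Finset ℕ) : P.weylGroup :=
  ((J.sort (· ≤ ·)).map fun j => refl P (Γ.root j)).prod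

/-- The product `r̂_{j₁} ⋯ r̂_{jₛ}` for `J = {j₁ < ⋯ < jₛ}`. -/
def affine (Γ : LambdaChain b lam) (J : Finset ℕ) : V ≃ᵃ[ℝ] V :=
  ((J.sort (· ≤ ·)).map Γ.affineRefl).prod

theorem isLinearPart_affineRefl (Γ : LambdaChain b lam) (k : ℕ) :
    IsLinearPart (refl P (Γ.root k)) (Γ.affineRefl k) := by
  obtain ⟨m, hm⟩ := exists_affineSimple_eq b (Γ.label k)
  obtain ⟨c, hc⟩ := (isLinearPart_affineProd b (Γ.word.take k)).conj
    (affineSimpleRoot b (Γ.label k)) m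
  intro x
  have : refl P (Γ.root k) • x = P.reflection (Γ.root k) x := rfl
  rw [this, affineRefl, hm, hc, hc, RootPairing.reflection_apply]
  simp only [map_zero, zero_sub, neg_smul, sub_neg_eq_add, sub_smul]
  change x - (P.coroot' (Γ.root k) x • P.root (Γ.root k) - c • P.root (Γ.root k)) =
    x - P.coroot' (Γ.root k) x • P.root (Γ.root k) + (0 + c • P.root (Γ.root k))
  abel

theorem isLinearPart_affine (Γ : LambdaChain b lam) (J : Finset ℕ) :
    IsLinearPart (Γ.weyl J) (Γ.affine J) := by
  unfold weyl affine
  induction J.sort (· ≤ ·) with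
  | nil => exact isLinearPart_one
  | cons x l ih => simpa using (isLinearPart_affineRefl Γ x).mul ih

/-- `J = {j₁ < ⋯ < jₛ}` is admissible if `1 ⋖ r_{j₁} ⋖ r_{j₁} r_{j₂} ⋖ ⋯ ⋖ r_{j₁} ⋯ r_{jₛ}`. -/
def IsAdmissible (Γ : LambdaChain b lam) (J : Finset ℕ) : Prop :=
  (∀ j ∈ J, j < Γ.length) ∧
    ∀ j ∈ J, Covers b (Γ.weyl (J.filter (· ≤ j))) (Γ.weyl (J.filter (· < j)))

/-- The collection `𝒜(Γ)` of admissible subsets. -/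
def Admissible (Γ : LambdaChain b lam) : Type := {J : Finset ℕ // Γ.IsAdmissible J}

/-- The weight `μ(J) = - r̂_{j₁} ⋯ r̂_{jₛ}(-lam)`. -/
def weight (Γ : LambdaChain b lam) (J : Finset ℕ) : V := - Γ.affine J (-lam)

/-! ### Folded chains and root operators

Folding at the positions of `J` replaces the root `β` in position `k` by
`γ = r_{j₁} ⋯ r_{jₘ}(β)` and moves the wall between the alcoves number `k` and `k + 1` of the
alcove path by `r̂_{j₁} ⋯ r̂_{jₘ}`, where `j₁ < ⋯ < jₘ` are the elements of `J` below `k`. -/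

/-- The root `γ` of the folded chain `Γ(J)` in a given position. -/
def foldedRoot (Γ : LambdaChain b lam) (J : Finset ℕ) (k : ℕ) : ι :=
  P.weylGroupToPerm (Γ.weyl (J.filter (· < k))) (Γ.root k)

/-- The affine reflection in the hyperplane that contains the wall of the folded gallery `γ(J)`
in a given position. -/
def foldedRefl (Γ : LambdaChain b lam) (J : Finset ℕ) (k : ℕ) : V ≃ᵃ[ℝ] V :=
  Γ.affine (J.filter (· < k)) * Γ.affineRefl k * (Γ.affine (J.filter (· < k)))⁻¹

/-- The integer `l` such that the face of the folded gallery `γ(J)` in a given position lies in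
`H_{-|γ|,l}`; see `setOf_foldedRefl_eq_self`. The formula
holds because the reflection in `H_{-|γ|,l}` maps `0` to `-l|γ|`. -/
def level (Γ : LambdaChain b lam) (J : Finset ℕ) (k : ℕ) : ℝ :=
  -(P.coroot' (absRoot b (Γ.foldedRoot J k)) (Γ.foldedRefl J k 0)) / 2

/-- The hyperplane that contains the wall of `γ(J)` in a given position is `H_{-|γ|,l}`. -/
theorem setOf_foldedRefl_eq_self (Γ : LambdaChain b lam) (J : Finset ℕ) (k : ℕ) :
    {x | Γ.foldedRefl J k x = x} =
      hyperplane P (negRoot P (absRoot b (Γ.foldedRoot J k))) (Γ.level J k) := by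
  have hw := (isLinearPart_affine Γ (J.filter (· < k))).mul
    (isLinearPart_affineProd b (Γ.word.take k))
  obtain ⟨c, hc⟩ : ∃ c : ℝ, ∀ x, Γ.foldedRefl J k x =
      x - (P.coroot' (Γ.foldedRoot J k) x - c) • P.root (Γ.foldedRoot J k) := by
    obtain ⟨m, hm⟩ := exists_affineSimple_eq b (Γ.label k)
    obtain ⟨c, hc⟩ := hw.conj (affineSimpleRoot b (Γ.label k)) m
    refine ⟨c, fun x => ?_⟩
    have := hc x
    rw [← hm] at this
    simp only [map_mul] at this
    simpa [foldedRefl, affineRefl, mul_assoc, foldedRoot, root] using this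
  have hl : Γ.level J k = -(P.coroot' (absRoot b (Γ.foldedRoot J k))
      (c • P.root (Γ.foldedRoot J k))) / 2 := by
    rw [level, hc]; simp
  ext x
  rw [Set.mem_ofPred_eq, hc, hyperplane, Set.mem_ofPred_eq, hl]
  have hne := P.ne_zero (Γ.foldedRoot J k)
  rw [sub_eq_self, smul_eq_zero_iff_left hne, sub_eq_zero]
  have h2 : P.coroot' (Γ.foldedRoot J k) (P.root (Γ.foldedRoot J k)) = 2 := by simp
  unfold absRoot
  split_ifs with hp <;> simp only [coroot'_negRoot, map_smul, h2, smul_eq_mul] <;>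
    constructor <;> intro h <;> linarith

/-- `l_∞ = ⟨μ(J), α_p^∨⟩`. -/
def levelInfty (Γ : LambdaChain b lam) (p : b.support) (J : Finset ℕ) : ℝ :=
  P.coroot' (p : ι) (Γ.weight J)

open scoped Classical in
/-- `I(J,p)`, the set of positions with `γ = ±α_p`. -/
def positions (Γ : LambdaChain b lam) (p : b.support) (J : Finset ℕ) : Finset ℕ :=
  (Finset.range Γ.length).filter fun k =>
    Γ.foldedRoot J k = p ∨ Γ.foldedRoot J k = negRoot P p

/-- `M(J,p)`, the maximum of `l_∞` and of the levels in the positions `I(J,p)`. -/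
def maxLevel (Γ : LambdaChain b lam) (p : b.support) (J : Finset ℕ) : ℝ :=
  (insert (Γ.levelInfty p J) ((Γ.positions p J).image (Γ.level J))).max'
    (Finset.insert_nonempty _ _)

open scoped Classical in
/-- `m_F(J,p)`, the first position in `I(J,p)` with maximal level, or `⊤` (that is, `∞`). -/
def lowerM (Γ : LambdaChain b lam) (p : b.support) (J : Finset ℕ) : WithTop ℕ :=
  ((Γ.positions p J).filter fun i => Γ.level J i = Γ.maxLevel p J).min

open scoped Classical in
/-- `Γ.Lowers p J J'` says that `F_p(J)` is defined and equal to `J'`: one has `M(J,p) > 0`, and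
`J'` is `(J \ {m}) ∪ {k}`, where `m = m_F(J,p)` and `k` is the predecessor of `m` in
`I(J,p) ∪ {∞}`. -/
def Lowers (Γ : LambdaChain b lam) (p : b.support) (J J' : Finset ℕ) : Prop :=
  0 < Γ.maxLevel p J ∧
    ∃ k : ℕ, ((Γ.positions p J).filter fun i : ℕ => (i : WithTop ℕ) < Γ.lowerM p J).max = (k : WithBot ℕ) ∧
      J' = insert k (J.filter fun j : ℕ => (j : WithTop ℕ) ≠ Γ.lowerM p J)

/-- The directed colored graph on `𝒜(Γ)`: an arrow of color `p` from `J` to `F_p(J)`. -/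
def Arrow (Γ : LambdaChain b lam) (p : b.support) (J J' : Γ.Admissible) : Prop :=
  Γ.Lowers p J.1 J'.1

/-- Isomorphisms of directed colored graphs. -/
def IsGraphIso {Γ Γ' : LambdaChain b lam} (e : Γ.Admissible ≃ Γ'.Admissible) : Prop :=
  ∀ (p : b.support) (J K : Γ.Admissible), Γ.Arrow p J K ↔ Γ'.Arrow p (e J) (e K)

/-! ### Yang–Baxter moves -/

/-- `S` is (the set of indices of) a rank two root system contained in the given one. -/
def _root_.AlcovePath.IsRankTwoSubsystem (P : RootPairing ι ℝ V V') (S : Set ι) : Prop :=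
  (∀ i ∈ S, ∀ j ∈ S, P.reflectionPerm i j ∈ S) ∧
    Module.finrank ℝ (Submodule.span ℝ (P.root '' S)) = 2

/-- The roots of `Γ` in the positions `t, …, t + q - 1` are the positive roots, without
repetition, of the rank two root system `S`. -/
def IsDihedralSegment (Γ : LambdaChain b lam) (S : Set ι) (t q : ℕ) : Prop :=
  IsRankTwoSubsystem P S ∧ t + q ≤ Γ.length ∧
    Set.BijOn Γ.root (Set.Ico t (t + q)) {i | i ∈ S ∧ b.IsPos i}

/-- `Γ'` is obtained from `Γ` by reversing a segment formed by the positive roots of the rank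
two root system `S`. -/
def IsReversal (Γ Γ' : LambdaChain b lam) (S : Set ι) (t q : ℕ) : Prop :=
  Γ.IsDihedralSegment S t q ∧ Γ'.length = Γ.length ∧
    ∀ k < Γ.length,
      Γ'.root k = if t ≤ k ∧ k < t + q then Γ.root (2 * t + q - 1 - k) else Γ.root k

/-- The dihedral reflection subgroup `W̄` generated by the reflections in the roots of `S`. -/
def _root_.AlcovePath.reflectionSubgroup (P : RootPairing ι ℝ V V') (S : Set ι) :
    Subgroup P.weylGroup :=
  Subgroup.closure (refl P '' S)

/-- The representative of minimal length of the coset `u W̄`. -/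
def _root_.AlcovePath.minRep (b : P.Base) (S : Set ι) (u : P.weylGroup) : P.weylGroup :=
  Function.argminOn (weylLength b) {v | u⁻¹ * v ∈ reflectionSubgroup P S} ⟨u, by simp⟩

/-- The length in `W̄`, with respect to the generators `s_α`, `s_β` given by the first and the
last root of the segment, of the component `ū ∈ W̄` of `u = ⌊u⌋ ū`. -/
def dihedralLength (Γ : LambdaChain b lam) (S : Set ι) (t q : ℕ) (u : P.weylGroup) : ℕ :=
  wordLength {refl P (Γ.root t), refl P (Γ.root (t + q - 1))} ((minRep b S u)⁻¹ * u)

/-- The involution `Y_{q,a,b}` on the subsets of `{1, …, q}` that arise for the lengths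
`a ≤ b`. The cases are `∅ ↔ ∅` if `a = b` and `{1, …, q} ↔ {1, …, q}` if `a = 0`, `b = q`
(covered by the last lines), and
`{1} ↔ {q}`, `{q - a} ↔ {a + 1}` if `b = a + 1`, and
`{1, a + 2, …, b} ↔ {a + 1, …, b - 1, q}` if `a + 2 ≤ b < q`, and
`{1, a + 2, …, b - 1, q} ↔ {a + 1, …, b}` if `0 < a`, `a + 2 ≤ b ≤ q`. -/
def _root_.AlcovePath.ybInvolution (q a b : ℕ) (K : Finset ℕ) : Finset ℕ :=
  if b = a + 1 then
    if K = {1} then {q}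
    else if K = {q} then {1}
    else if 0 < a ∧ b < q ∧ K = {q - a} then {a + 1}
    else if 0 < a ∧ b < q ∧ K = {a + 1} then {q - a}
    else K
  else if a + 2 ≤ b then
    if b < q ∧ K = insert 1 (Finset.Icc (a + 2) b) then insert q (Finset.Icc (a + 1) (b - 1))
    else if b < q ∧ K = insert q (Finset.Icc (a + 1) (b - 1)) then
      insert 1 (Finset.Icc (a + 2) b)
    else if 0 < a ∧ b ≤ q ∧ K = insert 1 (insert q (Finset.Icc (a + 2) (b - 1))) then
      Finset.Icc (a + 1) b
    else if 0 < a ∧ b ≤ q ∧ K = Finset.Icc (a + 1) b then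
      insert 1 (insert q (Finset.Icc (a + 2) (b - 1)))
    else K
  else K

/-- The Yang–Baxter move `J ↦ Y(J)` for the segment `t, …, t + q - 1`. The positions in the
segment are renumbered `1, …, q` to apply `Y_{q,a,b}`. -/
def yangBaxter (Γ : LambdaChain b lam) (S : Set ι) (t q : ℕ) (J : Finset ℕ) : Finset ℕ :=
  let u := Γ.weyl (J.filter (· < t))
  let w := Γ.weyl (J.filter (· < t + q))
  let inner := (J.filter fun j => t ≤ j ∧ j < t + q).image fun j => j - t + 1
  let moved := ybInvolution q (Γ.dihedralLength S t q u) (Γ.dihedralLength S t q w) inner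
  (J.filter fun j => ¬ (t ≤ j ∧ j < t + q)) ∪ moved.image fun k => t + k - 1

/-- `IsYangBaxterComposite Γ Γ' f` says that `f` is the composite `Y_m ∘ ⋯ ∘ Y_1` of the
Yang–Baxter moves along some sequence of `lam`-chains `Γ = Γ_0, …, Γ_m = Γ'` in which each term
is obtained from the preceding one by reversing a segment formed by the positive roots of a rank
two root system. -/
inductive IsYangBaxterComposite (Γ : LambdaChain b lam) :
    LambdaChain b lam → (Finset ℕ → Finset ℕ) → Prop
  | refl : IsYangBaxterComposite Γ Γ id
  | step {Γ₁ Γ₂ : LambdaChain b lam} {f : Finset ℕ → Finset ℕ} {S : Set ι} {t q : ℕ}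
      (h : IsYangBaxterComposite Γ Γ₁ f) (hr : IsReversal Γ₁ Γ₂ S t q) :
      IsYangBaxterComposite Γ Γ₂ (Γ₁.yangBaxter S t q ∘ f)

end LambdaChain

end Chains

end RootSystem

end

end AlcovePath

set_option linter.unusedSectionVars false

/-! ### Words in generators and the length function of the Weyl group -/

namespace AlcovePath

/-! A `lam`-chain is a reduced gallery of alcoves from the fundamental alcove to its translate by
`-lam`. Such a gallery crosses each hyperplane at most once, so for dominant `lam` all roots of the
chain are positive, the wall in position `k` lies at level minus the number of earlier occurrences
of its root, and each positive root `β` occurs `⟨lam, β^∨⟩` times.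

Heights. For a simple root `α_p` and an admissible set `J`, follow the folded gallery and record the
sign of `w⁻¹ α_p`, where `w` is the product of the folds so far, together with an integer height
(`SignedWalk`). The positions with `γ = ±α_p` are the contacts of the walk. The levels `l_k` are the
heights at contacts and `⟨μ(J), α_p^∨⟩` is the final height. Admissibility enters through the
lifting property (`smul_eq_of_covers`): away from contacts the sign can turn positive, never
negative. Thus `F_p` moves a fold from the first maximal contact `m` (or from infinity) to the
preceding contact `k`, which multiplies the products of folds between the two by `s_p` and leaves
the others alone.

Uniqueness. A nonempty admissible set has a product with a left descent `p`. Its `p`-walk ends with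
negative sign, and moving the fold at the last maximal contact to the right gives a preimage under
`F_p` (`exists_lowers`). So `∅` is the only vertex without incoming arrow. As `F_p` increases the
sum of `n - j` over `j ∈ J`, an isomorphism is forced by induction from `∅`.

Yang–Baxter moves. The walls crossed in a reversible segment meet in a point `z` (`exists_vertex`),
and the roots of the segment appear in their cyclic order. An element of a coset of the dihedral
group is then labelled by an integer parameter modulo `2q` whose normalized absolute value is the
dihedral length. A saturated chain through the segment is determined by its two end parameters.
Hence `Y(J)` is the only admissible set of the reversed chain that agrees with `J` outside the
segment and has the same product after it. Folds in the segment fix `z`, and the walls of contacts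
in it pass through the image of `z`; so these contacts all have the same height. Exchanging one
segment for the other can therefore displace `k` and `m` only within the segment, and `F_p` commutes
with `Y` (`IsReversal.exists_lowers`).

Connectedness. By Matsumoto's theorem any two reduced words of the same element are related by braid
moves, and a braid move on a chain of length at least two reverses a dihedral segment. Every
composite of Yang–Baxter moves is thus an isomorphism, and by uniqueness all composites coincide. -/

theorem wordLength_le {G : Type*} [Monoid G] {T : Set G} (l : List G) (h : ∀ x ∈ l, x ∈ T) :
    wordLength T l.prod ≤ l.length :=
  Nat.sInf_le ⟨l, h, rfl, rfl⟩

theorem exists_word_length_eq {G : Type*} [Monoid G] {T : Set G} {g : G}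
    (hg : ∃ l : List G, (∀ x ∈ l, x ∈ T) ∧ l.prod = g) :
    ∃ l : List G, (∀ x ∈ l, x ∈ T) ∧ l.prod = g ∧ l.length = wordLength T g := by
  obtain ⟨l, h1, h2⟩ := hg
  exact Nat.sInf_mem (s := {n | ∃ l : List G, (∀ x ∈ l, x ∈ T) ∧ l.prod = g ∧ l.length = n})
    ⟨l.length, l, h1, h2, rfl⟩

section RootSystem

variable {ι V V' : Type*} [AddCommGroup V] [Module ℝ V] [AddCommGroup V'] [Module ℝ V']
  {P : RootPairing ι ℝ V V'}

theorem root_smul (w : P.weylGroup) (i : ι) : P.root (w • i) = w • P.root i :=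
  (P.weylGroup_apply_root w i).symm

theorem refl_smul_index (i j : ι) : refl P i • j = P.reflectionPerm i j := rfl

theorem refl_smul (i : ι) (x : V) : refl P i • x = x - P.coroot' i x • P.root i := rfl

theorem coroot'_smul (w : P.weylGroup) (i : ι) (x : V) :
    P.coroot' (w • i) (w • x) = P.coroot' i x := coroot'_weylGroup_smul w i x

theorem weyl_ext {w w' : P.weylGroup} (h : ∀ x : V, w • x = w' • x) : w = w' := by
  apply Subtype.ext
  apply RootPairing.Equiv.weightHom_injective P
  ext x
  exact h x

theorem root_negRoot (i : ι) : P.root (negRoot P i) = -P.root i := by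
  simp [negRoot]

theorem refl_mul_self (i : ι) : refl P i * refl P i = 1 := by
  apply weyl_ext
  intro x
  rw [mul_smul, one_smul]
  exact P.reflection_same i x

theorem refl_inv (i : ι) : (refl P i)⁻¹ = refl P i :=
  inv_eq_of_mul_eq_one_right (refl_mul_self i)

theorem refl_smul_refl_smul {α : Type*} [MulAction P.weylGroup α] (i : ι) (x : α) :
    refl P i • refl P i • x = x := by
  rw [← mul_smul, refl_mul_self, one_smul]

theorem refl_smul_self (i : ι) : refl P i • i = negRoot P i := rfl

theorem negRoot_negRoot (i : ι) : negRoot P (negRoot P i) = i := by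
  apply P.root.injective; simp [root_negRoot]

theorem negRoot_ne (i : ι) : negRoot P i ≠ i := by
  exact fun h => P.ne_neg i h.symm

theorem smul_negRoot (w : P.weylGroup) (i : ι) : w • negRoot P i = negRoot P (w • i) := by
  apply P.root.injective
  rw [root_smul, root_negRoot, root_negRoot, root_smul, smul_neg]

theorem refl_conj (w : P.weylGroup) (i : ι) : w * refl P i * w⁻¹ = refl P (w • i) := by
  apply weyl_ext
  intro x
  rw [mul_smul, mul_smul, refl_smul, refl_smul, smul_sub, smul_inv_smul, weylGroup_smul_smul,
    root_smul]
  congr 2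
  rw [← coroot'_smul w, smul_inv_smul]

theorem refl_smul_eq (w : P.weylGroup) (i : ι) : refl P (w • i) * w = w * refl P i := by
  rw [← refl_conj]; group

theorem refl_negRoot (i : ι) : refl P (negRoot P i) = refl P i := by
  apply weyl_ext
  intro x
  rw [refl_smul, refl_smul, coroot'_negRoot, root_negRoot, neg_smul_neg]

theorem isPos_negRoot (b : P.Base) (i : ι) : b.IsPos (negRoot P i) ↔ ¬ b.IsPos i :=
  RootPairing.Base.IsPos.neg_iff_not b i

theorem eq_or_eq_negRoot_of_refl_eq [P.IsReduced] {i j : ι} (h : refl P i = refl P j) :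
    i = j ∨ i = negRoot P j := by
  by_contra! hc
  have hl := RootPairing.IsReduced.linearIndependent P hc.1
    (fun h => hc.2 (P.root_eq_neg_iff.mp h))
  have h1 : refl P j • P.root i = refl P i • P.root i := by rw [h]
  rw [refl_smul, refl_smul, RootPairing.root_coroot'_eq_pairing, RootPairing.root_coroot'_eq_pairing,
    P.pairing_same] at h1
  have h2 := LinearIndependent.pair_iff.mp hl 2 (-P.pairing i j) (by
    rw [neg_smul]
    have := sub_eq_zero.mpr h1
    rw [← this]; abel)
  exact two_ne_zero h2.1

theorem eq_of_refl_eq [P.IsReduced] {b : P.Base} {i j : ι} (hi : b.IsPos i) (hj : b.IsPos j)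
    (h : refl P i = refl P j) : i = j := by
  rcases eq_or_eq_negRoot_of_refl_eq h with h | h
  · exact h
  · rw [h, isPos_negRoot] at hi; exact absurd hj hi

section Length

variable [Finite ι] [P.IsCrystallographic] [P.IsReduced] {b : P.Base}

theorem isPos_refl_smul {i j : ι} (hj : j ∈ b.support) (hij : i ≠ j) (hi : b.IsPos i) :
    b.IsPos (refl P j • i) := hi.reflectionPerm hj hij

theorem exists_simple_word (b : P.Base) (w : P.weylGroup) :
    ∃ l : List P.weylGroup, (∀ x ∈ l, x ∈ simpleReflections b) ∧ l.prod = w := by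
  have key : ∀ i, ∃ l : List P.weylGroup, (∀ x ∈ l, x ∈ simpleReflections b) ∧
      l.prod = refl P i := by
    intro i
    induction i using b.induction_reflect with
    | h₀ i h =>
      obtain ⟨l, h1, h2⟩ := h
      exact ⟨l, h1, h2.trans (refl_negRoot i).symm⟩
    | h₁ i hi => exact ⟨[refl P i], by simp [simpleReflections]; exact ⟨i, hi, rfl⟩, by simp⟩
    | h₂ i j h hj =>
      obtain ⟨l, h1, h2⟩ := h
      have hs : refl P j ∈ simpleReflections b := ⟨j, hj, rfl⟩
      refine ⟨refl P j :: (l ++ [refl P j]), ?_, ?_⟩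
      · intro x hx
        simp only [List.mem_cons, List.mem_append, List.not_mem_nil, or_false] at hx
        rcases hx with rfl | hx | rfl
        · exact hs
        · exact h1 x hx
        · exact hs
      · have := refl_conj (refl P j) i
        rw [refl_inv] at this
        simp [h2]
        rw [← mul_assoc, this]; rfl
  obtain ⟨w, hw⟩ := w
  induction hw using RootPairing.weylGroup.induction with
  | mem j => exact key j
  | one => exact ⟨[], by simp, rfl⟩
  | mul w w' hw hw' h h' =>
    obtain ⟨l, h1, h2⟩ := h
    obtain ⟨l', h1', h2'⟩ := h'
    refine ⟨l ++ l', ?_, ?_⟩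
    · intro x hx
      rcases List.mem_append.mp hx with h | h
      · exact h1 x h
      · exact h1' x h
    · rw [List.prod_append, h2, h2']; rfl

theorem weylLength_mul_le (w : P.weylGroup) {i : ι} (hi : i ∈ b.support) :
    weylLength b (w * refl P i) ≤ weylLength b w + 1 := by
  obtain ⟨l, h1, h2, h3⟩ := exists_word_length_eq (exists_simple_word b w)
  have := wordLength_le (T := simpleReflections b) (l ++ [refl P i]) (by
    intro x hx
    rcases List.mem_append.mp hx with h | h
    · exact h1 x h
    · rw [List.mem_singleton.mp h]; exact ⟨i, hi, rfl⟩)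
  simpa [h2, h3, weylLength] using this

theorem weylLength_inv_le (w : P.weylGroup) : weylLength b w⁻¹ ≤ weylLength b w := by
  obtain ⟨l, h1, h2, h3⟩ := exists_word_length_eq (exists_simple_word b w)
  have h : ∀ x ∈ l, x⁻¹ = x := by
    intro x hx
    obtain ⟨i, -, rfl⟩ := h1 x hx
    exact refl_inv i
  have hp : l.reverse.prod = w⁻¹ := by
    rw [← h2, List.prod_inv_reverse]
    congr 2
    exact (List.map_congr_left h).trans (List.map_id _) |>.symm
  have := wordLength_le (T := simpleReflections b) l.reverse (by simpa using h1)
  rw [hp, List.length_reverse, h3] at this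
  exact this

theorem weylLength_inv (w : P.weylGroup) : weylLength b w⁻¹ = weylLength b w :=
  le_antisymm (weylLength_inv_le w) (by simpa using weylLength_inv_le (b := b) w⁻¹)

/-- If `w` maps the positive root `β` to a negative one, a letter can be deleted from any word for
`w` to obtain a word for `w s_β`. -/
theorem exists_shorter_word (l : List P.weylGroup) (h : ∀ x ∈ l, x ∈ simpleReflections b) {i : ι}
    (hi : b.IsPos i) (hn : ¬ b.IsPos (l.prod • i)) :
    ∃ l' : List P.weylGroup, (∀ x ∈ l', x ∈ simpleReflections b) ∧ l'.prod = l.prod * refl P i ∧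
      l'.length < l.length := by
  induction l with
  | nil => simp [hi] at hn
  | cons x l ih =>
    have hl : ∀ x ∈ l, x ∈ simpleReflections b := fun y hy => h y (List.mem_cons_of_mem _ hy)
    have hx := h x List.mem_cons_self
    by_cases hp : b.IsPos (l.prod • i)
    · obtain ⟨j, hj, rfl⟩ := hx
      -- A simple reflection makes no positive root negative except its own simple root, so the sign
      -- is lost exactly at this letter, which is the one to delete.
      have : l.prod • i = j := by
        by_contra hne
        apply hn
        rw [List.prod_cons, mul_smul]
        exact isPos_refl_smul hj hne hp
      refine ⟨l, hl, ?_, by simp⟩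
      rw [List.prod_cons, mul_assoc, ← refl_smul_eq, this, ← mul_assoc, refl_mul_self, one_mul]
    · obtain ⟨l', h1, h2, h3⟩ := ih hl hp
      refine ⟨x :: l', ?_, ?_, by simpa using h3⟩
      · intro y hy
        rcases List.mem_cons.mp hy with rfl | hy
        · exact hx
        · exact h1 y hy
      · rw [List.prod_cons, List.prod_cons, h2, mul_assoc]

theorem weylLength_mul_refl_lt {w : P.weylGroup} {i : ι} (hi : b.IsPos i)
    (h : ¬ b.IsPos (w • i)) : weylLength b (w * refl P i) < weylLength b w := by
  obtain ⟨l, h1, rfl, h3⟩ := exists_word_length_eq (exists_simple_word b w)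
  obtain ⟨l', h1', h2', h3'⟩ := exists_shorter_word l h1 hi h
  have := wordLength_le l' h1'
  rw [h2'] at this
  unfold weylLength
  omega

/-- The preceding lemma applies to `w * refl P i`, which maps `i` to a negative root. -/
theorem weylLength_lt_mul_refl {w : P.weylGroup} {i : ι} (hi : b.IsPos i)
    (h : b.IsPos (w • i)) : weylLength b w < weylLength b (w * refl P i) := by
  have := weylLength_mul_refl_lt (w := w * refl P i) hi (by
    rw [mul_smul, refl_smul_self, smul_negRoot, isPos_negRoot, not_not]; exact h)
  rwa [mul_assoc, refl_mul_self, mul_one] at this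

theorem weylLength_lt_mul_refl_iff {w : P.weylGroup} {i : ι} (hi : b.IsPos i) :
    weylLength b w < weylLength b (w * refl P i) ↔ b.IsPos (w • i) := by
  refine ⟨fun h => ?_, weylLength_lt_mul_refl hi⟩
  by_contra hn
  have := weylLength_mul_refl_lt hi hn
  omega

theorem weylLength_lt_refl_mul_iff {w : P.weylGroup} {i : ι} (hi : b.IsPos i) :
    weylLength b w < weylLength b (refl P i * w) ↔ b.IsPos (w⁻¹ • i) := by
  rw [← weylLength_lt_mul_refl_iff hi, weylLength_inv, ← weylLength_inv (refl P i * w), mul_inv_rev,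
    refl_inv]

theorem weylLength_simple_mul {w : P.weylGroup} {p : ι} (hp : p ∈ b.support)
    (h : b.IsPos (w⁻¹ • p)) : weylLength b (refl P p * w) = weylLength b w + 1 := by
  have h1 := (weylLength_lt_refl_mul_iff (b.isPos_of_mem_support hp)).mpr h
  have h2 := weylLength_mul_le (b := b) w⁻¹ hp
  rw [weylLength_inv, ← weylLength_inv (w⁻¹ * refl P p), mul_inv_rev, refl_inv, inv_inv] at h2
  omega

theorem weylLength_simple_mul' {w : P.weylGroup} {p : ι} (hp : p ∈ b.support)
    (h : ¬ b.IsPos (w⁻¹ • p)) : weylLength b w = weylLength b (refl P p * w) + 1 := by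
  have := weylLength_simple_mul (w := refl P p * w) hp (b := b) (by
    rw [mul_inv_rev, refl_inv, mul_smul, refl_smul_self, smul_negRoot, isPos_negRoot]; exact h)
  rwa [← mul_assoc, refl_mul_self, one_mul] at this

/-- The lifting property: if `s_p` is a left descent of `w s_i` but not of `w`, where `w s_i`
covers `w`, then `w s_i = s_p w`. -/
theorem smul_eq_of_covers {w : P.weylGroup} {i p : ι} (hp : p ∈ b.support) (hi : b.IsPos i)
    (hc : weylLength b (w * refl P i) = weylLength b w + 1)
    (h : b.IsPos (w⁻¹ • p)) (h' : ¬ b.IsPos ((w * refl P i)⁻¹ • p)) : w • i = p := by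
  have hwi : b.IsPos (w • i) := (weylLength_lt_mul_refl_iff hi).mp (by omega)
  -- Otherwise `s_p` keeps `w • i` positive, so `s_p w s_i` is longer than `s_p w`, whose length is
  -- `ℓ(w) + 1`. But `s_p` is a left descent of `w s_i`, so `s_p w s_i` has length `ℓ(w)`.
  by_contra hne
  have h1 := weylLength_simple_mul hp h
  have h2 := weylLength_simple_mul' hp h'
  have h3 : b.IsPos ((refl P p * w) • i) := by
    rw [mul_smul]; exact isPos_refl_smul hp hne hwi
  have h4 := weylLength_lt_mul_refl hi h3
  rw [mul_assoc] at h4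
  omega

end Length

end RootSystem

end AlcovePath

/-! ### Positive coroots, coroot heights and the root of the highest coroot -/

namespace AlcovePath

section RootSystem

variable {ι V V' : Type*} [AddCommGroup V] [Module ℝ V] [AddCommGroup V'] [Module ℝ V']
  {P : RootPairing ι ℝ V V'}

section Positive

variable [Finite ι]

theorem rootForm_root_self_pos [Fintype ι] (P : RootPairing ι ℝ V V') (i : ι) :
    0 < P.RootForm (P.root i) (P.root i) := by
  rw [P.rootForm_apply_apply]
  exact Finset.sum_pos' (fun j _ => mul_self_nonneg _) ⟨i, Finset.mem_univ _, by simp⟩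

/-- Evaluation of coroots at a point is, up to positive factors, a linear function of the root. -/
theorem exists_linear_coroot' (P : RootPairing ι ℝ V V') :
    ∃ c : ι → ℝ, (∀ i, 0 < c i) ∧
      ∀ x, ∃ F : V →ₗ[ℝ] ℝ, ∀ i, F (P.root i) = c i * P.coroot' i x := by
  have := Fintype.ofFinite ι
  -- The weights are the squared lengths of the roots in the canonical form, and `F` is twice the
  -- pairing of the polarization with `x`; the identity behind this is `(α, α) α^∨ = 2 ·
  -- polarization(α)`.
  refine ⟨fun i => P.RootForm (P.root i) (P.root i), fun i => rootForm_root_self_pos P i, fun x =>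
    ⟨(P.toLinearMap x).comp ((2 : ℝ) • P.Polarization), fun i => ?_⟩⟩
  have h := congrArg (P.toLinearMap x) (P.rootForm_self_smul_coroot i)
  rw [map_smul, smul_eq_mul] at h
  change _ = _ * (P.toLinearMap x (P.coroot i))
  rw [h]
  simp [two_smul]

/-- Positive roots are reached by adding simple roots, but coroots are not additive along the way.
The functional of `exists_linear_coroot'` is additive in the root and has the sign of the coroot
pairing. -/
theorem coroot'_pos_of_isPos [P.IsCrystallographic] {b : P.Base} {x : V}
    (hx : ∀ j ∈ b.support, 0 < P.coroot' j x) {i : ι} (hi : b.IsPos i) : 0 < P.coroot' i x := by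
  obtain ⟨c, hc, hF⟩ := exists_linear_coroot' P
  obtain ⟨F, hF⟩ := hF x
  have key : 0 < F (P.root i) := by
    refine hi.induction_on_add (p := fun i => 0 < F (P.root i)) ?_ ?_
    · intro j hj
      rw [hF]; exact mul_pos (hc j) (hx j hj)
    · intro i j k hk h hj
      rw [hk, map_add, hF j]
      exact add_pos h (mul_pos (hc j) (hx j hj))
  rw [hF] at key
  exact pos_of_mul_pos_right key (hc i).le

/-- The point is `e` times the sum of the fundamental weights. With `e = 1` it compares positivity
with coroot heights; with a small `e` it lies in the fundamental alcove. -/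
theorem exists_coroot'_eq [P.IsRootSystem] (b : P.Base) (e : ℝ) :
    ∃ x : V, ∀ i, P.coroot' i x = e * b.flip.height i := by
  let x := P.toPerfPair.symm (b.toCoweightBasis.constr ℝ fun _ => e)
  have hx : ∀ y, P.toLinearMap x y = b.toCoweightBasis.constr ℝ (fun _ => e) y := by
    intro y
    have := P.toLinearMap.apply_symm_toPerfPair_self (b.toCoweightBasis.constr ℝ (fun _ => e))
    exact LinearMap.congr_fun this y
  have hs : ∀ j ∈ b.support, P.toLinearMap x (P.coroot j) = e := by
    intro j hj
    rw [hx, ← b.toCoweightBasis_apply ⟨j, hj⟩, Module.Basis.constr_basis]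
  refine ⟨x, fun i => ?_⟩
  obtain ⟨f, -, -, hf⟩ := b.flip.exists_root_eq_sum_int i
  rw [RootPairing.Base.height_eq_sum hf]
  change P.toLinearMap x (P.flip.root i) = _
  rw [hf, map_sum, Int.cast_sum, Finset.mul_sum]
  refine Finset.sum_congr rfl fun j hj => ?_
  rw [map_zsmul]
  change f j • P.toLinearMap x (P.coroot j) = _
  rw [hs j hj, zsmul_eq_mul, mul_comm]

/-- Positivity refers to roots, whereas `theta` is chosen by the height of coroots. Evaluation at
the point with all simple coroots equal to `1` links the two. -/
theorem isPos_iff_flip_height [P.IsRootSystem] [P.IsCrystallographic] (b : P.Base) (i : ι) :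
    b.IsPos i ↔ 0 < b.flip.height i := by
  obtain ⟨x, hx⟩ := exists_coroot'_eq b 1
  have key : ∀ i, b.IsPos i → 0 < b.flip.height i := by
    intro i hi
    have := coroot'_pos_of_isPos (x := x) (fun j hj => by
      rw [hx, RootPairing.Base.height_one_of_mem_support (b := b.flip) hj]; norm_num) hi
    rw [hx, one_mul] at this
    exact_mod_cast this
  refine ⟨key i, fun h => ?_⟩
  by_contra hn
  rw [← isPos_negRoot] at hn
  have h1 := key _ hn
  have h2 := b.flip.height_reflectionPerm_self i
  change b.flip.height (negRoot P i) = _ at h2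
  omega

theorem flip_height_negRoot (b : P.Base) (i : ι) :
    b.flip.height (negRoot P i) = -b.flip.height i :=
  b.flip.height_reflectionPerm_self i

theorem flip_height_refl_smul [P.IsCrystallographic] (b : P.Base) (i j : ι) :
    b.flip.height (refl P i • j) = b.flip.height j - P.pairingIn ℤ i j * b.flip.height i := by
  have h : P.flip.root (P.reflectionPerm i j) =
      P.flip.root j + (-P.pairingIn ℤ i j) • P.flip.root i := by
    rw [RootPairing.flip_root, P.coroot_reflectionPerm, P.coreflection_apply_coroot,
      ← P.algebraMap_pairingIn ℤ, neg_smul, sub_eq_add_neg]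
    simp [Int.cast_smul_eq_zsmul]
  rw [refl_smul_index, b.flip.height_add_zsmul h, smul_eq_mul]
  ring

end Positive

section Theta

variable [Finite ι] [P.IsRootSystem] [P.IsIrreducible] {b : P.Base}

theorem flip_height_le_theta (b : P.Base) (j : ι) :
    b.flip.height j ≤ b.flip.height (theta b) :=
  (exists_highestCoroot b).choose_spec j

theorem flip_height_theta_pos (b : P.Base) : 0 < b.flip.height (theta b) := by
  have h := flip_height_le_theta b (negRoot P (theta b))
  rw [flip_height_negRoot] at h
  have := b.flip.height_ne_zero (theta b)
  omega

variable [P.IsCrystallographic]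

theorem isPos_theta (b : P.Base) : b.IsPos (theta b) :=
  (isPos_iff_flip_height b _).mpr (flip_height_theta_pos b)

theorem fundamentalAlcove_nonempty (b : P.Base) : (fundamentalAlcove b).Nonempty := by
  have hθ := flip_height_theta_pos b
  -- No coroot is higher than that of `theta b`, so this scaling puts all positive coroots strictly
  -- between `0` and `1`.
  obtain ⟨x, hx⟩ := exists_coroot'_eq b (1 / (b.flip.height (theta b) + 1))
  refine ⟨x, fun i hi => ?_⟩
  rw [isPos_iff_flip_height] at hi
  have h1 : (0 : ℝ) < b.flip.height i := by exact_mod_cast hi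
  have h2 : (b.flip.height i : ℝ) ≤ b.flip.height (theta b) := by
    exact_mod_cast flip_height_le_theta b i
  rw [hx]
  constructor
  · positivity
  · rw [one_div, inv_mul_lt_iff₀ (by linarith)]
    linarith

/-- The pairing of `θ` with the coroot of a positive root other than `θ` is `0` or `1`. -/
theorem pairingIn_theta [P.IsReduced] {j : ι} (hj : b.IsPos j) (hne : j ≠ theta b) :
    P.pairingIn ℤ (theta b) j = 0 ∨ P.pairingIn ℤ (theta b) j = 1 := by
  have hθ := flip_height_theta_pos b
  have hjpos := (isPos_iff_flip_height b j).mp hj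
  have h0 := flip_height_le_theta b j
  have hmem := P.pairingIn_pairingIn_mem_set_of_isCrystal_of_isRed' (i := theta b) (j := j)
    (fun h => hne (P.root.injective h.symm)) (fun h => by
      have h1 := P.root_eq_neg_iff.mp h
      have h2 := isPos_theta b
      rw [h1] at h2
      exact (isPos_negRoot b j).mp h2 hj)
  have h1 := flip_height_refl_smul b j (theta b)
  have h2 := flip_height_refl_smul b (theta b) j
  have h3 := flip_height_le_theta b (refl P j • theta b)
  have h4 := flip_height_le_theta b (negRoot P (refl P (theta b) • j))
  have h5 := b.flip.height_ne_zero (refl P j • theta b)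
  rw [flip_height_negRoot] at h4
  have h6 : 0 ≤ P.pairingIn ℤ j (theta b) := by
    by_contra hneg
    nlinarith
  have h7 : P.pairingIn ℤ (theta b) j ≤ 2 := by
    by_contra hneg
    nlinarith
  generalize P.pairingIn ℤ (theta b) j = n at *
  generalize P.pairingIn ℤ j (theta b) = n' at *
  simp only [Set.mem_insert_iff, Set.mem_singleton_iff, Prod.mk.injEq] at hmem
  have h8 : n = 2 → n' = 1 := by omega
  -- If `n = 2`, maximality applied to the negative of `s_θ(j)` makes the coroot of `j` as high as
  -- that of `θ`. Since then `n' = 1`, the coroot `θ^∨ - α_j^∨` of `s_j(θ)` would have height zero.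
  have h9 : n ≠ 2 := by
    intro h
    rw [h8 h] at h1
    rw [h] at h2
    omega
  omega

end Theta

end RootSystem

end AlcovePath

/-! ### How the strips containing an alcove change when a wall is crossed -/

namespace AlcovePath

section RootSystem

variable {ι V V' : Type*} [AddCommGroup V] [Module ℝ V] [AddCommGroup V'] [Module ℝ V']
  {P : RootPairing ι ℝ V V'} [Finite ι] [P.IsRootSystem] [P.IsIrreducible] {b : P.Base}

noncomputable section

/-- The wall reflection of a gallery given by a word. -/
def wordRefl (b : P.Base) (word : List (Option b.support)) (k : ℕ) : V ≃ᵃ[ℝ] V :=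
  affineProd b (word.take k) * affineSimple b (word.getD k none) *
    (affineProd b (word.take k))⁻¹

/-- The root of the wall of a gallery given by a word. -/
def wordRoot (b : P.Base) (word : List (Option b.support)) (k : ℕ) : ι :=
  linearProd b (word.take k) • affineSimpleRoot b (word.getD k none)

theorem coroot'_neg_smul_inv (w : P.weylGroup) (i : ι) (x : V) :
    P.coroot' i (w • x) = P.coroot' (w⁻¹ • i) x := by
  rw [← coroot'_smul w (w⁻¹ • i), smul_inv_smul]

theorem affineProd_nil (b : P.Base) : affineProd b [] = 1 := rfl

theorem affineProd_cons (b : P.Base) (x : Option b.support) (l : List (Option b.support)) :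
    affineProd b (x :: l) = affineSimple b x * affineProd b l := by simp [affineProd]

theorem affineProd_append (b : P.Base) (l l' : List (Option b.support)) :
    affineProd b (l ++ l') = affineProd b l * affineProd b l' := by simp [affineProd]

theorem linearProd_append (b : P.Base) (l l' : List (Option b.support)) :
    linearProd b (l ++ l') = linearProd b l * linearProd b l' := by simp [linearProd]

theorem affineReflection_mul_self (i : ι) (k : ℤ) :
    affineReflection P i k * affineReflection P i k = 1 := by
  ext x
  change affineReflection P i k (affineReflection P i k x) = x
  rw [affineReflection_apply, affineReflection_apply]
  simp only [map_sub, map_smul, RootPairing.root_coroot'_eq_pairing, P.pairing_same, smul_eq_mul]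
  module

theorem affineSimple_mul_self (x : Option b.support) :
    affineSimple b x * affineSimple b x = 1 := by
  obtain ⟨k, hk⟩ := exists_affineSimple_eq b x
  rw [hk, affineReflection_mul_self]

theorem affineSimple_inv (x : Option b.support) : (affineSimple b x)⁻¹ = affineSimple b x :=
  inv_eq_of_mul_eq_one_right (affineSimple_mul_self x)

theorem IsLinearPart.eq {w w' : P.weylGroup} {g : V ≃ᵃ[ℝ] V} (h : IsLinearPart w g)
    (h' : IsLinearPart w' g) : w = w' := by
  apply weyl_ext
  intro x
  have := (h x).symm.trans (h' x)
  simpa using this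

theorem affineReflection_congr {i j : ι} {k l : ℤ}
    (h : affineReflection P i k = affineReflection P j l) : refl P i = refl P j :=
  (isLinearPart_affineReflection i k).eq (h ▸ isLinearPart_affineReflection j l)

theorem affineReflection_negRoot (i : ι) (k : ℤ) :
    affineReflection P (negRoot P i) k = affineReflection P i (-k) := by
  ext x
  rw [affineReflection_apply, affineReflection_apply, coroot'_negRoot, root_negRoot]
  push_cast
  module

/-- The affine reflection in the wall with label `x` of the fundamental alcove. -/
theorem coroot'_mem_Ioo {x0 : V} (hx : x0 ∈ fundamentalAlcove b) (i : ι) :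
    ⌊P.coroot' i x0⌋ = (open scoped Classical in if b.IsPos i then 0 else -1) ∧
      (⌊P.coroot' i x0⌋ : ℝ) < P.coroot' i x0 := by
  by_cases hi : b.IsPos i
  · have h := hx i hi
    have : ⌊P.coroot' i x0⌋ = 0 := Int.floor_eq_iff.mpr (by simpa using ⟨h.1.le, h.2⟩)
    rw [this, if_pos hi]
    exact ⟨rfl, by simpa using h.1⟩
  · have h := hx _ ((isPos_negRoot b i).mpr hi)
    rw [coroot'_negRoot] at h
    have : ⌊P.coroot' i x0⌋ = -1 :=
      Int.floor_eq_iff.mpr (by push_cast; constructor <;> linarith [h.1, h.2])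
    rw [this, if_neg hi]
    exact ⟨rfl, by push_cast; linarith [h.1, h.2]⟩

variable [P.IsCrystallographic]

theorem exists_int_coroot'_affineReflection (i j : ι) (k m : ℤ) {x : V}
    (hx : P.coroot' j x = m) (hx' : ∃ n : ℤ, P.coroot' i x = n) :
    ∃ n : ℤ, P.coroot' j (affineReflection P i k x) = n := by
  obtain ⟨n, hn⟩ := hx'
  refine ⟨m - (n - k) * P.pairingIn ℤ i j, ?_⟩
  rw [affineReflection_apply, map_sub, map_smul, hx, hn, RootPairing.root_coroot'_eq_pairing,
    ← P.algebraMap_pairingIn ℤ]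
  simp

theorem exists_int_coroot'_affineProd (l : List (Option b.support)) (j : ι) :
    ∃ n : ℤ, P.coroot' j (affineProd b l 0) = n := by
  induction l generalizing j with
  | nil => exact ⟨0, by simp [affineProd_nil]⟩
  | cons x l ih =>
    obtain ⟨k, hk⟩ := exists_affineSimple_eq b x
    obtain ⟨m, hm⟩ := ih j
    rw [affineProd_cons, hk]
    exact exists_int_coroot'_affineReflection _ j k m hm (ih _)

/-- The strip of the hyperplane arrangement in direction `i` that contains `x`. -/
def strip (P : RootPairing ι ℝ V V') (i : ι) (x : V) : ℤ := ⌊P.coroot' i x⌋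

theorem exists_coroot'_affineProd (l : List (Option b.support)) (j : ι) :
    ∃ n : ℤ, ∀ x, P.coroot' j (affineProd b l x) = P.coroot' ((linearProd b l)⁻¹ • j) x + n := by
  obtain ⟨n, hn⟩ := exists_int_coroot'_affineProd (b := b) l j
  refine ⟨n, fun x => ?_⟩
  rw [isLinearPart_affineProd b l x, map_add, hn, coroot'_neg_smul_inv]

/-- Elements of the affine Weyl group permute the coroot pairings up to integers, so points in
images of the open alcove lie on no hyperplane. The strictness accounts for the `- 1` in
`strip_negRoot`. -/
theorem strip_lt {x0 : V} (hx : x0 ∈ fundamentalAlcove b) (l : List (Option b.support)) (j : ι) :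
    (strip P j (affineProd b l x0) : ℝ) < P.coroot' j (affineProd b l x0) := by
  obtain ⟨n, hn⟩ := exists_coroot'_affineProd l j
  unfold strip
  rw [hn, Int.floor_add_intCast]
  push_cast
  linarith [(coroot'_mem_Ioo hx ((linearProd b l)⁻¹ • j)).2]

theorem strip_negRoot {x0 : V} (hx : x0 ∈ fundamentalAlcove b) (l : List (Option b.support))
    (j : ι) : strip P (negRoot P j) (affineProd b l x0) = -strip P j (affineProd b l x0) - 1 := by
  have h1 := strip_lt hx l j
  have h2 : P.coroot' j (affineProd b l x0) < strip P j (affineProd b l x0) + 1 :=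
    Int.lt_floor_add_one _
  rw [strip, coroot'_negRoot, Int.floor_eq_iff]
  push_cast
  constructor <;> linarith

variable [P.IsReduced]

/-- The root `α₀ = -θ` is negative and its strip at the alcove is `-1`. Hence `s₀` and the `s_i`
obey one rule: reflect in the lower boundary of the strip in direction `α_x`. -/
theorem affineSimple_eq {x0 : V} (hx : x0 ∈ fundamentalAlcove b) (x : Option b.support) :
    affineSimple b x = affineReflection P (affineSimpleRoot b x)
      (strip P (affineSimpleRoot b x) x0) := by
  unfold strip
  rw [(coroot'_mem_Ioo hx _).1]
  cases x with
  | none =>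
    rw [if_neg]; · rfl
    rw [affineSimpleRoot, isPos_negRoot, not_not]
    exact isPos_theta b
  | some i => rw [if_pos]; · rfl
              exact b.isPos_of_mem_support i.2

/-- For `s_i` this is the permutation of the positive roots other than `α_i`. For `s₀` one has `⟨θ,
β^∨⟩ ∈ {0, 1}`: if it is `0` the root `s_θ β` stays positive, and if it is `1` that root becomes
negative and the translation part makes up for the drop by one. -/
theorem strip_affineSimple_of_pos {x0 : V} (hx : x0 ∈ fundamentalAlcove b) (x : Option b.support)
    {j : ι} (hj : b.IsPos j) (h1 : j ≠ affineSimpleRoot b x)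
    (h2 : j ≠ negRoot P (affineSimpleRoot b x)) :
    strip P j (affineSimple b x x0) = strip P j x0 := by
  cases x with
  | some i =>
    have : affineSimple b (some i) x0 = refl P (i : ι) • x0 := by
      change affineReflection P i 0 x0 = _
      rw [affineReflection_apply, refl_smul]; simp
    have hp : b.IsPos (refl P (i : ι) • j) := isPos_refl_smul i.2 h1 hj
    unfold strip
    rw [this, coroot'_neg_smul_inv, refl_inv, (coroot'_mem_Ioo hx _).1, (coroot'_mem_Ioo hx _).1,
      if_pos hp, if_pos hj]
  | none =>
    have hne : j ≠ theta b := by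
      simpa [affineSimpleRoot, negRoot_negRoot] using h2
    have h0 : affineSimple b none x0 = refl P (theta b) • x0 + P.root (theta b) := by
      change affineReflection P (negRoot P (theta b)) (-1) x0 = _
      rw [affineReflection_negRoot, affineReflection_apply, refl_smul]
      simp only [neg_neg, Int.cast_one]
      module
    have hc : P.coroot' j (affineSimple b none x0) =
        P.coroot' (refl P (theta b) • j) x0 + P.pairingIn ℤ (theta b) j := by
      rw [h0, map_add, coroot'_neg_smul_inv, refl_inv, RootPairing.root_coroot'_eq_pairing,
        ← P.algebraMap_pairingIn ℤ]
      simp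
    have hh := flip_height_refl_smul b (theta b) j
    have hjp := (isPos_iff_flip_height b j).mp hj
    have hle := flip_height_le_theta b j
    have h5 := b.flip.height_ne_zero (refl P (theta b) • j)
    unfold strip
    rw [hc, Int.floor_add_intCast, (coroot'_mem_Ioo hx _).1, (coroot'_mem_Ioo hx _).1,
      if_pos hj]
    rcases pairingIn_theta hj hne with h | h
    · rw [h] at hh ⊢
      rw [if_pos]; · rfl
      rw [isPos_iff_flip_height]; omega
    · rw [h] at hh ⊢
      rw [if_neg]; · rfl
      rw [isPos_iff_flip_height]; omega

open scoped Classical in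
theorem strip_affineSimple {x0 : V} (hx : x0 ∈ fundamentalAlcove b) (x : Option b.support)
    (j : ι) : strip P j (affineSimple b x x0) = strip P j x0 -
      (if j = affineSimpleRoot b x then 1 else 0) +
      (if j = negRoot P (affineSimpleRoot b x) then 1 else 0) := by
  have hprod : affineSimple b x = affineProd b [x] := by simp [affineProd]
  have hneg := fun j => strip_negRoot hx [x] j
  have hneg' := fun j => strip_negRoot hx [] j
  rw [← hprod] at hneg
  simp only [affineProd_nil, AffineEquiv.coe_one, id] at hneg'
  have hroot : strip P (affineSimpleRoot b x) (affineSimple b x x0) =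
      strip P (affineSimpleRoot b x) x0 - 1 := by
    have h1 : (strip P (affineSimpleRoot b x) x0 : ℝ) < P.coroot' (affineSimpleRoot b x) x0 :=
      (coroot'_mem_Ioo hx _).2
    have h2 : P.coroot' (affineSimpleRoot b x) x0 < strip P (affineSimpleRoot b x) x0 + 1 :=
      Int.lt_floor_add_one _
    have h3 := affineSimple_eq hx x
    generalize strip P (affineSimpleRoot b x) x0 = v at *
    rw [strip, h3, affineReflection_apply, Int.floor_eq_iff, map_sub, map_smul,
      RootPairing.root_coroot'_eq_pairing, P.pairing_same, smul_eq_mul]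
    push_cast
    constructor <;> linarith
  by_cases h1 : j = affineSimpleRoot b x
  · subst h1
    rw [if_pos rfl, if_neg (negRoot_ne _).symm, hroot, add_zero]
  by_cases h2 : j = negRoot P (affineSimpleRoot b x)
  · subst h2
    rw [if_pos rfl, if_neg h1, hneg, hneg', hroot]
    omega
  rw [if_neg h1, if_neg h2, sub_zero, add_zero]
  by_cases hj : b.IsPos j
  · exact strip_affineSimple_of_pos hx x hj h1 h2
  · have := strip_affineSimple_of_pos hx x ((isPos_negRoot b j).mpr hj)
      (fun h => h2 (by rw [← h, negRoot_negRoot]))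
      (fun h => h1 (by simpa only [negRoot_negRoot] using congrArg (negRoot P) h))
    rw [hneg, hneg'] at this
    omega

theorem strip_affineProd (l : List (Option b.support)) (j : ι) :
    ∃ n : ℤ, ∀ x, strip P j (affineProd b l x) = strip P ((linearProd b l)⁻¹ • j) x + n := by
  obtain ⟨n, hn⟩ := exists_coroot'_affineProd l j
  exact ⟨n, fun x => by unfold strip; rw [hn, Int.floor_add_intCast]⟩

open scoped Classical in
theorem strip_affineProd_concat {x0 : V} (hx : x0 ∈ fundamentalAlcove b)
    (l : List (Option b.support)) (x : Option b.support) (j : ι) :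
    strip P j (affineProd b (l ++ [x]) x0) = strip P j (affineProd b l x0) -
      (if j = linearProd b l • affineSimpleRoot b x then 1 else 0) +
      (if j = negRoot P (linearProd b l • affineSimpleRoot b x) then 1 else 0) := by
  obtain ⟨n, hn⟩ := strip_affineProd l j
  have h : affineProd b (l ++ [x]) x0 = affineProd b l (affineSimple b x x0) := by
    rw [affineProd_append]; simp [affineProd_cons, affineProd_nil, AffineEquiv.mul_def]
  rw [h, hn, hn, strip_affineSimple hx]
  simp only [inv_smul_eq_iff, smul_negRoot]
  ring

/-- The uniform rule of `affineSimple_eq`, transported by the group element to another alcove of the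
gallery. It makes the reflections `r̂_k` explicit. -/
theorem affineProd_conj {x0 : V} (hx : x0 ∈ fundamentalAlcove b) (l : List (Option b.support))
    (x : Option b.support) :
    affineProd b l * affineSimple b x * (affineProd b l)⁻¹ =
      affineReflection P (linearProd b l • affineSimpleRoot b x)
        (strip P (linearProd b l • affineSimpleRoot b x) (affineProd b l x0)) := by
  ext y
  obtain ⟨y, rfl⟩ := (affineProd b l).surjective y
  have h1 : (affineProd b l * affineSimple b x * (affineProd b l)⁻¹) (affineProd b l y) =
      affineProd b l (affineSimple b x y) := by
    simp [AffineEquiv.mul_def, AffineEquiv.inv_def]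
  obtain ⟨n, hn⟩ := exists_int_coroot'_affineProd (b := b) l
    (linearProd b l • affineSimpleRoot b x)
  have hL := isLinearPart_affineProd b l
  have hc : ∀ z, P.coroot' (linearProd b l • affineSimpleRoot b x) (affineProd b l z) =
      P.coroot' (affineSimpleRoot b x) z + n := by
    intro z
    rw [hL z, map_add, hn, coroot'_smul]
  have hs : strip P (linearProd b l • affineSimpleRoot b x) (affineProd b l x0) =
      strip P (affineSimpleRoot b x) x0 + n := by
    unfold strip; rw [hc, Int.floor_add_intCast]
  rw [h1, affineReflection_apply, hc, hs, affineSimple_eq hx, affineReflection_apply, hL, hL y,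
    smul_sub, weylGroup_smul_smul, root_smul]
  push_cast
  simp only [sub_smul, add_smul]
  abel

end

end RootSystem

end AlcovePath

/-! ### Reduced galleries, the exchange condition and the levels of a chain -/

namespace AlcovePath

/-- A predicate on `{0, …, n}` that changes in at most one place is constant before and after
it. -/
theorem iff_of_unique_change {S : ℕ → Prop} {k n : ℕ}
    (h : ∀ j, j < n → ¬(S j ↔ S (j + 1)) → j = k) :
    (∀ j ≤ k, j ≤ n → (S j ↔ S 0)) ∧ ∀ j, k < j → j ≤ n → (S j ↔ S n) := by
  constructor
  · intro j hj hjn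
    induction j with
    | zero => rfl
    | succ j ih =>
      rw [← ih (by omega) (by omega)]
      by_contra hc
      have := h j (by omega) (fun h => hc h.symm)
      omega
  · intro j hj hjn
    induction hm : n - j generalizing j with
    | zero => rw [show j = n by omega]
    | succ m ih =>
      rw [← ih (j + 1) (by omega) (by omega) (by omega)]
      by_contra hc
      have := h j (by omega) hc
      omega

theorem exists_change {S : ℕ → Prop} {n : ℕ} (h0 : S 0) (hn : ¬ S n) :
    ∃ k < n, S k ∧ ¬ S (k + 1) := by
  by_contra! hc
  exact hn (Nat.rec (motive := fun k => k ≤ n → S k) (fun _ => h0)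
    (fun k ih hk => hc k (by omega) (ih (by omega))) n le_rfl)

section RootSystem

variable {ι V V' : Type*} [AddCommGroup V] [Module ℝ V] [AddCommGroup V'] [Module ℝ V']
  {P : RootPairing ι ℝ V V'} [Finite ι] [P.IsRootSystem] [P.IsIrreducible] {b : P.Base}

theorem affineProd_reverse (l : List (Option b.support)) :
    affineProd b l.reverse = (affineProd b l)⁻¹ := by
  induction l with
  | nil => simp [affineProd_nil]
  | cons x l ih =>
    rw [List.reverse_cons, affineProd_append, ih, affineProd_cons, affineProd_cons, affineProd_nil,
      mul_one, mul_inv_rev, affineSimple_inv]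

/-- A word is reduced if no shorter word has the same product. -/
def IsReducedWord (b : P.Base) (word : List (Option b.support)) : Prop :=
  ∀ l : List (Option b.support), affineProd b l = affineProd b word → word.length ≤ l.length

theorem exists_map_affineSimple {l : List (V ≃ᵃ[ℝ] V)}
    (h : ∀ x ∈ l, x ∈ Set.range (affineSimple b)) :
    ∃ l' : List (Option b.support), l = l'.map (affineSimple b) := by
  have : l ∈ Set.range (List.map (affineSimple b)) := by rw [Set.range_list_map]; exact h
  exact this.imp fun _ h => h.symm

theorem isReducedWord_iff {word : List (Option b.support)} :
    IsReducedWord b word ↔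
      word.length = wordLength (Set.range (affineSimple b)) (affineProd b word) := by
  have h1 : ∀ l : List (Option b.support),
      ∀ x ∈ l.map (affineSimple b), x ∈ Set.range (affineSimple b) := by
    intro l x hx
    obtain ⟨y, -, rfl⟩ := List.mem_map.mp hx
    exact ⟨y, rfl⟩
  have h2 := exists_word_length_eq ⟨word.map (affineSimple b), h1 word, rfl⟩
  constructor
  · intro h
    apply le_antisymm
    · obtain ⟨l, hl, hl', hl''⟩ := h2
      obtain ⟨l, rfl⟩ := exists_map_affineSimple hl
      have := h l hl'
      rw [List.length_map] at hl''
      exact hl'' ▸ this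
    · simpa [affineProd] using wordLength_le _ (h1 word)
  · intro h l hl
    rw [h, ← hl]
    simpa [affineProd] using wordLength_le _ (h1 l)

theorem exists_isReducedWord (l : List (Option b.support)) :
    ∃ l', IsReducedWord b l' ∧ affineProd b l' = affineProd b l := by
  classical
  have hex : ∃ n, ∃ l' : List (Option b.support), l'.length = n ∧
      affineProd b l' = affineProd b l := ⟨_, l, rfl, rfl⟩
  obtain ⟨l', h1, h2⟩ := Nat.find_spec hex
  refine ⟨l', fun l'' h => ?_, h2⟩
  rw [h1]
  exact Nat.find_min' hex ⟨l'', rfl, h.trans h2⟩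

theorem wordRefl_append (u v : List (Option b.support)) (x : Option b.support) :
    wordRefl b (u ++ x :: v) u.length =
      affineProd b u * affineSimple b x * (affineProd b u)⁻¹ := by
  simp [wordRefl]

theorem exists_split (l : List (Option b.support)) {k : ℕ} (hk : k < l.length) :
    ∃ u x v, l = u ++ x :: v ∧ u.length = k :=
  ⟨l.take k, l[k], l.drop (k + 1), by simp, by simp; omega⟩

/-- The wall reflections of a reduced word are pairwise distinct. -/
theorem wordRefl_injOn {l : List (Option b.support)} (hl : IsReducedWord b l) {i j : ℕ}
    (hij : i < j) (hj : j < l.length) : wordRefl b l i ≠ wordRefl b l j := by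
  intro h
  obtain ⟨u, x, v, rfl, rfl⟩ := exists_split l (hij.trans hj)
  obtain ⟨v', y, w, hv, hlen⟩ := exists_split v (k := j - u.length - 1)
    (by simp at hj; omega)
  subst hv
  have hj' : j = (u ++ x :: v').length := by simp; omega
  rw [wordRefl_append, show u ++ x :: (v' ++ y :: w) = (u ++ x :: v') ++ y :: w by simp, hj',
    wordRefl_append, affineProd_append, affineProd_cons] at h
  -- Equality of the two wall reflections means that the letter `y` moved to the left through `v'`
  -- becomes `x`, so both letters can be deleted, contrary to reducedness.
  have h2 : affineProd b v' * affineSimple b y = affineSimple b x * affineProd b v' := by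
    have hx := affineSimple_mul_self (b := b) x
    generalize affineProd b u = g at *
    generalize affineProd b v' = g' at *
    generalize affineSimple b x = s at *
    generalize affineSimple b y = t at *
    have h3 : s = s * g' * t * (s * g')⁻¹ := by
      have := congrArg (fun z => g⁻¹ * z * g) h
      calc s = g⁻¹ * (g * s * g⁻¹) * g := by group
        _ = _ := this
        _ = _ := by group
    calc g' * t = s⁻¹ * (s * g' * t * (s * g')⁻¹) * (s * g') := by group
      _ = s⁻¹ * s * (s * g') := by rw [← h3]
      _ = _ := by group
  have := hl (u ++ v' ++ w) (by
    simp only [affineProd_append, affineProd_cons, mul_assoc]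
    congr 1
    rw [← mul_assoc (affineProd b v') (affineSimple b y), h2, ← mul_assoc, ← mul_assoc,
      affineSimple_mul_self, one_mul])
  simp at this

theorem wordRefl_mul (l : List (Option b.support)) {k : ℕ} (hk : k < l.length) :
    wordRefl b l k * affineProd b l = affineProd b (l.eraseIdx k) := by
  obtain ⟨u, x, v, rfl, rfl⟩ := exists_split l hk
  rw [wordRefl_append, affineProd_append, affineProd_cons, List.eraseIdx_append_of_length_le le_rfl]
  simp only [Nat.sub_self, List.eraseIdx_cons_zero, affineProd_append]
  calc _ = affineProd b u * (affineSimple b x * affineSimple b x) * affineProd b v := by group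
    _ = _ := by rw [affineSimple_mul_self, mul_one]

variable [P.IsCrystallographic] [P.IsReduced]

theorem wordRefl_eq {x0 : V} (hx : x0 ∈ fundamentalAlcove b) (l : List (Option b.support))
    (k : ℕ) : wordRefl b l k = affineReflection P (wordRoot b l k)
      (strip P (wordRoot b l k) (affineProd b (l.take k) x0)) :=
  affineProd_conj hx _ _

open scoped Classical in
theorem strip_take_succ {x0 : V} (hx : x0 ∈ fundamentalAlcove b) (l : List (Option b.support))
    {k : ℕ} (hk : k < l.length) (j : ι) :
    strip P j (affineProd b (l.take (k + 1)) x0) = strip P j (affineProd b (l.take k) x0) -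
      (if j = wordRoot b l k then 1 else 0) + (if j = negRoot P (wordRoot b l k) then 1 else 0) := by
  have : l.take (k + 1) = l.take k ++ [l.getD k none] := by
    simp [hk]
  rw [this, strip_affineProd_concat hx]
  rfl

/-- The gallery crosses the hyperplane `H_{j,v}` only in steps with the corresponding wall
reflection. -/
theorem wordRefl_eq_of_crossing {x0 : V} (hx : x0 ∈ fundamentalAlcove b)
    (l : List (Option b.support)) {k : ℕ} (hk : k < l.length) (j : ι) (v : ℤ)
    (h : ¬ (v ≤ strip P j (affineProd b (l.take k) x0) ↔
      v ≤ strip P j (affineProd b (l.take (k + 1)) x0))) :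
    wordRefl b l k = affineReflection P j v := by
  have hs := strip_take_succ hx l hk j
  rw [wordRefl_eq hx]
  by_cases h1 : j = wordRoot b l k
  · rw [if_pos h1, if_neg (by rw [h1]; exact (negRoot_ne _).symm)] at hs
    rw [← h1]
    congr 1
    omega
  by_cases h2 : j = negRoot P (wordRoot b l k)
  · rw [if_pos h2, if_neg h1] at hs
    have h3 : wordRoot b l k = negRoot P j := by rw [h2, negRoot_negRoot]
    rw [h3, affineReflection_negRoot, strip_negRoot hx]
    congr 1
    omega
  · rw [if_neg h1, if_neg h2] at hs
    exact absurd (by rw [hs]; simp) h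

/-- Two crossings of one hyperplane would give equal wall reflections in two positions, which
`wordRefl_injOn` excludes. So before the crossing one is on the side of the start, and after it on
the side of the end. -/
theorem crossing_unique {x0 : V} (hx : x0 ∈ fundamentalAlcove b) {l : List (Option b.support)}
    (hl : IsReducedWord b l) {k : ℕ} (hk : k < l.length) (j : ι) (v : ℤ)
    (h : ¬ (v ≤ strip P j (affineProd b (l.take k) x0) ↔
      v ≤ strip P j (affineProd b (l.take (k + 1)) x0))) :
    (v ≤ strip P j (affineProd b (l.take k) x0) ↔ v ≤ strip P j x0) ∧
    (v ≤ strip P j (affineProd b (l.take (k + 1)) x0) ↔ v ≤ strip P j (affineProd b l x0)) := by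
  have huniq : ∀ m, m < l.length → ¬ (v ≤ strip P j (affineProd b (l.take m) x0) ↔
      v ≤ strip P j (affineProd b (l.take (m + 1)) x0)) → m = k := by
    intro m hm hc
    have h1 := wordRefl_eq_of_crossing hx l hm j v hc
    have h2 := wordRefl_eq_of_crossing hx l hk j v h
    by_contra hne
    rcases Nat.lt_or_gt_of_ne hne with h' | h'
    · exact wordRefl_injOn hl h' hk (h1.trans h2.symm)
    · exact wordRefl_injOn hl h' hm (h2.trans h1.symm)
  have := iff_of_unique_change (S := fun m => v ≤ strip P j (affineProd b (l.take m) x0)) huniq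
  have h1 := this.1 k le_rfl hk.le
  have h2 := this.2 (k + 1) (by omega) (by omega)
  simp only [List.take_zero, List.take_length] at h1 h2
  exact ⟨h1, h2⟩

/-- The wall of the fundamental alcove with label `x` separates the alcoves `A` and `g A` if some
reduced word for `g` starts with `x`. -/
theorem strip_lt_of_cons {x0 : V} (hx : x0 ∈ fundamentalAlcove b) {x : Option b.support}
    {l : List (Option b.support)} (hl : IsReducedWord b (x :: l)) :
    strip P (affineSimpleRoot b x) (affineProd b (x :: l) x0) <
      strip P (affineSimpleRoot b x) x0 := by
  have h0 : wordRoot b (x :: l) 0 = affineSimpleRoot b x := by simp [wordRoot, linearProd]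
  have hs := strip_take_succ hx (x :: l) (k := 0) (by simp) (affineSimpleRoot b x)
  rw [h0, if_pos rfl, if_neg (negRoot_ne _).symm] at hs
  have h1 : affineProd b ((x :: l).take 0) x0 = x0 := rfl
  rw [h1] at hs
  have := crossing_unique hx hl (k := 0) (by simp) (affineSimpleRoot b x)
    (strip P (affineSimpleRoot b x) x0) (by rw [h1]; omega)
  omega

/-- The exchange condition. -/
theorem exists_eraseIdx {x : Option b.support} {l l' : List (Option b.support)}
    (hl : IsReducedWord b (x :: l)) (h : affineProd b l' = affineProd b (x :: l)) :
    ∃ k < l'.length, affineSimple b x * affineProd b l' = affineProd b (l'.eraseIdx k) := by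
  obtain ⟨x0, hx⟩ := fundamentalAlcove_nonempty b
  have h1 := strip_lt_of_cons hx hl
  -- The wall `x` separates the start from the common final alcove, so the gallery of `l'` crosses
  -- it as well. The letter at that crossing is the one to delete.
  obtain ⟨k, hk, h2, h3⟩ := exists_change (n := l'.length) (S := fun m =>
    strip P (affineSimpleRoot b x) x0 ≤
      strip P (affineSimpleRoot b x) (affineProd b (l'.take m) x0)) (le_refl _)
    (by rw [List.take_length, h]; omega)
  refine ⟨k, hk, ?_⟩
  rw [← wordRefl_mul l' hk, wordRefl_eq_of_crossing hx l' hk (affineSimpleRoot b x)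
    (strip P (affineSimpleRoot b x) x0) (fun h => h3 (h.mp h2)), ← affineSimple_eq hx]

/-- The action on alcoves is free: the first letter of a nonempty reduced word gives a wall
separating the fundamental alcove from its image. -/
theorem affineProd_eq_one {l : List (Option b.support)} {x0 : V} (hx : x0 ∈ fundamentalAlcove b)
    (hlx : affineProd b l x0 ∈ fundamentalAlcove b) : affineProd b l = 1 := by
  obtain ⟨l', h1, h2⟩ := exists_isReducedWord l
  cases l' with
  | nil => rw [← h2, affineProd_nil]
  | cons x l' =>
    have := strip_lt_of_cons hx h1
    rw [h2] at this
    unfold strip at this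
    rw [(coroot'_mem_Ioo hx _).1, (coroot'_mem_Ioo hlx _).1] at this
    exact absurd this (lt_irrefl _)

namespace LambdaChain

variable {lam : V}

theorem isReducedWord (Γ : LambdaChain b lam) : IsReducedWord b Γ.word :=
  isReducedWord_iff.mpr Γ.reduced

theorem root_eq_wordRoot (Γ : LambdaChain b lam) (k : ℕ) : Γ.root k = wordRoot b Γ.word k := rfl

theorem affineRefl_eq_wordRefl (Γ : LambdaChain b lam) (k : ℕ) :
    Γ.affineRefl k = wordRefl b Γ.word k := rfl

/-- Both products carry the fundamental alcove to the same translate, and the action on alcoves is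
free. This justifies speaking of the element `v_{-lam}`. -/
theorem affineProd_word_eq (Γ Γ' : LambdaChain b lam) :
    affineProd b Γ.word = affineProd b Γ'.word := by
  obtain ⟨x0, hx⟩ := fundamentalAlcove_nonempty b
  have h1 : affineProd b Γ.word x0 ∈ affineProd b Γ'.word '' fundamentalAlcove b := by
    rw [Γ'.maps_alcove, ← Γ.maps_alcove]; exact ⟨x0, hx, rfl⟩
  obtain ⟨y, hy, hyx⟩ := h1
  have h2 : affineProd b (Γ'.word.reverse ++ Γ.word) = 1 := by
    apply affineProd_eq_one hx
    rw [affineProd_append, affineProd_reverse, AffineEquiv.mul_def, AffineEquiv.trans_apply, ← hyx,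
      AffineEquiv.inv_def, AffineEquiv.symm_apply_apply]
    exact hy
  rw [affineProd_append, affineProd_reverse, inv_mul_eq_one] at h2
  exact h2.symm

theorem exists_sub_mem (Γ : LambdaChain b lam) {x0 : V} (hx : x0 ∈ fundamentalAlcove b) :
    ∃ y ∈ fundamentalAlcove b, affineProd b Γ.word x0 = y - lam := by
  have : affineProd b Γ.word x0 ∈ affineProd b Γ.word '' fundamentalAlcove b := ⟨x0, hx, rfl⟩
  rw [Γ.maps_alcove] at this
  obtain ⟨y, hy, h⟩ := this
  exact ⟨y, hy, h.symm⟩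

theorem strip_affineProd_word (Γ : LambdaChain b lam) {x0 : V} (hx : x0 ∈ fundamentalAlcove b)
    {i : ι} (hi : b.IsPos i) {m : ℤ} (hm : P.coroot' i lam = m) :
    strip P i (affineProd b Γ.word x0) = -m := by
  obtain ⟨y, hy, h⟩ := Γ.exists_sub_mem hx
  rw [h, strip, map_sub, hm, Int.floor_sub_intCast, (coroot'_mem_Ioo hy i).1, if_pos hi]
  omega

theorem strip_self {x0 : V} (hx : x0 ∈ fundamentalAlcove b) {i : ι} (hi : b.IsPos i) :
    strip P i x0 = 0 := by
  rw [strip, (coroot'_mem_Ioo hx i).1, if_pos hi]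

/-- A step with a negative root would raise the strip of a positive root. By uniqueness of crossings
that strip would be higher at the end than at the start, whereas by dominance it goes from `0` to
`-⟨lam, β^∨⟩ ≤ 0`. -/
theorem isPos_root (hlam : IsDominantWeight b lam) (Γ : LambdaChain b lam) {k : ℕ}
    (hk : k < Γ.length) : b.IsPos (Γ.root k) := by
  obtain ⟨x0, hx⟩ := fundamentalAlcove_nonempty b
  by_contra hn
  rw [← isPos_negRoot] at hn
  have hs := strip_take_succ hx Γ.word hk (negRoot P (Γ.root k))
  rw [← root_eq_wordRoot, if_neg (negRoot_ne _), if_pos rfl] at hs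
  have := crossing_unique hx Γ.isReducedWord hk (negRoot P (Γ.root k))
    (strip P (negRoot P (Γ.root k)) (affineProd b (Γ.word.take k) x0) + 1) (by omega)
  obtain ⟨m, hm⟩ := hlam.1 (negRoot P (Γ.root k))
  have hm0 : (0 : ℝ) ≤ m := hm ▸ hlam.2 _ hn
  have hm0 : 0 ≤ m := by exact_mod_cast hm0
  rw [strip_self hx hn, Γ.strip_affineProd_word hx hn hm] at this
  omega

open scoped Classical in
/-- The number of positions before `k` in which the root is `i`. -/
noncomputable def count (Γ : LambdaChain b lam) (k : ℕ) (i : ι) : ℕ :=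
  ((Finset.range k).filter fun l => Γ.root l = i).card

open scoped Classical in
theorem count_succ (Γ : LambdaChain b lam) (k : ℕ) (i : ι) :
    Γ.count (k + 1) i = Γ.count k i + if Γ.root k = i then 1 else 0 := by
  unfold count
  rw [Finset.range_add_one, Finset.filter_insert]
  split_ifs
  · rw [Finset.card_insert_of_notMem (by simp)]
  · rfl

/-- All roots of the chain being positive, a step with root `i` lowers the strip by one and no step
raises it. This yields both the level of `r̂_k` and, at the end of the gallery, the multiplicity
`⟨lam, i^∨⟩` of `i`. -/
theorem strip_take (hlam : IsDominantWeight b lam) (Γ : LambdaChain b lam) {x0 : V}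
    (hx : x0 ∈ fundamentalAlcove b) {k : ℕ} (hk : k ≤ Γ.length) {i : ι} (hi : b.IsPos i) :
    strip P i (affineProd b (Γ.word.take k) x0) = -Γ.count k i := by
  induction k with
  | zero => rw [List.take_zero, affineProd_nil]; simp [count, strip_self hx hi]
  | succ k ih =>
    have hs := strip_take_succ hx Γ.word hk i
    rw [if_neg (c := i = negRoot P _), ih (by omega)] at hs
    · rw [hs, count_succ, ← root_eq_wordRoot]
      rw [eq_comm (a := i)]
      push_cast
      split_ifs <;> ring
    · rintro rfl
      exact (isPos_negRoot b _).mp hi (Γ.isPos_root hlam hk)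

theorem affineRefl_eq (hlam : IsDominantWeight b lam) (Γ : LambdaChain b lam) {k : ℕ}
    (hk : k < Γ.length) :
    Γ.affineRefl k = affineReflection P (Γ.root k) (-Γ.count k (Γ.root k)) := by
  obtain ⟨x0, hx⟩ := fundamentalAlcove_nonempty b
  rw [affineRefl_eq_wordRefl, wordRefl_eq hx, ← root_eq_wordRoot, Γ.strip_take hlam hx hk.le
    (Γ.isPos_root hlam hk)]

theorem coroot'_lam (hlam : IsDominantWeight b lam) (Γ : LambdaChain b lam) {i : ι}
    (hi : b.IsPos i) : P.coroot' i lam = Γ.count Γ.length i := by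
  obtain ⟨x0, hx⟩ := fundamentalAlcove_nonempty b
  obtain ⟨m, hm⟩ := hlam.1 i
  have h1 := Γ.strip_affineProd_word hx hi hm
  have h2 := Γ.strip_take hlam hx le_rfl hi
  rw [length, List.take_length, h1] at h2
  rw [hm]
  have h3 : m = Γ.count Γ.length i := by rw [length]; omega
  exact_mod_cast h3

theorem coroot'_mem_strip (hlam : IsDominantWeight b lam) (Γ : LambdaChain b lam) {x0 : V}
    (hx : x0 ∈ fundamentalAlcove b) {k : ℕ} (hk : k ≤ Γ.length) {i : ι} (hi : b.IsPos i) :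
    -(Γ.count k i : ℝ) < P.coroot' i (affineProd b (Γ.word.take k) x0) ∧
      P.coroot' i (affineProd b (Γ.word.take k) x0) < -Γ.count k i + 1 := by
  have h := Γ.strip_take hlam hx hk hi
  have h1 := strip_lt hx (Γ.word.take k) i
  have h2 : P.coroot' i (affineProd b (Γ.word.take k) x0) <
    strip P i (affineProd b (Γ.word.take k) x0) + 1 := Int.lt_floor_add_one _
  rw [h] at h1 h2
  push_cast at h1 h2
  exact ⟨h1, h2⟩

end LambdaChain

end RootSystem

end AlcovePath

/-! ### Combinatorics of signed walks -/

namespace AlcovePath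

/-- A signed walk of length `n`: the sign `pos` and the height `e` change only in the positions
marked by `C` (contacts with a wall) or in those of the set `J` of folding positions. -/
structure SignedWalk (n : ℕ) (J : Finset ℕ) (C pos : ℕ → Prop) (e : ℕ → ℤ) : Prop where
  pos_zero : pos 0
  height_zero : e 0 = 0
  lt_of_mem : ∀ k ∈ J, k < n
  lt_of_contact : ∀ k, C k → k < n
  pos_succ_of_notMem : ∀ k < n, k ∉ J → (pos (k + 1) ↔ pos k)
  height_of_pos : ∀ k < n, k ∉ J → C k → pos k → e (k + 1) = e k + 1
  height_of_neg : ∀ k < n, k ∉ J → C k → ¬ pos k → e (k + 1) = e k - 1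
  height_of_notMem : ∀ k < n, k ∉ J → ¬ C k → e (k + 1) = e k
  pos_of_fold : ∀ k ∈ J, C k → pos k
  neg_of_fold : ∀ k ∈ J, C k → ¬ pos (k + 1)
  height_of_fold : ∀ k ∈ J, C k → e (k + 1) = e k - 1
  -- The asymmetry on which everything rests: a fold away from the contacts may turn a negative sign
  -- into a positive one, but not conversely.
  pos_of_mem : ∀ k ∈ J, ¬ C k → pos k → pos (k + 1)
  height_of_mem_pos : ∀ k ∈ J, ¬ C k → (pos k ↔ pos (k + 1)) → e (k + 1) = e k
  height_of_mem_neg : ∀ k ∈ J, ¬ C k → ¬ pos k → pos (k + 1) → e (k + 1) = e k + 1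

/-- The contacts `k` and `m` (or the end `m = n` of the walk) are consecutive. -/
def Consecutive (n : ℕ) (C : ℕ → Prop) (k m : ℕ) : Prop :=
  C k ∧ k < m ∧ (C m ∨ m = n) ∧ ∀ i, k < i → i < m → ¬ C i

/-- `m` is the first contact of maximal positive height, and `k` is the contact preceding it. -/
def LowersAt (n : ℕ) (C : ℕ → Prop) (e : ℕ → ℤ) (k m : ℕ) : Prop :=
  0 < e m ∧ Consecutive n C k m ∧ (∀ i, C i → e i ≤ e m) ∧ e n ≤ e m ∧ ∀ i, C i → i < m → e i < e m

namespace SignedWalk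

variable {n : ℕ} {J : Finset ℕ} {C pos : ℕ → Prop} {e : ℕ → ℤ}

/-- Between contacts, the sign stays positive and the height constant. -/
theorem pos_of_no_contact (h : SignedWalk n J C pos e) {k m : ℕ} (hkm : k ≤ m) (hmn : m ≤ n)
    (hk : pos k) (hC : ∀ i, k ≤ i → i < m → ¬ C i) : pos m ∧ e m = e k := by
  induction m, hkm using Nat.le_induction with
  | base => exact ⟨hk, rfl⟩
  | succ m hm ih =>
    obtain ⟨h1, h2⟩ := ih (by omega) fun i hi hi' => hC i hi (by omega)
    have hCm := hC m hm (by omega)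
    by_cases hJ : m ∈ J
    · have := h.pos_of_mem m hJ hCm h1
      exact ⟨this, by rw [h.height_of_mem_pos m hJ hCm (iff_of_true h1 this), h2]⟩
    · exact ⟨(h.pos_succ_of_notMem m (by omega) hJ).mpr h1,
        by rw [h.height_of_notMem m (by omega) hJ hCm, h2]⟩

/-- Between contacts, when the sign changes from negative to positive the height grows by one. -/
theorem height_of_no_contact (h : SignedWalk n J C pos e) {k m : ℕ} (hkm : k ≤ m) (hmn : m ≤ n)
    (hk : ¬ pos k) (hC : ∀ i, k ≤ i → i < m → ¬ C i) :
    (pos m → e m = e k + 1) ∧ (¬ pos m → e m = e k) := by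
  induction m, hkm using Nat.le_induction with
  | base => exact ⟨fun h => absurd h hk, fun _ => rfl⟩
  | succ m hm ih =>
    obtain ⟨h1, h2⟩ := ih (by omega) fun i hi hi' => hC i hi (by omega)
    have hCm := hC m hm (by omega)
    by_cases hJ : m ∈ J
    · have h3 := h.pos_of_mem m hJ hCm
      have h4 := h.height_of_mem_pos m hJ hCm
      have h5 := h.height_of_mem_neg m hJ hCm
      by_cases hp : pos m <;> by_cases hp' : pos (m + 1) <;> simp_all
    · have h3 := h.pos_succ_of_notMem m (by omega) hJ
      have h4 := h.height_of_notMem m (by omega) hJ hCm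
      rw [h3, h4]; exact ⟨h1, h2⟩

/-- A negative sign is preceded by a higher contact. -/
theorem exists_contact_of_neg (h : SignedWalk n J C pos e) {k : ℕ} (hk : k ≤ n) (hp : ¬ pos k) :
    ∃ i < k, C i ∧ e k < e i := by
  induction k with
  | zero => exact absurd h.pos_zero hp
  | succ k ih =>
    by_cases hJC : k ∈ J ∧ C k
    · exact ⟨k, by omega, hJC.2, by rw [h.height_of_fold k hJC.1 hJC.2]; omega⟩
    have hpk : ¬ pos k := by
      intro hpk
      by_cases hJ : k ∈ J
      · exact hp (h.pos_of_mem k hJ (fun hC => hJC ⟨hJ, hC⟩) hpk)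
      · exact hp ((h.pos_succ_of_notMem k (by omega) hJ).mpr hpk)
    obtain ⟨i, hi, hC, he⟩ := ih (by omega) hpk
    refine ⟨i, by omega, hC, lt_of_le_of_lt ?_ he⟩
    by_cases hJ : k ∈ J
    · exact (h.height_of_mem_pos k hJ (fun hC => hJC ⟨hJ, hC⟩) (iff_of_false hpk hp)).le
    · by_cases hCk : C k
      · rw [h.height_of_neg k (by omega) hJ hCk hpk]; omega
      · exact (h.height_of_notMem k (by omega) hJ hCk).le

theorem exists_next (n : ℕ) (C : ℕ → Prop) {k : ℕ} (hk : k < n) :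
    ∃ m ≤ n, k < m ∧ (C m ∨ m = n) ∧ ∀ i, k < i → i < m → ¬ C i := by
  classical
  have hex : ∃ m, k < m ∧ (C m ∨ m = n) := ⟨n, hk, Or.inr rfl⟩
  refine ⟨Nat.find hex, Nat.find_min' hex ⟨hk, Or.inr rfl⟩, (Nat.find_spec hex).1,
    (Nat.find_spec hex).2, fun i hi hi' hC => Nat.find_min hex hi' ⟨hi, Or.inl hC⟩⟩

theorem exists_previous {C : ℕ → Prop} {i m : ℕ} (him : i < m) (hi : C i) :
    ∃ k < m, C k ∧ ∀ i, k < i → i < m → ¬ C i := by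
  classical
  induction m with
  | zero => omega
  | succ m ih =>
    by_cases hm : C m
    · exact ⟨m, by omega, hm, fun i _ _ => by omega⟩
    · have : i ≠ m := fun h => hm (h ▸ hi)
      obtain ⟨k, hk, hC, h⟩ := ih (by omega)
      refine ⟨k, by omega, hC, fun i h1 h2 => ?_⟩
      rcases (Nat.lt_succ_iff_lt_or_eq.mp h2) with h2 | rfl
      · exact h i h1 h2
      · exact hm

theorem exists_max (n : ℕ) (C : ℕ → Prop) (hC : ∀ k, C k → k < n) (e : ℕ → ℤ) :
    ∃ M, (∃ m, (C m ∨ m = n) ∧ e m = M) ∧ ∀ i, C i ∨ i = n → e i ≤ M := by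
  classical
  obtain ⟨m, hm, h⟩ := Finset.exists_max_image ((Finset.range (n + 1)).filter
    fun i => C i ∨ i = n) e ⟨n, by simp⟩
  simp only [Finset.mem_filter, Finset.mem_range] at hm h
  refine ⟨e m, ⟨m, hm.2, rfl⟩, fun i hi => h i ⟨?_, hi⟩⟩
  rcases hi with hi | rfl
  · exact (hC i hi).trans (by omega)
  · omega

/-- If the positive sign is followed by an unfolded contact, a later contact is higher. -/
theorem exists_higher (h : SignedWalk n J C pos e) {k : ℕ} (hk : k < n) (hJ : k ∉ J) (hC : C k)
    (hp : pos k) : ∃ m, (C m ∨ m = n) ∧ e m = e k + 1 := by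
  obtain ⟨m, hmn, hkm, hm, hb⟩ := exists_next n C hk
  have h1 := (h.pos_succ_of_notMem k hk hJ).mpr hp
  have h2 := h.pos_of_no_contact (show k + 1 ≤ m by omega) hmn h1 fun i hi hi' => hb i (by omega) hi'
  exact ⟨m, hm, by rw [h2.2, h.height_of_pos k hk hJ hC hp]⟩

/-- The structure of a walk before the first maximal contact. -/
theorem lowersAt_spec (h : SignedWalk n J C pos e) {k m : ℕ} (hl : LowersAt n C e k m) :
    k ∉ J ∧ pos k ∧ e k = e m - 1 ∧ (∀ i, k < i → i ≤ m → pos i ∧ e i = e m) ∧ (C m → m ∈ J) ∧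
      m ≤ n := by
  obtain ⟨h0, ⟨hCk, hkm, hm, hb⟩, hmax, hmaxn, hfirst⟩ := hl
  have hmn : m ≤ n := by
    rcases hm with hm | rfl
    · exact (h.lt_of_contact m hm).le
    · exact le_rfl
  have hkn : k < n := by omega
  have hpm : pos m := by
    by_contra hp
    obtain ⟨i, hi, hCi, he⟩ := h.exists_contact_of_neg hmn hp
    have := hmax i hCi
    omega
  -- Were the sign negative after `k`, it would turn positive by `m` without a contact, so `e m = e
  -- (k + 1) + 1`. An earlier contact higher than `e (k + 1)` would then reach the maximum before
  -- `m`.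
  have hpk1 : pos (k + 1) := by
    by_contra hp
    have h1 := (h.height_of_no_contact (show k + 1 ≤ m by omega) hmn hp
      fun i hi hi' => hb i (by omega) hi').1 hpm
    obtain ⟨i, hi, hCi, he⟩ := h.exists_contact_of_neg (show k + 1 ≤ n by omega) hp
    have := hfirst i hCi (by omega)
    omega
  have hJ : k ∉ J := fun hJ => h.neg_of_fold k hJ hCk hpk1
  have hpk := (h.pos_succ_of_notMem k hkn hJ).mp hpk1
  have hall : ∀ i, k < i → i ≤ m → pos i ∧ e i = e (k + 1) := fun i hi hi' =>
    h.pos_of_no_contact (show k + 1 ≤ i by omega) (by omega) hpk1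
      fun i hi hi' => hb i (by omega) (by omega)
  have hem := (hall m hkm le_rfl).2
  refine ⟨hJ, hpk, ?_, fun i hi hi' => ⟨(hall i hi hi').1, (hall i hi hi').2.trans hem.symm⟩, ?_,
    hmn⟩
  · rw [hem, h.height_of_pos k hkn hJ hCk hpk]; ring
  · intro hCm
    by_contra hJm
    obtain ⟨m', hm', he⟩ := h.exists_higher (h.lt_of_contact m hCm) hJm hCm hpm
    rcases hm' with hm' | rfl
    · have := hmax m' hm'; omega
    · omega

/-- If the maximal height is positive, there is a first contact at which it is attained, and a
contact before it. -/
theorem exists_lowersAt (h : SignedWalk n J C pos e) (hM : ∃ m, (C m ∨ m = n) ∧ 0 < e m) :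
    ∃ k m, LowersAt n C e k m := by
  classical
  obtain ⟨M, hex, hmax⟩ := exists_max n C h.lt_of_contact e
  obtain ⟨m1, hm1, hm0⟩ := hM
  have hM0 : 0 < M := hm0.trans_le (hmax m1 hm1)
  obtain ⟨m, hm, rfl, hmin⟩ : ∃ m, (C m ∨ m = n) ∧ e m = M ∧
      ∀ i < m, ¬ ((C i ∨ i = n) ∧ e i = M) :=
    ⟨Nat.find hex, (Nat.find_spec hex).1, (Nat.find_spec hex).2, fun i => Nat.find_min hex⟩
  have hfirst : ∀ i, C i → i < m → e i < e m := fun i hi him =>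
    lt_of_le_of_ne (hmax i (Or.inl hi)) fun he => hmin i him ⟨Or.inl hi, he⟩
  have hmn : m ≤ n := by
    rcases hm with hm | hm
    · exact (h.lt_of_contact _ hm).le
    · exact hm.le
  have hC : ∃ i, i < m ∧ C i := by
    by_contra hC
    push Not at hC
    have := (h.pos_of_no_contact (Nat.zero_le m) hmn h.pos_zero fun i _ hi => hC i hi).2
    rw [h.height_zero] at this
    omega
  obtain ⟨i, him, hi⟩ := hC
  obtain ⟨k, hkm, hCk, hb⟩ := exists_previous him hi
  exact ⟨k, m, hM0, ⟨hCk, hkm, hm, hb⟩, fun i hi => hmax i (Or.inl hi), hmax n (Or.inr rfl), hfirst⟩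

/-- The structure of a walk with negative final sign around its last maximal contact. -/
theorem exists_last_max (h : SignedWalk n J C pos e) (hn : ¬ pos n) :
    ∃ k m, Consecutive n C k m ∧ 0 ≤ e k ∧ k ∈ J ∧ m ∉ J ∧ pos k ∧ m ≤ n ∧
      (∀ i, k < i → i ≤ m → ¬ pos i ∧ e i = e k - 1) ∧ (∀ i, C i → e i ≤ e k) ∧
      (∀ i, C i → k < i → e i < e k) ∧ e n < e k := by
  classical
  obtain ⟨M, ⟨m0, hm0, hM⟩, hmax⟩ := exists_max n C h.lt_of_contact e
  have hnM : e n < M := by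
    obtain ⟨i, hi, hCi, he⟩ := h.exists_contact_of_neg le_rfl hn
    exact he.trans_le (hmax i (Or.inl hCi))
  -- Up to the first change from positive to negative the height starts at `0` and never drops, and
  -- that change can only happen at a contact.
  have hM0 : 0 ≤ M := by
    obtain ⟨i, hin, hpi, hpi'⟩ := exists_change h.pos_zero hn
    have hex : ∃ i, i < n ∧ pos i ∧ ¬ pos (i + 1) := ⟨i, hin, hpi, hpi'⟩
    obtain ⟨h1, h2, h3⟩ := Nat.find_spec hex
    have hmin := fun i => Nat.find_min hex (m := i)
    set j := Nat.find hex
    have hC : C j := by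
      by_contra hC
      by_cases hJ : j ∈ J
      · exact h3 (h.pos_of_mem j hJ hC h2)
      · exact h3 ((h.pos_succ_of_notMem j h1 hJ).mpr h2)
    have hall : ∀ i ≤ j, pos i ∧ 0 ≤ e i := by
      intro i hi
      induction i with
      | zero => exact ⟨h.pos_zero, h.height_zero.ge⟩
      | succ i ih =>
        obtain ⟨h4, h5⟩ := ih (by omega)
        have h6 : pos (i + 1) := by
          by_contra hc
          exact hmin i (by omega) ⟨by omega, h4, hc⟩
        refine ⟨h6, ?_⟩
        by_cases hJ : i ∈ J <;> by_cases hCi : C i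
        · exact absurd h6 (h.neg_of_fold i hJ hCi)
        · rw [h.height_of_mem_pos i hJ hCi (iff_of_true h4 h6)]; exact h5
        · rw [h.height_of_pos i (by omega) hJ hCi h4]; omega
        · rw [h.height_of_notMem i (by omega) hJ hCi]; exact h5
    exact (hall j le_rfl).2.trans (hmax j (Or.inl hC))
  have hCm0 : C m0 := by
    rcases hm0 with hm0 | rfl
    · exact hm0
    · omega
  obtain ⟨k, hkn, ⟨hCk, hek⟩, hlast⟩ := exists_previous (C := fun i => C i ∧ e i = M)
    (h.lt_of_contact m0 hCm0) ⟨hCm0, hM⟩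
  subst hek
  have hlast' : ∀ i, C i → k < i → e i < e k := fun i hi hki =>
    lt_of_le_of_ne (hmax i (Or.inl hi)) fun he => hlast i hki (h.lt_of_contact i hi) ⟨hi, he⟩
  have hpk : pos k := by
    by_contra hp
    obtain ⟨i, hi, hCi, he⟩ := h.exists_contact_of_neg hkn.le hp
    have := hmax i (Or.inl hCi)
    omega
  -- An unfolded contact with positive sign is followed by a contact, or by the end of the walk,
  -- that is one higher.
  have hkJ : k ∈ J := by
    by_contra hJ
    obtain ⟨m, hm, he⟩ := h.exists_higher hkn hJ hCk hpk
    have := hmax m hm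
    omega
  obtain ⟨m, hmn, hkm, hm, hb⟩ := exists_next n C hkn
  have hem : e m < e k := by
    rcases hm with hm | rfl
    exacts [hlast' m hm hkm, hnM]
  have hp1 := h.neg_of_fold k hkJ hCk
  have he1 := h.height_of_fold k hkJ hCk
  have hpm : ¬ pos m := fun hp => by
    have := (h.height_of_no_contact (show k + 1 ≤ m by omega) hmn hp1
      fun i hi hi' => hb i (by omega) hi').1 hp
    omega
  refine ⟨k, m, ⟨hCk, hkm, hm, hb⟩, hM0, hkJ, ?_, hpk, hmn, ?_, fun i hi => hmax i (Or.inl hi),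
    hlast', hnM⟩
  · intro hmJ
    rcases hm with hm | rfl
    · exact hpm (h.pos_of_fold m hmJ hm)
    · exact absurd (h.lt_of_mem _ hmJ) (lt_irrefl _)
  · intro i hki him
    have hpi : ¬ pos i := fun hp => hpm (h.pos_of_no_contact him hmn hp
      fun j hj hj' => hb j (by omega) hj').1
    exact ⟨hpi, by rw [(h.height_of_no_contact (show k + 1 ≤ i by omega) (by omega) hp1
      fun j hj hj' => hb j (by omega) (by omega)).2 hpi, he1]⟩

/-- Two walks with the same contacts, signs and folding positions from `a` on have the same
increments from there on. -/
theorem height_sub_eq {J' : Finset ℕ} {pos' : ℕ → Prop} {e' : ℕ → ℤ}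
    (h : SignedWalk n J C pos e) (h' : SignedWalk n J' C pos' e') {a c : ℕ} (hac : a ≤ c)
    (hcn : c ≤ n) (hpos : ∀ i, a ≤ i → i ≤ c → (pos i ↔ pos' i))
    (hJ : ∀ i, a ≤ i → i < c → (i ∈ J ↔ i ∈ J')) : e' c - e c = e' a - e a := by
  induction c, hac using Nat.le_induction with
  | base => rfl
  | succ c hc ih =>
    rw [← ih (by omega) (fun i hi hi' => hpos i hi (by omega)) fun i hi hi' => hJ i hi (by omega)]
    have hp := hpos c hc (by omega)
    have hp1 := hpos (c + 1) (by omega) le_rfl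
    have hJc := hJ c hc (by omega)
    by_cases hm : c ∈ J <;> by_cases hC : C c
    · rw [h.height_of_fold c hm hC, h'.height_of_fold c (hJc.mp hm) hC]; ring
    · by_cases hpc : pos c ↔ pos (c + 1)
      · rw [h.height_of_mem_pos c hm hC hpc, h'.height_of_mem_pos c (hJc.mp hm) hC
          (by rw [← hp, ← hp1]; exact hpc)]
      · have h1 := h.pos_of_mem c hm hC
        have h2 : ¬ pos c := by tauto
        have h3 : pos (c + 1) := by tauto
        rw [h.height_of_mem_neg c hm hC h2 h3, h'.height_of_mem_neg c (hJc.mp hm) hC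
          (by rwa [← hp]) (by rwa [← hp1])]; ring
    · by_cases hpc : pos c
      · rw [h.height_of_pos c (by omega) hm hC hpc,
          h'.height_of_pos c (by omega) (by rwa [← hJc]) hC (by rwa [← hp])]; ring
      · rw [h.height_of_neg c (by omega) hm hC hpc,
          h'.height_of_neg c (by omega) (by rwa [← hJc]) hC (by rwa [← hp])]; ring
    · rw [h.height_of_notMem c (by omega) hm hC,
          h'.height_of_notMem c (by omega) (by rwa [← hJc]) hC]

/-- Moving a fold from the last maximal contact to the next contact raises the walk by two after
it, so that the new position becomes the first maximal contact. -/
theorem lowersAt_of_last_max {K : Finset ℕ} {pos' : ℕ → Prop} {e' : ℕ → ℤ}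
    (h : SignedWalk n J C pos e) (h' : SignedWalk n K C pos' e') {k m : ℕ}
    (hc : Consecutive n C k m) (h0 : 0 ≤ e k) (hmJ : m ∉ J) (hk : pos k) (hmn : m ≤ n)
    (hneg : ∀ i, k < i → i ≤ m → ¬ pos i ∧ e i = e k - 1) (hmax : ∀ i, C i → e i ≤ e k)
    (hlast : ∀ i, C i → k < i → e i < e k) (hn : e n < e k)
    (hpos1 : ∀ i ≤ k, pos i ↔ pos' i) (hpos2 : ∀ i, k < i → i ≤ m → pos' i)
    (hpos3 : ∀ i, m < i → i ≤ n → (pos i ↔ pos' i)) (hkK : k ∉ K) (hmK : C m → m ∈ K)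
    (hJK : ∀ i, i ≠ k → i ≠ m → (i ∈ J ↔ i ∈ K)) : LowersAt n C e' k m := by
  obtain ⟨hCk, hkm, hm, hb⟩ := hc
  have hle : ∀ i ≤ k, e' i = e i := by
    intro i hi
    have := h.height_sub_eq h' (Nat.zero_le i) (by omega) (fun j _ hj => hpos1 j (by omega))
      fun j _ hj => hJK j (by omega) (by omega)
    rw [h.height_zero, h'.height_zero] at this
    omega
  have he1 : e' (k + 1) = e k + 1 := by
    rw [h'.height_of_pos k (by omega) hkK hCk ((hpos1 k le_rfl).mp hk), hle k le_rfl]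
  have hem : e' m = e k + 1 := by
    rw [(h'.pos_of_no_contact (show k + 1 ≤ m by omega) hmn (hpos2 _ (by omega) (by omega))
      fun i hi hi' => hb i (by omega) hi').2, he1]
  have hgt : ∀ i, m < i → i ≤ n → e' i = e i + 2 := by
    intro i hi hin
    have hCm : C m := by
      rcases hm with hm | rfl
      exacts [hm, absurd hi (by omega)]
    have h1 := h'.height_of_fold m (hmK hCm) hCm
    have h2 := h.height_of_neg m (by omega) hmJ hCm (hneg m hkm le_rfl).1
    have h3 := (hneg m hkm le_rfl).2
    have := h.height_sub_eq h' (show m + 1 ≤ i by omega) hin (fun j hj hj' => hpos3 j (by omega)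
      (by omega)) fun j hj hj' => hJK j (by omega) (by omega)
    omega
  have hlt : ∀ i, C i → i < m → e' i < e' m := by
    intro i hi him
    rcases le_or_gt i k with hik | hik
    · rw [hle i hik, hem]; have := hmax i hi; omega
    · exact absurd hi (hb i hik him)
  refine ⟨by omega, ⟨hCk, hkm, hm, hb⟩, fun i hi => ?_, ?_, hlt⟩
  · rcases lt_trichotomy i m with him | rfl | him
    · exact (hlt i hi him).le
    · exact le_rfl
    · rw [hgt i him (h.lt_of_contact i hi).le, hem]; have := hlast i hi (by omega); omega
  · rcases hmn.lt_or_eq with hmn | rfl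
    · rw [hgt n hmn le_rfl]; omega
    · exact le_rfl

end SignedWalk

end AlcovePath

/-! ### Folded galleries as signed walks -/

namespace AlcovePath

section RootSystem

variable {ι V V' : Type*} [AddCommGroup V] [Module ℝ V] [AddCommGroup V'] [Module ℝ V']
  {P : RootPairing ι ℝ V V'} [Finite ι] [P.IsRootSystem] [P.IsIrreducible] {b : P.Base}

theorem sort_filter_lt_succ (J : Finset ℕ) (k : ℕ) :
    (J.filter (· < k + 1)).sort (· ≤ ·) =
      (J.filter (· < k)).sort (· ≤ ·) ++ if k ∈ J then [k] else [] := by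
  refine List.Perm.eq_of_pairwise' (r := (· ≤ ·)) (Finset.pairwise_sort _ _) ?_ ?_
  · rw [List.pairwise_append]
    refine ⟨Finset.pairwise_sort _ _, by split_ifs <;> simp, fun a ha c hc => ?_⟩
    rw [Finset.mem_sort, Finset.mem_filter] at ha
    split_ifs at hc
    · rw [List.mem_singleton] at hc; omega
    · simp at hc
  · rw [List.perm_ext_iff_of_nodup (Finset.sort_nodup _ _)]
    · intro a
      split_ifs with hk
      · simp only [Finset.mem_sort, Finset.mem_filter, List.mem_append, List.mem_singleton]
        constructor
        · rintro ⟨h1, h2⟩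
          rcases Nat.lt_succ_iff_lt_or_eq.mp h2 with h | h
          exacts [Or.inl ⟨h1, h⟩, Or.inr h]
        · rintro (⟨h1, h2⟩ | rfl)
          exacts [⟨h1, by omega⟩, ⟨hk, by omega⟩]
      · simp only [Finset.mem_sort, Finset.mem_filter, List.append_nil]
        constructor
        · rintro ⟨h1, h2⟩
          rcases Nat.lt_succ_iff_lt_or_eq.mp h2 with h | rfl
          exacts [⟨h1, h⟩, absurd h1 hk]
        · rintro ⟨h1, h2⟩
          exact ⟨h1, by omega⟩
    · rw [List.nodup_append]
      refine ⟨Finset.sort_nodup _ _, by split_ifs <;> simp, fun a ha c hc => ?_⟩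
      rw [Finset.mem_sort, Finset.mem_filter] at ha
      split_ifs at hc
      · rw [List.mem_singleton] at hc; omega
      · simp at hc

namespace LambdaChain

variable {lam : V} (Γ : LambdaChain b lam) (J : Finset ℕ)

/-- The product of the reflections in the positions of `J` below `k`. -/
noncomputable def weylAt (k : ℕ) : P.weylGroup := Γ.weyl (J.filter (· < k))

/-- The product of the affine reflections in the positions of `J` below `k`. -/
noncomputable def affineAt (k : ℕ) : V ≃ᵃ[ℝ] V := Γ.affine (J.filter (· < k))

theorem weylAt_zero : Γ.weylAt J 0 = 1 := by simp [weylAt, weyl]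

theorem affineAt_zero : Γ.affineAt J 0 = 1 := by simp [affineAt, affine]

variable {J} {k : ℕ}

theorem weylAt_succ (hk : k ∈ J) : Γ.weylAt J (k + 1) = Γ.weylAt J k * refl P (Γ.root k) := by
  rw [weylAt, weyl, sort_filter_lt_succ]; simp [hk, weylAt, weyl]

theorem weylAt_succ_of_notMem (hk : k ∉ J) : Γ.weylAt J (k + 1) = Γ.weylAt J k := by
  rw [weylAt, weyl, sort_filter_lt_succ]; simp [hk, weylAt, weyl]

theorem affineAt_succ (hk : k ∈ J) : Γ.affineAt J (k + 1) = Γ.affineAt J k * Γ.affineRefl k := by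
  rw [affineAt, affine, sort_filter_lt_succ]; simp [hk, affineAt, affine]

theorem affineAt_succ_of_notMem (hk : k ∉ J) : Γ.affineAt J (k + 1) = Γ.affineAt J k := by
  rw [affineAt, affine, sort_filter_lt_succ]; simp [hk, affineAt, affine]

theorem weylAt_congr {K : Finset ℕ} (h : ∀ i < k, i ∈ J ↔ i ∈ K) :
    Γ.weylAt J k = Γ.weylAt K k := by
  unfold weylAt
  congr 1
  ext i
  simp only [Finset.mem_filter]
  exact ⟨fun ⟨h1, h2⟩ => ⟨(h i h2).mp h1, h2⟩, fun ⟨h1, h2⟩ => ⟨(h i h2).mpr h1, h2⟩⟩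

theorem filter_lt_length (hJ : ∀ j ∈ J, j < Γ.length) : J.filter (· < Γ.length) = J :=
  Finset.filter_true_of_mem hJ

theorem filter_le_eq (k : ℕ) : J.filter (· ≤ k) = J.filter (· < k + 1) := by
  simp only [Nat.lt_succ_iff]

theorem isAdmissible_iff : Γ.IsAdmissible J ↔
    (∀ j ∈ J, j < Γ.length) ∧ ∀ j ∈ J, Covers b (Γ.weylAt J (j + 1)) (Γ.weylAt J j) := by
  unfold IsAdmissible weylAt
  simp only [filter_le_eq]

theorem isLinearPart_affineAt (k : ℕ) : IsLinearPart (Γ.weylAt J k) (Γ.affineAt J k) :=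
  Γ.isLinearPart_affine _

theorem affineAt_apply (k : ℕ) (x : V) :
    Γ.affineAt J k x = Γ.weylAt J k • x + Γ.affineAt J k 0 := Γ.isLinearPart_affineAt k x

/-- The root that is mapped to `α_p` by the folding at the positions below `k`. -/
noncomputable def pull (p : ι) (J : Finset ℕ) (k : ℕ) : ι := (Γ.weylAt J k)⁻¹ • p

/-- The position `k` is in contact with a wall of direction `α_p`. -/
def Contact (p : ι) (J : Finset ℕ) (k : ℕ) : Prop :=
  k < Γ.length ∧ (Γ.root k = Γ.pull p J k ∨ Γ.root k = negRoot P (Γ.pull p J k))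

open scoped Classical in
/-- The signed number of positions before `k` in which the root is `±i`. -/
noncomputable def signedCount (k : ℕ) (i : ι) : ℤ :=
  if b.IsPos i then Γ.count k i else -Γ.count k (negRoot P i)

/-- The height of the folded path with respect to `α_p`. -/
noncomputable def height (p : ι) (J : Finset ℕ) (k : ℕ) : ℤ :=
  Γ.signedCount k (Γ.pull p J k) - ⌊P.coroot' p (Γ.affineAt J k 0)⌋

theorem coroot'_affineAt (p : ι) (k : ℕ) (x : V) : P.coroot' p (Γ.affineAt J k x) =
    P.coroot' (Γ.pull p J k) x + P.coroot' p (Γ.affineAt J k 0) := by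
  rw [affineAt_apply, map_add, coroot'_neg_smul_inv, pull]

variable [P.IsCrystallographic] [P.IsReduced]

theorem signedCount_negRoot (k : ℕ) (i : ι) :
    Γ.signedCount k (negRoot P i) = -Γ.signedCount k i := by
  unfold signedCount
  by_cases h : b.IsPos i
  · rw [if_neg (by rwa [isPos_negRoot, not_not]), if_pos h, negRoot_negRoot]
  · rw [if_pos (by rwa [isPos_negRoot]), if_neg h, neg_neg]

theorem signedCount_zero (i : ι) : Γ.signedCount 0 i = 0 := by
  simp [signedCount, count]

theorem affineRefl_apply (hlam : IsDominantWeight b lam) (hk : k < Γ.length) (x : V) :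
    Γ.affineRefl k x = x - (P.coroot' (Γ.root k) x + Γ.count k (Γ.root k)) • P.root (Γ.root k) := by
  rw [Γ.affineRefl_eq hlam hk, affineReflection_apply]
  push_cast
  rw [sub_neg_eq_add]

/-- Integrality makes the floor in the definition of `height` exact. -/
theorem exists_int_coroot'_affineAt (hlam : IsDominantWeight b lam) (p : ι) {k : ℕ}
    (hk : k ≤ Γ.length) : ∃ m : ℤ, P.coroot' p (Γ.affineAt J k 0) = m := by
  induction k with
  | zero => exact ⟨0, by simp [affineAt_zero]⟩
  | succ k ih =>
    obtain ⟨m, hm⟩ := ih (by omega)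
    by_cases hJ : k ∈ J
    · refine ⟨-Γ.count k (Γ.root k) * P.pairingIn ℤ (Γ.root k) (Γ.pull p J k) + m, ?_⟩
      rw [Γ.affineAt_succ hJ, AffineEquiv.mul_def, AffineEquiv.trans_apply, coroot'_affineAt, hm,
        Γ.affineRefl_apply hlam hk]
      rw [map_sub, map_smul, P.root_coroot'_eq_pairing, ← P.algebraMap_pairingIn ℤ]
      simp
    · exact ⟨m, by rw [Γ.affineAt_succ_of_notMem hJ, hm]⟩

theorem height_eq (hlam : IsDominantWeight b lam) (p : ι) {k : ℕ} (hk : k ≤ Γ.length) :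
    (Γ.height p J k : ℝ) = Γ.signedCount k (Γ.pull p J k) - P.coroot' p (Γ.affineAt J k 0) := by
  obtain ⟨m, hm⟩ := Γ.exists_int_coroot'_affineAt (J := J) hlam p hk
  rw [height, hm, Int.floor_intCast]
  push_cast
  ring

/-- The point number `k` of a gallery inside the alcoves of the path. -/
noncomputable def pathPoint (x0 : V) (k : ℕ) : V := affineProd b (Γ.word.take k) x0

theorem pathPoint_succ (x0 : V) (hk : k < Γ.length) :
    Γ.pathPoint x0 (k + 1) = Γ.affineRefl k (Γ.pathPoint x0 k) := by
  unfold pathPoint affineRefl label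
  have : Γ.word.take (k + 1) = Γ.word.take k ++ [Γ.word.getD k none] := by
    rw [List.take_add_one, List.getD_eq_getElem?_getD, List.getElem?_eq_getElem hk]; rfl
  rw [this, affineProd_append, affineProd_cons, affineProd_nil, mul_one]
  simp [AffineEquiv.mul_def, AffineEquiv.inv_def]

theorem coroot'_pathPoint_mem (hlam : IsDominantWeight b lam) {x0 : V}
    (hx : x0 ∈ fundamentalAlcove b) {k : ℕ} (hk : k ≤ Γ.length) (i : ι) :
    (b.IsPos i → -(Γ.signedCount k i : ℝ) < P.coroot' i (Γ.pathPoint x0 k) ∧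
      P.coroot' i (Γ.pathPoint x0 k) < -Γ.signedCount k i + 1) ∧
    (¬ b.IsPos i → -(Γ.signedCount k i : ℝ) - 1 < P.coroot' i (Γ.pathPoint x0 k) ∧
      P.coroot' i (Γ.pathPoint x0 k) < -Γ.signedCount k i) := by
  constructor
  · intro hi
    have := Γ.coroot'_mem_strip hlam hx hk hi
    rw [signedCount, if_pos hi]
    exact_mod_cast this
  · intro hi
    have := Γ.coroot'_mem_strip hlam hx hk ((isPos_negRoot b i).mpr hi)
    rw [coroot'_negRoot] at this
    rw [signedCount, if_neg hi, pathPoint]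
    push_cast
    constructor <;> linarith [this.1, this.2]

/-- The alcove of the folded gallery lies just above the hyperplane at level `-height` if the sign
is positive and just below it if the sign is negative. Since a fold does not move this alcove,
comparing the descriptions before and after it determines the change of height: none if the sign
persists, `-1` from positive to negative, `+1` from negative to positive. -/
theorem height_mem (hlam : IsDominantWeight b lam) {x0 : V} (hx : x0 ∈ fundamentalAlcove b)
    (p : ι) {k : ℕ} (hk : k ≤ Γ.length) :
    (b.IsPos (Γ.pull p J k) →
      -(Γ.height p J k : ℝ) < P.coroot' p (Γ.affineAt J k (Γ.pathPoint x0 k)) ∧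
      P.coroot' p (Γ.affineAt J k (Γ.pathPoint x0 k)) < -Γ.height p J k + 1) ∧
    (¬ b.IsPos (Γ.pull p J k) →
      -(Γ.height p J k : ℝ) - 1 < P.coroot' p (Γ.affineAt J k (Γ.pathPoint x0 k)) ∧
      P.coroot' p (Γ.affineAt J k (Γ.pathPoint x0 k)) < -Γ.height p J k) := by
  have h := Γ.coroot'_pathPoint_mem hlam hx hk (Γ.pull p J k)
  rw [Γ.height_eq hlam p hk, Γ.coroot'_affineAt p k (Γ.pathPoint x0 k)]
  exact ⟨fun hp => ⟨by linarith [(h.1 hp).1], by linarith [(h.1 hp).2]⟩,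
    fun hp => ⟨by linarith [(h.2 hp).1], by linarith [(h.2 hp).2]⟩⟩

/-- The unfolded gallery moves on by `r̂_k` and the fold applies `r̂_k` once more; the two cancel.
-/
theorem affineAt_pathPoint_succ (x0 : V) (hk : k < Γ.length) (hJ : k ∈ J) :
    Γ.affineAt J (k + 1) (Γ.pathPoint x0 (k + 1)) = Γ.affineAt J k (Γ.pathPoint x0 k) := by
  rw [Γ.affineAt_succ hJ, Γ.pathPoint_succ x0 hk, AffineEquiv.mul_def, AffineEquiv.trans_apply]
  congr 1
  unfold affineRefl
  have := affineSimple_mul_self (b := b) (Γ.label k)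
  rw [← AffineEquiv.trans_apply, ← AffineEquiv.mul_def]
  have h2 : affineProd b (List.take k Γ.word) * affineSimple b (Γ.label k) *
    (affineProd b (List.take k Γ.word))⁻¹ * (affineProd b (List.take k Γ.word) *
      affineSimple b (Γ.label k) * (affineProd b (List.take k Γ.word))⁻¹) = 1 := by
    simp only [mul_assoc]
    rw [inv_mul_cancel_left, ← mul_assoc (affineSimple b (Γ.label k)), this,
      one_mul, mul_inv_cancel]
  rw [h2]; rfl

theorem signedCount_succ (hlam : IsDominantWeight b lam) (hk : k < Γ.length) (i : ι) :
    (Γ.root k = i ∨ Γ.root k = negRoot P i → b.IsPos i →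
      Γ.signedCount (k + 1) i = Γ.signedCount k i + 1) ∧
    (Γ.root k = i ∨ Γ.root k = negRoot P i → ¬ b.IsPos i →
      Γ.signedCount (k + 1) i = Γ.signedCount k i - 1) ∧
    (¬ (Γ.root k = i ∨ Γ.root k = negRoot P i) →
      Γ.signedCount (k + 1) i = Γ.signedCount k i) := by
  have hpos := Γ.isPos_root hlam hk
  unfold signedCount
  refine ⟨fun h hi => ?_, fun h hi => ?_, fun h => ?_⟩
  · have : Γ.root k = i := by
      rcases h with h | h
      · exact h
      · rw [h, isPos_negRoot] at hpos; exact absurd hi hpos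
    rw [if_pos hi, if_pos hi, count_succ, if_pos this]
    push_cast; ring
  · have : Γ.root k = negRoot P i := by
      rcases h with h | h
      · exact absurd (h ▸ hpos) hi
      · exact h
    rw [if_neg hi, if_neg hi, count_succ, if_pos this]
    push_cast; ring
  · rw [not_or] at h
    rw [count_succ, count_succ, if_neg h.1, if_neg h.2, add_zero, add_zero]

theorem pull_succ (p : ι) (hJ : k ∈ J) :
    Γ.pull p J (k + 1) = refl P (Γ.root k) • Γ.pull p J k := by
  rw [pull, Γ.weylAt_succ hJ, mul_inv_rev, refl_inv, mul_smul, pull]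

theorem pull_succ_of_notMem (p : ι) (hJ : k ∉ J) : Γ.pull p J (k + 1) = Γ.pull p J k := by
  rw [pull, Γ.weylAt_succ_of_notMem hJ, pull]

theorem isPos_weylAt_smul_root (hlam : IsDominantWeight b lam) (hJ : Γ.IsAdmissible J)
    (hk : k ∈ J) : b.IsPos (Γ.weylAt J k • Γ.root k) := by
  rw [isAdmissible_iff] at hJ
  rw [← weylLength_lt_mul_refl_iff (Γ.isPos_root hlam (hJ.1 k hk)), ← Γ.weylAt_succ hk,
    (hJ.2 k hk).2]
  omega

theorem weylLength_weylAt (hJ : Γ.IsAdmissible J) (hk : k ∈ J) :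
    weylLength b (Γ.weylAt J k * refl P (Γ.root k)) = weylLength b (Γ.weylAt J k) + 1 := by
  rw [isAdmissible_iff] at hJ
  rw [← Γ.weylAt_succ hk, (hJ.2 k hk).2]

theorem contact_iff (p : ι) : Γ.Contact p J k ↔
    k < Γ.length ∧ (Γ.weylAt J k • Γ.root k = p ∨ Γ.weylAt J k • Γ.root k = negRoot P p) := by
  unfold Contact pull
  rw [eq_inv_smul_iff, ← smul_negRoot, eq_inv_smul_iff]

/-- The folded paths of admissible sets are signed walks. -/
theorem signedWalk (hlam : IsDominantWeight b lam) (hJ : Γ.IsAdmissible J) {p : ι}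
    (hp : p ∈ b.support) : SignedWalk Γ.length J (Γ.Contact p J)
      (fun k => b.IsPos (Γ.pull p J k)) (Γ.height p J) := by
  obtain ⟨x0, hx⟩ := fundamentalAlcove_nonempty b
  have hn := (Γ.isAdmissible_iff.mp hJ).1
  have hpp : b.IsPos p := b.isPos_of_mem_support hp
  -- A cover makes the image of the root at a fold positive, so at a folded contact this image is
  -- `α_p` and not `-α_p`.
  have hfold : ∀ k ∈ J, Γ.Contact p J k → Γ.root k = Γ.pull p J k := by
    intro k hk hC
    rw [contact_iff] at hC
    rcases hC.2 with h | h
    · rw [pull, eq_inv_smul_iff, h]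
    · have := Γ.isPos_weylAt_smul_root hlam hJ hk
      rw [h, isPos_negRoot] at this
      exact absurd hpp this
  have hstay : ∀ k ∈ J, (b.IsPos (Γ.pull p J k) ↔ b.IsPos (Γ.pull p J (k + 1))) →
      Γ.height p J (k + 1) = Γ.height p J k := by
    intro k hk hiff
    have h1 := Γ.height_mem (J := J) hlam hx p (hn k hk).le
    have h2 := Γ.height_mem (J := J) hlam hx p (hn k hk)
    rw [Γ.affineAt_pathPoint_succ x0 (hn k hk) hk] at h2
    by_cases hpos : b.IsPos (Γ.pull p J k)
    · have h1 := h1.1 hpos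
      have h2 := h2.1 (hiff.mp hpos)
      have h3 : (Γ.height p J k : ℝ) < Γ.height p J (k + 1) + 1 := by linarith [h1.1, h2.2]
      have h4 : (Γ.height p J (k + 1) : ℝ) < Γ.height p J k + 1 := by linarith [h1.2, h2.1]
      norm_cast at h3 h4
      omega
    · have h1 := h1.2 hpos
      have h2 := h2.2 (fun h => hpos (hiff.mpr h))
      have h3 : (Γ.height p J k : ℝ) < Γ.height p J (k + 1) + 1 := by linarith [h1.2, h2.1]
      have h4 : (Γ.height p J (k + 1) : ℝ) < Γ.height p J k + 1 := by linarith [h1.1, h2.2]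
      norm_cast at h3 h4
      omega
  have hturn : ∀ k ∈ J, b.IsPos (Γ.root k) := fun k hk => Γ.isPos_root hlam (hn k hk)
  exact
    { pos_zero := by rw [pull, weylAt_zero, inv_one, one_smul]; exact hpp
      height_zero := by
        rw [height, signedCount_zero, affineAt_zero]
        simp
      lt_of_mem := hn
      lt_of_contact := fun k hk => hk.1
      pos_succ_of_notMem := fun k _ hk => by rw [Γ.pull_succ_of_notMem p hk]
      height_of_pos := fun k hkn hk hC hpos => by
        rw [height, Γ.pull_succ_of_notMem p hk, Γ.affineAt_succ_of_notMem hk,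
          (Γ.signedCount_succ hlam hkn _).1 hC.2 hpos, height]
        ring
      height_of_neg := fun k hkn hk hC hpos => by
        rw [height, Γ.pull_succ_of_notMem p hk, Γ.affineAt_succ_of_notMem hk,
          (Γ.signedCount_succ hlam hkn _).2.1 hC.2 hpos, height]
        ring
      height_of_notMem := fun k hkn hk hC => by
        rw [height, Γ.pull_succ_of_notMem p hk, Γ.affineAt_succ_of_notMem hk,
          (Γ.signedCount_succ hlam hkn _).2.2 (fun h => hC ⟨hkn, h⟩), height]
      pos_of_fold := fun k hk hC => by
        rw [← hfold k hk hC]; exact hturn k hk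
      neg_of_fold := fun k hk hC => by
        rw [Γ.pull_succ p hk, ← hfold k hk hC, refl_smul_self, isPos_negRoot, not_not]
        exact hturn k hk
      height_of_fold := fun k hk hC => by
        have hpos : b.IsPos (Γ.pull p J k) := by
          rw [← hfold k hk hC]; exact hturn k hk
        have hneg : ¬ b.IsPos (Γ.pull p J (k + 1)) := by
          rw [Γ.pull_succ p hk, ← hfold k hk hC, refl_smul_self, isPos_negRoot, not_not]
          exact hturn k hk
        have h1 := (Γ.height_mem (J := J) hlam hx p (hn k hk).le).1 hpos
        have h2 := (Γ.height_mem (J := J) hlam hx p (hn k hk)).2 hneg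
        rw [Γ.affineAt_pathPoint_succ x0 (hn k hk) hk] at h2
        have h3 : (Γ.height p J (k + 1) : ℝ) < Γ.height p J k := by linarith [h1.1, h2.2]
        have h4 : (Γ.height p J k : ℝ) < Γ.height p J (k + 1) + 2 := by linarith [h1.2, h2.1]
        norm_cast at h3 h4
        omega
      pos_of_mem := fun k hk hC hpos => by
        by_contra hneg
        refine hC ⟨hn k hk, Or.inl ?_⟩
        rw [pull, eq_inv_smul_iff]
        -- A sign turning from positive to negative means that `s_p` becomes a left descent in a
        -- cover; by the lifting property the cover is then multiplication by `s_p`, so the position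
        -- is a contact.
        refine smul_eq_of_covers hp (hturn k hk) (Γ.weylLength_weylAt hJ hk) hpos ?_
        rw [← Γ.weylAt_succ hk]
        exact hneg
      height_of_mem_pos := fun k hk _ hiff => hstay k hk hiff
      height_of_mem_neg := fun k hk _ hneg hpos => by
        have h1 := (Γ.height_mem (J := J) hlam hx p (hn k hk).le).2 hneg
        have h2 := (Γ.height_mem (J := J) hlam hx p (hn k hk)).1 hpos
        rw [Γ.affineAt_pathPoint_succ x0 (hn k hk) hk] at h2
        have h3 : (Γ.height p J k : ℝ) < Γ.height p J (k + 1) := by linarith [h1.2, h2.1]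
        have h4 : (Γ.height p J (k + 1) : ℝ) < Γ.height p J k + 2 := by linarith [h1.1, h2.2]
        norm_cast at h3 h4
        omega }

end LambdaChain

end RootSystem

end AlcovePath

/-! ### Levels are heights: the root operators in terms of signed walks -/

namespace AlcovePath

section RootSystem

variable {ι V V' : Type*} [AddCommGroup V] [Module ℝ V] [AddCommGroup V'] [Module ℝ V']
  {P : RootPairing ι ℝ V V'} [Finite ι] [P.IsRootSystem] [P.IsIrreducible] {b : P.Base}
  [P.IsCrystallographic] [P.IsReduced]

namespace LambdaChain

variable {lam : V} (Γ : LambdaChain b lam) {J : Finset ℕ} {k m : ℕ}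

theorem mem_positions (p : b.support) : k ∈ Γ.positions p J ↔ Γ.Contact p J k := by
  classical
  unfold positions
  rw [contact_iff, Finset.mem_filter, Finset.mem_range]
  rfl

/-- Let `y` be the point folded to `0`. The level is read off from the image of `0` under the folded
reflection, and the height from the image of `0` under the folding; expressed through `y`, both
equal the signed count plus the pairing of `y` with the pulled back root. -/
theorem level_eq (hlam : IsDominantWeight b lam) {p : b.support} (hk : Γ.Contact p J k) :
    Γ.level J k = Γ.height p J k := by
  have hpp : b.IsPos (p : ι) := b.isPos_of_mem_support p.2
  have hpos := Γ.isPos_root hlam hk.1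
  obtain ⟨y, hy⟩ := (Γ.affineAt J k).surjective 0
  have h1 : Γ.foldedRefl J k 0 = Γ.affineAt J k (Γ.affineRefl k y) := by
    have : (Γ.affineAt J k)⁻¹ 0 = y := by
      rw [AffineEquiv.inv_def, ← hy, AffineEquiv.symm_apply_apply]
    rw [← this]; rfl
  have h2 : P.coroot' p (Γ.affineAt J k 0) = -P.coroot' (Γ.pull p J k) y := by
    have := Γ.coroot'_affineAt (J := J) (p : ι) k y
    rw [hy, map_zero] at this
    linarith
  have h3 : P.coroot' (p : ι) (Γ.foldedRefl J k 0) =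
      -(P.coroot' (Γ.root k) y + Γ.count k (Γ.root k)) *
        P.coroot' (Γ.pull p J k) (P.root (Γ.root k)) := by
    rw [h1, coroot'_affineAt, h2, Γ.affineRefl_apply hlam hk.1, map_sub, map_smul, smul_eq_mul]
    ring
  have h4 : absRoot b (Γ.foldedRoot J k) = p := by
    rw [contact_iff] at hk
    change absRoot b (Γ.weylAt J k • Γ.root k) = p
    rcases hk.2 with h | h
    · rw [h, absRoot, if_pos hpp]
    · rw [h, absRoot, if_neg (by rwa [isPos_negRoot, not_not]), negRoot_negRoot]
  rw [level, h4, h3, Γ.height_eq hlam p hk.1.le, h2]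
  rcases hk.2 with h | h
  · rw [← h, signedCount, if_pos hpos]
    simp
    ring
  · have h' : Γ.pull p J k = negRoot P (Γ.root k) := by rw [h, negRoot_negRoot]
    rw [h', signedCount_negRoot, signedCount, if_pos hpos, coroot'_negRoot, coroot'_negRoot]
    simp
    ring

/-- At the end of the chain the signed count of a root is its coroot pairing with `lam`, which turns
the height into `⟨μ(J), α_p^∨⟩`. -/
theorem levelInfty_eq (hlam : IsDominantWeight b lam) (hJ : ∀ j ∈ J, j < Γ.length)
    (p : b.support) : Γ.levelInfty p J = Γ.height p J Γ.length := by
  have h : Γ.affine J = Γ.affineAt J Γ.length := by rw [affineAt, Γ.filter_lt_length hJ]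
  rw [levelInfty, weight, h, map_neg, coroot'_affineAt, Γ.height_eq hlam _ le_rfl, map_neg]
  unfold signedCount
  split_ifs with hp
  · rw [Γ.coroot'_lam hlam hp]; push_cast; ring
  · have := Γ.coroot'_lam hlam ((isPos_negRoot b _).mpr hp)
    rw [coroot'_negRoot] at this
    push_cast
    linarith

/-- The value `∞` of `m_F` corresponds to `m = Γ.length`. This number never belongs to `J`, so
erasing it has no effect and one formula covers both cases. -/
theorem lowersAt_positions (hlam : IsDominantWeight b lam) (hJ : ∀ j ∈ J, j < Γ.length)
    {p : b.support} (h : LowersAt Γ.length (Γ.Contact p J) (Γ.height p J) k m) :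
    Γ.maxLevel p J = Γ.height p J m ∧
      ((Γ.positions p J).filter fun i : ℕ => (i : WithTop ℕ) < Γ.lowerM p J).max =
        (k : WithBot ℕ) ∧
      (J.filter fun j : ℕ => (j : WithTop ℕ) ≠ Γ.lowerM p J) = J.erase m := by
  classical
  obtain ⟨-, ⟨hCk, hkm, hm, hb⟩, hmax, hmaxn, hfirst⟩ := h
  have h1 : Γ.maxLevel p J = Γ.height p J m := by
    apply le_antisymm
    · apply Finset.max'_le
      intro y hy
      rw [Finset.mem_insert, Finset.mem_image] at hy
      rcases hy with rfl | ⟨i, hi, rfl⟩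
      · rw [Γ.levelInfty_eq hlam hJ]; exact_mod_cast hmaxn
      · rw [mem_positions] at hi
        rw [Γ.level_eq hlam hi]; exact_mod_cast hmax i hi
    · apply Finset.le_max'
      rw [Finset.mem_insert, Finset.mem_image]
      rcases hm with hm | rfl
      · exact Or.inr ⟨m, (Γ.mem_positions p).mpr hm, Γ.level_eq hlam hm⟩
      · exact Or.inl (Γ.levelInfty_eq hlam hJ p).symm
  have h2 : ∀ i, i ∈ (Γ.positions p J).filter (fun i => Γ.level J i = Γ.maxLevel p J) ↔
      Γ.Contact p J i ∧ Γ.height p J i = Γ.height p J m := by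
    intro i
    rw [Finset.mem_filter, mem_positions, h1]
    refine and_congr_right fun hi => ?_
    rw [Γ.level_eq hlam hi]
    norm_cast
  have hlast : ∀ i, Γ.Contact p J i → i < m → i ≤ k := by
    intro i hi him
    by_contra hki
    exact hb i (by omega) him hi
  by_cases hCm : Γ.Contact p J m
  · have h3 : Γ.lowerM p J = m := by
      rw [lowerM, Finset.min_eq_inf_withTop]
      apply le_antisymm
      · exact Finset.inf_le (f := fun i : ℕ => (i : WithTop ℕ)) ((h2 m).mpr ⟨hCm, rfl⟩)
      · apply Finset.le_inf
        intro i hi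
        obtain ⟨hi, he⟩ := (h2 i).mp hi
        have : m ≤ i := by
          by_contra hc
          have := hfirst i hi (by omega)
          omega
        exact WithTop.coe_le_coe.mpr this
    refine ⟨h1, ?_, ?_⟩
    · rw [h3]
      apply le_antisymm
      · apply Finset.max_le
        intro i hi
        rw [Finset.mem_filter, mem_positions] at hi
        have := hlast i hi.1 (by exact_mod_cast hi.2)
        exact WithBot.coe_le_coe.mpr this
      · apply Finset.le_max
        rw [Finset.mem_filter, mem_positions]
        exact ⟨hCk, by exact_mod_cast hkm⟩
    · rw [h3]
      ext i
      rw [Finset.mem_filter, Finset.mem_erase]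
      simp only [ne_eq, Nat.cast_inj, and_comm]
  · have hmn : m = Γ.length := hm.resolve_left hCm
    have h3 : Γ.lowerM p J = ⊤ := by
      rw [lowerM, Finset.min_eq_top, Finset.eq_empty_iff_forall_notMem]
      intro i hi
      obtain ⟨hi, he⟩ := (h2 i).mp hi
      have := hfirst i hi (hmn ▸ hi.1)
      omega
    refine ⟨h1, ?_, ?_⟩
    · rw [h3]
      apply le_antisymm
      · apply Finset.max_le
        intro i hi
        rw [Finset.mem_filter, mem_positions] at hi
        have := hlast i hi.1 (hmn ▸ hi.1.1)
        exact WithBot.coe_le_coe.mpr this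
      · apply Finset.le_max
        rw [Finset.mem_filter, mem_positions]
        exact ⟨hCk, WithTop.coe_lt_top k⟩
    · rw [h3, Finset.erase_eq_of_notMem, Finset.filter_true_of_mem]
      · intro i _
        exact WithTop.coe_ne_top
      · intro hmJ
        have := hJ m hmJ
        omega

/-- The root operator in terms of the heights of the folded path. -/
theorem lowers_iff (hlam : IsDominantWeight b lam) (hJ : Γ.IsAdmissible J) {p : b.support}
    {J' : Finset ℕ} : Γ.Lowers p J J' ↔
      ∃ k m, LowersAt Γ.length (Γ.Contact p J) (Γ.height p J) k m ∧ J' = insert k (J.erase m) := by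
  have hn := (Γ.isAdmissible_iff.mp hJ).1
  constructor
  · rintro ⟨h0, k, hk, hJ'⟩
    have hmem := Finset.max'_mem (insert (Γ.levelInfty p J) ((Γ.positions p J).image (Γ.level J)))
      (Finset.insert_nonempty _ _)
    have hex : ∃ m, (Γ.Contact p J m ∨ m = Γ.length) ∧ 0 < Γ.height p J m := by
      change Γ.maxLevel p J ∈ _ at hmem
      rw [Finset.mem_insert, Finset.mem_image] at hmem
      rcases hmem with h | ⟨i, hi, h⟩
      · refine ⟨Γ.length, Or.inr rfl, ?_⟩
        rw [h, Γ.levelInfty_eq hlam hn] at h0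
        exact_mod_cast h0
      · rw [mem_positions] at hi
        refine ⟨i, Or.inl hi, ?_⟩
        rw [← h, Γ.level_eq hlam hi] at h0
        exact_mod_cast h0
    obtain ⟨k', m, h⟩ := (Γ.signedWalk hlam hJ p.2).exists_lowersAt hex
    obtain ⟨-, h1, h2⟩ := Γ.lowersAt_positions hlam hn h
    refine ⟨k', m, h, ?_⟩
    rw [h1] at hk
    have : k' = k := by exact_mod_cast hk
    rw [hJ', h2, this]
  · rintro ⟨k, m, h, hJ'⟩
    obtain ⟨h1, h2, h3⟩ := Γ.lowersAt_positions hlam hn h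
    refine ⟨?_, k, h2, ?_⟩
    · rw [h1]; exact_mod_cast h.1
    · rw [h3, hJ']

theorem Lowers.unique {p : b.support} {J' J'' : Finset ℕ} (h : Γ.Lowers p J J')
    (h' : Γ.Lowers p J J'') : J' = J'' := by
  obtain ⟨-, k, hk, rfl⟩ := h
  obtain ⟨-, k', hk', rfl⟩ := h'
  rw [hk] at hk'
  have : k = k' := by exact_mod_cast hk'
  rw [this]

end LambdaChain

end RootSystem

end AlcovePath

/-! ### Moving a fold; preimages under root operators; uniqueness of isomorphisms -/

namespace AlcovePath

section RootSystem

variable {ι V V' : Type*} [AddCommGroup V] [Module ℝ V] [AddCommGroup V'] [Module ℝ V']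
  {P : RootPairing ι ℝ V V'} [Finite ι] [P.IsRootSystem] [P.IsIrreducible] {b : P.Base}
  [P.IsCrystallographic] [P.IsReduced]

theorem covers_simple_mul_self {w : P.weylGroup} {p : ι} (hp : p ∈ b.support)
    (h : b.IsPos (w⁻¹ • p)) : Covers b (refl P p * w) w := by
  refine ⟨⟨w⁻¹ • p, h, ?_⟩, weylLength_simple_mul hp h⟩
  rw [← refl_smul_eq, smul_inv_smul]

/-- Left multiplication by `s_p` raises both lengths by one and does not affect the reflection
multiplied on the right. This is how covers survive between the two ends of a moved fold. -/
theorem covers_simple_mul_iff {u w : P.weylGroup} {p : ι} (hp : p ∈ b.support)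
    (hu : b.IsPos (u⁻¹ • p)) (hw : b.IsPos (w⁻¹ • p)) :
    Covers b (refl P p * u) (refl P p * w) ↔ Covers b u w := by
  unfold Covers
  rw [weylLength_simple_mul hp hu, weylLength_simple_mul hp hw]
  simp only [mul_assoc, mul_right_inj, add_left_inj]

namespace LambdaChain

variable {lam : V} (Γ : LambdaChain b lam) {J K : Finset ℕ} {k m : ℕ} {p : ι}

/-- `K` arises from `J` by moving the fold in the contact `m` (or at infinity) to the contact
`k`. -/
structure IsSwap (p : ι) (J K : Finset ℕ) (k m : ℕ) : Prop where
  lt : k < m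
  lt_length : k < Γ.length
  notMem : k ∉ J
  mem : k ∈ K
  notMem' : m ∉ K
  iff : ∀ i, i ≠ k → i ≠ m → (i ∈ J ↔ i ∈ K)
  smul_eq : Γ.weylAt J k • Γ.root k = p
  mem_or : m ∈ J ∨ m = Γ.length
  lt_of_mem : m ∈ J → m < Γ.length
  smul_eq_of_mem : m ∈ J → Γ.weylAt J m • Γ.root m = p

namespace IsSwap

variable {Γ}

theorem weylAt_of_le (h : Γ.IsSwap p J K k m) {i : ℕ} (hi : i ≤ k) :
    Γ.weylAt K i = Γ.weylAt J i :=
  Γ.weylAt_congr fun j hj => (h.iff j (by omega) (by have := h.lt; omega)).symm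

/-- The new fold at `k` is right multiplication by `r_k`, which equals left multiplication by `s_p`
because the root in position `k` is folded to `α_p`. The factor `s_p` remains on the left until, at
`m`, the missing fold cancels it. -/
theorem weylAt_of_mem (h : Γ.IsSwap p J K k m) {i : ℕ} (hi : k < i) (him : i ≤ m) :
    Γ.weylAt K i = refl P p * Γ.weylAt J i := by
  induction i, hi using Nat.le_induction with
  | base =>
    rw [Γ.weylAt_succ h.mem, Γ.weylAt_succ_of_notMem h.notMem, h.weylAt_of_le le_rfl, ← h.smul_eq,
      refl_smul_eq]
  | succ i hi ih =>
    have := h.iff i (by omega) (by omega)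
    by_cases hJ : i ∈ J
    · rw [Γ.weylAt_succ hJ, Γ.weylAt_succ (this.mp hJ), ih (by omega), mul_assoc]
    · rw [Γ.weylAt_succ_of_notMem hJ, Γ.weylAt_succ_of_notMem (by rwa [← this]), ih (by omega)]

theorem weylAt_of_lt (h : Γ.IsSwap p J K k m) (hm : m ∈ J) {i : ℕ} (hi : m < i) :
    Γ.weylAt K i = Γ.weylAt J i := by
  induction i, hi using Nat.le_induction with
  | base =>
    rw [Γ.weylAt_succ hm, Γ.weylAt_succ_of_notMem h.notMem', h.weylAt_of_mem h.lt le_rfl,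
      ← h.smul_eq_of_mem hm, refl_smul_eq]
  | succ i hi ih =>
    have := h.iff i (by have := h.lt; omega) (by omega)
    by_cases hJ : i ∈ J
    · rw [Γ.weylAt_succ hJ, Γ.weylAt_succ (this.mp hJ), ih]
    · rw [Γ.weylAt_succ_of_notMem hJ, Γ.weylAt_succ_of_notMem (by rwa [← this]), ih]

theorem pull_of_le (h : Γ.IsSwap p J K k m) {i : ℕ} (hi : i ≤ k) (j : ι) :
    Γ.pull j K i = Γ.pull j J i := by rw [pull, pull, h.weylAt_of_le hi]

theorem pull_of_mem (h : Γ.IsSwap p J K k m) {i : ℕ} (hi : k < i) (him : i ≤ m) :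
    Γ.pull p K i = negRoot P (Γ.pull p J i) := by
  rw [pull, pull, h.weylAt_of_mem hi him, mul_inv_rev, refl_inv, mul_smul, refl_smul_self,
    smul_negRoot]

theorem pull_of_lt (h : Γ.IsSwap p J K k m) (hm : m ∈ J) {i : ℕ} (hi : m < i) (j : ι) :
    Γ.pull j K i = Γ.pull j J i := by rw [pull, pull, h.weylAt_of_lt hm hi]

/-- Moving the fold changes the pulled back root at most by a sign, and contacts do not see the
sign. -/
theorem contact_iff (h : Γ.IsSwap p J K k m) {i : ℕ} : Γ.Contact p K i ↔ Γ.Contact p J i := by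
  unfold Contact
  refine and_congr_right fun hin => ?_
  rcases le_or_gt i k with hik | hik
  · rw [h.pull_of_le hik]
  rcases le_or_gt i m with him | him
  · rw [h.pull_of_mem hik him, negRoot_negRoot, or_comm]
  · rcases h.mem_or with hm | hm
    · rw [h.pull_of_lt hm him]
    · omega

/-- Outside the interval from `k` to `m` the products of folds agree, and inside it they differ by
`s_p` on the left; since `s_p` is no left descent of those for `J`, covers correspond to covers. The
moved folds themselves are covers of the form `s_p w` over `w`. -/
theorem isAdmissible_iff (hlam : IsDominantWeight b lam) (hp : p ∈ b.support)
    (h : Γ.IsSwap p J K k m) (hpos : ∀ i, k < i → i ≤ m → b.IsPos (Γ.pull p J i)) :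
    Γ.IsAdmissible K ↔ Γ.IsAdmissible J := by
  have hkm := h.lt
  rw [Γ.isAdmissible_iff, Γ.isAdmissible_iff]
  have hmid : ∀ j, k < j → j < m → (Covers b (Γ.weylAt K (j + 1)) (Γ.weylAt K j) ↔
      Covers b (Γ.weylAt J (j + 1)) (Γ.weylAt J j)) := by
    intro j hkj hjm
    rw [h.weylAt_of_mem (by omega) hjm, h.weylAt_of_mem hkj hjm.le]
    exact covers_simple_mul_iff hp (hpos _ (by omega) hjm) (hpos _ hkj hjm.le)
  have hkK : Covers b (Γ.weylAt K (k + 1)) (Γ.weylAt K k) := by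
    rw [h.weylAt_of_mem (by omega) hkm, Γ.weylAt_succ_of_notMem h.notMem, h.weylAt_of_le le_rfl]
    apply covers_simple_mul_self hp
    have := h.smul_eq
    rw [← this, inv_smul_smul]
    exact Γ.isPos_root hlam h.lt_length
  have hmJ : m ∈ J → Covers b (Γ.weylAt J (m + 1)) (Γ.weylAt J m) := by
    intro hm
    rw [Γ.weylAt_succ hm, ← refl_smul_eq, h.smul_eq_of_mem hm]
    exact covers_simple_mul_self hp (hpos m hkm le_rfl)
  constructor
  · rintro ⟨hK, hc⟩
    have hn : ∀ j ∈ J, j < Γ.length := by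
      intro j hj
      by_cases hjk : j = k
      · exact absurd hj (hjk ▸ h.notMem)
      by_cases hjm : j = m
      · exact hjm ▸ h.lt_of_mem (hjm ▸ hj)
      · exact hK j ((h.iff j hjk hjm).mp hj)
    refine ⟨hn, fun j hj => ?_⟩
    by_cases hjk : j = k
    · exact absurd hj (hjk ▸ h.notMem)
    by_cases hjm : j = m
    · subst hjm; exact hmJ hj
    have hcj := hc j ((h.iff j hjk hjm).mp hj)
    rcases lt_or_gt_of_ne hjk with hjk | hjk
    · rwa [h.weylAt_of_le hjk, h.weylAt_of_le hjk.le] at hcj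
    rcases lt_or_gt_of_ne hjm with hjm | hjm
    · rwa [hmid j hjk hjm] at hcj
    · have hmJ' : m ∈ J := h.mem_or.resolve_right (by have := hn j hj; omega)
      rwa [h.weylAt_of_lt hmJ' (by omega), h.weylAt_of_lt hmJ' hjm] at hcj
  · rintro ⟨hJ, hc⟩
    have hn : ∀ j ∈ K, j < Γ.length := by
      intro j hj
      by_cases hjk : j = k
      · exact hjk ▸ h.lt_length
      by_cases hjm : j = m
      · exact absurd hj (hjm ▸ h.notMem')
      · exact hJ j ((h.iff j hjk hjm).mpr hj)
    refine ⟨hn, fun j hj => ?_⟩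
    by_cases hjk : j = k
    · rw [hjk]; exact hkK
    by_cases hjm : j = m
    · exact absurd hj (hjm ▸ h.notMem')
    have hcj := hc j ((h.iff j hjk hjm).mpr hj)
    rcases lt_or_gt_of_ne hjk with hjk | hjk
    · rwa [h.weylAt_of_le hjk, h.weylAt_of_le hjk.le]
    rcases lt_or_gt_of_ne hjm with hjm | hjm
    · rwa [hmid j hjk hjm]
    · have hmJ' : m ∈ J := h.mem_or.resolve_right (by have := hn j hj; omega)
      rwa [h.weylAt_of_lt hmJ' (by omega), h.weylAt_of_lt hmJ' hjm]

end IsSwap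

theorem root_eq_pull (hlam : IsDominantWeight b lam) (hC : Γ.Contact p J k)
    (hpos : b.IsPos (Γ.pull p J k)) : Γ.root k = Γ.pull p J k := by
  rcases hC.2 with h | h
  · exact h
  · have := Γ.isPos_root hlam hC.1
    rw [h, isPos_negRoot] at this
    exact absurd hpos this

theorem weylAt_smul_root (hlam : IsDominantWeight b lam) (hC : Γ.Contact p J k)
    (hpos : b.IsPos (Γ.pull p J k)) : Γ.weylAt J k • Γ.root k = p := by
  rw [Γ.root_eq_pull hlam hC hpos, pull, smul_inv_smul]

theorem isSwap_of_lowersAt (hlam : IsDominantWeight b lam) (hJ : Γ.IsAdmissible J)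
    (hp : p ∈ b.support)
    (h : LowersAt Γ.length (Γ.Contact p J) (Γ.height p J) k m) :
    Γ.IsSwap p J (insert k (J.erase m)) k m ∧
      ∀ i, k < i → i ≤ m → b.IsPos (Γ.pull p J i) := by
  have hw := Γ.signedWalk hlam hJ hp
  obtain ⟨hkJ, hpk, -, hpos, hmJ, hmn⟩ := hw.lowersAt_spec h
  obtain ⟨-, ⟨hCk, hkm, hm, hb⟩, -⟩ := h
  have hCm : m ∈ J → Γ.Contact p J m := fun hmJ => hm.resolve_right (by
    have := hw.lt_of_mem m hmJ; omega)
  refine ⟨⟨hkm, hCk.1, hkJ, Finset.mem_insert_self _ _, ?_, ?_, Γ.weylAt_smul_root hlam hCk hpk,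
    hm.imp_left hmJ, hw.lt_of_mem m, fun hmJ => Γ.weylAt_smul_root hlam (hCm hmJ)
      (hpos m hkm le_rfl).1⟩, fun i hi hi' => (hpos i hi hi').1⟩
  · simp [hkm.ne']
  · intro i hik him
    simp [hik, him]

theorem Lowers.isAdmissible (hlam : IsDominantWeight b lam) (hJ : Γ.IsAdmissible J)
    {p : b.support} (h : Γ.Lowers p J K) : Γ.IsAdmissible K := by
  obtain ⟨k, m, hl, rfl⟩ := (Γ.lowers_iff hlam hJ).mp h
  obtain ⟨h1, h2⟩ := Γ.isSwap_of_lowersAt hlam hJ p.2 hl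
  exact (h1.isAdmissible_iff hlam p.2 h2).mpr hJ

/-- The first letter of a reduced word is a left descent, so a word without left descents is empty.
-/
theorem exists_simple_descent {w : P.weylGroup} (h : ∀ p ∈ b.support, b.IsPos (w⁻¹ • p)) :
    weylLength b w = 0 := by
  obtain ⟨l, hl, hlw, hlen⟩ := exists_word_length_eq (exists_simple_word b w)
  change l.length = weylLength b w at hlen
  cases l with
  | nil => rw [← hlen]; rfl
  | cons x l =>
    exfalso
    obtain ⟨p, hp, rfl⟩ := hl x List.mem_cons_self
    have h1 := weylLength_simple_mul hp (h p hp)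
    have h2 : refl P p * w = l.prod := by
      rw [← hlw, List.prod_cons, ← mul_assoc, refl_mul_self, one_mul]
    have h3 : weylLength b l.prod ≤ l.length :=
      wordLength_le l fun y hy => hl y (List.mem_cons_of_mem _ hy)
    rw [h2] at h1
    rw [List.length_cons] at hlen
    omega

theorem weylLength_weylAt_eq_card (hJ : Γ.IsAdmissible J) (k : ℕ) :
    weylLength b (Γ.weylAt J k) = (J.filter (· < k)).card := by
  induction k with
  | zero =>
    rw [weylAt_zero]
    simpa [weylLength] using wordLength_le (T := simpleReflections b) [] (by simp)
  | succ k ih =>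
    by_cases hk : k ∈ J
    · rw [((Γ.isAdmissible_iff.mp hJ).2 k hk).2, ih]
      have : J.filter (· < k + 1) = insert k (J.filter (· < k)) := by
        ext i
        simp only [Finset.mem_filter, Finset.mem_insert]
        constructor
        · rintro ⟨h1, h2⟩; by_cases h : i = k <;> [exact Or.inl h; exact Or.inr ⟨h1, by omega⟩]
        · rintro (rfl | ⟨h1, h2⟩) <;> [exact ⟨hk, by omega⟩; exact ⟨h1, by omega⟩]
      rw [this, Finset.card_insert_of_notMem (by simp)]
    · rw [Γ.weylAt_succ_of_notMem hk, ih]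
      congr 1
      ext i
      simp only [Finset.mem_filter]
      refine and_congr_right fun hi => ?_
      have : i ≠ k := fun h => hk (h ▸ hi)
      omega

/-- Every nonempty admissible set is in the image of a root operator. -/
theorem exists_lowers (hlam : IsDominantWeight b lam) (hJ : Γ.IsAdmissible J) (hne : J.Nonempty) :
    ∃ (p : b.support) (K : Finset ℕ), Γ.IsAdmissible K ∧ Γ.Lowers p K J := by
  classical
  -- The length of `w(J)` is the cardinality of `J`, so `w(J) ≠ 1` has a left descent `p`; that is,
  -- the `p`-walk ends with negative sign.
  obtain ⟨p, hp, hneg⟩ : ∃ p ∈ b.support, ¬ b.IsPos (Γ.pull p J Γ.length) := by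
    by_contra hc
    push Not at hc
    have h1 := exists_simple_descent hc
    rw [Γ.weylLength_weylAt_eq_card hJ, Γ.filter_lt_length hJ.1, Finset.card_eq_zero] at h1
    exact hne.ne_empty h1
  have hw := Γ.signedWalk hlam hJ hp
  obtain ⟨k, m, hc, h0, hkJ, hmJ, hpk, hmn, hn, hmax, hlast, hend⟩ := hw.exists_last_max hneg
  have hkm := hc.2.1
  -- The root operator read backwards: the fold at the last maximal contact moves to the next
  -- contact, or disappears if there is none.
  let K := if m < Γ.length then insert m (J.erase k) else J.erase k
  have hmK : m ∈ K ↔ m < Γ.length := by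
    by_cases hlt : m < Γ.length <;> simp [K, hlt, hmJ]
  have hkK : k ∉ K := by
    by_cases hlt : m < Γ.length <;> simp [K, hlt, hkm.ne]
  have hiff : ∀ i, i ≠ k → i ≠ m → (i ∈ K ↔ i ∈ J) := by
    intro i hik him
    by_cases hlt : m < Γ.length <;> simp [K, hlt, hik, him]
  have hWk : ∀ i ≤ k, Γ.weylAt K i = Γ.weylAt J i := fun i hi =>
    Γ.weylAt_congr fun j hj => hiff j (by omega) (by omega)
  have hroot := Γ.weylAt_smul_root hlam hc.1 hpk
  have hWm : ∀ i, k < i → i ≤ m → Γ.weylAt J i = refl P p * Γ.weylAt K i := by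
    intro i hi him
    induction i, hi using Nat.le_induction with
    | base =>
      rw [Γ.weylAt_succ hkJ, Γ.weylAt_succ_of_notMem hkK, hWk k le_rfl]
      conv_rhs => rw [← hroot, refl_smul_eq]
    | succ i hi ih =>
      have := hiff i (by omega) (by omega)
      by_cases hiJ : i ∈ J
      · rw [Γ.weylAt_succ hiJ, Γ.weylAt_succ (this.mpr hiJ), ih (by omega), mul_assoc]
      · rw [Γ.weylAt_succ_of_notMem hiJ, Γ.weylAt_succ_of_notMem (by rwa [this]), ih (by omega)]
  have hs : Γ.IsSwap p K J k m := by
    refine ⟨hkm, hc.1.1, hkK, hkJ, hmJ, hiff, by rw [hWk k le_rfl, hroot], ?_, hmK.mp, ?_⟩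
    · rw [hmK]; omega
    · intro hm
      rw [hmK] at hm
      have hCm := hc.2.2.1.resolve_right hm.ne
      have h1 : Γ.root m = negRoot P (Γ.pull p J m) := by
        rcases hCm.2 with h | h
        · exact absurd (h ▸ Γ.isPos_root hlam hm) (hn m hkm le_rfl).1
        · exact h
      have h2 : Γ.weylAt K m = refl P p * Γ.weylAt J m := by
        rw [hWm m hkm le_rfl, ← mul_assoc, refl_mul_self, one_mul]
      rw [h2, mul_smul, h1, smul_negRoot, smul_negRoot, pull, smul_inv_smul, refl_smul_self,
        negRoot_negRoot]
  have hpull : ∀ i, k < i → i ≤ m → b.IsPos (Γ.pull p K i) := by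
    intro i hi him
    have := (hn i hi him).1
    rwa [hs.pull_of_mem hi him, isPos_negRoot, not_not] at this
  have hK : Γ.IsAdmissible K := (hs.isAdmissible_iff hlam hp hpull).mp hJ
  have hCeq : Γ.Contact p K = Γ.Contact p J := funext fun i => propext hs.contact_iff.symm
  refine ⟨⟨p, hp⟩, K, hK, ?_⟩
  rw [Γ.lowers_iff hlam hK]
  refine ⟨k, m, ?_, ?_⟩
  · have hw' := Γ.signedWalk hlam hK hp
    rw [hCeq] at hw' ⊢
    refine hw.lowersAt_of_last_max hw' hc h0 hmJ hpk hmn hn hmax hlast hend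
      (fun i hi => by rw [hs.pull_of_le hi]) hpull (fun i hi hin => ?_) hkK
      (fun hm => hmK.mpr hm.1) fun i hik him => (hiff i hik him).symm
    rw [hs.pull_of_lt (hmK.mpr (by omega)) hi]
  · ext i
    rw [Finset.mem_insert, Finset.mem_erase]
    by_cases hik : i = k
    · simp [hik, hkJ]
    by_cases him : i = m
    · simp [him, hmJ, hkm.ne']
    · simp [hik, him, hiff i hik him]

theorem not_lowers_empty {p : b.support} : ¬ Γ.Lowers p J ∅ := by
  rintro ⟨-, k, -, h⟩
  exact Finset.insert_ne_empty _ _ h.symm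

/-- A fold moves to an earlier position or a new one appears. This statistic is the measure for the
induction in the uniqueness proof. -/
theorem sum_lt_of_lowers (hlam : IsDominantWeight b lam) (hJ : Γ.IsAdmissible J) {p : b.support}
    (h : Γ.Lowers p J K) : ∑ j ∈ J, (Γ.length - j) < ∑ j ∈ K, (Γ.length - j) := by
  obtain ⟨k, m, hl, rfl⟩ := (Γ.lowers_iff hlam hJ).mp h
  obtain ⟨h1, -⟩ := Γ.isSwap_of_lowersAt hlam hJ p.2 hl
  rw [Finset.sum_insert (fun hk => h1.notMem (Finset.mem_of_mem_erase hk))]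
  have hk := h1.lt_length
  have hkm := h1.lt
  by_cases hm : m ∈ J
  · rw [← Finset.add_sum_erase J _ hm]
    have := h1.lt_of_mem hm
    omega
  · rw [Finset.erase_eq_of_notMem hm]
    omega

/-- There is at most one isomorphism of colored directed graphs. -/
theorem IsGraphIso.unique (hlam : IsDominantWeight b lam) {Γ Γ' : LambdaChain b lam}
    {e e' : Γ.Admissible ≃ Γ'.Admissible} (he : IsGraphIso e) (he' : IsGraphIso e') : e' = e := by
  -- An isomorphism preserves the absence of incoming arrows, and `∅` is the only vertex with this
  -- property.
  have hempty : ∀ e : Γ.Admissible ≃ Γ'.Admissible, IsGraphIso e → ∀ J : Γ.Admissible,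
      J.1 = ∅ → (e J).1 = ∅ := by
    intro e he J hJ
    by_contra hne
    obtain ⟨p, K, hK, hl⟩ := Γ'.exists_lowers hlam (e J).2 (Finset.nonempty_iff_ne_empty.mpr hne)
    obtain ⟨L, hL⟩ := e.surjective (⟨K, hK⟩ : {K // Γ'.IsAdmissible K})
    have : Γ.Arrow p L J := by
      rw [he p, hL]; exact hl
    rw [Arrow, hJ] at this
    exact Γ.not_lowers_empty this
  -- Every other vertex is the unique target of an arrow of some color from a vertex with smaller
  -- sum, where both isomorphisms already agree.
  have key : ∀ (N : ℕ) (J : Γ.Admissible), ∑ j ∈ J.1, (Γ.length - j) ≤ N → e' J = e J := by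
    intro N
    induction N with
    | zero =>
      intro J hJ
      have hJ0 : J.1 = ∅ := by
        by_contra hne
        obtain ⟨p, K, hK, hl⟩ := Γ.exists_lowers hlam J.2 (Finset.nonempty_iff_ne_empty.mpr hne)
        have := Γ.sum_lt_of_lowers hlam hK hl
        omega
      exact Subtype.ext ((hempty e' he' J hJ0).trans (hempty e he J hJ0).symm)
    | succ N ih =>
      intro J hJ
      by_cases hJ0 : J.1 = ∅
      · exact Subtype.ext ((hempty e' he' J hJ0).trans (hempty e he J hJ0).symm)
      obtain ⟨p, K, hK, hl⟩ := Γ.exists_lowers hlam J.2 (Finset.nonempty_iff_ne_empty.mpr hJ0)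
      have hlt := Γ.sum_lt_of_lowers hlam hK hl
      have h1 := (he p ⟨K, hK⟩ J).mp hl
      have h2 := (he' p ⟨K, hK⟩ J).mp hl
      rw [ih ⟨K, hK⟩ (by change ∑ j ∈ K, _ ≤ N; omega)] at h2
      exact Subtype.ext (Lowers.unique Γ' h2 h1)
  exact Equiv.ext fun J => key _ J le_rfl

end LambdaChain

end RootSystem

end AlcovePath

/-! ### Dihedral groups: parameters of coset elements -/

namespace AlcovePath

section RootSystem

variable {ι V V' : Type*} [AddCommGroup V] [Module ℝ V] [AddCommGroup V'] [Module ℝ V']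
  {P : RootPairing ι ℝ V V'} [Finite ι] [P.IsRootSystem] [P.IsIrreducible] {b : P.Base}
  [P.IsCrystallographic] [P.IsReduced]

/-- The roots of a dihedral root system with `q` positive roots, in their cyclic order. -/
structure DihedralRoots (b : P.Base) (q : ℕ) (β : ℤ → ι) : Prop where
  two_le : 2 ≤ q
  add : ∀ m, β (m + q) = negRoot P (β m)
  -- As in a plane in which `β m` points in direction `mπ/q`: the reflection in `β i` sends the
  -- angle of `β j` to that of index `2i + q - j`, and `j = i` gives the negative root.
  refl_smul : ∀ i j, refl P (β i) • β j = β (2 * i + q - j)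
  isPos : ∀ m : ℤ, 0 ≤ m → m < q → b.IsPos (β m)

/-- The element `x` maps the roots `β m`, `A ≤ m < A + q`, to positive roots. -/
def HasParam (b : P.Base) (q : ℕ) (β : ℤ → ι) (x : P.weylGroup) (A : ℤ) : Prop :=
  ∀ m, A ≤ m → m < A + q → b.IsPos (x • β m)

/-- The parameter of `x * refl P (β j)`, where `A` is that of `x`, in the range from `-q` to
`q`. -/
def dihedralStep (q : ℕ) (A j : ℤ) : ℤ :=
  if 2 * j + 1 - A ≤ q then 2 * j + 1 - A else 2 * j + 1 - A - 2 * q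

namespace DihedralRoots

variable {q : ℕ} {β : ℤ → ι}

theorem add_two_mul (h : DihedralRoots b q β) (m : ℤ) : β (m + 2 * q) = β m := by
  rw [show m + 2 * (q : ℤ) = m + q + q by ring, h.add, h.add, negRoot_negRoot]

theorem sub (h : DihedralRoots b q β) (m : ℤ) : β (m - q) = negRoot P (β m) := by
  rw [← h.add_two_mul, show m - q + 2 * (q : ℤ) = m + q by ring, h.add]

theorem refl_add (h : DihedralRoots b q β) (m : ℤ) : refl P (β (m + q)) = refl P (β m) := by
  rw [h.add, refl_negRoot]

theorem refl_sub (h : DihedralRoots b q β) (m : ℤ) : refl P (β (m - q)) = refl P (β m) := by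
  rw [h.sub, refl_negRoot]

theorem refl_mul_refl_mul_refl (h : DihedralRoots b q β) (i j : ℤ) :
    refl P (β i) * refl P (β j) * refl P (β i) = refl P (β (2 * i - j)) := by
  have := refl_conj (refl P (β i)) (β j)
  rw [refl_inv, h.refl_smul] at this
  rw [this, show 2 * i + q - j = 2 * i - j + q by ring, h.refl_add]

/-- The rotation of the dihedral group. -/
theorem refl_eq_zpow (h : DihedralRoots b q β) (m : ℤ) :
    refl P (β m) = refl P (β 0) * (refl P (β 0) * refl P (β 1)) ^ m := by
  have step : ∀ m, refl P (β m) * refl P (β (m + 1)) =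
      refl P (β (m + 1)) * refl P (β (m + 1 + 1)) := by
    intro m
    have := h.refl_mul_refl_mul_refl (m + 1) m
    rw [show 2 * (m + 1) - m = m + 1 + 1 by ring] at this
    rw [← this, mul_assoc, ← mul_assoc (refl P (β (m + 1))), refl_mul_self, one_mul]
  have key : ∀ m, refl P (β m) * refl P (β (m + 1)) = refl P (β 0) * refl P (β 1) := by
    intro m
    induction m using Int.induction_on with
    | zero => rfl
    | succ m ih => rw [← step, ih]
    | pred m ih => rw [step, sub_add_cancel, ih]
  have succ : ∀ m, refl P (β (m + 1)) = refl P (β m) * (refl P (β 0) * refl P (β 1)) := by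
    intro m
    rw [← key m, ← mul_assoc, refl_mul_self, one_mul]
  induction m using Int.induction_on with
  | zero => simp
  | succ m ih => rw [succ, ih, zpow_add_one, mul_assoc]
  | pred m ih =>
    have h1 := succ (-m - 1)
    rw [sub_add_cancel, ih] at h1
    rw [zpow_sub_one, ← mul_assoc, h1, mul_inv_cancel_right]

/-- All reflections are `s₀ ρ^m` with the rotation `ρ = s₀ s₁`, and `s₀` inverts `ρ`; so a product
of two reflections depends only on the difference of their indices. -/
theorem refl_mul_refl (h : DihedralRoots b q β) (i j : ℤ) :
    refl P (β i) * refl P (β j) = refl P (β 0) * refl P (β (j - i)) := by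
  have h0 : (refl P (β 0) * refl P (β 1)) ^ i * refl P (β 0) =
      refl P (β 0) * (refl P (β 0) * refl P (β 1)) ^ (-i) := by
    have h1 := h.refl_eq_zpow i
    have h2 : (refl P (β i))⁻¹ = refl P (β i) := refl_inv _
    rw [h1, mul_inv_rev, refl_inv, ← zpow_neg] at h2
    have h3 := congrArg (fun g => refl P (β 0) * g * refl P (β 0)) h2
    simp only [mul_assoc, refl_mul_self, mul_one] at h3
    rw [← mul_assoc (refl P (β 0)) (refl P (β 0)), refl_mul_self, one_mul] at h3
    rw [← h3]
  rw [h.refl_eq_zpow i, h.refl_eq_zpow j, h.refl_eq_zpow (j - i), mul_assoc, ← mul_assoc (_ ^ i),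
    h0, mul_assoc, ← zpow_add, neg_add_eq_sub]

/-- The elements of the dihedral group. -/
theorem eq_or_eq_of_mem (h : DihedralRoots b q β) {g : P.weylGroup}
    (hg : g ∈ reflectionSubgroup P (Set.range β)) :
    ∃ c, g = refl P (β c) ∨ g = refl P (β 0) * refl P (β c) := by
  refine Subgroup.closure_induction'' (p := fun g _ => ∃ c, g = refl P (β c) ∨
    g = refl P (β 0) * refl P (β c)) ?_ ?_ ?_ ?_ hg
  · rintro _ ⟨_, ⟨j, rfl⟩, rfl⟩
    exact ⟨j, Or.inl rfl⟩
  · rintro _ ⟨_, ⟨j, rfl⟩, rfl⟩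
    rw [refl_inv]
    exact ⟨j, Or.inl rfl⟩
  · exact ⟨0, Or.inr (refl_mul_self _).symm⟩
  · rintro x y - - ⟨c, hc⟩ ⟨d, hd⟩
    have h3 : ∀ c d, refl P (β 0) * refl P (β c) * refl P (β d) = refl P (β (d - c)) := by
      intro c d
      rw [mul_assoc, h.refl_mul_refl, ← mul_assoc, refl_mul_self, one_mul]
    rcases hc with rfl | rfl <;> rcases hd with rfl | rfl
    · exact ⟨_, Or.inr (h.refl_mul_refl c d)⟩
    · refine ⟨c + d, Or.inl ?_⟩
      rw [← mul_assoc, h.refl_mul_refl c 0, h3]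
      congr 2; ring
    · exact ⟨_, Or.inl (h3 c d)⟩
    · refine ⟨c + d, Or.inr ?_⟩
      rw [← mul_assoc, h3, h.refl_mul_refl]
      congr 3; ring

variable {x : P.weylGroup} {A : ℤ}

theorem hasParam_add (h : DihedralRoots b q β) (hx : HasParam b q β x A) :
    HasParam b q β x (A + 2 * q) := by
  intro m h1 h2
  have := hx (m - 2 * q) (by omega) (by omega)
  rwa [← h.add_two_mul, sub_add_cancel] at this

theorem hasParam_sub (h : DihedralRoots b q β) (hx : HasParam b q β x A) :
    HasParam b q β x (A - 2 * q) := by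
  intro m h1 h2
  have := hx (m + 2 * q) (by omega) (by omega)
  rwa [h.add_two_mul] at this

/-- The reflection sends index `m` to `2j + q - m`, which lies in the window `[A, A + q)` exactly
when `m` lies in the window starting at `2j + 1 - A`. -/
theorem hasParam_mul_refl (h : DihedralRoots b q β) (hx : HasParam b q β x A) (j : ℤ) :
    HasParam b q β (x * refl P (β j)) (2 * j + 1 - A) := by
  intro m h1 h2
  rw [mul_smul, h.refl_smul]
  exact hx _ (by omega) (by omega)

theorem hasParam_step (h : DihedralRoots b q β) (hx : HasParam b q β x A) (j : ℤ) :
    HasParam b q β (x * refl P (β j)) (dihedralStep q A j) := by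
  have := h.hasParam_mul_refl hx j
  unfold dihedralStep
  split_ifs
  · exact this
  · exact h.hasParam_sub this

theorem not_isPos_of_hasParam (h : DihedralRoots b q β) (hx : HasParam b q β x A) {m : ℤ}
    (h1 : A + q ≤ m) (h2 : m < A + 2 * q) : ¬ b.IsPos (x • β m) := by
  have := hx (m - q) (by omega) (by omega)
  rwa [h.sub, smul_negRoot, isPos_negRoot] at this

/-- The half turn after a window of positive images has negative images, so two windows whose starts
differ by less than a full turn must coincide. -/
theorem hasParam_unique (h : DihedralRoots b q β) (hx : HasParam b q β x A) {A' : ℤ}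
    (hx' : HasParam b q β x A') (h1 : A ≤ A') (h2 : A' < A + 2 * q) : A = A' := by
  have hq := h.two_le
  by_contra hne
  rcases le_or_gt A' (A + q) with h3 | h3
  · exact h.not_isPos_of_hasParam hx (m := A + q) le_rfl (by omega) (hx' _ h3 (by omega))
  · exact h.not_isPos_of_hasParam (h.hasParam_sub hx') (m := A' - q) (by omega) (by omega)
      (hx _ (by omega) (by omega))

theorem hasParam_unique' (h : DihedralRoots b q β) (hx : HasParam b q β x A) {A' : ℤ}
    (hx' : HasParam b q β x A') (hA : |A| ≤ q) (hA' : |A'| ≤ q) :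
    A = A' ∨ |A| = q ∧ A' = -A := by
  rw [abs_le] at hA hA'
  have hq := h.two_le
  rcases le_total A A' with hle | hle
  · rcases lt_or_ge A' (A + 2 * q) with h2 | h2
    · exact Or.inl (h.hasParam_unique hx hx' hle h2)
    · right
      exact ⟨by rw [show A = -q by omega, abs_neg, abs_of_nonneg (by omega)], by omega⟩
  · rcases lt_or_ge A (A' + 2 * q) with h2 | h2
    · exact Or.inl (h.hasParam_unique hx' hx hle h2).symm
    · right
      exact ⟨by rw [show A = q by omega, abs_of_nonneg (by omega)], by omega⟩

theorem abs_eq_of_hasParam (h : DihedralRoots b q β) (hx : HasParam b q β x A) {A' : ℤ}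
    (hx' : HasParam b q β x A') (hA : |A| ≤ q) (hA' : |A'| ≤ q) : |A| = |A'| := by
  rcases h.hasParam_unique' hx hx' hA hA' with h1 | h1
  · rw [h1]
  · rw [h1.2, abs_neg]

/-- For `0 ≤ j < q` both conditions say that `j` lies in the window `[A, A + q)`. -/
theorem isPos_smul_iff (h : DihedralRoots b q β) (hx : HasParam b q β x A) (hA : |A| ≤ q) {j : ℤ}
    (h0 : 0 ≤ j) (hj : j < q) : b.IsPos (x • β j) ↔ |A| < |dihedralStep q A j| := by
  have key : |A| < |dihedralStep q A j| ↔ A ≤ j ∧ j < A + q := by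
    rw [abs_le] at hA
    unfold dihedralStep
    split_ifs <;> rw [lt_abs, abs_lt, abs_lt] <;> omega
  rw [abs_le] at hA
  rw [key]
  constructor
  · intro hp
    constructor
    · by_contra hc
      exact h.not_isPos_of_hasParam (h.hasParam_sub hx) (m := j) (by omega) (by omega) hp
    · by_contra hc
      exact h.not_isPos_of_hasParam hx (m := j) (by omega) (by omega) hp
  · rintro ⟨h1, h2⟩
    exact hx j h1 h2

theorem abs_dihedralStep_le (hA : |A| ≤ q) {j : ℤ} (h0 : 0 ≤ j) (hj : j < q) :
    |dihedralStep q A j| ≤ q := by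
  rw [abs_le] at *
  unfold dihedralStep
  split_ifs <;> omega

/-- The length in `W` grows if and only if the absolute value of the parameter does. -/
theorem weylLength_lt_iff (h : DihedralRoots b q β) (hx : HasParam b q β x A) (hA : |A| ≤ q)
    {j : ℤ} (h0 : 0 ≤ j) (hj : j < q) :
    weylLength b x < weylLength b (x * refl P (β j)) ↔ |A| < |dihedralStep q A j| := by
  rw [weylLength_lt_mul_refl_iff (h.isPos j h0 hj), h.isPos_smul_iff hx hA h0 hj]

theorem exists_index (h : DihedralRoots b q β) (c : ℤ) :
    ∃ j : ℤ, 0 ≤ j ∧ j < q ∧ refl P (β c) = refl P (β j) ∧ ∃ k, c = j + k * q := by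
  have hq := h.two_le
  have key : ∀ (n : ℤ) (c : ℤ), refl P (β (c + n * q)) = refl P (β c) := by
    intro n
    induction n using Int.induction_on with
    | zero => simp
    | succ n ih => intro c; rw [show c + (n + 1) * q = c + n * q + (q : ℤ) by ring, h.refl_add, ih]
    | pred n ih => intro c; rw [show c + (-n - 1) * q = c + -n * q - (q : ℤ) by ring, h.refl_sub, ih]
  have hd := Int.emod_add_mul_ediv c q
  refine ⟨c % q, Int.emod_nonneg _ (by omega), Int.emod_lt_of_pos _ (by omega), ?_, c / q, by
    rw [mul_comm]; exact hd.symm⟩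
  conv_lhs => rw [← hd, mul_comm (q : ℤ)]
  rw [key]

/-- Elements of a coset of the dihedral group are determined by their parameters. -/
theorem eq_one_of_hasParam (h : DihedralRoots b q β) {g : P.weylGroup}
    (hg : g ∈ reflectionSubgroup P (Set.range β)) (hx : HasParam b q β x A)
    (hxg : HasParam b q β (x * g) A) : g = 1 := by
  have hq := h.two_le
  have shift : ∀ (n : ℤ) {y : P.weylGroup} {C : ℤ}, HasParam b q β y C →
      HasParam b q β y (C + n * (2 * q)) := by
    intro n y C hy
    induction n using Int.induction_on with
    | zero => simpa using hy
    | succ n ih =>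
      have := h.hasParam_add ih
      rwa [show C + n * (2 * q) + 2 * (q : ℤ) = C + (n + 1) * (2 * q) by ring] at this
    | pred n ih =>
      have := h.hasParam_sub ih
      rwa [show C + -n * (2 * q) - 2 * (q : ℤ) = C + (-n - 1) * (2 * q) by ring] at this
  have mod : ∀ {C : ℤ}, HasParam b q β (x * g) C → ∃ n, A = C + n * (2 * q) := by
    intro C hC
    have h1 := Int.emod_add_mul_ediv (A - C) (2 * q)
    have h2 := Int.emod_nonneg (A - C) (b := 2 * (q : ℤ)) (by omega)
    have h3 := Int.emod_lt_of_pos (A - C) (b := 2 * (q : ℤ)) (by omega)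
    have h4 := shift ((A - C) / (2 * q)) hC
    have h5 : A = C + (A - C) / (2 * q) * (2 * q) + (A - C) % (2 * q) := by
      rw [mul_comm ((A - C) / (2 * q))]; linarith
    have h6 := h.hasParam_unique h4 hxg (by omega) (by omega)
    exact ⟨_, h6.symm⟩
  obtain ⟨c, rfl | rfl⟩ := h.eq_or_eq_of_mem hg
  · obtain ⟨n, hn⟩ := mod (h.hasParam_mul_refl hx c)
    -- A reflection changes the parity of the parameter, so it cannot preserve the parameter modulo
    -- `2q`.
    have : 2 * (A - c - n * q) = 1 := by linarith
    omega
  · rw [← mul_assoc] at mod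
    obtain ⟨n, hn⟩ := mod (h.hasParam_mul_refl (h.hasParam_mul_refl hx 0) c)
    obtain ⟨j, hj0, hjq, hr, k, hk⟩ := h.exists_index c
    -- The rotation `s₀ s_c` shifts the parameter by `2c`. Hence `q` divides `c`, and `s_c = s₀`.
    have h1 : c = -n * q := by linarith
    have h2 : j = 0 := by
      have h3 : j = (-n - k) * q := by linarith
      rcases lt_trichotomy (-n - k) 0 with h4 | h4 | h4
      · nlinarith
      · rw [h3, h4, zero_mul]
      · nlinarith
    rw [hr, h2, refl_mul_self]

theorem refl_mem (j : ℤ) : refl P (β j) ∈ reflectionSubgroup P (Set.range β) :=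
  Subgroup.subset_closure ⟨_, ⟨j, rfl⟩, rfl⟩

theorem inv_mul_minRep_mem (S : Set ι) (x : P.weylGroup) :
    x⁻¹ * minRep b S x ∈ reflectionSubgroup P S :=
  Function.argminOn_mem (weylLength b) {v | x⁻¹ * v ∈ reflectionSubgroup P S} _

theorem weylLength_minRep_le {S : Set ι} {x v : P.weylGroup}
    (hv : x⁻¹ * v ∈ reflectionSubgroup P S) : weylLength b (minRep b S x) ≤ weylLength b v :=
  Function.argminOn_le (weylLength b) {v | x⁻¹ * v ∈ reflectionSubgroup P S} hv

/-- If a positive root of the subsystem had negative image, multiplication by its reflection would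
give a shorter element of the coset. -/
theorem hasParam_minRep (h : DihedralRoots b q β) (x : P.weylGroup) :
    HasParam b q β (minRep b (Set.range β) x) 0 := by
  intro m h0 hm
  rw [zero_add] at hm
  by_contra hneg
  have h1 := weylLength_mul_refl_lt (h.isPos m h0 hm) hneg
  have h2 := weylLength_minRep_le (b := b) (S := Set.range β) (x := x)
    (v := minRep b (Set.range β) x * refl P (β m))
    (by rw [← mul_assoc]; exact mul_mem (inv_mul_minRep_mem _ x) (refl_mem m))
  omega

theorem minRep_inv_mul_mem (S : Set ι) (x : P.weylGroup) :
    (minRep b S x)⁻¹ * x ∈ reflectionSubgroup P S := by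
  have := inv_mem (inv_mul_minRep_mem (b := b) S x)
  rwa [mul_inv_rev, inv_inv] at this

/-- Every element of the coset is the minimal representative, which has parameter `0`, times one or
two reflections. -/
theorem exists_hasParam (h : DihedralRoots b q β) (x : P.weylGroup) :
    ∃ A : ℤ, -q < A ∧ A ≤ q ∧ HasParam b q β x A := by
  have hq := h.two_le
  have hv := h.hasParam_minRep x
  have hg := minRep_inv_mul_mem (b := b) (Set.range β) x
  set v := minRep b (Set.range β) x
  have hx : x = v * (v⁻¹ * x) := by rw [mul_inv_cancel_left]
  have step : ∀ {y : P.weylGroup} {C : ℤ} (c : ℤ), -q < C → C ≤ q → HasParam b q β y C →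
      ∃ A : ℤ, -q < A ∧ A ≤ q ∧ HasParam b q β (y * refl P (β c)) A := by
    intro y C c h1 h2 hy
    obtain ⟨j, hj0, hjq, hr, -⟩ := h.exists_index c
    refine ⟨dihedralStep q C j, ?_, ?_, hr ▸ h.hasParam_step hy j⟩ <;>
      unfold dihedralStep <;> split_ifs <;> omega
  obtain ⟨c, hc | hc⟩ := h.eq_or_eq_of_mem hg <;> rw [hx, hc]
  · exact step c (by omega) (by omega) hv
  · obtain ⟨C, h1, h2, h3⟩ := step 0 (by omega) (by omega) hv
    rw [← mul_assoc]
    exact step c h1 h2 h3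

/-- A cover within a coset increases the absolute value of the parameter by one. -/
theorem abs_step_of_covers (h : DihedralRoots b q β) (hx : HasParam b q β x A) (hA : |A| ≤ q)
    {j : ℤ} (h0 : 0 ≤ j) (hj : j < q)
    (hc : weylLength b (x * refl P (β j)) = weylLength b x + 1) :
    |dihedralStep q A j| = |A| + 1 := by
  have hq := h.two_le
  have hlt := (h.weylLength_lt_iff hx hA h0 hj).mp (by omega)
  have hle := abs_dihedralStep_le hA h0 hj
  by_contra hne
  have hB := h.hasParam_step hx j
  set B := dihedralStep q A j with hBdef
  have hpar : ∃ n, B = A + 1 + 2 * n := by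
    rw [hBdef, dihedralStep]
    split_ifs
    · exact ⟨j - A, by ring⟩
    · exact ⟨j - A - q, by ring⟩
  -- A parameter of opposite parity and larger absolute value is reached by a single reflection that
  -- increases the length. If `|B| ≥ |A| + 3`, this interposes elements with parameters `|A| + 1`
  -- and `|A| + 2`, so the length grows by at least three.
  have interp : ∀ {y : P.weylGroup} {C D : ℤ}, HasParam b q β y C → |C| < |D| → |D| ≤ q →
      (∃ n, D = C + 1 + 2 * n) → ∃ c, HasParam b q β (y * refl P (β c)) D ∧
      weylLength b y < weylLength b (y * refl P (β c)) := by
    rintro y C D hy h1 h2 ⟨n, hn⟩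
    obtain ⟨i, hi0, hiq, hr, k, hk⟩ := h.exists_index (C + n)
    have h3 := h.hasParam_mul_refl hy (C + n)
    rw [show 2 * (C + n) + 1 - C = D by rw [hn]; ring] at h3
    refine ⟨C + n, h3, ?_⟩
    rw [hr] at h3 ⊢
    have h4 := abs_dihedralStep_le (j := i) (h1.le.trans h2) hi0 hiq
    rw [h.weylLength_lt_iff hy (h1.le.trans h2) hi0 hiq,
      h.abs_eq_of_hasParam (h.hasParam_step hy i) h3 h4 h2]
    exact h1
  obtain ⟨n, hn⟩ := hpar
  have hA3 : |A| + 3 ≤ |B| := by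
    rcases abs_cases A with ⟨h1, h2⟩ | ⟨h1, h2⟩ <;> rcases abs_cases B with ⟨h3, h4⟩ | ⟨h3, h4⟩ <;>
      omega
  have hA0 := abs_nonneg A
  have hA1 : |(|A| + 1)| = |A| + 1 := abs_of_nonneg (by omega)
  have hA2 : |(|A| + 2)| = |A| + 2 := abs_of_nonneg (by omega)
  obtain ⟨c1, h1, l1⟩ := interp (D := |A| + 1) hx (by omega) (by omega) (by
      rcases abs_cases A with ⟨h1, h2⟩ | ⟨h1, h2⟩
      · exact ⟨0, by omega⟩
      · exact ⟨-A, by omega⟩)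
  obtain ⟨c2, h2, l2⟩ := interp (D := |A| + 2) h1 (by omega) (by omega) ⟨0, by ring⟩
  obtain ⟨c3, h3, l3⟩ := interp (D := B) h2 (by omega) hle (by
      rcases abs_cases A with ⟨h1, h2⟩ | ⟨h1, h2⟩
      · exact ⟨n - 1, by omega⟩
      · exact ⟨n + A - 1, by omega⟩)
  -- The three interpolating reflections lead to the same parameter in the same coset, hence to the
  -- same element.
  have h4 := h.eq_one_of_hasParam (x := x * refl P (β j))
    (g := refl P (β j) * (refl P (β c1) * refl P (β c2) * refl P (β c3)))
    (mul_mem (refl_mem j) (mul_mem (mul_mem (refl_mem _) (refl_mem _)) (refl_mem _))) hB (by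
      rw [← mul_assoc, mul_assoc x, refl_mul_self, mul_one, ← mul_assoc, ← mul_assoc]; exact h3)
  have h5 : x * refl P (β c1) * refl P (β c2) * refl P (β c3) = x * refl P (β j) := by
    rw [mul_eq_one_iff_eq_inv'] at h4
    rw [mul_assoc, mul_assoc, ← mul_assoc (refl P (β c1)), h4, refl_inv]
  rw [h5] at l3
  omega

/-- The dihedral length is the absolute value of the parameter. -/
theorem wordLength_eq (h : DihedralRoots b q β) (hx : HasParam b q β x A) (hA : |A| ≤ q) :
    (wordLength {refl P (β 0), refl P (β (q - 1))} ((minRep b (Set.range β) x)⁻¹ * x) : ℤ) =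
      |A| := by
  have hq := h.two_le
  have hv := h.hasParam_minRep x
  have hg := minRep_inv_mul_mem (b := b) (Set.range β) x
  set v := minRep b (Set.range β) x
  set g := v⁻¹ * x with hgdef
  have hx' : HasParam b q β (v * g) A := by rwa [hgdef, mul_inv_cancel_left]
  -- The generator `s₀` replaces `A` by `1 - A`, and `s_{q-1}` replaces it by `-1 - A` modulo `2q`.
  -- The first brings a positive parameter, the second a negative one, closer to `0` by one.
  have upper : ∀ (n : ℕ) (g : P.weylGroup) (A : ℤ), g ∈ reflectionSubgroup P (Set.range β) →
      HasParam b q β (v * g) A → |A| ≤ q → |A| = n →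
      ∃ l : List P.weylGroup, (∀ y ∈ l, y ∈ ({refl P (β 0), refl P (β (q - 1))} : Set _)) ∧
        l.prod = g ∧ l.length = n := by
    intro n
    induction n with
    | zero =>
      intro g A hg hx hA hn
      have hA0 : A = 0 := by simpa using hn
      exact ⟨[], by simp, (h.eq_one_of_hasParam hg hv (hA0 ▸ hx)).symm, rfl⟩
    | succ n ih =>
      intro g A hg hx hA hn
      rcases abs_cases A with ⟨h1, h2⟩ | ⟨h1, h2⟩
      · obtain ⟨l, hl, hlg, hln⟩ := ih (g * refl P (β 0)) (1 - A) (mul_mem hg (refl_mem _))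
          (by have := h.hasParam_mul_refl hx 0
              rwa [mul_assoc, show 2 * 0 + 1 - A = 1 - A by ring] at this)
          (by rw [abs_le]; omega) (by rw [abs_of_nonpos (by omega)]; omega)
        refine ⟨l ++ [refl P (β 0)], ?_, ?_, by simp [hln]⟩
        · intro y hy
          rcases List.mem_append.mp hy with hy | hy
          · exact hl y hy
          · rw [List.mem_singleton] at hy; exact Or.inl hy
        · rw [List.prod_append, hlg, List.prod_singleton, mul_assoc, refl_mul_self, mul_one]
      · obtain ⟨l, hl, hlg, hln⟩ := ih (g * refl P (β (q - 1))) (-1 - A)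
          (mul_mem hg (refl_mem _))
          (by have := h.hasParam_sub (h.hasParam_mul_refl hx (q - 1))
              rwa [mul_assoc, show 2 * ((q : ℤ) - 1) + 1 - A - 2 * q = -1 - A by ring] at this)
          (by rw [abs_le]; omega) (by rw [abs_of_nonneg (by omega)]; omega)
        refine ⟨l ++ [refl P (β (q - 1))], ?_, ?_, by simp [hln]⟩
        · intro y hy
          rcases List.mem_append.mp hy with hy | hy
          · exact hl y hy
          · rw [List.mem_singleton] at hy; exact Or.inr hy
        · rw [List.prod_append, hlg, List.prod_singleton, mul_assoc, refl_mul_self, mul_one]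
  -- Each generator changes the absolute value of the normalized parameter by at most one.
  have lower : ∀ l : List P.weylGroup,
      (∀ y ∈ l, y ∈ ({refl P (β 0), refl P (β (q - 1))} : Set _)) →
      ∃ C, HasParam b q β (v * l.prod) C ∧ |C| ≤ q ∧ |C| ≤ l.length := by
    intro l
    induction l using List.reverseRecOn with
    | nil => exact fun _ => ⟨0, by simpa using hv, by simp, by simp⟩
    | append_singleton l y ih =>
      intro hl
      obtain ⟨C, hC, hCq, hCl⟩ := ih fun y hy => hl y (List.mem_append_left _ hy)
      have hy : ∃ j : ℤ, 0 ≤ j ∧ j < q ∧ (j = 0 ∨ j = q - 1) ∧ y = refl P (β j) := by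
        rcases hl y (by simp) with hy | hy
        · exact ⟨0, le_rfl, by omega, Or.inl rfl, hy⟩
        · exact ⟨q - 1, by omega, by omega, Or.inr rfl, hy⟩
      obtain ⟨j, hj0, hjq, hj, rfl⟩ := hy
      refine ⟨dihedralStep q C j, ?_, abs_dihedralStep_le hCq hj0 hjq, ?_⟩
      · rw [List.prod_append, List.prod_singleton, ← mul_assoc]
        exact h.hasParam_step hC j
      · rw [List.length_append, List.length_singleton]
        push_cast
        rw [abs_le] at *
        unfold dihedralStep
        split_ifs <;> rcases hj with rfl | rfl <;> omega
  obtain ⟨l, hl, hlg, hln⟩ := upper A.natAbs g A hg hx' hA (by simp)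
  obtain ⟨l', hl', hlg', hln'⟩ := exists_word_length_eq ⟨l, hl, hlg⟩
  obtain ⟨C, hC, hCq, hCl⟩ := lower l' hl'
  rw [hlg'] at hC
  have h1 := h.abs_eq_of_hasParam hx' hC hA hCq
  have h2 := wordLength_le l hl
  rw [hlg] at h2
  rw [← hln'] at h2 ⊢
  have h3 : ((l.length : ℕ) : ℤ) = |A| := by rw [hln, Int.natCast_natAbs]
  omega

end DihedralRoots

end RootSystem

end AlcovePath

/-! ### Rank two subsystems and their simple coroots -/

namespace AlcovePath

section RootSystem

variable {ι V V' : Type*} [AddCommGroup V] [Module ℝ V] [AddCommGroup V'] [Module ℝ V']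
  {P : RootPairing ι ℝ V V'} [Finite ι] [P.IsRootSystem] [P.IsIrreducible] {b : P.Base}
  [P.IsCrystallographic] [P.IsReduced] {S : Set ι}

theorem IsRankTwoSubsystem.refl_smul_mem (hS : IsRankTwoSubsystem P S) {i j : ι} (hi : i ∈ S)
    (hj : j ∈ S) : refl P i • j ∈ S := hS.1 i hi j hj

theorem IsRankTwoSubsystem.negRoot_mem (hS : IsRankTwoSubsystem P S) {i : ι} (hi : i ∈ S) :
    negRoot P i ∈ S := hS.1 i hi i hi

theorem coroot'_refl_smul (i j : ι) (x : V) :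
    P.coroot' (refl P i • j) x = P.coroot' j x - P.pairing i j * P.coroot' i x := by
  rw [← refl_smul_refl_smul (P := P) i x, coroot'_smul, refl_smul_refl_smul, refl_smul, map_sub, map_smul,
    P.root_coroot'_eq_pairing, smul_eq_mul]
  ring

theorem root_ne_of_ne {i j : ι} (h : i ≠ j) (h' : i ≠ negRoot P j) :
    P.root i ≠ P.root j ∧ P.root i ≠ -P.root j := by
  refine ⟨fun he => h (P.root.injective he), fun he => h' (P.root.injective ?_)⟩
  rw [he, root_negRoot]

/-- In a rank two subsystem, every coroot is a combination of two nonproportional ones. -/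
theorem IsRankTwoSubsystem.exists_comb (hS : IsRankTwoSubsystem P S) {i j k : ι} (hi : i ∈ S)
    (hj : j ∈ S) (hk : k ∈ S) (h : i ≠ j) (h' : i ≠ negRoot P j) :
    ∃ p r : ℝ, ∀ x, P.coroot' k x = p * P.coroot' i x + r * P.coroot' j x := by
  have hne := root_ne_of_ne h h'
  have hli : LinearIndependent ℝ ![P.root i, P.root j] :=
    RootPairing.IsReduced.linearIndependent P h hne.2
  have hle : Submodule.span ℝ (Set.range ![P.root i, P.root j]) ≤
      Submodule.span ℝ (P.root '' S) := by
    apply Submodule.span_mono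
    rintro _ ⟨m, rfl⟩
    fin_cases m
    exacts [⟨i, hi, rfl⟩, ⟨j, hj, rfl⟩]
  have hfin : FiniteDimensional ℝ (Submodule.span ℝ (P.root '' S)) :=
    FiniteDimensional.span_of_finite ℝ (Set.toFinite _)
  have heq := Submodule.eq_of_le_of_finrank_le hle
    (by rw [hS.2, finrank_span_eq_card hli, Fintype.card_fin])
  have hmem : P.root k ∈ Submodule.span ℝ (Set.range ![P.root i, P.root j]) := by
    rw [heq]; exact Submodule.subset_span ⟨k, hk, rfl⟩
  rw [Matrix.range_cons, Matrix.range_cons, Matrix.range_empty, Set.union_empty,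
    Set.singleton_union, Submodule.mem_span_pair] at hmem
  obtain ⟨p, r, hpr⟩ := hmem
  -- The linear relation holds for roots; the rescaled functional transfers it to coroots.
  obtain ⟨c, hc, hF⟩ := exists_linear_coroot' P
  refine ⟨p * c i / c k, r * c j / c k, fun x => ?_⟩
  obtain ⟨F, hF⟩ := hF x
  have h1 := congrArg F hpr
  rw [map_add, map_smul, map_smul, hF, hF, hF, smul_eq_mul, smul_eq_mul] at h1
  have hck := (hc k).ne'
  field_simp
  linarith

/-- A positive pairing of coroots in a subsystem yields the difference of the coroots. -/
theorem IsRankTwoSubsystem.exists_sub (hS : IsRankTwoSubsystem P S) {i j : ι} (hi : i ∈ S)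
    (hj : j ∈ S) (h : i ≠ j) (h' : i ≠ negRoot P j) (hpos : 0 < P.pairingIn ℤ i j) :
    ∃ k ∈ S, ∀ x, P.coroot' k x = P.coroot' i x - P.coroot' j x := by
  have hne := root_ne_of_ne h h'
  have hmem := P.pairingIn_pairingIn_mem_set_of_isCrystal_of_isRed' _ _ hne.1 hne.2
  have hor : P.pairingIn ℤ i j = 1 ∨ P.pairingIn ℤ j i = 1 := by
    simp only [Set.mem_insert_iff, Set.mem_singleton_iff, Prod.mk.injEq] at hmem
    omega
  rcases hor with h1 | h1
  · refine ⟨negRoot P (refl P i • j), hS.negRoot_mem (hS.refl_smul_mem hi hj), fun x => ?_⟩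
    rw [coroot'_negRoot, coroot'_refl_smul, ← P.algebraMap_pairingIn ℤ, h1]
    simp
  · refine ⟨refl P j • i, hS.refl_smul_mem hj hi, fun x => ?_⟩
    rw [coroot'_refl_smul, ← P.algebraMap_pairingIn ℤ, h1]
    simp

/-- The coroot of `i` is not the sum of two positive coroots of the subsystem. -/
def IsIndecomposable (b : P.Base) (S : Set ι) (i : ι) : Prop :=
  ∀ j ∈ S, b.IsPos j → ∀ k ∈ S, b.IsPos k → ¬ ∀ x, P.coroot' i x = P.coroot' j x + P.coroot' k x

theorem coroot'_comb_height {i j k : ι} {p r : ℝ}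
    (h : ∀ x, P.coroot' k x = p * P.coroot' i x + r * P.coroot' j x) :
    (b.flip.height k : ℝ) = p * b.flip.height i + r * b.flip.height j := by
  obtain ⟨x, hx⟩ := exists_coroot'_eq b 1
  have := h x
  simpa [hx] using this

/-- Two indecomposable positive coroots in a rank two subsystem are its simple coroots. -/
theorem IsRankTwoSubsystem.exists_nat_comb (hS : IsRankTwoSubsystem P S) {i j : ι} (hi : i ∈ S)
    (hj : j ∈ S) (hpi : b.IsPos i) (hpj : b.IsPos j) (hne : i ≠ j)
    (hdi : IsIndecomposable b S i) (hdj : IsIndecomposable b S j) {k : ι} (hk : k ∈ S)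
    (hpk : b.IsPos k) :
    ∃ p r : ℕ, ∀ x, P.coroot' k x = p * P.coroot' i x + r * P.coroot' j x := by
  have hneg : ∀ {i j : ι}, b.IsPos i → b.IsPos j → i ≠ negRoot P j := by
    rintro i j hi hj rfl
    exact (isPos_negRoot b j).mp hi hj
  have hht := fun i => isPos_iff_flip_height b i
  have key : ∀ {i j k : ι}, i ∈ S → j ∈ S → b.IsPos i → b.IsPos j → k ∈ S → b.IsPos k → i ≠ j →
      IsIndecomposable b S i → k ≠ i → 0 < P.pairingIn ℤ k i →
      ∃ l ∈ S, b.IsPos l ∧ ∀ x, P.coroot' k x = P.coroot' l x + P.coroot' i x := by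
    intro i j k hi hj hpi hpj hk hpk hij hdi hki hpos
    obtain ⟨l, hl, hlx⟩ := hS.exists_sub hk hi hki (hneg hpk hpi) hpos
    refine ⟨l, hl, ?_, fun x => by rw [hlx]; ring⟩
    by_contra hc
    refine hdi k hk hpk (negRoot P l) (hS.negRoot_mem hl) ((isPos_negRoot b l).mpr hc) fun x => ?_
    rw [coroot'_negRoot, hlx]; ring
  -- A positive pairing would make the difference of the two coroots, up to sign, a positive coroot,
  -- and one of the two coroots would decompose.
  have hij : P.pairingIn ℤ i j ≤ 0 := by
    by_contra hc
    obtain ⟨l, hl, hpl, hlx⟩ := key hj hi hpj hpi hi hpi hne.symm hdj hne (by omega)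
    exact hdi l hl hpl j hj hpj hlx
  have hji : P.pairingIn ℤ j i ≤ 0 := by
    by_contra hc
    obtain ⟨l, hl, hpl, hlx⟩ := key hi hj hpi hpj hj hpj hne hdi hne.symm (by omega)
    exact hdj l hl hpl i hi hpi hlx
  -- Induction on the coroot height: as long as `k` has a positive pairing with `i` or `j`, that
  -- coroot can be split off.
  have main : ∀ (N : ℕ) (k : ι), k ∈ S → b.IsPos k → b.flip.height k ≤ N →
      ∃ p r : ℕ, ∀ x, P.coroot' k x = p * P.coroot' i x + r * P.coroot' j x := by
    intro N
    induction N with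
    | zero =>
      intro k _ hpk hN
      have := (hht k).mp hpk
      omega
    | succ N ih =>
      intro k hk hpk hN
      by_cases hki : k = i
      · exact ⟨1, 0, fun x => by rw [hki]; simp⟩
      by_cases hkj : k = j
      · exact ⟨0, 1, fun x => by rw [hkj]; simp⟩
      by_cases h1 : 0 < P.pairingIn ℤ k i
      · obtain ⟨l, hl, hpl, hlx⟩ := key hi hj hpi hpj hk hpk hne hdi hki h1
        have hh : b.flip.height k = b.flip.height l + b.flip.height i := by
          have := coroot'_comb_height (b := b) (i := l) (j := i) (p := 1) (r := 1) (fun x => by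
            rw [hlx x, one_mul, one_mul])
          rw [one_mul, one_mul] at this
          exact_mod_cast this
        have := (hht i).mp hpi
        obtain ⟨p, r, hpr⟩ := ih l hl hpl (by omega)
        exact ⟨p + 1, r, fun x => by rw [hlx, hpr]; push_cast; ring⟩
      by_cases h2 : 0 < P.pairingIn ℤ k j
      · obtain ⟨l, hl, hpl, hlx⟩ := key hj hi hpj hpi hk hpk hne.symm hdj hkj h2
        have hh : b.flip.height k = b.flip.height l + b.flip.height j := by
          have := coroot'_comb_height (b := b) (i := l) (j := j) (p := 1) (r := 1) (fun x => by
            rw [hlx x, one_mul, one_mul])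
          rw [one_mul, one_mul] at this
          exact_mod_cast this
        have := (hht j).mp hpj
        obtain ⟨p, r, hpr⟩ := ih l hl hpl (by omega)
        exact ⟨p, r + 1, fun x => by rw [hlx, hpr]; push_cast; ring⟩
      exfalso
      obtain ⟨p, r, hpr⟩ := hS.exists_comb hi hj hk hne (hneg hpi hpj)
      have hH := coroot'_comb_height (b := b) hpr
      have hHi : (0 : ℝ) < b.flip.height i := by exact_mod_cast (hht i).mp hpi
      have hHj : (0 : ℝ) < b.flip.height j := by exact_mod_cast (hht j).mp hpj
      have hHk : (0 : ℝ) < b.flip.height k := by exact_mod_cast (hht k).mp hpk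
      have cast : ∀ l m : ι, P.coroot' m (P.root l) = P.pairingIn ℤ l m := by
        intro l m
        rw [P.root_coroot'_eq_pairing, ← P.algebraMap_pairingIn ℤ]; rfl
      have hki' : (P.pairingIn ℤ k i : ℝ) ≤ 0 := by exact_mod_cast not_lt.mp h1
      have hkj' : (P.pairingIn ℤ k j : ℝ) ≤ 0 := by exact_mod_cast not_lt.mp h2
      have hik' : (P.pairingIn ℤ i k : ℝ) ≤ 0 := by
        exact_mod_cast (P.pairingIn_le_zero_iff ℤ).mp (not_lt.mp h1)
      have hjk' : (P.pairingIn ℤ j k : ℝ) ≤ 0 := by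
        exact_mod_cast (P.pairingIn_le_zero_iff ℤ).mp (not_lt.mp h2)
      have hij' : (P.pairingIn ℤ i j : ℝ) ≤ 0 := by exact_mod_cast hij
      have hji' : (P.pairingIn ℤ j i : ℝ) ≤ 0 := by exact_mod_cast hji
      have e1 := hpr (P.root k)
      have e2 := hpr (P.root i)
      have e3 := hpr (P.root j)
      simp only [cast, P.pairingIn_same] at e1 e2 e3
      push_cast at e1 e2 e3
      -- Here all pairings among `i`, `j`, `k` are nonpositive. If both coefficients are
      -- nonnegative, then `⟨k, k^∨⟩ = 2` is nonpositive; if both are negative, the height of `k` is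
      -- negative. In the mixed cases pairing with `i` or `j` forces the nonnegative coefficient to
      -- vanish, and the height is negative again.
      rcases lt_or_ge p 0 with hp | hp <;> rcases lt_or_ge r 0 with hr | hr
      · nlinarith
      · have : 0 ≤ -p * P.pairingIn ℤ j i * -1 := by nlinarith
        have hr0 : r ≤ 0 := by nlinarith
        nlinarith
      · have : 0 ≤ -r * P.pairingIn ℤ i j * -1 := by nlinarith
        have hp0 : p ≤ 0 := by nlinarith
        nlinarith
      · nlinarith
  exact main (b.flip.height k).toNat k hk hpk (Int.self_le_toNat _)

/-- Two nonproportional coroots take any given values at some point. -/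
theorem exists_coroot'_pair {i j : ι} (h : i ≠ j) (h' : i ≠ negRoot P j) (u v : ℝ) :
    ∃ z : V, P.coroot' i z = u ∧ P.coroot' j z = v := by
  have hne := root_ne_of_ne h h'
  have : IsAddTorsionFree V := .of_isTorsionFree ℝ V
  have hw : P.coxeterWeight i j ≠ 4 := RootPairing.coxeterWeight_ne_four_of_linearIndependent P
    (RootPairing.IsReduced.linearIndependent P h hne.2)
  rw [RootPairing.coxeterWeight] at hw
  -- The determinant of the Cartan matrix of the pair, nonzero as the roots are independent; the
  -- point sought is given by Cramer's rule.
  obtain ⟨D, hD⟩ : ∃ D, D = 4 - P.pairing i j * P.pairing j i := ⟨_, rfl⟩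
  have hd : D ≠ 0 := fun hc => hw (by linarith)
  refine ⟨((2 * u - P.pairing j i * v) / D) • P.root i +
    ((2 * v - P.pairing i j * u) / D) • P.root j, ?_, ?_⟩ <;>
  · simp only [map_add, map_smul, P.root_coroot'_eq_pairing, P.pairing_same, smul_eq_mul]
    field_simp
    rw [hD]
    ring

end RootSystem

end AlcovePath

/-! ### The cyclic order of the roots of a rank two subsystem -/

namespace AlcovePath

/-- A strictly decreasing sequence of `q - 1` integers in `{1, …, q - 1}` leaves no gaps: its values
are bounded above by descending from the left end and below by ascending from the right end. This
will identify a reflection from its effect on the cyclic order. -/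
theorem eq_sub_of_antitone {q : ℤ} {f : ℤ → ℤ} (hf : ∀ l, 0 < l → l < q → 0 < f l ∧ f l < q)
    (hanti : ∀ l m, 0 < l → l < m → m < q → f m < f l) {l : ℤ} (h0 : 0 < l) (hl : l < q) :
    f l = q - l := by
  have h1 : ∀ l, 1 ≤ l → l < q → f l ≤ q - l := by
    intro l hl0
    induction l, hl0 using Int.leInduction with
    | base => intro h; have := (hf 1 (by omega) h).2; omega
    | succ l hl0 ih =>
      intro h
      have := ih (by omega)
      have := hanti l (l + 1) (by omega) (by omega) h
      omega
  have h2 : ∀ l, 1 ≤ l → l < q → l ≤ f (q - l) := by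
    intro l hl0
    induction l, hl0 using Int.leInduction with
    | base => intro h; have := (hf (q - 1) (by omega) (by omega)).1; omega
    | succ l hl0 ih =>
      intro h
      have := ih (by omega)
      have := hanti (q - (l + 1)) (q - l) (by omega) (by omega) (by omega)
      omega
  have h3 := h1 l h0 hl
  have h4 := h2 (q - l) (by omega) (by omega)
  rw [sub_sub_cancel] at h4
  omega

/-- A property of integers that is invariant under translation by `q` holds everywhere if it holds
on some interval of length `q`. -/
theorem forall_of_periodic {q : ℤ} (hq : 0 < q) {p : ℤ → Prop} (hp : ∀ m, p (m + q) ↔ p m) {a : ℤ}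
    (h : ∀ m, a ≤ m → m < a + q → p m) (m : ℤ) : p m := by
  have key : ∀ n m : ℤ, p (m + n * q) ↔ p m := by
    intro n
    induction n using Int.induction_on with
    | zero => simp
    | succ n ih => intro m; rw [show m + (n + 1) * q = m + n * q + q by ring, hp, ih]
    | pred n ih => intro m; rw [← hp, show m + (-n - 1) * q + q = m + -n * q by ring, ih]
  have h1 := Int.emod_add_mul_ediv (m - a) q
  have h2 := Int.emod_nonneg (m - a) hq.ne'
  have h3 := Int.emod_lt_of_pos (m - a) hq
  have h4 := (key ((m - a) / q) ((m - a) % q + a)).mpr (h _ (by omega) (by omega))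
  rwa [mul_comm, show (m - a) % q + a + q * ((m - a) / q) = m by linarith] at h4

section RootSystem

variable {ι V V' : Type*} [AddCommGroup V] [Module ℝ V] [AddCommGroup V'] [Module ℝ V']
  {P : RootPairing ι ℝ V V'} [Finite ι] [P.IsRootSystem] [P.IsIrreducible] {b : P.Base}
  [P.IsCrystallographic] [P.IsReduced] {S : Set ι}

open scoped Classical in
/-- The extension of a finite sequence of roots to a sequence with `β (m + q) = -β m`. -/
noncomputable def cyclicRoot (P : RootPairing ι ℝ V V') (q : ℕ) (β : ℕ → ι) (m : ℤ) : ι :=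
  if Even (m / q) then β (m % q).toNat else negRoot P (β (m % q).toNat)

variable {q : ℕ} {β : ℕ → ι}

theorem cyclicRoot_add (hq : 0 < q) (m : ℤ) :
    cyclicRoot P q β (m + q) = negRoot P (cyclicRoot P q β m) := by
  unfold cyclicRoot
  have h1 : (m + q) / (q : ℤ) = m / q + 1 := by
    have := Int.add_mul_ediv_right m 1 (c := (q : ℤ)) (by omega)
    rwa [one_mul] at this
  rw [h1, Int.add_emod_right]
  by_cases h : Even (m / q)
  · rw [if_pos h, if_neg (by rw [Int.even_add_one]; simpa using h)]
  · rw [if_neg h, if_pos (by rwa [Int.even_add_one]), negRoot_negRoot]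

theorem cyclicRoot_natCast {j : ℕ} (hj : j < q) : cyclicRoot P q β j = β j := by
  unfold cyclicRoot
  rw [Int.ediv_eq_zero_of_lt (by omega) (by omega), Int.emod_eq_of_lt (by omega) (by omega)]
  simp

/-- The area form of a pair of points on the coroots. -/
def areaForm (P : RootPairing ι ℝ V V') (v v' : V) (i j : ι) : ℝ :=
  P.coroot' i v * P.coroot' j v' - P.coroot' j v * P.coroot' i v'

theorem areaForm_negRoot_left (v v' : V) (i j : ι) :
    areaForm P v v' (negRoot P i) j = -areaForm P v v' i j := by
  simp only [areaForm, coroot'_negRoot]; ring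

theorem areaForm_negRoot_right (v v' : V) (i j : ι) :
    areaForm P v v' i (negRoot P j) = -areaForm P v v' i j := by
  simp only [areaForm, coroot'_negRoot]; ring

theorem areaForm_swap (v v' : V) (i j : ι) : areaForm P v v' i j = -areaForm P v v' j i := by
  simp only [areaForm]; ring

theorem areaForm_self (v v' : V) (i : ι) : areaForm P v v' i i = 0 := by
  simp only [areaForm]; ring

/-- Reflections in a rank two subsystem reverse the orientation. -/
theorem IsRankTwoSubsystem.areaForm_refl_smul (hS : IsRankTwoSubsystem P S) {a c : ι} (ha : a ∈ S)
    (hc : c ∈ S) (hac : a ≠ c) (hac' : a ≠ negRoot P c) (v v' : V) {i j k : ι} (hi : i ∈ S)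
    (hj : j ∈ S) (hk : k ∈ S) :
    areaForm P v v' (refl P i • j) (refl P i • k) = -areaForm P v v' j k := by
  obtain ⟨p, r, h⟩ := hS.exists_comb ha hc hi hac hac'
  obtain ⟨p', r', h'⟩ := hS.exists_comb ha hc hj hac hac'
  obtain ⟨p'', r'', h''⟩ := hS.exists_comb ha hc hk hac hac'
  have e := h (P.root i)
  have e' := h' (P.root i)
  have e'' := h'' (P.root i)
  simp only [P.root_coroot'_eq_pairing, P.pairing_same] at e e' e''
  simp only [areaForm, coroot'_refl_smul, h v, h v', h' v, h' v', h'' v, h'' v', e', e'']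
  linear_combination ((p' * r'' - p'' * r') * (P.coroot' a v * P.coroot' c v' -
    P.coroot' c v * P.coroot' a v')) * e

/-- A sequence of points that cross the walls of a rank two subsystem one at a time puts its
positive roots into cyclic order. -/
theorem IsRankTwoSubsystem.dihedralRoots (hS : IsRankTwoSubsystem P S) (hq : 2 ≤ q)
    (hβ : Set.BijOn β (Set.Ico 0 q) {i | i ∈ S ∧ b.IsPos i}) {v : ℕ → V}
    (hv : ∀ k < q, ∀ j < q, (k ≤ j → 0 < P.coroot' (β j) (v k)) ∧
      (j < k → P.coroot' (β j) (v k) < 0)) :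
    DihedralRoots b q (cyclicRoot P q β) ∧ Set.range (cyclicRoot P q β) = S := by
  set γ := cyclicRoot P q β with hγ
  have hadd : ∀ m, γ (m + q) = negRoot P (γ m) := cyclicRoot_add (by omega)
  have hnat : ∀ j < q, γ (j : ℕ) = β j := fun j hj => cyclicRoot_natCast hj
  have hmem0 : ∀ j < q, β j ∈ S ∧ b.IsPos (β j) := fun j hj => hβ.mapsTo ⟨Nat.zero_le j, hj⟩
  have hmem : ∀ m, γ m ∈ S := by
    refine forall_of_periodic (q := q) (by omega) (fun m => ?_) (a := 0) fun m h0 hm => ?_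
    · rw [hadd]
      refine ⟨fun h => ?_, hS.negRoot_mem⟩
      have := hS.negRoot_mem h
      rwa [negRoot_negRoot] at this
    · obtain ⟨j, rfl⟩ := Int.eq_ofNat_of_zero_le h0
      rw [hnat j (by omega)]
      exact (hmem0 j (by omega)).1
  have hsurj : ∀ i ∈ S, ∃ j < q, i = β j ∨ i = negRoot P (β j) := by
    intro i hi
    by_cases hp : b.IsPos i
    · obtain ⟨j, hj, rfl⟩ := hβ.surjOn ⟨hi, hp⟩
      exact ⟨j, hj.2, Or.inl rfl⟩
    · obtain ⟨j, hj, hji⟩ := hβ.surjOn ⟨hS.negRoot_mem hi, (isPos_negRoot b i).mpr hp⟩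
      exact ⟨j, hj.2, Or.inr (by rw [hji, negRoot_negRoot])⟩
  have hne : ∀ {i j : ℕ}, i < q → j < q → i ≠ j → β i ≠ β j ∧ β i ≠ negRoot P (β j) := by
    refine fun {i j} hi hj hij => ⟨fun h => hij (hβ.injOn ⟨Nat.zero_le i, hi⟩ ⟨Nat.zero_le j, hj⟩ h),
      fun h => ?_⟩
    have := (hmem0 i hi).2
    rw [h, isPos_negRoot] at this
    exact this (hmem0 j hj).2
  have hac := hne (i := 0) (j := q - 1) (by omega) (by omega) (by omega)
  have hcomb := fun {k : ι} (hk : k ∈ S) => hS.exists_comb (hmem0 0 (by omega)).1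
    (hmem0 (q - 1) (by omega)).1 hk hac.1 hac.2
  -- The points `v 0` and `v k` lie on opposite sides of the first wall and on the same side of the
  -- last one. So every `v k`, together with `v 0`, defines the same orientation of the plane of
  -- coroots.
  have hbase : ∀ k, 0 < k → k < q → 0 < areaForm P (v 0) (v k) (β 0) (β (q - 1)) := by
    intro k h0 hk
    have h1 := (hv 0 (by omega) 0 (by omega)).1 le_rfl
    have h2 := (hv 0 (by omega) (q - 1) (by omega)).1 (by omega)
    have h3 := (hv k hk 0 (by omega)).2 h0
    have h4 := (hv k hk (q - 1) (by omega)).1 (by omega)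
    unfold areaForm
    nlinarith [mul_pos h1 h4, mul_pos h2 (neg_pos.mpr h3)]
  set ω := areaForm P (v 0) (v 1) with hω
  -- On the subsystem the area forms for different `k` are proportional, with positive ratio by
  -- `hbase`. For `k = j` the sign is visible, because wall `i` separates `v j` from `v 0` while
  -- wall `j` does not.
  have harea0 : ∀ i j, i < j → j < q → 0 < ω (β i) (β j) := by
    intro i j hij hj
    obtain ⟨p, r, h⟩ := hcomb (hmem0 i (by omega)).1
    obtain ⟨p', r', h'⟩ := hcomb (hmem0 j hj).1
    have e : ∀ k, areaForm P (v 0) (v k) (β i) (β j) =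
        (p * r' - p' * r) * areaForm P (v 0) (v k) (β 0) (β (q - 1)) := by
      intro k
      simp only [areaForm, h (v 0), h (v k), h' (v 0), h' (v k)]
      ring
    have h1 := (hv 0 (by omega) i (by omega)).1 (by omega)
    have h2 := (hv 0 (by omega) j (by omega)).1 (by omega)
    have h3 := (hv j hj i (by omega)).2 hij
    have h4 := (hv j hj j hj).1 le_rfl
    have h5 : 0 < areaForm P (v 0) (v j) (β i) (β j) := by
      unfold areaForm
      nlinarith [mul_pos h1 h4, mul_pos h2 (neg_pos.mpr h3)]
    rw [e] at h5
    rw [hω, e]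
    exact mul_pos (pos_of_mul_pos_left h5 (hbase j (by omega) hj).le) (hbase 1 (by omega) (by omega))
  have harea : ∀ i l : ℤ, 0 < l → l < q → 0 < ω (γ i) (γ (i + l)) := by
    intro i l h0 hl
    revert i
    refine forall_of_periodic (q := q) (by omega) (fun m => ?_) (a := 0) fun m hm0 hm => ?_
    · rw [show m + (q : ℤ) + l = m + l + q by ring, hadd, hadd, hω, areaForm_negRoot_left,
        areaForm_negRoot_right, neg_neg]
    · obtain ⟨i, rfl⟩ := Int.eq_ofNat_of_zero_le hm0
      obtain ⟨l, rfl⟩ := Int.eq_ofNat_of_zero_le h0.le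
      rw [hnat i (by omega)]
      by_cases hil : i + l < q
      · have := hnat (i + l) hil
        push_cast at this
        rw [this]
        exact harea0 i (i + l) (by omega) hil
      · have h1 := hadd ((i + l - q : ℕ) : ℤ)
        rw [hnat _ (by omega), show ((i + l - q : ℕ) : ℤ) + q = i + l by omega] at h1
        rw [h1, hω, areaForm_negRoot_right, areaForm_swap, neg_neg]
        exact harea0 _ _ (by omega) (by omega)
  have hwin : ∀ (a : ℤ), ∀ i ∈ S, ∃ l : ℤ, 0 ≤ l ∧ l < q ∧
      (i = γ (a + l) ∨ i = negRoot P (γ (a + l))) := by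
    intro a i hi
    refine forall_of_periodic (q := q) (p := fun a => ∃ l : ℤ, 0 ≤ l ∧ l < q ∧
      (i = γ (a + l) ∨ i = negRoot P (γ (a + l)))) (by omega) (fun m => ?_) (a := -q + 1)
      (fun m hm0 hm => ?_) a
    · refine exists_congr fun l => and_congr_right fun _ => and_congr_right fun _ => ?_
      rw [show m + (q : ℤ) + l = m + l + q by ring, hadd, negRoot_negRoot, or_comm]
    · obtain ⟨j, hj, hij⟩ := hsurj i hi
      rw [← hnat j hj] at hij
      by_cases hjm : (j : ℤ) < m + q
      · exact ⟨j - m, by omega, by omega, by rwa [show m + ((j : ℤ) - m) = j by ring]⟩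
      · refine ⟨j - m - q, by omega, by omega, ?_⟩
        have := hadd (m + (j - m - q))
        rw [show m + ((j : ℤ) - m - q) + q = j by ring] at this
        rw [this, negRoot_negRoot] at hij
        exact hij.symm
  -- The reflection negates `γ i` and reverses the orientation, hence it preserves the open half
  -- turn that follows `γ i`.
  have hrefl : ∀ i l : ℤ, 0 < l → l < q → ∃ l' : ℤ, (0 < l' ∧ l' < q) ∧
      refl P (γ i) • γ (i + l) = γ (i + l') := by
    intro i l h0 hl
    obtain ⟨l', h0', hl', h⟩ := hwin i _ (hS.refl_smul_mem (hmem i) (hmem (i + l)))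
    have hpos : 0 < ω (γ i) (refl P (γ i) • γ (i + l)) := by
      have := hS.areaForm_refl_smul (hmem0 0 (by omega)).1 (hmem0 (q - 1) (by omega)).1 hac.1 hac.2
        (v 0) (v 1) (hmem i) (hmem i) (hmem (i + l))
      rw [refl_smul_self, areaForm_negRoot_left, neg_inj] at this
      rw [hω, this]
      exact harea i l h0 hl
    have h0l : l' ≠ 0 := by
      rintro rfl
      rw [add_zero] at h
      rcases h with h | h <;> rw [h, hω] at hpos
      · rw [areaForm_self] at hpos; exact lt_irrefl _ hpos
      · rw [areaForm_negRoot_right, areaForm_self, neg_zero] at hpos; exact lt_irrefl _ hpos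
    refine ⟨l', ⟨by omega, hl'⟩, h.resolve_right fun hc => ?_⟩
    have := harea i l' (by omega) hl'
    rw [hc, hω, areaForm_negRoot_right] at hpos
    linarith
  -- On this half turn the reflection reverses the order, so it acts on the indices as a strictly
  -- decreasing map of `{1, …, q - 1}` to itself.
  have hreflect : ∀ i l : ℤ, 0 < l → l < q → refl P (γ i) • γ (i + l) = γ (i + (q - l)) := by
    intro i
    choose! f hf hfγ using hrefl i
    intro l h0 hl
    rw [hfγ l h0 hl, eq_sub_of_antitone hf ?_ h0 hl]
    intro l m h0 hlm hm
    by_contra hc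
    have h1 := hS.areaForm_refl_smul (hmem0 0 (by omega)).1 (hmem0 (q - 1) (by omega)).1 hac.1
      hac.2 (v 0) (v 1) (hmem i) (hmem (i + l)) (hmem (i + m))
    have h2 := harea (i + l) (m - l) (by omega) (by omega)
    rw [show i + l + (m - l) = i + m by ring] at h2
    rw [hfγ l h0 (by omega), hfγ m (by omega) hm] at h1
    rcases (not_lt.mp hc).lt_or_eq with hlt | heq
    · have h3 := harea (i + f l) (f m - f l) (by omega) (by have := (hf m (by omega) hm).2
                                                            have := (hf l h0 (by omega)).1
                                                            omega)
      rw [show i + f l + (f m - f l) = i + f m by ring, hω, h1, ← hω] at h3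
      linarith
    · rw [heq, areaForm_self, ← hω] at h1
      linarith
  refine ⟨⟨hq, hadd, fun i j => ?_, fun m h0 hm => ?_⟩, ?_⟩
  · revert j
    refine forall_of_periodic (q := q) (by omega) (fun j => ?_) (a := i) fun j h0 hj => ?_
    · have h1 := hadd (2 * i + q - (j + q))
      rw [sub_add_eq_sub_sub, sub_add_cancel] at h1
      rw [hadd, smul_negRoot, h1, sub_add_eq_sub_sub]
      constructor
      · intro h; rw [← h, negRoot_negRoot]
      · intro h; rw [h, negRoot_negRoot]
    · by_cases hij : j = i
      · rw [hij, refl_smul_self, ← hadd]; congr 1; ring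
      · have := hreflect i (j - i) (by omega) (by omega)
        rw [add_sub_cancel] at this
        rw [this]; congr 1; ring
  · obtain ⟨j, rfl⟩ := Int.eq_ofNat_of_zero_le h0
    rw [hnat j (by omega)]
    exact (hmem0 j (by omega)).2
  · ext i
    constructor
    · rintro ⟨m, rfl⟩; exact hmem m
    · intro hi
      obtain ⟨l, -, -, h | h⟩ := hwin 0 i hi
      · exact ⟨_, h.symm⟩
      · exact ⟨_, (hadd _).trans h.symm⟩

end RootSystem

end AlcovePath

/-! ### The vertex and the cyclic order of a dihedral segment -/

namespace AlcovePath

section RootSystem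

variable {ι V V' : Type*} [AddCommGroup V] [Module ℝ V] [AddCommGroup V'] [Module ℝ V']
  {P : RootPairing ι ℝ V V'} [Finite ι] [P.IsRootSystem] [P.IsIrreducible] {b : P.Base}
  [P.IsCrystallographic] [P.IsReduced] {S : Set ι}

namespace LambdaChain

variable {lam : V} {Γ : LambdaChain b lam} {t q : ℕ}

/-- The roots of a segment in cyclic order. -/
noncomputable def segmentRoot (Γ : LambdaChain b lam) (t q : ℕ) : ℤ → ι :=
  cyclicRoot P q fun j => Γ.root (t + j)

theorem segmentRoot_natCast {j : ℕ} (hj : j < q) : Γ.segmentRoot t q j = Γ.root (t + j) :=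
  cyclicRoot_natCast hj

namespace IsDihedralSegment

theorem root_mem (h : Γ.IsDihedralSegment S t q) {j : ℕ} (hj : j < q) :
    Γ.root (t + j) ∈ S ∧ b.IsPos (Γ.root (t + j)) :=
  h.2.2.mapsTo ⟨by omega, by omega⟩

theorem exists_root_eq (h : Γ.IsDihedralSegment S t q) {i : ι} (hi : i ∈ S) (hp : b.IsPos i) :
    ∃ j < q, Γ.root (t + j) = i := by
  obtain ⟨k, hk, rfl⟩ := h.2.2.surjOn ⟨hi, hp⟩
  exact ⟨k - t, by have := hk.1; have := hk.2; omega, by rw [Nat.add_sub_cancel' hk.1]⟩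

theorem root_injOn (h : Γ.IsDihedralSegment S t q) {i j : ℕ} (hi : i < q) (hj : j < q)
    (hij : Γ.root (t + i) = Γ.root (t + j)) : i = j := by
  have : t + i = t + j := h.2.2.injOn ⟨by omega, by omega⟩ ⟨by omega, by omega⟩ hij
  omega

theorem bijOn (h : Γ.IsDihedralSegment S t q) :
    Set.BijOn (fun j => Γ.root (t + j)) (Set.Ico 0 q) {i | i ∈ S ∧ b.IsPos i} := by
  refine ⟨fun j hj => h.root_mem hj.2, fun i hi j hj hij => h.root_injOn hi.2 hj.2 hij,
    fun i hi => ?_⟩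
  obtain ⟨j, hj, rfl⟩ := h.exists_root_eq hi.1 hi.2
  exact ⟨j, ⟨Nat.zero_le j, hj⟩, rfl⟩

theorem two_le (h : Γ.IsDihedralSegment S t q) : 2 ≤ q := by
  by_contra hq
  have hle : Submodule.span ℝ (P.root '' S) ≤ Submodule.span ℝ {P.root (Γ.root t)} := by
    rw [Submodule.span_le]
    rintro _ ⟨i, hi, rfl⟩
    have key : ∀ i ∈ S, b.IsPos i → i = Γ.root t := by
      intro i hi hp
      obtain ⟨j, hj, rfl⟩ := h.exists_root_eq hi hp
      rw [show j = 0 by omega, add_zero]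
    by_cases hp : b.IsPos i
    · rw [key i hi hp]; exact Submodule.subset_span rfl
    · have h1 := key _ (h.1.negRoot_mem hi) ((isPos_negRoot b i).mpr hp)
      have h2 : P.root i = -P.root (Γ.root t) := by rw [← h1, root_negRoot, neg_neg]
      rw [h2]
      exact Submodule.neg_mem _ (Submodule.subset_span rfl)
  have h1 := Submodule.finrank_mono hle
  rw [h.1.2, finrank_span_singleton (P.ne_zero _)] at h1
  omega

theorem count_eq (h : Γ.IsDihedralSegment S t q) {j k : ℕ} (hj : j < q) (hk : k ≤ q) :
    Γ.count (t + k) (Γ.root (t + j)) =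
      Γ.count t (Γ.root (t + j)) + if j < k then 1 else 0 := by
  induction k with
  | zero => simp
  | succ k ih =>
    rw [← add_assoc, count_succ, ih (by omega)]
    by_cases hjk : k = j
    · subst hjk; simp
    · rw [if_neg (c := Γ.root (t + k) = _) fun he => hjk (h.root_injOn (by omega) hj he), add_zero]
      have : j < k ↔ j < k + 1 := by omega
      simp only [this]

theorem coroot'_mem (hlam : IsDominantWeight b lam) (h : Γ.IsDihedralSegment S t q) {x0 : V}
    (hx : x0 ∈ fundamentalAlcove b) {j k : ℕ} (hj : j < q) (hk : k ≤ q) :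
    (k ≤ j → -(Γ.count t (Γ.root (t + j)) : ℝ) <
        P.coroot' (Γ.root (t + j)) (Γ.pathPoint x0 (t + k)) ∧
      P.coroot' (Γ.root (t + j)) (Γ.pathPoint x0 (t + k)) <
        -Γ.count t (Γ.root (t + j)) + 1) ∧
    (j < k → -(Γ.count t (Γ.root (t + j)) : ℝ) - 1 <
        P.coroot' (Γ.root (t + j)) (Γ.pathPoint x0 (t + k)) ∧
      P.coroot' (Γ.root (t + j)) (Γ.pathPoint x0 (t + k)) <
        -Γ.count t (Γ.root (t + j))) := by
  have h1 := Γ.coroot'_mem_strip hlam hx (k := t + k) (by have := h.2.1; omega) (h.root_mem hj).2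
  rw [h.count_eq hj hk] at h1
  change _ < P.coroot' _ (Γ.pathPoint x0 (t + k)) ∧ P.coroot' _ (Γ.pathPoint x0 (t + k)) < _ at h1
  constructor
  · intro hkj
    rw [if_neg (by omega), add_zero] at h1
    exact h1
  · intro hjk
    rw [if_pos hjk] at h1
    push_cast at h1
    exact ⟨by linarith [h1.1], by linarith [h1.2]⟩

/-- The walls crossed in the segment meet in a point. -/
theorem exists_vertex (hlam : IsDominantWeight b lam) (h : Γ.IsDihedralSegment S t q) :
    ∃ z : V, ∀ j < q, P.coroot' (Γ.root (t + j)) z = -Γ.count t (Γ.root (t + j)) := by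
  obtain ⟨x0, hx⟩ := fundamentalAlcove_nonempty b
  have hq := h.two_le
  have hm := fun {j k : ℕ} (hj : j < q) (hk : k ≤ q) => h.coroot'_mem hlam hx hj hk
  set a : ℕ → ℤ := fun j => -Γ.count t (Γ.root (t + j)) with ha
  have hacast : ∀ j, -(Γ.count t (Γ.root (t + j)) : ℝ) = a j := by intro j; simp [ha]
  simp only [hacast] at hm ⊢
  have hnz : ∀ i, ¬ ∀ x, P.coroot' i x = 0 := by
    intro i hi
    have := hi (P.root i)
    rw [P.root_coroot'_eq_pairing, P.pairing_same] at this
    norm_num at this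
  -- Just after the first wall the other coroots are still above their levels `a`, and after the
  -- segment all are below. If the coroot in position `0` were a sum of two others, the integer `a i
  -- + a j` would lie strictly between `a 0 - 1` and `a 0`. The last root is treated likewise,
  -- comparing the start of the segment with the point before its last wall.
  have hd0 : IsIndecomposable b S (Γ.root (t + 0)) := by
    intro i hi hpi j hj hpj hij
    obtain ⟨i, hiq, rfl⟩ := h.exists_root_eq hi hpi
    obtain ⟨j, hjq, rfl⟩ := h.exists_root_eq hj hpj
    have hi0 : i ≠ 0 := by
      rintro rfl
      exact hnz (Γ.root (t + j)) fun x => by linarith [hij x]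
    have hj0 : j ≠ 0 := by
      rintro rfl
      exact hnz (Γ.root (t + i)) fun x => by linarith [hij x]
    have h1 := ((hm (j := i) (k := 1) hiq (by omega)).1 (by omega)).1
    have h2 := ((hm (j := j) (k := 1) hjq (by omega)).1 (by omega)).1
    have h3 := ((hm (j := 0) (k := 1) (by omega) (by omega)).2 (by omega)).2
    have h4 := ((hm (j := i) (k := q) hiq le_rfl).2 hiq).2
    have h5 := ((hm (j := j) (k := q) hjq le_rfl).2 hjq).2
    have h6 := ((hm (j := 0) (k := q) (by omega) le_rfl).2 (by omega)).1
    have e1 := hij (Γ.pathPoint x0 (t + 1))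
    have e2 := hij (Γ.pathPoint x0 (t + q))
    have l1 : (a i : ℝ) + a j < a 0 := by linarith
    have l2 : (a 0 : ℝ) - 1 < a i + a j := by linarith
    norm_cast at l1
    have l2 : a 0 - 1 < a i + a j := by exact_mod_cast l2
    omega
  have hdq : IsIndecomposable b S (Γ.root (t + (q - 1))) := by
    intro i hi hpi j hj hpj hij
    obtain ⟨i, hiq, rfl⟩ := h.exists_root_eq hi hpi
    obtain ⟨j, hjq, rfl⟩ := h.exists_root_eq hj hpj
    have hi0 : i ≠ q - 1 := by
      rintro rfl
      exact hnz (Γ.root (t + j)) fun x => by linarith [hij x]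
    have hj0 : j ≠ q - 1 := by
      rintro rfl
      exact hnz (Γ.root (t + i)) fun x => by linarith [hij x]
    have h1 := ((hm (j := i) (k := 0) hiq (by omega)).1 (by omega)).1
    have h2 := ((hm (j := j) (k := 0) hjq (by omega)).1 (by omega)).1
    have h3 := ((hm (j := q - 1) (k := 0) (by omega) (by omega)).1 (by omega)).2
    have h4 := ((hm (j := i) (k := q - 1) hiq (by omega)).2 (by omega)).2
    have h5 := ((hm (j := j) (k := q - 1) hjq (by omega)).2 (by omega)).2
    have h6 := ((hm (j := q - 1) (k := q - 1) (by omega) (by omega)).1 le_rfl).1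
    have e1 := hij (Γ.pathPoint x0 (t + 0))
    have e2 := hij (Γ.pathPoint x0 (t + (q - 1)))
    have l1 : (a i : ℝ) + a j < a (q - 1) + 1 := by linarith
    have l2 : (a (q - 1) : ℝ) < a i + a j := by linarith
    have l1 : a i + a j < a (q - 1) + 1 := by exact_mod_cast l1
    have l2 : a (q - 1) < a i + a j := by exact_mod_cast l2
    omega
  have hr0 := h.root_mem (j := 0) (by omega)
  have hrq := h.root_mem (j := q - 1) (by omega)
  have hne : Γ.root (t + 0) ≠ Γ.root (t + (q - 1)) := fun he => by
    have := h.root_injOn (by omega) (by omega) he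
    omega
  have hne' : Γ.root (t + 0) ≠ negRoot P (Γ.root (t + (q - 1))) := fun he => by
    have := hr0.2
    rw [he, isPos_negRoot] at this
    exact this hrq.2
  -- The first and the last coroot are the simple coroots of the subsystem; their two walls
  -- determine the candidate for the vertex.
  obtain ⟨z, hz0, hzq⟩ := exists_coroot'_pair hne hne' (a 0 : ℝ) (a (q - 1) : ℝ)
  refine ⟨z, fun j hj => ?_⟩
  obtain ⟨p, r, hpr⟩ := h.1.exists_nat_comb hr0.1 hrq.1 hr0.2 hrq.2 hne hd0 hdq (h.root_mem hj).1
    (h.root_mem hj).2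
  have hpos : 0 < p + r := by
    by_contra hc
    exact hnz (Γ.root (t + j)) fun x => by rw [hpr, show p = 0 by omega, show r = 0 by omega]; simp
  have hpos' : (0 : ℝ) < p + r := by exact_mod_cast hpos
  have h1 := ((hm (j := 0) (k := 0) (by omega) (by omega)).1 le_rfl).1
  have h2 := ((hm (j := q - 1) (k := 0) (by omega) (by omega)).1 (by omega)).1
  have h3 := ((hm (j := j) (k := 0) hj (by omega)).1 (by omega)).2
  have h4 := ((hm (j := 0) (k := q) (by omega) le_rfl).2 (by omega)).2
  have h5 := ((hm (j := q - 1) (k := q) (by omega) le_rfl).2 (by omega)).2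
  have h6 := ((hm (j := j) (k := q) hj le_rfl).2 hj).1
  rw [hpr] at h3 h6 ⊢
  rw [hz0, hzq]
  have hp0 : (0 : ℝ) ≤ p := Nat.cast_nonneg p
  have hr0 : (0 : ℝ) ≤ r := Nat.cast_nonneg r
  -- The bounds before and after the segment confine the integer `p a₀ + r a_{q-1}` strictly between
  -- `a j - 1` and `a j + 1`. So the other walls pass through `z` too.
  have l1 : (p : ℝ) * a 0 + r * a (q - 1) < a j + 1 := by
    have := mul_le_mul_of_nonneg_left h1.le hp0
    have := mul_le_mul_of_nonneg_left h2.le hr0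
    linarith
  have l2 : (a j : ℝ) - 1 < p * a 0 + r * a (q - 1) := by
    have := mul_le_mul_of_nonneg_left h4.le hp0
    have := mul_le_mul_of_nonneg_left h5.le hr0
    linarith
  have l1 : (p : ℤ) * a 0 + r * a (q - 1) < a j + 1 := by exact_mod_cast l1
  have l2 : a j - 1 < (p : ℤ) * a 0 + r * a (q - 1) := by exact_mod_cast l2
  have : (p : ℤ) * a 0 + r * a (q - 1) = a j := by omega
  exact_mod_cast this

/-- Seen from the common vertex, the points of the gallery cross the linear walls of the subsystem
one at a time. -/
theorem dihedralRoots (hlam : IsDominantWeight b lam) (h : Γ.IsDihedralSegment S t q) :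
    DihedralRoots b q (Γ.segmentRoot t q) ∧ Set.range (Γ.segmentRoot t q) = S := by
  obtain ⟨x0, hx⟩ := fundamentalAlcove_nonempty b
  obtain ⟨z, hz⟩ := h.exists_vertex hlam
  refine h.1.dihedralRoots h.two_le h.bijOn (v := fun k => Γ.pathPoint x0 (t + k) - z)
    fun k hk j hj => ?_
  have hm := h.coroot'_mem hlam hx hj hk.le
  simp only [map_sub, hz j hj]
  exact ⟨fun hkj => by linarith [(hm.1 hkj).1], fun hjk => by linarith [(hm.2 hjk).2]⟩

theorem dihedralLength_eq (hlam : IsDominantWeight b lam) (h : Γ.IsDihedralSegment S t q)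
    {u : P.weylGroup} {A : ℤ} (hu : HasParam b q (Γ.segmentRoot t q) u A) (hA : |A| ≤ q) :
    (Γ.dihedralLength S t q u : ℤ) = |A| := by
  obtain ⟨hd, hr⟩ := h.dihedralRoots hlam
  have hq := h.two_le
  have := hd.wordLength_eq hu hA
  have h0 := Γ.segmentRoot_natCast (t := t) (show 0 < q by omega)
  have h1 := Γ.segmentRoot_natCast (t := t) (show q - 1 < q by omega)
  rw [Nat.cast_sub (by omega), Nat.cast_one] at h1
  rw [Nat.cast_zero] at h0
  rw [hr, h0, h1, add_zero] at this
  rw [dihedralLength, Nat.add_sub_assoc (by omega)]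
  exact this

end IsDihedralSegment

end LambdaChain

end RootSystem

end AlcovePath

/-! ### Saturated walks in a dihedral group -/

namespace AlcovePath

/-- The parameters along a walk in a dihedral group that uses the reflections in `K`. -/
def dihedralWalk (q : ℕ) (K : Finset ℕ) (A : ℤ) : ℕ → ℤ
  | 0 => A
  | j + 1 => if j ∈ K then dihedralStep q (dihedralWalk q K A j) j else dihedralWalk q K A j

/-- Each reflection of the walk increases the length by one. -/
def IsGoodWalk (q : ℕ) (K : Finset ℕ) (A : ℤ) : Prop :=
  ∀ j ∈ K, j < q ∧ |dihedralWalk q K A (j + 1)| = |dihedralWalk q K A j| + 1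

/-- The reflections used by the walk from `A` to `B`. -/
def InChain (q : ℕ) (A B i : ℤ) : Prop :=
  (0 ≤ A ∧ 0 ≤ B ∧ A ≤ i ∧ i < B) ∨
  (0 ≤ A ∧ B < 0 ∧ ((A ≤ i ∧ i < -B - 1) ∨ i = q - 1)) ∨
  (A < 0 ∧ 0 ≤ B ∧ (i = 0 ∨ (-A + 1 ≤ i ∧ i < B))) ∨
  (A < 0 ∧ B = A - 1 ∧ i = q - 1 + A) ∨
  (A < 0 ∧ B < A - 1 ∧ (i = 0 ∨ (-A + 1 ≤ i ∧ i < -B - 1) ∨ i = q - 1))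

/-- The parameter with respect to the reversed order of the roots. -/
def reverseParam (q : ℕ) (A : ℤ) : ℤ := if A = q then q else -A

variable {q : ℕ} {K : Finset ℕ} {A B : ℤ}

theorem dihedralWalk_zero : dihedralWalk q K A 0 = A := rfl

theorem dihedralWalk_succ {j : ℕ} (hj : j ∈ K) :
    dihedralWalk q K A (j + 1) = dihedralStep q (dihedralWalk q K A j) j := if_pos hj

theorem dihedralWalk_succ_of_notMem {j : ℕ} (hj : j ∉ K) :
    dihedralWalk q K A (j + 1) = dihedralWalk q K A j := if_neg hj

theorem abs_eq_add_one {x y : ℤ} (h : |x| = |y| + 1) :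
    (0 ≤ y ∧ (x = y + 1 ∨ x = -y - 1)) ∨ (y < 0 ∧ (x = -y + 1 ∨ x = y - 1)) := by
  rcases abs_cases x with ⟨h1, h2⟩ | ⟨h1, h2⟩ <;> rcases abs_cases y with ⟨h3, h4⟩ | ⟨h3, h4⟩ <;>
    omega

/-- The condition `|A'| = |A| + 1` leaves two values for the new parameter, and `A' ≡ 2j + 1 - A`
modulo `2q` then determines `j`. At most two reflections are thus available at each parameter, which
makes good walks rigid. -/
theorem dihedralStep_cases {A j : ℤ} (h : |dihedralStep q A j| = |A| + 1) (h0 : 0 ≤ j)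
    (hj : j < q) :
    (0 ≤ A ∧ (j = A ∧ dihedralStep q A j = A + 1 ∨
      j = q - 1 ∧ A < q - 1 ∧ dihedralStep q A j = -A - 1)) ∨
    (A < 0 ∧ (j = 0 ∧ dihedralStep q A j = -A + 1 ∨
      j = q - 1 + A ∧ 1 - q < A ∧ dihedralStep q A j = A - 1)) := by
  have := abs_eq_add_one h
  unfold dihedralStep at *
  split_ifs at * <;> omega

theorem IsGoodWalk.step (h : IsGoodWalk q K A) {j : ℕ} (hj : j ∈ K) :
    (0 ≤ dihedralWalk q K A j ∧ (j = dihedralWalk q K A j ∧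
        dihedralWalk q K A (j + 1) = dihedralWalk q K A j + 1 ∨
      (j : ℤ) = q - 1 ∧ dihedralWalk q K A j < q - 1 ∧
        dihedralWalk q K A (j + 1) = -dihedralWalk q K A j - 1)) ∨
    (dihedralWalk q K A j < 0 ∧ ((j : ℤ) = 0 ∧
        dihedralWalk q K A (j + 1) = -dihedralWalk q K A j + 1 ∨
      (j : ℤ) = q - 1 + dihedralWalk q K A j ∧ 1 - q < dihedralWalk q K A j ∧
        dihedralWalk q K A (j + 1) = dihedralWalk q K A j - 1)) := by
  obtain ⟨h1, h2⟩ := h j hj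
  rw [dihedralWalk_succ hj] at h2 ⊢
  exact dihedralStep_cases h2 (by omega) (by omega)

/-- From `A ≥ 0` the only steps before the last position are `A → A + 1 → ⋯` by consecutive
reflections; a jump to a negative parameter is possible only at position `q - 1`. -/
theorem IsGoodWalk.invariant_of_nonneg (h : IsGoodWalk q K A) (h0 : 0 ≤ A) {j : ℕ}
    (hj : j ≤ q) :
    (A ≤ dihedralWalk q K A j ∧ (dihedralWalk q K A j = A ∨ dihedralWalk q K A j ≤ j) ∧
      ∀ i < j, i ∈ K ↔ A ≤ i ∧ i < dihedralWalk q K A j) ∨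
    (dihedralWalk q K A j < 0 ∧ j = q ∧ A < -dihedralWalk q K A j ∧ -q < dihedralWalk q K A j ∧
      ∀ i < j, i ∈ K ↔ (A ≤ i ∧ i < -dihedralWalk q K A j - 1) ∨ (i : ℤ) = q - 1) := by
  induction j with
  | zero => left; rw [dihedralWalk_zero]; simp
  | succ j ih =>
    rcases ih (by omega) with ⟨h1, h2, h3⟩ | ⟨-, h2, -⟩
    · by_cases hK : j ∈ K
      · have hs := h.step hK
        rcases hs with ⟨-, ⟨h4, h5⟩ | ⟨h4, h5, h6⟩⟩ | ⟨h4, -⟩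
        · left
          refine ⟨by omega, by omega, fun i hi => ?_⟩
          rcases Nat.lt_succ_iff_lt_or_eq.mp hi with hi | rfl
          · rw [h3 i hi]; omega
          · simp only [hK, true_iff]; omega
        · right
          refine ⟨by omega, by omega, by omega, by omega, fun i hi => ?_⟩
          rcases Nat.lt_succ_iff_lt_or_eq.mp hi with hi | rfl
          · rw [h3 i hi]; omega
          · simp only [hK, true_iff]; omega
        · omega
      · left
        rw [dihedralWalk_succ_of_notMem hK]
        refine ⟨h1, by omega, fun i hi => ?_⟩
        rcases Nat.lt_succ_iff_lt_or_eq.mp hi with hi | rfl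
        · exact h3 i hi
        · simp only [hK, false_iff]; omega
    · omega

/-- From `A < 0` the walk rests, or jumps at position `0` to `-A + 1` and continues as in the
nonnegative case, or takes the step to `A - 1` at position `q - 1 + A`. After that step the next
admissible position has already been passed. -/
theorem IsGoodWalk.invariant_of_neg (h : IsGoodWalk q K A) (h0 : A < 0) {j : ℕ} (hj : j ≤ q) :
    (dihedralWalk q K A j = A ∧ ∀ i < j, i ∉ K) ∨
    (dihedralWalk q K A j = A - 1 ∧ q - 1 + A < j ∧ -q < A - 1 ∧
      ∀ i < j, i ∈ K ↔ (i : ℤ) = q - 1 + A) ∨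
    (0 < j ∧ -A + 1 ≤ dihedralWalk q K A j ∧
      (dihedralWalk q K A j = -A + 1 ∨ dihedralWalk q K A j ≤ j) ∧
      ∀ i < j, i ∈ K ↔ i = 0 ∨ (-A + 1 ≤ i ∧ i < dihedralWalk q K A j)) ∨
    (j = q ∧ dihedralWalk q K A j < A - 1 ∧ -q < dihedralWalk q K A j ∧
      ∀ i < j, i ∈ K ↔ i = 0 ∨ (-A + 1 ≤ i ∧ i < -dihedralWalk q K A j - 1) ∨ (i : ℤ) = q - 1) := by
  induction j with
  | zero => left; rw [dihedralWalk_zero]; simp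
  | succ j ih =>
    rcases ih (by omega) with ⟨h1, h2⟩ | ⟨h1, h2, h2', h3⟩ | ⟨h1, h2, h3, h4⟩ | ⟨h1, -⟩
    · by_cases hK : j ∈ K
      · rcases h.step hK with ⟨h4, -⟩ | ⟨-, ⟨h4, h5⟩ | ⟨h4, h5, h6⟩⟩
        · omega
        · right; right; left
          refine ⟨by omega, by omega, by omega, fun i hi => ?_⟩
          have : i = j := by omega
          subst this
          simp only [hK, true_iff]; omega
        · right; left
          refine ⟨by omega, by omega, by omega, fun i hi => ?_⟩
          rcases Nat.lt_succ_iff_lt_or_eq.mp hi with hi | rfl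
          · simp only [h2 i hi, false_iff]; omega
          · simp only [hK, true_iff]; omega
      · left
        rw [dihedralWalk_succ_of_notMem hK]
        refine ⟨h1, fun i hi => ?_⟩
        rcases Nat.lt_succ_iff_lt_or_eq.mp hi with hi | rfl
        exacts [h2 i hi, hK]
    · have hK : j ∉ K := by
        intro hK
        rcases h.step hK with ⟨h4, -⟩ | ⟨-, ⟨h4, h5⟩ | ⟨h4, h5, h6⟩⟩ <;> omega
      right; left
      rw [dihedralWalk_succ_of_notMem hK]
      refine ⟨h1, by omega, h2', fun i hi => ?_⟩
      rcases Nat.lt_succ_iff_lt_or_eq.mp hi with hi | rfl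
      · exact h3 i hi
      · simp only [hK, false_iff]; omega
    · by_cases hK : j ∈ K
      · rcases h.step hK with ⟨-, ⟨h5, h6⟩ | ⟨h5, h6, h7⟩⟩ | ⟨h5, -⟩
        · right; right; left
          refine ⟨by omega, by omega, by omega, fun i hi => ?_⟩
          rcases Nat.lt_succ_iff_lt_or_eq.mp hi with hi | rfl
          · rw [h4 i hi]; omega
          · simp only [hK, true_iff]; omega
        · right; right; right
          refine ⟨by omega, by omega, by omega, fun i hi => ?_⟩
          rcases Nat.lt_succ_iff_lt_or_eq.mp hi with hi | rfl
          · rw [h4 i hi]; omega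
          · simp only [hK, true_iff]; omega
        · omega
      · right; right; left
        rw [dihedralWalk_succ_of_notMem hK]
        refine ⟨by omega, h2, by omega, fun i hi => ?_⟩
        rcases Nat.lt_succ_iff_lt_or_eq.mp hi with hi | rfl
        · exact h4 i hi
        · simp only [hK, false_iff]; omega
    · omega

/-- A good walk is determined by its ends. -/
theorem IsGoodWalk.mem_iff (h : IsGoodWalk q K A) (hA : -q < A) (hA' : A ≤ q) :
    (-q < dihedralWalk q K A q ∧ dihedralWalk q K A q ≤ q ∧
      (dihedralWalk q K A q = A ∨ |A| < |dihedralWalk q K A q|)) ∧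
    ∀ i : ℕ, i ∈ K ↔ i < q ∧ InChain q A (dihedralWalk q K A q) i := by
  have hlt : ∀ i, i ∈ K → i < q := fun i hi => (h i hi).1
  have key : (-q < dihedralWalk q K A q ∧ dihedralWalk q K A q ≤ q ∧
      (dihedralWalk q K A q = A ∨ |A| < |dihedralWalk q K A q|)) ∧
      ∀ i < q, i ∈ K ↔ InChain q A (dihedralWalk q K A q) i := by
    rcases le_or_gt 0 A with h0 | h0
    · rcases h.invariant_of_nonneg h0 (j := q) le_rfl with ⟨h1, h2, h3⟩ | ⟨h1, -, h2, h3, h4⟩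
      · refine ⟨⟨by omega, by omega, ?_⟩, fun i hi => ?_⟩
        · rw [abs_of_nonneg h0, abs_of_nonneg (by omega)]; omega
        · rw [h3 i hi, InChain]; omega
      · refine ⟨⟨by omega, by omega, ?_⟩, fun i hi => ?_⟩
        · rw [abs_of_nonneg h0, abs_of_neg h1]; omega
        · rw [h4 i hi, InChain]; omega
    · rcases h.invariant_of_neg h0 (j := q) le_rfl with ⟨h1, h2⟩ | ⟨h1, h2, h2', h3⟩ |
        ⟨h1, h2, h3, h4⟩ | ⟨-, h2, h3, h4⟩
      · refine ⟨⟨by omega, by omega, Or.inl h1⟩, fun i hi => ?_⟩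
        simp only [h2 i hi, false_iff, InChain]; omega
      · refine ⟨⟨by omega, by omega, Or.inr ?_⟩, fun i hi => ?_⟩
        · rw [abs_of_neg h0, abs_of_neg (by omega)]; omega
        · rw [h3 i hi, InChain]; omega
      · refine ⟨⟨by omega, by omega, Or.inr ?_⟩, fun i hi => ?_⟩
        · rw [abs_of_neg h0, abs_of_nonneg (by omega)]; omega
        · rw [h4 i hi, InChain]; omega
      · refine ⟨⟨by omega, by omega, Or.inr ?_⟩, fun i hi => ?_⟩
        · rw [abs_of_neg h0, abs_of_neg (by omega)]; omega
        · rw [h4 i hi, InChain]; omega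
  refine ⟨key.1, fun i => ⟨fun hi => ⟨hlt i hi, (key.2 i (hlt i hi)).mp hi⟩,
    fun hi => (key.2 i hi.1).mpr hi.2⟩⟩

/-- Existence of a good walk is reduced to exhibiting its sequence of parameters and checking the
local rules of `dihedralStep_cases`. -/
theorem isGoodWalk_of_eq (hK : ∀ j ∈ K, j < q) (f : ℕ → ℤ) (h0 : f 0 = A)
    (hf : ∀ j < q, (j ∈ K ∧
      ((0 ≤ f j ∧ (f j = j ∧ f (j + 1) = j + 1 ∨
        (j : ℤ) = q - 1 ∧ f j < q - 1 ∧ f (j + 1) = -f j - 1)) ∨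
      (f j < 0 ∧ -q < f j ∧ (j = 0 ∧ f (j + 1) = -f j + 1 ∨
        (j : ℤ) = q - 1 + f j ∧ 1 - q < f j ∧ f (j + 1) = f j - 1)))) ∨
      (j ∉ K ∧ f (j + 1) = f j)) :
    IsGoodWalk q K A ∧ dihedralWalk q K A q = f q := by
  have hs : ∀ j ∈ K, f (j + 1) = dihedralStep q (f j) j ∧
      ((0 ≤ f j ∧ (f (j + 1) = f j + 1 ∨ f (j + 1) = -f j - 1)) ∨
        (f j < 0 ∧ (f (j + 1) = -f j + 1 ∨ f (j + 1) = f j - 1))) := by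
    intro j hj
    have hjq := hK j hj
    rcases hf j hjq with ⟨-, ⟨h1, ⟨h2, h3⟩ | ⟨h2, h3, h4⟩⟩ | ⟨h1, h2, ⟨h3, h4⟩ | ⟨h3, h4, h5⟩⟩⟩ | h
    · refine ⟨?_, by omega⟩
      rw [dihedralStep, if_pos (by omega)]; omega
    · refine ⟨?_, by omega⟩
      rw [dihedralStep, if_neg (by omega)]; omega
    · refine ⟨?_, by omega⟩
      rw [dihedralStep, if_pos (by omega)]; omega
    · refine ⟨?_, by omega⟩
      rw [dihedralStep, if_neg (by omega)]; omega
    · exact absurd hj h.1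
  have key : ∀ j ≤ q, dihedralWalk q K A j = f j := by
    intro j hj
    induction j with
    | zero => exact h0.symm
    | succ j ih =>
      have ih := ih (by omega)
      by_cases hj' : j ∈ K
      · rw [dihedralWalk_succ hj', ih, (hs j hj').1]
      · rw [dihedralWalk_succ_of_notMem hj', ih]
        rcases hf j (by omega) with h | h
        exacts [absurd h.1 hj', h.2.symm]
  refine ⟨fun j hj => ⟨hK j hj, ?_⟩, key q le_rfl⟩
  rw [key _ (hK j hj), key _ (hK j hj).le]
  rcases (hs j hj).2 with ⟨h1, h2⟩ | ⟨h1, h2⟩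
  · rw [abs_of_nonneg h1]
    rcases h2 with h2 | h2 <;> rw [h2]
    · rw [abs_of_nonneg (by omega)]
    · rw [abs_of_nonpos (by omega)]; ring
  · rw [abs_of_neg h1]
    rcases h2 with h2 | h2 <;> rw [h2]
    · rw [abs_of_nonneg (by omega)]
    · rw [abs_of_nonpos (by omega)]; ring

theorem inChain_nonneg_nonneg (h0 : 0 ≤ A) (h1 : 0 ≤ B) {i : ℤ} :
    InChain q A B i ↔ A ≤ i ∧ i < B := by
  unfold InChain; omega

theorem inChain_nonneg_neg (h0 : 0 ≤ A) (h1 : B < 0) {i : ℤ} :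
    InChain q A B i ↔ (A ≤ i ∧ i < -B - 1) ∨ i = q - 1 := by
  unfold InChain; omega

theorem inChain_neg_nonneg (h0 : A < 0) (h1 : 0 ≤ B) {i : ℤ} :
    InChain q A B i ↔ i = 0 ∨ (-A + 1 ≤ i ∧ i < B) := by
  unfold InChain; omega

theorem inChain_neg_eq (h0 : A < 0) (h1 : B = A - 1) {i : ℤ} :
    InChain q A B i ↔ i = q - 1 + A := by
  unfold InChain; omega

theorem inChain_neg_lt (h0 : A < 0) (h1 : B < A - 1) {i : ℤ} :
    InChain q A B i ↔ i = 0 ∨ (-A + 1 ≤ i ∧ i < -B - 1) ∨ i = q - 1 := by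
  unfold InChain; omega

theorem inChain_self {i : ℤ} : ¬ InChain q A A i := by
  unfold InChain; omega

/-- Every admissible pair of ends belongs to a good walk. -/
theorem isGoodWalk_of_inChain (hA : -q < A) (hA' : A ≤ q) (hB : -q < B) (hB' : B ≤ q)
    (hAB : B = A ∨ |A| < |B|) (hK : ∀ i : ℕ, i ∈ K ↔ i < q ∧ InChain q A B i) :
    IsGoodWalk q K A ∧ dihedralWalk q K A q = B := by
  have hlt : ∀ j ∈ K, j < q := fun j hj => ((hK j).mp hj).1
  rcases hAB with rfl | hAB
  · exact isGoodWalk_of_eq (A := B) hlt (fun _ => B) rfl fun j hj =>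
      Or.inr ⟨fun h => inChain_self ((hK j).mp h).2, rfl⟩
  rcases le_or_gt 0 A with h0 | h0 <;> rcases le_or_gt 0 B with h1 | h1
  · rw [abs_of_nonneg h0, abs_of_nonneg h1] at hAB
    simp only [inChain_nonneg_nonneg h0 h1] at hK
    -- The walk waits at `A` until position `A`, then keeps pace with the position, and rests from
    -- `B` on. The other sign patterns add a jump at position `0` or at position `q - 1`; only the
    -- step from `A` to `A - 1` is of a different kind.
    have := isGoodWalk_of_eq (A := A) hlt (fun j => if j ≤ A then A else if j ≤ B then j else B)
      (by simp [h0]) (fun j hj => by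
        rw [hK]
        push_cast
        rcases lt_trichotomy (j : ℤ) A with h | h | h
        · rw [if_pos h.le, if_pos (by omega)]; omega
        · rw [if_pos h.le, if_neg (by omega), if_pos (by omega)]; omega
        · simp only [if_neg (show ¬ (j : ℤ) ≤ A by omega), if_neg (show ¬ (j : ℤ) + 1 ≤ A by omega)]
          split_ifs <;> omega)
    refine ⟨this.1, this.2.trans ?_⟩
    split_ifs <;> omega
  · rw [abs_of_nonneg h0, abs_of_neg h1] at hAB
    simp only [inChain_nonneg_neg h0 h1] at hK
    have := isGoodWalk_of_eq (A := A) hlt (fun j => if j < q then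
        (if j ≤ A then A else if j ≤ -B - 1 then j else -B - 1) else B)
      (by rw [if_pos (by omega), if_pos (by omega)]) (fun j hj => by
        rw [hK, if_pos hj]
        push_cast
        by_cases h : j + 1 < q
        · rw [if_pos h]; split_ifs <;> omega
        · rw [if_neg h]; split_ifs <;> omega)
    refine ⟨this.1, this.2.trans ?_⟩
    rw [if_neg (lt_irrefl _)]
  · rw [abs_of_neg h0, abs_of_nonneg h1] at hAB
    simp only [inChain_neg_nonneg h0 h1] at hK
    have := isGoodWalk_of_eq (A := A) hlt (fun j => if j = 0 then A else if j ≤ -A + 1 then -A + 1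
        else if j ≤ B then j else B)
      (by simp) (fun j hj => by
        rw [hK, if_neg (Nat.succ_ne_zero j)]
        push_cast
        by_cases h : j = 0
        · rw [if_pos h]; split_ifs <;> omega
        · rw [if_neg h]; split_ifs <;> omega)
    refine ⟨this.1, this.2.trans ?_⟩
    split_ifs <;> omega
  · rw [abs_of_neg h0, abs_of_neg h1] at hAB
    by_cases hBA : B = A - 1
    · simp only [inChain_neg_eq h0 hBA] at hK
      have := isGoodWalk_of_eq (A := A) hlt (fun j => if j ≤ q - 1 + A then A else B)
        (by rw [if_pos]; push_cast; omega) (fun j hj => by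
          rw [hK]
          push_cast
          split_ifs <;> omega)
      refine ⟨this.1, this.2.trans ?_⟩
      split_ifs <;> omega
    · simp only [inChain_neg_lt h0 (show B < A - 1 by omega)] at hK
      have := isGoodWalk_of_eq (A := A) hlt (fun j => if j = 0 then A else
          if j < q then (if j ≤ -A + 1 then -A + 1 else if j ≤ -B - 1 then j else -B - 1) else B)
        (by simp) (fun j hj => by
          rw [hK, if_neg (Nat.succ_ne_zero j), if_pos hj]
          push_cast
          by_cases h : j = 0
          · rw [if_pos h, if_pos (by omega), if_pos (by omega)]; omega
          · rw [if_neg h]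
            by_cases h : j + 1 < q
            · rw [if_pos h]; split_ifs <;> omega
            · rw [if_neg h]; split_ifs <;> omega)
      refine ⟨this.1, this.2.trans ?_⟩
      rw [if_neg (by omega), if_neg (lt_irrefl _)]

end AlcovePath

/-! ### The explicit Yang–Baxter involution as reversal of parameters -/

namespace AlcovePath

section Values

variable {q a b : ℕ} {K : Finset ℕ}

theorem ybInvolution_singleton_one (h : b = a + 1) : ybInvolution q a b {1} = {q} := by
  rw [ybInvolution, if_pos h, if_pos rfl]

theorem ybInvolution_singleton_self (h : b = a + 1) (hq : 2 ≤ q) :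
    ybInvolution q a b {q} = {1} := by
  rw [ybInvolution, if_pos h, if_neg, if_pos rfl]
  rw [Finset.singleton_inj]; omega

theorem ybInvolution_singleton_sub (h : b = a + 1) (ha : 0 < a) (hb : b < q) :
    ybInvolution q a b {q - a} = {a + 1} := by
  rw [ybInvolution, if_pos h, if_neg, if_neg, if_pos ⟨ha, hb, rfl⟩] <;>
  rw [Finset.singleton_inj] <;> omega

theorem ybInvolution_singleton_succ (h : b = a + 1) (ha : 0 < a) (hb : b < q) :
    ybInvolution q a b {a + 1} = {q - a} := by
  rw [ybInvolution, if_pos h, if_neg, if_neg]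
  · split_ifs with h1 h2
    · rw [← h1.2.2, Finset.singleton_inj]
    · rfl
    · exact absurd ⟨ha, hb, rfl⟩ h2
  all_goals rw [Finset.singleton_inj]; omega

theorem ybInvolution_insert_one (h : a + 2 ≤ b) (hb : b < q) :
    ybInvolution q a b (insert 1 (Finset.Icc (a + 2) b)) =
      insert q (Finset.Icc (a + 1) (b - 1)) := by
  rw [ybInvolution, if_neg (by omega), if_pos h, if_pos ⟨hb, rfl⟩]

theorem finset_ne_of_mem {x : ℕ} {X Y : Finset ℕ} (h : x ∈ X) (h' : x ∉ Y) : X ≠ Y := by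
  rintro rfl; exact h' h

theorem ybInvolution_insert_self (h : a + 2 ≤ b) (hb : b < q) :
    ybInvolution q a b (insert q (Finset.Icc (a + 1) (b - 1))) =
      insert 1 (Finset.Icc (a + 2) b) := by
  rw [ybInvolution, if_neg (by omega), if_pos h, if_neg, if_pos ⟨hb, rfl⟩]
  rintro ⟨-, h1⟩
  exact finset_ne_of_mem (x := q) (by simp) (by simp; omega) h1

theorem ybInvolution_insert_insert (h : a + 2 ≤ b) (ha : 0 < a) (hb : b ≤ q) :
    ybInvolution q a b (insert 1 (insert q (Finset.Icc (a + 2) (b - 1)))) =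
      Finset.Icc (a + 1) b := by
  rw [ybInvolution, if_neg (by omega), if_pos h, if_neg, if_neg, if_pos ⟨ha, hb, rfl⟩]
  · rintro ⟨h2, h1⟩
    exact finset_ne_of_mem (x := 1) (by simp) (by simp; omega) h1
  · rintro ⟨h2, h1⟩
    exact finset_ne_of_mem (x := q) (by simp) (by simp; omega) h1

theorem ybInvolution_Icc (h : a + 2 ≤ b) (ha : 0 < a) (hb : b ≤ q) :
    ybInvolution q a b (Finset.Icc (a + 1) b) =
      insert 1 (insert q (Finset.Icc (a + 2) (b - 1))) := by
  rw [ybInvolution, if_neg (by omega), if_pos h, if_neg, if_neg, if_neg, if_pos ⟨ha, hb, rfl⟩]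
  · rintro ⟨-, h2, h1⟩
    exact finset_ne_of_mem (x := 1) (by simp) (by simp; omega) h1.symm
  · rintro ⟨h2, h1⟩
    exact finset_ne_of_mem (x := q) (by simp) (by simp; omega) h1.symm
  · rintro ⟨h2, h1⟩
    exact finset_ne_of_mem (x := 1) (by simp) (by simp; omega) h1.symm

theorem ybInvolution_self : ybInvolution q a a K = K := by
  rw [ybInvolution, if_neg (by omega), if_neg (by omega)]

theorem ybInvolution_Icc_full (hq : 2 ≤ q) :
    ybInvolution q 0 q (Finset.Icc 1 q) = Finset.Icc 1 q := by
  rw [ybInvolution, if_neg (by omega), if_pos (by omega), if_neg (by omega), if_neg (by omega),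
    if_neg (by omega), if_neg (by omega)]

end Values

variable {q : ℕ}

theorem reverseParam_of_eq {A : ℤ} (h : A = q) : reverseParam q A = q := if_pos h

theorem reverseParam_of_ne {A : ℤ} (h : A ≠ q) : reverseParam q A = -A := if_neg h

section Moves

variable {a b : ℕ} {K K' : Finset ℕ} {C D : ℤ}

/-- Position `x` of the involution is index `x - 1` of the walk, so `K` is the interval from `a + 1`
to `b`. The reversed walk has ends `-a` and `reverseParam q b`; its shape, and with it the
applicable rule, depends on whether `a = 0`, `b = q` or `b = a + 1`. -/
theorem ybInvolution_eq_of_nonneg_of_nonneg (hq : 2 ≤ q) (hab : a < b) (hb : b ≤ q)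
    (hK : ∀ x : ℕ, x ∈ K ↔ 1 ≤ x ∧ x ≤ q ∧ InChain q a b (x - 1)) (hC : C = -a)
    (hD : D = reverseParam q b)
    (hK' : ∀ x : ℕ, x ∈ K' ↔ 1 ≤ x ∧ x ≤ q ∧ InChain q C D (x - 1)) :
    ybInvolution q a b K = K' := by
  subst hC hD
  simp only [inChain_nonneg_nonneg (Int.natCast_nonneg a) (Int.natCast_nonneg b)] at hK
  have e : K = Finset.Icc (a + 1) b := by
    ext x; rw [hK, Finset.mem_Icc]; omega
  by_cases h1 : b = a + 1
  · have e : K = {a + 1} := by rw [e, h1, Finset.Icc_self]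
    rw [e]
    by_cases hbq : b = q
    · rw [show a + 1 = q by omega, ybInvolution_singleton_self h1 hq]
      rw [reverseParam_of_eq (by omega)] at hK'
      simp only [inChain_neg_nonneg (show -(a : ℤ) < 0 by omega) (Int.natCast_nonneg q)] at hK'
      ext x; rw [hK', Finset.mem_singleton]; omega
    · rw [reverseParam_of_ne (by omega)] at hK'
      by_cases ha : a = 0
      · subst ha
        rw [zero_add, ybInvolution_singleton_one h1]
        simp only [inChain_nonneg_neg (show 0 ≤ -((0 : ℕ) : ℤ) by simp)
          (show -(b : ℤ) < 0 by omega)] at hK'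
        ext x; rw [hK', Finset.mem_singleton]; omega
      · rw [ybInvolution_singleton_succ h1 (by omega) (by omega)]
        simp only [inChain_neg_eq (show -(a : ℤ) < 0 by omega)
          (show -(b : ℤ) = -a - 1 by omega)] at hK'
        ext x; rw [hK', Finset.mem_singleton]; omega
  have h2 : a + 2 ≤ b := by omega
  rw [e]
  by_cases ha : a = 0
  · subst ha
    by_cases hbq : b = q
    · subst hbq
      rw [zero_add, ybInvolution_Icc_full hq]
      rw [reverseParam_of_eq rfl] at hK'
      simp only [inChain_nonneg_nonneg (show 0 ≤ -((0 : ℕ) : ℤ) by simp)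
        (Int.natCast_nonneg b)] at hK'
      ext x; rw [hK', Finset.mem_Icc]; omega
    · rw [show Finset.Icc (0 + 1) b = insert 1 (Finset.Icc (0 + 2) b) by
        ext x; simp only [Finset.mem_insert, Finset.mem_Icc]; omega,
        ybInvolution_insert_one h2 (by omega)]
      rw [reverseParam_of_ne (by omega)] at hK'
      simp only [inChain_nonneg_neg (show 0 ≤ -((0 : ℕ) : ℤ) by simp)
        (show -(b : ℤ) < 0 by omega)] at hK'
      ext x; rw [hK', Finset.mem_insert, Finset.mem_Icc]; omega
  · rw [ybInvolution_Icc h2 (by omega) hb]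
    by_cases hbq : b = q
    · rw [reverseParam_of_eq (by omega)] at hK'
      simp only [inChain_neg_nonneg (show -(a : ℤ) < 0 by omega) (Int.natCast_nonneg q)] at hK'
      ext x; rw [hK']; simp only [Finset.mem_insert, Finset.mem_Icc]; omega
    · rw [reverseParam_of_ne (by omega)] at hK'
      simp only [inChain_neg_lt (show -(a : ℤ) < 0 by omega)
        (show -(b : ℤ) < -a - 1 by omega)] at hK'
      ext x; rw [hK']; simp only [Finset.mem_insert, Finset.mem_Icc]; omega

/-- A walk that ends with the jump at `q` corresponds to one that uses position `1` first, or to the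
initial interval when `a = 0`. -/
theorem ybInvolution_eq_of_nonneg_of_neg (hq : 2 ≤ q) (hab : a < b) (hb : b < q)
    (hK : ∀ x : ℕ, x ∈ K ↔ 1 ≤ x ∧ x ≤ q ∧ InChain q a (-b) (x - 1)) (hC : C = -a) (hD : D = b)
    (hK' : ∀ x : ℕ, x ∈ K' ↔ 1 ≤ x ∧ x ≤ q ∧ InChain q C D (x - 1)) :
    ybInvolution q a b K = K' := by
  subst hC hD
  simp only [inChain_nonneg_neg (Int.natCast_nonneg a) (show -(b : ℤ) < 0 by omega)] at hK
  have e' : K' = insert 1 (Finset.Icc (a + 2) b) := by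
    by_cases ha : a = 0
    · subst ha
      simp only [inChain_nonneg_nonneg (show 0 ≤ -((0 : ℕ) : ℤ) by simp)
        (Int.natCast_nonneg b)] at hK'
      ext x; rw [hK', Finset.mem_insert, Finset.mem_Icc]; omega
    · simp only [inChain_neg_nonneg (show -(a : ℤ) < 0 by omega) (Int.natCast_nonneg b)] at hK'
      ext x; rw [hK', Finset.mem_insert, Finset.mem_Icc]; omega
  have e : K = insert q (Finset.Icc (a + 1) (b - 1)) := by
    ext x; rw [hK, Finset.mem_insert, Finset.mem_Icc]; omega
  by_cases h1 : b = a + 1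
  · have f : K = {q} := by
      rw [e, Finset.Icc_eq_empty (by omega)]; rfl
    have f' : K' = {1} := by
      rw [e', Finset.Icc_eq_empty (by omega)]; rfl
    rw [f, f', ybInvolution_singleton_self h1 hq]
  · rw [e, e', ybInvolution_insert_self (by omega) hb]

/-- The initial jump at position `1` turns into the final jump at `q`, except that for `b = q` the
end stays `q` under reversal and the reversed walk is an interval. -/
theorem ybInvolution_eq_of_neg_of_nonneg (ha : 0 < a) (hab : a < b) (hb : b ≤ q)
    (hK : ∀ x : ℕ, x ∈ K ↔ 1 ≤ x ∧ x ≤ q ∧ InChain q (-a) b (x - 1)) (hC : C = a)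
    (hD : D = reverseParam q b)
    (hK' : ∀ x : ℕ, x ∈ K' ↔ 1 ≤ x ∧ x ≤ q ∧ InChain q C D (x - 1)) :
    ybInvolution q a b K = K' := by
  subst hC hD
  simp only [inChain_neg_nonneg (show -(a : ℤ) < 0 by omega) (Int.natCast_nonneg b)] at hK
  have e : K = insert 1 (Finset.Icc (a + 2) b) := by
    ext x; rw [hK, Finset.mem_insert, Finset.mem_Icc]; omega
  by_cases hbq : b = q
  · rw [reverseParam_of_eq (by omega)] at hK'
    simp only [inChain_nonneg_nonneg (Int.natCast_nonneg a) (Int.natCast_nonneg q)] at hK'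
    have e' : K' = Finset.Icc (a + 1) b := by
      ext x; rw [hK', Finset.mem_Icc]; omega
    by_cases h1 : b = a + 1
    · rw [e, e', h1, Finset.Icc_eq_empty (by omega), Finset.Icc_self, insert_empty_eq,
        ybInvolution_singleton_one rfl, ← h1, hbq]
    · rw [e', ← ybInvolution_insert_insert (by omega) ha hb, e]
      congr 1
      ext x; simp only [Finset.mem_insert, Finset.mem_Icc]; omega
  · rw [reverseParam_of_ne (by omega)] at hK'
    simp only [inChain_nonneg_neg (Int.natCast_nonneg a) (show -(b : ℤ) < 0 by omega)] at hK'
    have e' : K' = insert q (Finset.Icc (a + 1) (b - 1)) := by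
      ext x; rw [hK', Finset.mem_insert, Finset.mem_Icc]; omega
    by_cases h1 : b = a + 1
    · rw [e, e', h1, Finset.Icc_eq_empty (by omega), Finset.Icc_eq_empty (by omega),
        insert_empty_eq, insert_empty_eq, ybInvolution_singleton_one rfl]
    · rw [e, e', ybInvolution_insert_one (by omega) (by omega)]

/-- The reversed walk has nonnegative ends and is an interval. The original one is either the single
step of the case `b = a + 1` or has jumps at both ends of the segment. -/
theorem ybInvolution_eq_of_neg_of_neg (ha : 0 < a) (hab : a < b) (hb : b < q)
    (hK : ∀ x : ℕ, x ∈ K ↔ 1 ≤ x ∧ x ≤ q ∧ InChain q (-a) (-b) (x - 1)) (hC : C = a) (hD : D = b)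
    (hK' : ∀ x : ℕ, x ∈ K' ↔ 1 ≤ x ∧ x ≤ q ∧ InChain q C D (x - 1)) :
    ybInvolution q a b K = K' := by
  subst hC hD
  simp only [inChain_nonneg_nonneg (Int.natCast_nonneg a) (Int.natCast_nonneg b)] at hK'
  have e' : K' = Finset.Icc (a + 1) b := by
    ext x; rw [hK', Finset.mem_Icc]; omega
  by_cases h1 : b = a + 1
  · simp only [inChain_neg_eq (show -(a : ℤ) < 0 by omega)
      (show -(b : ℤ) = -a - 1 by omega)] at hK
    have e : K = {q - a} := by
      ext x; rw [hK, Finset.mem_singleton]; omega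
    rw [e, e', ybInvolution_singleton_sub h1 ha hb, h1, Finset.Icc_self]
  · simp only [inChain_neg_lt (show -(a : ℤ) < 0 by omega)
      (show -(b : ℤ) < -a - 1 by omega)] at hK
    have e : K = insert 1 (insert q (Finset.Icc (a + 2) (b - 1))) := by
      ext x; rw [hK]; simp only [Finset.mem_insert, Finset.mem_Icc]; omega
    rw [e, e', ybInvolution_insert_insert (by omega) ha hb.le]

/-- The explicit form of the Yang–Baxter move. -/
theorem ybInvolution_eq {A B : ℤ} (hq : 2 ≤ q) (hA : -q < A) (hB : -q < B)
    (hB' : B ≤ q) (hAB : B = A ∨ |A| < |B|) (ha : (a : ℤ) = |A|) (hb : (b : ℤ) = |B|)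
    (hK : ∀ x : ℕ, x ∈ K ↔ 1 ≤ x ∧ x ≤ q ∧ InChain q A B (x - 1))
    (hK' : ∀ x : ℕ, x ∈ K' ↔ 1 ≤ x ∧ x ≤ q ∧
      InChain q (reverseParam q A) (reverseParam q B) (x - 1)) :
    ybInvolution q a b K = K' := by
  rcases hAB with rfl | hAB
  · obtain rfl : a = b := by omega
    rw [ybInvolution_self]
    ext x; rw [hK, hK']; simp [inChain_self]
  have hab : a < b := by omega
  rcases le_or_gt 0 A with h0 | h0 <;> rcases le_or_gt 0 B with h1 | h1
  · rw [abs_of_nonneg h0] at ha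
    rw [abs_of_nonneg h1] at hb
    subst ha hb
    exact ybInvolution_eq_of_nonneg_of_nonneg hq hab (by omega) hK
      (reverseParam_of_ne (by omega)) rfl hK'
  · rw [abs_of_nonneg h0] at ha
    rw [abs_of_neg h1, eq_neg_iff_add_eq_zero, add_comm, ← eq_neg_iff_add_eq_zero] at hb
    subst ha hb
    exact ybInvolution_eq_of_nonneg_of_neg hq hab (by omega) hK
      (reverseParam_of_ne (by omega)) (by rw [reverseParam_of_ne (by omega), neg_neg]) hK'
  · rw [abs_of_neg h0, eq_neg_iff_add_eq_zero, add_comm, ← eq_neg_iff_add_eq_zero] at ha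
    rw [abs_of_nonneg h1] at hb
    subst ha hb
    exact ybInvolution_eq_of_neg_of_nonneg (by omega) hab (by omega) hK
      (by rw [reverseParam_of_ne (by omega), neg_neg]) rfl hK'
  · rw [abs_of_neg h0, eq_neg_iff_add_eq_zero, add_comm, ← eq_neg_iff_add_eq_zero] at ha
    rw [abs_of_neg h1, eq_neg_iff_add_eq_zero, add_comm, ← eq_neg_iff_add_eq_zero] at hb
    subst ha hb
    exact ybInvolution_eq_of_neg_of_neg (by omega) hab (by omega) hK
      (by rw [reverseParam_of_ne (by omega), neg_neg])
      (by rw [reverseParam_of_ne (by omega), neg_neg]) hK'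

end Moves

end AlcovePath

/-! ### Admissible sets inside a reversed segment -/

namespace AlcovePath

section RootSystem

variable {ι V V' : Type*} [AddCommGroup V] [Module ℝ V] [AddCommGroup V'] [Module ℝ V']
  {P : RootPairing ι ℝ V V'} [Finite ι] [P.IsRootSystem] [P.IsIrreducible] {b : P.Base}
  [P.IsCrystallographic] [P.IsReduced] {S : Set ι}

namespace LambdaChain

variable {lam : V} {Γ Γ' : LambdaChain b lam} {t q : ℕ} {J J' : Finset ℕ}

theorem weylAt_eq_of_le {a k : ℕ} (hak : a ≤ k) (h0 : Γ'.weylAt J' a = Γ.weylAt J a)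
    (hr : ∀ i, a ≤ i → i < k → i ∈ J → Γ'.root i = Γ.root i)
    (hJ : ∀ i, a ≤ i → i < k → (i ∈ J' ↔ i ∈ J)) : Γ'.weylAt J' k = Γ.weylAt J k := by
  induction k, hak using Nat.le_induction with
  | base => exact h0
  | succ k hk ih =>
    have ih := ih (fun i h1 h2 => hr i h1 (by omega)) (fun i h1 h2 => hJ i h1 (by omega))
    have hJk := hJ k hk (by omega)
    by_cases h : k ∈ J
    · rw [weylAt_succ _ h, weylAt_succ _ (hJk.mpr h), ih, hr k hk (by omega) h]
    · rw [weylAt_succ_of_notMem _ h, weylAt_succ_of_notMem _ (mt hJk.mp h), ih]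

theorem affineAt_eq_of_le {a k : ℕ} (hak : a ≤ k) (h0 : Γ'.affineAt J' a = Γ.affineAt J a)
    (hr : ∀ i, a ≤ i → i < k → i ∈ J → Γ'.affineRefl i = Γ.affineRefl i)
    (hJ : ∀ i, a ≤ i → i < k → (i ∈ J' ↔ i ∈ J)) : Γ'.affineAt J' k = Γ.affineAt J k := by
  induction k, hak using Nat.le_induction with
  | base => exact h0
  | succ k hk ih =>
    have ih := ih (fun i h1 h2 => hr i h1 (by omega)) (fun i h1 h2 => hJ i h1 (by omega))
    have hJk := hJ k hk (by omega)
    by_cases h : k ∈ J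
    · rw [affineAt_succ _ h, affineAt_succ _ (hJk.mpr h), ih, hr k hk (by omega) h]
    · rw [affineAt_succ_of_notMem _ h, affineAt_succ_of_notMem _ (mt hJk.mp h), ih]

namespace IsReversal

theorem root_eq (h : Γ.IsReversal Γ' S t q) {k : ℕ} (hk : k < Γ.length) (hk' : k < t ∨ t + q ≤ k) :
    Γ'.root k = Γ.root k := by
  rw [h.2.2 k hk, if_neg (by omega)]

theorem root_add (h : Γ.IsReversal Γ' S t q) {j : ℕ} (hj : j < q) :
    Γ'.root (t + j) = Γ.root (t + (q - 1 - j)) := by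
  have := h.1.2.1
  rw [h.2.2 _ (by omega), if_pos (by omega)]
  congr 1; omega

theorem symm (h : Γ.IsReversal Γ' S t q) : Γ'.IsReversal Γ S t q := by
  have hlen := h.1.2.1
  refine ⟨⟨h.1.1, h.2.1 ▸ hlen, ?_⟩, h.2.1.symm, fun k hk => ?_⟩
  · have hroot : ∀ k ∈ Set.Ico t (t + q), Γ'.root k = Γ.root (2 * t + q - 1 - k) := by
      intro k hk
      rw [h.2.2 k (hk.2.trans_le hlen), if_pos ⟨hk.1, hk.2⟩]
    have hbij : Set.BijOn (fun k => 2 * t + q - 1 - k) (Set.Ico t (t + q)) (Set.Ico t (t + q)) := by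
      refine ⟨fun k hk => ?_, fun k hk l hl hkl => ?_, fun k hk => ⟨2 * t + q - 1 - k, ?_, ?_⟩⟩ <;>
      simp only [Set.mem_Ico] at * <;> omega
    exact ((h.1.2.2.comp hbij).congr fun k hk => (hroot k hk).symm)
  · rw [h.2.1] at hk
    split_ifs with hseg
    · rw [h.2.2 _ (by omega), if_pos (by omega)]
      congr 1; omega
    · rw [h.root_eq hk (by omega)]

theorem segmentRoot_eq (h : Γ.IsReversal Γ' S t q) (m : ℤ) :
    Γ'.segmentRoot t q m = Γ.segmentRoot t q (q - 1 - m) := by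
  have hq := h.1.two_le
  have hadd : ∀ (Γ : LambdaChain b lam) m,
      Γ.segmentRoot t q (m + q) = negRoot P (Γ.segmentRoot t q m) :=
    fun Γ m => cyclicRoot_add (by omega) m
  revert m
  refine forall_of_periodic (q := q) (by omega) (fun m => ?_) (a := 0) fun m h0 hm => ?_
  · rw [hadd, show (q : ℤ) - 1 - m = q - 1 - (m + q) + q by ring, hadd]
    constructor
    · intro h
      rw [← negRoot_negRoot (P := P) (Γ'.segmentRoot t q m), h]
    · intro h
      rw [h, negRoot_negRoot]
  · obtain ⟨j, rfl⟩ := Int.eq_ofNat_of_zero_le h0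
    rw [segmentRoot_natCast (by omega), h.root_add (by omega),
      ← segmentRoot_natCast (show q - 1 - j < q by omega)]
    congr 1; omega

/-- Reversal replaces `β m` by `β (q - 1 - m)`, so the window starting at `A` becomes the one
starting at `-A`. In the normalized range from `-q` (excluded) to `q`, the value `-q` is represented
by `q`. -/
theorem hasParam (hlam : IsDominantWeight b lam) (h : Γ.IsReversal Γ' S t q) {x : P.weylGroup}
    {A : ℤ} (hx : HasParam b q (Γ.segmentRoot t q) x A) :
    HasParam b q (Γ'.segmentRoot t q) x (reverseParam q A) := by
  have key : HasParam b q (Γ'.segmentRoot t q) x (-A) := by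
    intro m h1 h2
    rw [h.segmentRoot_eq]
    exact hx _ (by omega) (by omega)
  by_cases hA : A = q
  · have := (h.symm.1.dihedralRoots hlam).1.hasParam_add key
    rw [reverseParam_of_eq hA]
    rwa [hA, show -(q : ℤ) + 2 * q = q by ring] at this
  · rwa [reverseParam_of_ne hA]

end IsReversal

/-- The elements of `J` in the segment, numbered from `0`. -/
def inSegment (t q : ℕ) (J : Finset ℕ) : Finset ℕ := (Finset.range q).filter fun j => t + j ∈ J

theorem mem_inSegment {j : ℕ} : j ∈ inSegment t q J ↔ j < q ∧ t + j ∈ J := by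
  simp [inSegment]

namespace IsDihedralSegment

theorem refl_segmentRoot_mem {j : ℕ} (hj : j < q) : refl P (Γ.root (t + j)) ∈
      reflectionSubgroup P (Set.range (Γ.segmentRoot t q)) := by
  rw [← segmentRoot_natCast hj]
  exact DihedralRoots.refl_mem j

theorem inv_mul_weylAt_mem {j : ℕ} (hj : j ≤ q) : (Γ.weylAt J t)⁻¹ * Γ.weylAt J (t + j) ∈
      reflectionSubgroup P (Set.range (Γ.segmentRoot t q)) := by
  induction j with
  | zero => simp
  | succ j ih =>
    by_cases hJ : t + j ∈ J
    · rw [← add_assoc, weylAt_succ _ hJ, ← mul_assoc]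
      exact mul_mem (ih (by omega)) (refl_segmentRoot_mem (by omega))
    · rw [← add_assoc, weylAt_succ_of_notMem _ hJ]
      exact ih (by omega)

theorem hasParam_weylAt (hlam : IsDominantWeight b lam) (h : Γ.IsDihedralSegment S t q) {A : ℤ}
    (hA : HasParam b q (Γ.segmentRoot t q) (Γ.weylAt J t) A) {j : ℕ} (hj : j ≤ q) :
    HasParam b q (Γ.segmentRoot t q) (Γ.weylAt J (t + j))
      (dihedralWalk q (inSegment t q J) A j) := by
  induction j with
  | zero => exact hA
  | succ j ih =>
    have ih := ih (by omega)
    by_cases hJ : t + j ∈ J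
    · rw [← add_assoc, weylAt_succ _ hJ, dihedralWalk_succ (mem_inSegment.mpr ⟨by omega, hJ⟩),
        ← segmentRoot_natCast (show j < q by omega)]
      exact (h.dihedralRoots hlam).1.hasParam_step ih j
    · rw [← add_assoc, weylAt_succ_of_notMem _ hJ,
        dihedralWalk_succ_of_notMem (fun h => hJ (mem_inSegment.mp h).2)]
      exact ih

theorem abs_dihedralWalk_le {K : Finset ℕ} {A : ℤ} (hA : |A| ≤ q) {j : ℕ} (hj : j ≤ q) :
    |dihedralWalk q K A j| ≤ q := by
  induction j with
  | zero => exact hA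
  | succ j ih =>
    have ih := ih (by omega)
    by_cases hJ : j ∈ K
    · rw [dihedralWalk_succ hJ]
      exact DihedralRoots.abs_dihedralStep_le ih (by omega) (by omega)
    · rwa [dihedralWalk_succ_of_notMem hJ]

theorem isGoodWalk (hlam : IsDominantWeight b lam) (h : Γ.IsDihedralSegment S t q)
    (hJ : Γ.IsAdmissible J) {A : ℤ} (hA : HasParam b q (Γ.segmentRoot t q) (Γ.weylAt J t) A)
    (hA' : |A| ≤ q) : IsGoodWalk q (inSegment t q J) A := by
  intro j hj
  have hm := mem_inSegment.mp hj
  refine ⟨hm.1, ?_⟩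
  rw [dihedralWalk_succ hj]
  refine (h.dihedralRoots hlam).1.abs_step_of_covers (h.hasParam_weylAt hlam hA hm.1.le)
    (abs_dihedralWalk_le hA' hm.1.le) (by omega) (by omega) ?_
  rw [segmentRoot_natCast hm.1]
  exact weylLength_weylAt _ hJ hm.2

/-- The part of an admissible subset in the segment is determined by the ends of its walk. -/
theorem inSegment_eq (hlam : IsDominantWeight b lam) (h : Γ.IsDihedralSegment S t q)
    {K : Finset ℕ} (hJ : Γ.IsAdmissible J) (hK : Γ.IsAdmissible K)
    (h0 : Γ.weylAt J t = Γ.weylAt K t) (h1 : Γ.weylAt J (t + q) = Γ.weylAt K (t + q)) :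
    inSegment t q J = inSegment t q K := by
  have hd := (h.dihedralRoots hlam).1
  obtain ⟨A, hA1, hA2, hA⟩ := hd.exists_hasParam (Γ.weylAt J t)
  have hAq : |A| ≤ q := abs_le.mpr ⟨hA1.le, hA2⟩
  have hAK := h0 ▸ hA
  obtain ⟨⟨b1, b2, b3⟩, b4⟩ := (h.isGoodWalk hlam hJ hA hAq).mem_iff hA1 hA2
  obtain ⟨⟨c1, c2, c3⟩, c4⟩ := (h.isGoodWalk hlam hK hAK hAq).mem_iff hA1 hA2
  have e := hd.hasParam_unique' (h.hasParam_weylAt hlam hA le_rfl)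
    (h1 ▸ h.hasParam_weylAt hlam hAK le_rfl) (abs_le.mpr ⟨b1.le, b2⟩) (abs_le.mpr ⟨c1.le, c2⟩)
  -- The ambiguity between `q` and `-q` disappears because good walks end strictly above `-q`.
  have e : dihedralWalk q (inSegment t q J) A q = dihedralWalk q (inSegment t q K) A q := by
    rcases e with e | ⟨e1, e2⟩
    · exact e
    · rcases (abs_eq (by omega)).mp e1 with e1 | e1 <;> omega
  ext i
  rw [b4, c4, e]

end IsDihedralSegment

/-- The subsets `J` and `J'` agree outside the segment and have the same product up to the end of
the segment. -/
structure AgreeOutside (Γ Γ' : LambdaChain b lam) (t q : ℕ) (J J' : Finset ℕ) : Prop where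
  mem_iff : ∀ i, i < t ∨ t + q ≤ i → (i ∈ J' ↔ i ∈ J)
  weylAt_eq : Γ'.weylAt J' (t + q) = Γ.weylAt J (t + q)

theorem AgreeOutside.symm (h : AgreeOutside Γ Γ' t q J J') : AgreeOutside Γ' Γ t q J' J :=
  ⟨fun i hi => (h.mem_iff i hi).symm, h.weylAt_eq.symm⟩

namespace IsReversal

theorem weylAt_eq_of_le (h : Γ.IsReversal Γ' S t q) (hJ : ∀ i < t, i ∈ J' ↔ i ∈ J) {k : ℕ}
    (hk : k ≤ t) : Γ'.weylAt J' k = Γ.weylAt J k := by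
  have := h.1.2.1
  have hq := h.1.two_le
  refine LambdaChain.weylAt_eq_of_le (Nat.zero_le k) (by rw [weylAt_zero, weylAt_zero])
    (fun i _ hi _ => h.root_eq (by omega) (by omega)) fun i _ hi => hJ i (by omega)

theorem weylAt_eq_of_ge (h : Γ.IsReversal Γ' S t q) (hJ : ∀ j ∈ J, j < Γ.length)
    (hJJ : AgreeOutside Γ Γ' t q J J') {k : ℕ} (hk : t + q ≤ k) :
    Γ'.weylAt J' k = Γ.weylAt J k :=
  LambdaChain.weylAt_eq_of_le hk hJJ.weylAt_eq
    (fun i hi _ hJ' => h.root_eq (hJ i hJ') (Or.inr hi)) fun i hi _ => hJJ.mem_iff i (Or.inr hi)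

/-- The ends of the walk through the segment determine the folds used in it. Once admissibility is
known, this characterization replaces the explicit formula of the move. -/
theorem agreeOutside_unique (hlam : IsDominantWeight b lam) (h : Γ.IsReversal Γ' S t q)
    {K : Finset ℕ} (hJ : Γ'.IsAdmissible J') (hK : Γ'.IsAdmissible K)
    (hJJ : AgreeOutside Γ Γ' t q J J') (hJK : AgreeOutside Γ Γ' t q J K) : J' = K := by
  have hmem : ∀ i, i < t ∨ t + q ≤ i → (i ∈ J' ↔ i ∈ K) := fun i hi =>
    (hJJ.mem_iff i hi).trans (hJK.mem_iff i hi).symm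
  have e := h.symm.1.inSegment_eq hlam hJ hK
    (weylAt_congr _ fun i hi => hmem i (Or.inl hi)) (hJJ.weylAt_eq.trans hJK.weylAt_eq.symm)
  ext i
  by_cases hi : i < t ∨ t + q ≤ i
  · exact hmem i hi
  · have := Finset.ext_iff.mp e (i - t)
    rw [mem_inSegment, mem_inSegment, Nat.add_sub_cancel' (by omega)] at this
    simpa [show i - t < q by omega] using this

end IsReversal

end LambdaChain

end RootSystem

end AlcovePath

/-! ### Yang–Baxter moves preserve admissibility -/

namespace AlcovePath

section RootSystem

variable {ι V V' : Type*} [AddCommGroup V] [Module ℝ V] [AddCommGroup V'] [Module ℝ V']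
  {P : RootPairing ι ℝ V V'} [Finite ι] [P.IsRootSystem] [P.IsIrreducible] {b : P.Base}
  [P.IsCrystallographic] [P.IsReduced] {S : Set ι}

theorem abs_reverseParam {q : ℕ} (A : ℤ) : |reverseParam q A| = |A| := by
  unfold reverseParam
  split_ifs with h
  · rw [h]
  · exact abs_neg A

theorem reverseParam_mem {q : ℕ} {A : ℤ} (h : -q < A) (h' : A ≤ q) :
    -q < reverseParam q A ∧ reverseParam q A ≤ q := by
  unfold reverseParam
  split_ifs <;> omega

namespace LambdaChain

variable {lam : V} {Γ Γ' : LambdaChain b lam} {t q : ℕ} {J J' : Finset ℕ}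

namespace IsDihedralSegment

/-- The length of `weylAt` and the absolute value of the parameter grow at the same rate. -/
theorem weylLength_weylAt_add (hJ : Γ.IsAdmissible J) {A : ℤ}
    (hw : IsGoodWalk q (inSegment t q J) A) {j : ℕ} (hj : j ≤ q) :
    (weylLength b (Γ.weylAt J (t + j)) : ℤ) - |dihedralWalk q (inSegment t q J) A j| =
      weylLength b (Γ.weylAt J t) - |A| := by
  induction j with
  | zero => rfl
  | succ j ih =>
    have ih := ih (by omega)
    by_cases hm : t + j ∈ J
    · have := weylLength_weylAt _ hJ hm
      rw [← weylAt_succ _ hm] at this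
      have h2 := (hw j (mem_inSegment.mpr ⟨by omega, hm⟩)).2
      rw [← add_assoc, this, h2]
      push_cast
      omega
    · rw [← add_assoc, weylAt_succ_of_notMem _ hm,
        dihedralWalk_succ_of_notMem fun h => hm (mem_inSegment.mp h).2]
      exact ih

theorem weylLength_weylAt_lt (hlam : IsDominantWeight b lam) (h : Γ.IsDihedralSegment S t q)
    {A : ℤ} (hA : HasParam b q (Γ.segmentRoot t q) (Γ.weylAt J t) A) (hA' : |A| ≤ q)
    (hw : IsGoodWalk q (inSegment t q J) A) {j : ℕ} (hj : j < q) (hm : t + j ∈ J) :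
    weylLength b (Γ.weylAt J (t + j)) < weylLength b (Γ.weylAt J (t + j + 1)) := by
  rw [weylAt_succ _ hm, ← segmentRoot_natCast hj,
    (h.dihedralRoots hlam).1.weylLength_lt_iff (h.hasParam_weylAt hlam hA hj.le)
      (abs_dihedralWalk_le hA' hj.le) (by omega) (by omega)]
  have hm := mem_inSegment.mpr ⟨hj, hm⟩
  have := (hw j hm).2
  rw [dihedralWalk_succ hm] at this
  omega

/-- If the length grows along a segment as fast as the parameter, each step is a cover. -/
theorem weylLength_weylAt_succ (hlam : IsDominantWeight b lam) (h : Γ.IsDihedralSegment S t q)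
    {A : ℤ} (hA : HasParam b q (Γ.segmentRoot t q) (Γ.weylAt J t) A) (hA' : |A| ≤ q)
    (hw : IsGoodWalk q (inSegment t q J) A)
    (htotal : (weylLength b (Γ.weylAt J (t + q)) : ℤ) - |dihedralWalk q (inSegment t q J) A q| =
      weylLength b (Γ.weylAt J t) - |A|) {j : ℕ} (hj : j < q) (hm : t + j ∈ J) :
    weylLength b (Γ.weylAt J (t + j + 1)) = weylLength b (Γ.weylAt J (t + j)) + 1 := by
  -- Each fold raises the parameter's absolute value by exactly one and the length by at least one,
  -- so the difference `f` never decreases. Equal values at the two ends make it constant, and every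
  -- fold is a cover.
  set f : ℕ → ℤ := fun j => (weylLength b (Γ.weylAt J (t + j)) : ℤ) -
    |dihedralWalk q (inSegment t q J) A j| with hf
  have hstep : ∀ j < q, f j ≤ f (j + 1) := by
    intro j hj
    simp only [hf]
    rw [← add_assoc]
    by_cases hm : t + j ∈ J
    · have := h.weylLength_weylAt_lt hlam hA hA' hw hj hm
      have h2 := (hw j (mem_inSegment.mpr ⟨hj, hm⟩)).2
      omega
    · rw [weylAt_succ_of_notMem _ hm,
        dihedralWalk_succ_of_notMem fun h => hm (mem_inSegment.mp h).2]
  have hmono : ∀ i k, i ≤ k → k ≤ q → f i ≤ f k := by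
    intro i k hik hk
    induction k, hik using Nat.le_induction with
    | base => rfl
    | succ k hik ih => exact (ih (by omega)).trans (hstep k (by omega))
  have h0 : f q = f 0 := htotal
  have h1 := hmono 0 j (by omega) (by omega)
  have h2 := hmono (j + 1) q (by omega) le_rfl
  have h3 := hstep j hj
  have h4 := (hw j (mem_inSegment.mpr ⟨hj, hm⟩)).2
  have h5 : f (j + 1) = f j := by omega
  simp only [hf, ← add_assoc] at h5
  omega

end IsDihedralSegment

namespace IsReversal

/-- The good walk with reversed ends exists since reversal preserves absolute values. It leads to
the same element after the segment, so the lengths at both ends are unchanged, and the comparison of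
length with parameter shows that its steps are covers. -/
theorem isAdmissible_of_inSegment (hlam : IsDominantWeight b lam) (h : Γ.IsReversal Γ' S t q)
    (hJ : Γ.IsAdmissible J) {A : ℤ} (hA1 : -q < A) (hA2 : A ≤ q)
    (hA : HasParam b q (Γ.segmentRoot t q) (Γ.weylAt J t) A)
    (hout : ∀ i, i < t ∨ t + q ≤ i → (i ∈ J' ↔ i ∈ J))
    (hin : ∀ j : ℕ, j ∈ inSegment t q J' ↔ j < q ∧ InChain q (reverseParam q A)
      (reverseParam q (dihedralWalk q (inSegment t q J) A q)) j) :
    Γ'.IsAdmissible J' ∧ AgreeOutside Γ Γ' t q J J' := by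
  have hlen := h.1.2.1
  have hAq : |A| ≤ q := abs_le.mpr ⟨hA1.le, hA2⟩
  have hw := h.1.isGoodWalk hlam hJ hA hAq
  obtain ⟨⟨hB1, hB2, hAB⟩, -⟩ := hw.mem_iff hA1 hA2
  have htotal := IsDihedralSegment.weylLength_weylAt_add hJ hw le_rfl
  have hB := h.1.hasParam_weylAt hlam hA le_rfl
  set B := dihedralWalk q (inSegment t q J) A q
  obtain ⟨hA1', hA2'⟩ := reverseParam_mem hA1 hA2
  obtain ⟨hB1', hB2'⟩ := reverseParam_mem hB1 hB2
  obtain ⟨hw', hend⟩ := isGoodWalk_of_inChain hA1' hA2' hB1' hB2'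
    (by rw [abs_reverseParam, abs_reverseParam]; exact hAB.imp (congrArg _) id) hin
  have ht : ∀ k ≤ t, Γ'.weylAt J' k = Γ.weylAt J k := fun k hk =>
    h.weylAt_eq_of_le (fun i hi => hout i (Or.inl hi)) hk
  have hd' := (h.symm.1.dihedralRoots hlam)
  have hA' : HasParam b q (Γ'.segmentRoot t q) (Γ'.weylAt J' t) (reverseParam q A) := by
    rw [ht t le_rfl]; exact h.hasParam hlam hA
  have hAq' : |reverseParam q A| ≤ q := by rwa [abs_reverseParam]
  have hB' := h.symm.1.hasParam_weylAt hlam hA' le_rfl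
  rw [hend] at hB'
  -- Both products lie in the same coset of the dihedral group and have the same parameter.
  have hweyl : Γ'.weylAt J' (t + q) = Γ.weylAt J (t + q) := by
    have hmem : (Γ.weylAt J (t + q))⁻¹ * Γ'.weylAt J' (t + q) ∈
        reflectionSubgroup P (Set.range (Γ'.segmentRoot t q)) := by
      have h1 := IsDihedralSegment.inv_mul_weylAt_mem (Γ := Γ) (J := J) (t := t) (q := q) le_rfl
      have h2 := IsDihedralSegment.inv_mul_weylAt_mem (Γ := Γ') (J := J') (t := t) (q := q) le_rfl
      rw [(h.1.dihedralRoots hlam).2, ← hd'.2] at h1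
      rw [ht t le_rfl] at h2
      have := mul_mem (inv_mem h1) h2
      rwa [mul_inv_rev, inv_inv, mul_assoc, mul_inv_cancel_left] at this
    have := hd'.1.eq_one_of_hasParam hmem (h.hasParam hlam hB)
      (by rwa [mul_inv_cancel_left])
    exact (inv_mul_eq_one.mp this).symm
  have hagree : AgreeOutside Γ Γ' t q J J' := ⟨hout, hweyl⟩
  have htotal' : (weylLength b (Γ'.weylAt J' (t + q)) : ℤ) -
      |dihedralWalk q (inSegment t q J') (reverseParam q A) q| =
      weylLength b (Γ'.weylAt J' t) - |reverseParam q A| := by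
    rw [hend, hweyl, ht t le_rfl, abs_reverseParam, abs_reverseParam]
    exact htotal
  have hlt : ∀ j ∈ J', j < Γ'.length := by
    intro j hj
    by_cases hjt : j < t ∨ t + q ≤ j
    · rw [h.2.1]
      exact hJ.1 j ((hout j hjt).mp hj)
    · rw [h.2.1]; omega
  refine ⟨(Γ'.isAdmissible_iff).mpr ⟨hlt, fun j hj => ⟨⟨Γ'.root j,
    Γ'.isPos_root hlam (hlt j hj), weylAt_succ _ hj⟩, ?_⟩⟩, hagree⟩
  by_cases hjt : j < t
  · rw [ht _ (by omega), ht _ hjt.le]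
    exact ((Γ.isAdmissible_iff.mp hJ).2 j ((hout j (Or.inl hjt)).mp hj)).2
  by_cases hjq : t + q ≤ j
  · rw [h.weylAt_eq_of_ge hJ.1 hagree hjq, h.weylAt_eq_of_ge hJ.1 hagree (by omega)]
    exact ((Γ.isAdmissible_iff.mp hJ).2 j ((hout j (Or.inr hjq)).mp hj)).2
  obtain ⟨i, rfl⟩ := Nat.exists_eq_add_of_le (not_lt.mp hjt)
  exact h.symm.1.weylLength_weylAt_succ hlam hA' hAq' hw' htotal' (by omega) hj

/-- The Yang–Baxter move maps admissible subsets to admissible subsets. -/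
theorem yangBaxter_spec (hlam : IsDominantWeight b lam) (h : Γ.IsReversal Γ' S t q)
    (hJ : Γ.IsAdmissible J) :
    Γ'.IsAdmissible (Γ.yangBaxter S t q J) ∧ AgreeOutside Γ Γ' t q J (Γ.yangBaxter S t q J) := by
  have hq := h.1.two_le
  obtain ⟨A, hA1, hA2, hA⟩ := (h.1.dihedralRoots hlam).1.exists_hasParam (Γ.weylAt J t)
  have hAq : |A| ≤ q := abs_le.mpr ⟨hA1.le, hA2⟩
  have hw := h.1.isGoodWalk hlam hJ hA hAq
  obtain ⟨⟨hB1, hB2, hAB⟩, hK⟩ := hw.mem_iff hA1 hA2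
  have hB := h.1.hasParam_weylAt hlam hA le_rfl
  have ha := h.1.dihedralLength_eq hlam hA hAq
  have hb := h.1.dihedralLength_eq hlam hB (abs_le.mpr ⟨hB1.le, hB2⟩)
  set B := dihedralWalk q (inSegment t q J) A q with hBdef
  classical
  -- The formula for the move selects precisely the walk with reversed end parameters; the shift by
  -- one reflects the numbering of the segment from `1`.
  have hmoved : ybInvolution q (Γ.dihedralLength S t q (Γ.weylAt J t))
      (Γ.dihedralLength S t q (Γ.weylAt J (t + q)))
      ((J.filter fun j => t ≤ j ∧ j < t + q).image fun j => j - t + 1) =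
      (Finset.Icc 1 q).filter fun x : ℕ =>
        InChain q (reverseParam q A) (reverseParam q B) ((x : ℤ) - 1) := by
    refine ybInvolution_eq hq hA1 hB1 hB2 hAB ha hb (fun x => ?_) fun x => ?_
    · simp only [Finset.mem_image, Finset.mem_filter]
      constructor
      · rintro ⟨j, ⟨hj, h1, h2⟩, rfl⟩
        have := (hK (j - t)).mp
          (mem_inSegment.mpr ⟨by omega, by rwa [Nat.add_sub_cancel' h1]⟩)
        refine ⟨by omega, by omega, ?_⟩
        convert this.2 using 1
        push_cast; ring
      · rintro ⟨h1, h2, h3⟩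
        have := mem_inSegment.mp ((hK (x - 1)).mpr ⟨by omega, by
          convert h3 using 1
          omega⟩)
        exact ⟨t + (x - 1), ⟨this.2, by omega, by omega⟩, by omega⟩
    · simp only [Finset.mem_filter, Finset.mem_Icc, and_assoc]
  have hyb : Γ.yangBaxter S t q J = (J.filter fun j => ¬ (t ≤ j ∧ j < t + q)) ∪
      ((Finset.Icc 1 q).filter fun x : ℕ =>
        InChain q (reverseParam q A) (reverseParam q B) ((x : ℤ) - 1)).image
          fun k => t + k - 1 := by
    rw [← hmoved]; rfl
  refine h.isAdmissible_of_inSegment hlam hJ hA1 hA2 hA (fun i hi => ?_) fun j => ?_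
  · rw [hyb]
    simp only [Finset.mem_union, Finset.mem_filter, Finset.mem_image, Finset.mem_Icc]
    constructor
    · rintro (h1 | ⟨k, ⟨⟨h1, h2⟩, -⟩, h3⟩)
      · exact h1.1
      · omega
    · exact fun h1 => Or.inl ⟨h1, by omega⟩
  · rw [mem_inSegment, hyb]
    simp only [Finset.mem_union, Finset.mem_filter, Finset.mem_image, Finset.mem_Icc]
    refine and_congr_right fun hj => ⟨?_, fun h1 => Or.inr ⟨j + 1, ⟨by omega, ?_⟩, by omega⟩⟩
    · rintro (h1 | ⟨k, ⟨⟨h1, h2⟩, h3⟩, h4⟩)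
      · omega
      · convert h3 using 1
        omega
    · simpa using h1

end IsReversal

end LambdaChain

end RootSystem

end AlcovePath

/-! ### Maximal contacts and dihedral segments -/

namespace AlcovePath

section Transfer

variable {n t q k m : ℕ} {C C' : ℕ → Prop} {e e' : ℕ → ℤ} {L : ℤ}

theorem exists_first_mem {u : ℕ} (h : ∃ i, t ≤ i ∧ i < u ∧ C i) :
    ∃ i, t ≤ i ∧ i < u ∧ C i ∧ ∀ j, t ≤ j → j < i → ¬ C j := by
  classical
  obtain ⟨h1, h2, h3⟩ := Nat.find_spec h
  exact ⟨_, h1, h2, h3, fun j hj hj' hC => Nat.find_min h hj' ⟨hj, hj'.trans h2, hC⟩⟩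

theorem exists_last_mem {u : ℕ} (h : ∃ i, t ≤ i ∧ i < u ∧ C i) :
    ∃ i, t ≤ i ∧ i < u ∧ C i ∧ ∀ j, i < j → j < u → ¬ C j := by
  induction u with
  | zero => obtain ⟨i, -, hi, -⟩ := h; omega
  | succ u ih =>
    by_cases hu : t ≤ u ∧ C u
    · exact ⟨u, hu.1, by omega, hu.2, fun j h1 h2 => by omega⟩
    · obtain ⟨i, h1, h2, h3⟩ := h
      have hiu : i ≠ u := by rintro rfl; exact hu ⟨h1, h3⟩
      obtain ⟨i, h1, h2, h3, h4⟩ := ih ⟨i, h1, by omega, h3⟩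
      refine ⟨i, h1, by omega, h3, fun j h5 h6 hC => ?_⟩
      rcases Nat.lt_succ_iff_lt_or_eq.mp h6 with h6 | rfl
      exacts [h4 j h5 h6 hC, hu ⟨by omega, hC⟩]

/-- The positions determined by two height functions that agree outside a segment correspond to
each other, if the contacts in the segment all have the same height. -/
theorem LowersAt.transfer (h : LowersAt n C e k m) (hn : t + q ≤ n) (hlt : ∀ i, C i → i < n)
    (hC : ∀ i, i < t ∨ t + q ≤ i → (C' i ↔ C i)) (he : ∀ i ≤ n, i < t ∨ t + q ≤ i → e' i = e i)
    (hL : ∀ i, t ≤ i → i < t + q → C i → e i = L) (hL' : ∀ i, t ≤ i → i < t + q → C' i → e' i = L)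
    (hk : e k = e m - 1)
    (hcase : ((∃ i, t ≤ i ∧ i < t + q ∧ C i) ∧ ∃ i, t ≤ i ∧ i < t + q ∧ C' i) ∨
      ((∃ i < t, C i ∧ L < e i) ∧ ¬ (k < t ∧ t ≤ m)) ∨
      ((∀ i, t ≤ i → i < t + q → ¬ C i) ∧ ∀ i, t ≤ i → i < t + q → ¬ C' i)) :
    ∃ k' m', LowersAt n C' e' k' m' ∧ (k' = k ∨ t ≤ k ∧ k < t + q ∧ t ≤ k' ∧ k' < t + q) ∧
      (m' = m ∨ t ≤ m ∧ m < t + q ∧ t ≤ m' ∧ m' < t + q) := by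
  obtain ⟨h0, ⟨hCk, hkm, hm, hb⟩, hmax, hmaxn, hfirst⟩ := h
  have hmn : m ≤ n := by
    rcases hm with hm | rfl
    exacts [(hlt m hm).le, le_rfl]
  have hen : e' n = e n := he n le_rfl (Or.inr hn)
  have hout : ∀ i, i < t ∨ t + q ≤ i → C' i → C i ∧ e' i = e i := fun i hi hCi =>
    ⟨(hC i hi).mp hCi, he i (hlt i ((hC i hi).mp hCi)).le hi⟩
  have hmax' : L ≤ e m ∨ (∀ i, t ≤ i → i < t + q → ¬ C' i) → ∀ i, C' i → e' i ≤ e m := by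
    intro hLm i hCi
    by_cases hi : i < t ∨ t + q ≤ i
    · rw [(hout i hi hCi).2]; exact hmax i (hout i hi hCi).1
    · rw [hL' i (by omega) (by omega) hCi]
      exact hLm.resolve_right fun h => h i (by omega) (by omega) hCi
  have hfirst' : (t ≤ m → m < t + q → False) → (t ≤ m → L < e m ∨
      (∀ i, t ≤ i → i < t + q → ¬ C' i)) → ∀ i, C' i → i < m → e' i < e m := by
    intro h1 hLm i hCi him
    by_cases hi : i < t ∨ t + q ≤ i
    · rw [(hout i hi hCi).2]; exact hfirst i (hout i hi hCi).1 him
    · rw [hL' i (by omega) (by omega) hCi]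
      exact (hLm (by omega)).resolve_right fun h => h i (by omega) (by omega) hCi
  have same : (k < t ∨ t + q ≤ k) → (m < t ∨ t + q ≤ m) →
      (L ≤ e m ∨ ∀ i, t ≤ i → i < t + q → ¬ C' i) →
      (t ≤ m → L < e m ∨ ∀ i, t ≤ i → i < t + q → ¬ C' i) →
      (∀ i, k < i → i < m → t ≤ i → i < t + q → ¬ C' i) → LowersAt n C' e' k m := by
    intro hk1 hm1 h1 h2 h3
    rw [LowersAt, he m hmn hm1, hen]
    refine ⟨h0, ⟨(hC k hk1).mpr hCk, hkm, hm.imp_left (hC m hm1).mpr, fun i h4 h5 hCi => ?_⟩,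
      hmax' h1, hmaxn, hfirst' (by omega) h2⟩
    by_cases hi : i < t ∨ t + q ≤ i
    · exact hb i h4 h5 (hout i hi hCi).1
    · exact h3 i h4 h5 (by omega) (by omega) hCi
  -- If both walks have contacts in the segment, at most one of `k`, `m` lies in it, since their
  -- heights differ by one; an `m` there is replaced by the first and a `k` by the last contact of
  -- the other walk. If an earlier contact exceeds the level `L`, then neither lies in the segment
  -- nor is the segment enclosed between them. If there are no contacts in the segment, nothing
  -- changes.
  rcases hcase with ⟨⟨c, hc1, hc2, hc3⟩, hc'⟩ | ⟨⟨c, hc1, hc2, hc3⟩, hkm'⟩ | ⟨hno, hno'⟩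
  · have hLm : L ≤ e m := hL c hc1 hc2 hc3 ▸ hmax c hc3
    by_cases hmt : m < t
    · exact ⟨k, m, same (by omega) (by omega) (Or.inl hLm) (by omega) (by omega), Or.inl rfl,
        Or.inl rfl⟩
    by_cases hmq : m < t + q
    · have hCm : C m := hm.resolve_right (by omega)
      have hmL := hL m (by omega) hmq hCm
      have hkt : k < t := by
        by_contra hkt
        have := hL k (by omega) (by omega) hCk
        omega
      obtain ⟨m', h1, h2, h3, h4⟩ := exists_first_mem hc'
      refine ⟨k, m', ?_, Or.inl rfl, Or.inr ⟨by omega, hmq, h1, h2⟩⟩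
      rw [LowersAt, hL' m' h1 h2 h3, ← hmL, hen]
      refine ⟨h0, ⟨(hC k (by omega)).mpr hCk, by omega, Or.inl h3, fun i h5 h6 hCi => ?_⟩,
        hmax' (Or.inl hLm), hmaxn, fun i hCi him => ?_⟩
      · by_cases hi : i < t
        · exact hb i h5 (by omega) (hout i (by omega) hCi).1
        · exact h4 i (by omega) h6 hCi
      · have hi : i < t := by
          by_contra hi
          exact h4 i (by omega) him hCi
        rw [(hout i (Or.inl hi) hCi).2]
        exact hfirst i (hout i (Or.inl hi) hCi).1 (by omega)
    · have hLm' : L < e m := hL c hc1 hc2 hc3 ▸ hfirst c hc3 (by omega)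
      by_cases hkq : t + q ≤ k
      · exact ⟨k, m, same (by omega) (by omega) (Or.inl hLm) (fun _ => Or.inl hLm') (by omega),
          Or.inl rfl, Or.inl rfl⟩
      · have hkt : t ≤ k := by
          by_contra hkt
          exact hb c (by omega) (by omega) hc3
        obtain ⟨k', h1, h2, h3, h4⟩ := exists_last_mem hc'
        refine ⟨k', m, ?_, Or.inr ⟨hkt, by omega, h1, h2⟩, Or.inl rfl⟩
        rw [LowersAt, he m hmn (by omega), hen]
        refine ⟨h0, ⟨h3, by omega, hm.imp_left (hC m (by omega)).mpr, fun i h5 h6 hCi => ?_⟩,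
          hmax' (Or.inl hLm), hmaxn, hfirst' (by omega) fun _ => Or.inl hLm'⟩
        by_cases hi : i < t + q
        · exact h4 i h5 hi hCi
        · exact hb i (by omega) h6 (hout i (by omega) hCi).1
  · have hLm : L < e m := hc3.trans_le (hmax c hc2)
    have hmseg : m < t ∨ t + q ≤ m := by
      by_contra hmseg
      have := hL m (by omega) (by omega) (hm.resolve_right (by omega))
      omega
    have hkseg : k < t ∨ t + q ≤ k := by
      by_contra hkseg
      have h1 := hL k (by omega) (by omega) hCk
      have h2 := hfirst c hc2 (by omega)
      omega
    exact ⟨k, m, same hkseg hmseg (Or.inl hLm.le) (fun _ => Or.inl hLm) (by omega), Or.inl rfl,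
      Or.inl rfl⟩
  · have hkseg : k < t ∨ t + q ≤ k := by
      by_contra hkseg
      exact hno k (by omega) (by omega) hCk
    have hmseg : m < t ∨ t + q ≤ m := by
      by_contra hmseg
      exact hno m (by omega) (by omega) (hm.resolve_right (by omega))
    exact ⟨k, m, same hkseg hmseg (Or.inr hno') (fun _ => Or.inr hno') fun i _ _ => hno' i,
      Or.inl rfl, Or.inl rfl⟩

end Transfer

section RootSystem

variable {ι V V' : Type*} [AddCommGroup V] [Module ℝ V] [AddCommGroup V'] [Module ℝ V']
  {P : RootPairing ι ℝ V V'} [Finite ι] [P.IsRootSystem] [P.IsIrreducible] {b : P.Base}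
  [P.IsCrystallographic] [P.IsReduced] {S : Set ι}

namespace LambdaChain

variable {lam : V} {Γ Γ' : LambdaChain b lam} {t q : ℕ} {J J' : Finset ℕ}

namespace IsDihedralSegment

theorem root_or_of_mem (h : Γ.IsDihedralSegment S t q) {i : ι} (hi : i ∈ S) :
    ∃ j < q, i = Γ.root (t + j) ∨ i = negRoot P (Γ.root (t + j)) := by
  by_cases hp : b.IsPos i
  · obtain ⟨j, hj, rfl⟩ := h.exists_root_eq hi hp
    exact ⟨j, hj, Or.inl rfl⟩
  · obtain ⟨j, hj, hji⟩ := h.exists_root_eq (h.1.negRoot_mem hi) ((isPos_negRoot b i).mpr hp)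
    exact ⟨j, hj, Or.inr (by rw [hji, negRoot_negRoot])⟩

theorem pull_mem_iff (h : Γ.IsDihedralSegment S t q) {p : ι} {j : ℕ} (hj : j ≤ q) :
    Γ.pull p J (t + j) ∈ S ↔ Γ.pull p J t ∈ S := by
  induction j with
  | zero => rfl
  | succ j ih =>
    rw [← ih (by omega), ← add_assoc]
    by_cases hJ : t + j ∈ J
    · rw [pull_succ _ _ hJ]
      have hr := (h.root_mem (show j < q by omega)).1
      refine ⟨fun hs => ?_, h.1.refl_smul_mem hr⟩
      have := h.1.refl_smul_mem hr hs
      rwa [refl_smul_refl_smul] at this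
    · rw [pull_succ_of_notMem _ _ hJ]

theorem pull_mem_of_contact (h : Γ.IsDihedralSegment S t q) {p : ι} {j : ℕ} (hj : j < q)
    (hC : Γ.Contact p J (t + j)) : Γ.pull p J t ∈ S := by
  rw [← h.pull_mem_iff hj.le]
  have hr := (h.root_mem hj).1
  rcases hC.2 with h1 | h1
  · rwa [← h1]
  · have := h.1.negRoot_mem hr
    rwa [h1, negRoot_negRoot] at this

/-- The common vertex is fixed by the reflections of the segment. -/
theorem affineAt_vertex (hlam : IsDominantWeight b lam) (h : Γ.IsDihedralSegment S t q) {z : V}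
    (hz : ∀ j < q, P.coroot' (Γ.root (t + j)) z = -Γ.count t (Γ.root (t + j))) {j : ℕ}
    (hj : j ≤ q) : Γ.affineAt J (t + j) z = Γ.affineAt J t z := by
  induction j with
  | zero => rfl
  | succ j ih =>
    rw [← add_assoc]
    by_cases hJ : t + j ∈ J
    · have hlen := h.2.1
      rw [affineAt_succ _ hJ, AffineEquiv.mul_def, AffineEquiv.trans_apply,
        Γ.affineRefl_apply hlam (by omega), hz j (by omega),
        h.count_eq (show j < q by omega) (show j ≤ q by omega)]
      simpa using ih (by omega)
    · rw [affineAt_succ_of_notMem _ hJ]; exact ih (by omega)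

/-- The folds of the segment fix the vertex `z`, so the height differs from a constant only by the
excess of the signed count over the count prescribed by `z`. -/
theorem height_of_signedCount (hlam : IsDominantWeight b lam) (h : Γ.IsDihedralSegment S t q)
    {z : V} (hz : ∀ j < q, P.coroot' (Γ.root (t + j)) z = -Γ.count t (Γ.root (t + j))) {p : ι}
    {j : ℕ} (hj : j ≤ q) {s : ℤ}
    (hs : (Γ.signedCount (t + j) (Γ.pull p J (t + j)) : ℝ) =
      -P.coroot' (Γ.pull p J (t + j)) z + s) :
    (Γ.height p J (t + j) : ℝ) = -P.coroot' p (Γ.affineAt J t z) + s := by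
  have hlen := h.2.1
  have h1 := Γ.coroot'_affineAt (J := J) p (t + j) z
  rw [h.affineAt_vertex hlam hz hj] at h1
  rw [Γ.height_eq hlam p (by omega), hs]
  linarith

theorem signedCount_eq (h : Γ.IsDihedralSegment S t q) {z : V}
    (hz : ∀ j < q, P.coroot' (Γ.root (t + j)) z = -Γ.count t (Γ.root (t + j))) {j k : ℕ}
    (hj : j < q) (hk : k ≤ q) :
    (Γ.signedCount (t + k) (Γ.root (t + j)) : ℝ) =
      -P.coroot' (Γ.root (t + j)) z + if j < k then 1 else 0 := by
  rw [signedCount, if_pos (h.root_mem hj).2, h.count_eq hj hk, hz j hj]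
  split_ifs <;> simp

theorem height_start (hlam : IsDominantWeight b lam) (h : Γ.IsDihedralSegment S t q) {z : V}
    (hz : ∀ j < q, P.coroot' (Γ.root (t + j)) z = -Γ.count t (Γ.root (t + j))) {p : ι}
    (hp : Γ.pull p J t ∈ S) : (Γ.height p J t : ℝ) = -P.coroot' p (Γ.affineAt J t z) := by
  have := h.height_of_signedCount (J := J) (p := p) hlam hz (Nat.zero_le q) (s := 0) ?_
  · simpa using this
  · obtain ⟨j, hj, hji | hji⟩ := h.root_or_of_mem hp
    · have := h.signedCount_eq hz hj (Nat.zero_le q)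
      rw [add_zero, hji]
      simpa using this
    · have := h.signedCount_eq hz hj (Nat.zero_le q)
      rw [add_zero, hji, signedCount_negRoot, coroot'_negRoot]
      simpa [eq_comm, neg_eq_iff_eq_neg] using this

/-- At a contact the wall to be crossed passes through the vertex and its root has not been counted
in the segment yet, so the excess is zero as at the start. -/
theorem height_of_contact (hlam : IsDominantWeight b lam) (h : Γ.IsDihedralSegment S t q) {p : ι}
    {j : ℕ} (hj : j < q) (hC : Γ.Contact p J (t + j)) :
    Γ.height p J (t + j) = Γ.height p J t := by
  obtain ⟨z, hz⟩ := h.exists_vertex hlam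
  have h1 := h.height_start hlam hz (h.pull_mem_of_contact hj hC)
  have h2 := h.height_of_signedCount (J := J) (p := p) hlam hz hj.le (s := 0) ?_
  · rw [Int.cast_zero, add_zero, ← h1] at h2
    exact_mod_cast h2
  · have h3 := h.signedCount_eq hz hj hj.le
    rw [if_neg (lt_irrefl j), add_zero] at h3
    rw [Int.cast_zero, add_zero]
    rcases hC.2 with h4 | h4
    · rw [← h4, h3]
    · have h5 : Γ.pull p J (t + j) = negRoot P (Γ.root (t + j)) := by rw [h4, negRoot_negRoot]
      rw [h5, signedCount_negRoot, coroot'_negRoot, Int.cast_neg, h3]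

/-- After the segment each of its positive roots has been counted once, so the excess is `1` or
`-1`. A height that has changed while the sign is positive betrays a contact. -/
theorem height_end_ne (hlam : IsDominantWeight b lam) (h : Γ.IsDihedralSegment S t q) {p : ι}
    (hp : Γ.pull p J t ∈ S) : Γ.height p J (t + q) ≠ Γ.height p J t := by
  obtain ⟨z, hz⟩ := h.exists_vertex hlam
  have h1 := h.height_start hlam hz hp
  intro heq
  have key : ∀ s : ℤ, s ≠ 0 → (Γ.signedCount (t + q) (Γ.pull p J (t + q)) : ℝ) ≠
      -P.coroot' (Γ.pull p J (t + q)) z + s := by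
    intro s hs hsc
    have h2 := h.height_of_signedCount (J := J) (p := p) hlam hz le_rfl hsc
    rw [heq, h1] at h2
    exact hs (by exact_mod_cast left_eq_add.mp h2)
  obtain ⟨j, hj, hji⟩ := h.root_or_of_mem ((h.pull_mem_iff le_rfl).mpr hp)
  have h3 := h.signedCount_eq hz hj le_rfl
  rw [if_pos hj] at h3
  rcases hji with hji | hji
  · refine key 1 one_ne_zero ?_
    rw [hji, h3]; simp
  · refine key (-1) (by norm_num) ?_
    rw [hji, signedCount_negRoot, coroot'_negRoot, Int.cast_neg, h3]
    push_cast; ring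

/-- If the direction of the wall belongs to the segment and the walk is positive at its start, then
there is a contact in the segment. -/
theorem exists_contact (hlam : IsDominantWeight b lam) (h : Γ.IsDihedralSegment S t q)
    (hJ : Γ.IsAdmissible J) {p : ι} (hpb : p ∈ b.support) (hp : Γ.pull p J t ∈ S)
    (hpos : b.IsPos (Γ.pull p J t)) : ∃ i, t ≤ i ∧ i < t + q ∧ Γ.Contact p J i := by
  by_contra hno
  push Not at hno
  exact h.height_end_ne hlam hp ((Γ.signedWalk hlam hJ hpb).pos_of_no_contact (Nat.le_add_right t q)
    h.2.1 hpos hno).2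

end IsDihedralSegment

end LambdaChain

end RootSystem

end AlcovePath

/-! ### Root operators commute with Yang–Baxter moves -/

namespace AlcovePath

section RootSystem

variable {ι V V' : Type*} [AddCommGroup V] [Module ℝ V] [AddCommGroup V'] [Module ℝ V']
  {P : RootPairing ι ℝ V V'} [Finite ι] [P.IsRootSystem] [P.IsIrreducible] {b : P.Base}
  [P.IsCrystallographic] [P.IsReduced] {S : Set ι}

namespace LambdaChain

variable {lam : V} {Γ Γ' : LambdaChain b lam} {t q : ℕ} {J J' : Finset ℕ}

theorem count_eq_of_le {a k : ℕ} (hak : a ≤ k) {i : ι} (h0 : Γ'.count a i = Γ.count a i)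
    (hr : ∀ l, a ≤ l → l < k → Γ'.root l = Γ.root l) : Γ'.count k i = Γ.count k i := by
  induction k, hak using Nat.le_induction with
  | base => exact h0
  | succ k hk ih =>
    rw [count_succ, count_succ, ih (fun l h1 h2 => hr l h1 (by omega)), hr k hk (by omega)]

namespace IsDihedralSegment

theorem count_end (h : Γ.IsDihedralSegment S t q) (i : ι) :
    Γ.count (t + q) i = Γ.count t i + (open Classical in if i ∈ S ∧ b.IsPos i then 1 else 0) := by
  split_ifs with hi
  · obtain ⟨j, hj, rfl⟩ := h.exists_root_eq hi.1 hi.2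
    rw [h.count_eq hj le_rfl, if_pos hj]
  · have key : ∀ k ≤ q, Γ.count (t + k) i = Γ.count t i := by
      intro k hk
      induction k with
      | zero => rfl
      | succ k ih =>
        rw [← add_assoc, count_succ, ih (by omega), if_neg, add_zero]
        · intro hr
          exact hi (hr ▸ h.root_mem (by omega))
    exact key q le_rfl

end IsDihedralSegment

namespace IsReversal

theorem count_eq (h : Γ.IsReversal Γ' S t q) {k : ℕ} (hk : k ≤ Γ.length) (hk' : k ≤ t ∨ t + q ≤ k)
    (i : ι) : Γ'.count k i = Γ.count k i := by
  have hlen := h.1.2.1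
  have h0 : ∀ k ≤ t, Γ'.count k i = Γ.count k i := fun k hk =>
    count_eq_of_le (Nat.zero_le k) (by simp [count]) fun l _ hl => h.root_eq (by omega) (by omega)
  rcases hk' with hk' | hk'
  · exact h0 k hk'
  · refine count_eq_of_le hk' ?_ fun l h1 h2 => h.root_eq (by omega) (by omega)
    rw [h.1.count_end, h.symm.1.count_end, h0 t le_rfl]

theorem affineRefl_eq (hlam : IsDominantWeight b lam) (h : Γ.IsReversal Γ' S t q) {k : ℕ}
    (hk : k < Γ.length) (hk' : k < t ∨ t + q ≤ k) : Γ'.affineRefl k = Γ.affineRefl k := by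
  rw [LambdaChain.affineRefl_eq hlam Γ hk, LambdaChain.affineRefl_eq hlam Γ' (h.2.1 ▸ hk),
    h.root_eq hk hk', h.count_eq hk.le (by omega)]

theorem exists_common_vertex (hlam : IsDominantWeight b lam) (h : Γ.IsReversal Γ' S t q) :
    ∃ z : V, (∀ j < q, P.coroot' (Γ.root (t + j)) z = -Γ.count t (Γ.root (t + j))) ∧
      ∀ j < q, P.coroot' (Γ'.root (t + j)) z = -Γ'.count t (Γ'.root (t + j)) := by
  obtain ⟨z, hz⟩ := h.1.exists_vertex hlam
  refine ⟨z, hz, fun j hj => ?_⟩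
  have := h.1.2.1
  rw [h.root_add hj, h.count_eq (by omega) (Or.inl le_rfl), hz _ (by omega)]

theorem weylAt_eq (h : Γ.IsReversal Γ' S t q) (hJ : Γ.IsAdmissible J)
    (hJJ : AgreeOutside Γ Γ' t q J J') {k : ℕ} (hk : k ≤ t ∨ t + q ≤ k) : Γ'.weylAt J' k = Γ.weylAt J k := by
  rcases hk with hk | hk
  · exact h.weylAt_eq_of_le (fun i hi => hJJ.mem_iff i (Or.inl hi)) hk
  · exact h.weylAt_eq_of_ge hJ.1 hJJ hk

theorem pull_eq (h : Γ.IsReversal Γ' S t q) (hJ : Γ.IsAdmissible J)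
    (hJJ : AgreeOutside Γ Γ' t q J J') (p : ι) {k : ℕ} (hk : k ≤ t ∨ t + q ≤ k) : Γ'.pull p J' k = Γ.pull p J k := by
  rw [pull, pull, h.weylAt_eq hJ hJJ hk]

theorem contact_iff (h : Γ.IsReversal Γ' S t q) (hJ : Γ.IsAdmissible J)
    (hJJ : AgreeOutside Γ Γ' t q J J') (p : ι) {k : ℕ} (hk : k < t ∨ t + q ≤ k) :
    Γ'.Contact p J' k ↔ Γ.Contact p J k := by
  unfold Contact
  rw [h.2.1, h.pull_eq hJ hJJ p (by omega)]
  exact and_congr_right fun hkn => by rw [h.root_eq hkn hk]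

/-- After the segment both affine maps have the same linear part and agree at the common vertex `z`,
where neither has moved since the start of the segment. -/
theorem affineAt_eq (hlam : IsDominantWeight b lam) (h : Γ.IsReversal Γ' S t q)
    (hJJ : AgreeOutside Γ Γ' t q J J') {k : ℕ} (hkn : k ≤ Γ.length) (hk : k ≤ t ∨ t + q ≤ k) :
    Γ'.affineAt J' k = Γ.affineAt J k := by
  have hlen := h.1.2.1
  have h0 : ∀ k ≤ t, Γ'.affineAt J' k = Γ.affineAt J k := fun k hk =>
    affineAt_eq_of_le (Nat.zero_le k) (by rw [affineAt_zero, affineAt_zero])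
      (fun i _ hi _ => h.affineRefl_eq hlam (by omega) (by omega))
      fun i _ hi => hJJ.mem_iff i (by omega)
  rcases hk with hk | hk
  · exact h0 k hk
  · refine affineAt_eq_of_le hk ?_ (fun i h1 h2 _ => h.affineRefl_eq hlam (by omega) (Or.inr h1))
      fun i hi _ => hJJ.mem_iff i (Or.inr hi)
    obtain ⟨z, hz, hz'⟩ := h.exists_common_vertex hlam
    have h1 := h.1.affineAt_vertex (J := J) hlam hz le_rfl
    have h2 := h.symm.1.affineAt_vertex (J := J') hlam hz' le_rfl
    rw [h0 t le_rfl, ← h1, affineAt_apply, Γ.affineAt_apply (t + q) z, hJJ.weylAt_eq] at h2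
    have h3 := add_left_cancel h2
    ext x
    rw [affineAt_apply, Γ.affineAt_apply, hJJ.weylAt_eq, h3]

theorem height_eq (hlam : IsDominantWeight b lam) (h : Γ.IsReversal Γ' S t q) (hJ : Γ.IsAdmissible J)
    (hJJ : AgreeOutside Γ Γ' t q J J') (p : ι) {k : ℕ} (hkn : k ≤ Γ.length) (hk : k ≤ t ∨ t + q ≤ k) :
    Γ'.height p J' k = Γ.height p J k := by
  rw [height, height, h.pull_eq hJ hJJ p hk, h.affineAt_eq hlam hJJ hkn hk, signedCount,
    signedCount, h.count_eq hkn hk, h.count_eq hkn hk]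

/-- Root operators commute with Yang–Baxter moves. -/
theorem exists_lowers (hlam : IsDominantWeight b lam) (h : Γ.IsReversal Γ' S t q) (hJ : Γ.IsAdmissible J)
    (hJJ : AgreeOutside Γ Γ' t q J J') (hJ' : Γ'.IsAdmissible J') {p : b.support} {K : Finset ℕ}
    (hK : Γ.Lowers p J K) : ∃ K', Γ'.Lowers p J' K' ∧ AgreeOutside Γ Γ' t q K K' := by
  obtain ⟨k, m, hl, rfl⟩ := (Γ.lowers_iff hlam hJ).mp hK
  have hw := Γ.signedWalk hlam hJ p.2
  have hlen := h.1.2.1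
  obtain ⟨-, -, hk, hpos, -, hmn⟩ := hw.lowersAt_spec hl
  have hL : ∀ i, t ≤ i → i < t + q → Γ.Contact p J i → Γ.height p J i = Γ.height p J t := by
    intro i h1 h2 hC
    obtain ⟨j, rfl⟩ := Nat.exists_eq_add_of_le h1
    exact h.1.height_of_contact hlam (by omega) hC
  have hL' : ∀ i, t ≤ i → i < t + q → Γ'.Contact p J' i → Γ'.height p J' i = Γ.height p J t := by
    intro i h1 h2 hC
    obtain ⟨j, rfl⟩ := Nat.exists_eq_add_of_le h1
    rw [← h.height_eq hlam hJ hJJ p (by omega) (Or.inl le_rfl)]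
    exact h.symm.1.height_of_contact hlam (by omega) hC
  have hpt := h.pull_eq hJ hJJ p (Or.inl (le_refl t))
  obtain ⟨k', m', hl', hkk, hmm⟩ := hl.transfer hlen hw.lt_of_contact
    (C' := Γ'.Contact p J') (e' := Γ'.height p J') (fun i hi => h.contact_iff hJ hJJ p hi)
    (fun i hin hi => h.height_eq hlam hJ hJJ p hin (by omega)) hL hL' hk (by
      -- The three cases of `LowersAt.transfer`: if the direction belongs to the subsystem and the
      -- sign is positive, both segments have contacts; if the sign is negative, a higher contact
      -- precedes the segment; if the direction is not in the subsystem, neither segment has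
      -- contacts.
      by_cases hS : Γ.pull p J t ∈ S
      · by_cases hpt' : b.IsPos (Γ.pull p J t)
        · exact Or.inl ⟨h.1.exists_contact hlam hJ p.2 hS hpt',
            h.symm.1.exists_contact hlam hJ' p.2 (hpt ▸ hS) (hpt ▸ hpt')⟩
        · exact Or.inr (Or.inl ⟨hw.exists_contact_of_neg (by omega) hpt',
            fun hkm => hpt' (hpos t hkm.1 hkm.2).1⟩)
      · refine Or.inr (Or.inr ⟨fun i h1 h2 hC => ?_, fun i h1 h2 hC => ?_⟩) <;>
          obtain ⟨j, rfl⟩ := Nat.exists_eq_add_of_le h1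
        · exact hS (h.1.pull_mem_of_contact (by omega) hC)
        · exact hS (hpt ▸ h.symm.1.pull_mem_of_contact (by omega) hC))
  rw [← h.2.1] at hl'
  refine ⟨_, (Γ'.lowers_iff hlam hJ').mpr ⟨k', m', hl', rfl⟩, ?_⟩
  have hs := (Γ.isSwap_of_lowersAt hlam hJ p.2 hl).1
  have hs' := (Γ'.isSwap_of_lowersAt hlam hJ' p.2 hl').1
  have hlt := hs.lt
  have hlt' := hs'.lt
  refine ⟨fun i hi => ?_, ?_⟩
  · have := hJJ.mem_iff i hi
    simp only [Finset.mem_insert, Finset.mem_erase, this]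
    have e1 : i = k' ↔ i = k := by omega
    have e2 : i = m' ↔ i = m := by omega
    rw [e1, Ne, e2]
  -- The positions `k`, `k'` lie on the same side of the end of the segment, and so do `m`, `m'`;
  -- hence both products acquire the factor `s_p` or neither does.
  · have he := hJJ.weylAt_eq
    by_cases h1 : t + q ≤ k
    · rw [hs.weylAt_of_le h1, hs'.weylAt_of_le (by omega), he]
    · by_cases h2 : t + q ≤ m
      · rw [hs.weylAt_of_mem (by omega) h2, hs'.weylAt_of_mem (by omega) (by omega), he]
      · rw [hs.weylAt_of_lt (hs.mem_or.resolve_right (by omega)) (by omega),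
          hs'.weylAt_of_lt (hs'.mem_or.resolve_right (by have := h.2.1; omega)) (by omega), he]

/-- A Yang–Baxter move is an isomorphism of directed colored graphs. -/
theorem exists_isGraphIso (hlam : IsDominantWeight b lam) (h : Γ.IsReversal Γ' S t q) :
    ∃ e : Γ.Admissible ≃ Γ'.Admissible, IsGraphIso e ∧ ∀ J, (e J).1 = Γ.yangBaxter S t q J.1 := by
  have key : ∀ {Γ Γ' : LambdaChain b lam}, Γ.IsReversal Γ' S t q → ∀ J : Γ.Admissible,
      Γ'.yangBaxter S t q (Γ.yangBaxter S t q J.1) = J.1 := by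
    intro Γ Γ' h J
    have h1 := h.yangBaxter_spec hlam J.2
    have h2 := h.symm.yangBaxter_spec hlam h1.1
    -- The move back yields an admissible set agreeing with the image outside the segment, as `J`
    -- does, so it is `J`.
    exact h.symm.agreeOutside_unique hlam h2.1 J.2 h2.2 h1.2.symm
  refine ⟨⟨fun J => ⟨_, (h.yangBaxter_spec hlam J.2).1⟩,
    fun K => ⟨_, (h.symm.yangBaxter_spec hlam K.2).1⟩, fun J => Subtype.ext (key h J),
    fun K => Subtype.ext (key h.symm K)⟩, fun p J K => ⟨fun hl => ?_, fun hl => ?_⟩, fun J => rfl⟩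
  · obtain ⟨hJ, hJJ⟩ := h.yangBaxter_spec hlam J.2
    obtain ⟨hK, hKK⟩ := h.yangBaxter_spec hlam K.2
    obtain ⟨K', hl', hKK'⟩ := h.exists_lowers hlam J.2 hJJ hJ hl
    have := h.agreeOutside_unique hlam (Lowers.isAdmissible Γ' hlam hJ hl') hK hKK' hKK
    rw [this] at hl'
    exact hl'
  · obtain ⟨hJ, hJJ⟩ := h.yangBaxter_spec hlam J.2
    obtain ⟨hK, hKK⟩ := h.yangBaxter_spec hlam K.2
    obtain ⟨K', hl', hKK'⟩ := h.symm.exists_lowers hlam hJ hJJ.symm J.2 hl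
    have := h.symm.agreeOutside_unique hlam (Lowers.isAdmissible Γ hlam J.2 hl') K.2 hKK' hKK.symm
    rw [this] at hl'
    exact hl'

end IsReversal

theorem IsYangBaxterComposite.exists_isGraphIso (hlam : IsDominantWeight b lam)
    {f : Finset ℕ → Finset ℕ} (h : IsYangBaxterComposite Γ Γ' f) :
    ∃ e : Γ.Admissible ≃ Γ'.Admissible, IsGraphIso e ∧ ∀ J, (e J).1 = f J.1 := by
  induction h with
  | refl => exact ⟨Equiv.refl _, fun _ _ _ => Iff.rfl, fun _ => rfl⟩
  | step _ hr ih =>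
    obtain ⟨e, he, hf⟩ := ih
    obtain ⟨e', he', hf'⟩ := hr.exists_isGraphIso hlam
    refine ⟨e.trans e', fun p J K => (he p J K).trans (he' p _ _), fun J => ?_⟩
    rw [Equiv.trans_apply, hf', hf]; rfl

end LambdaChain

end RootSystem

end AlcovePath

/-! ### Alternating words, braid moves and Matsumoto's theorem -/

namespace AlcovePath

/-- The alternating word `i j i ⋯` of length `m`. -/
def alternating {α : Type*} (i j : α) : ℕ → List α
  | 0 => []
  | m + 1 => i :: alternating j i m

section Alternating

variable {α : Type*} {i j : α}

theorem length_alternating (m : ℕ) : (alternating i j m).length = m := by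
  induction m generalizing i j with
  | zero => rfl
  | succ m ih => rw [alternating, List.length_cons, ih]

theorem take_alternating {k m : ℕ} (hk : k ≤ m) :
    (alternating i j m).take k = alternating i j k := by
  induction k generalizing i j m with
  | zero => rfl
  | succ k ih =>
    obtain ⟨m, rfl⟩ := Nat.exists_eq_add_of_lt hk
    rw [alternating, List.take_succ_cons, ih (by omega)]
    rfl

theorem mem_alternating {x : α} {m : ℕ} (hx : x ∈ alternating i j m) : x = i ∨ x = j := by
  induction m generalizing i j with
  | zero => simp [alternating] at hx
  | succ m ih =>
    rcases List.mem_cons.mp hx with hx | hx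
    exacts [Or.inl hx, (ih hx).symm]

variable {G : Type*} [Group G] {s : α → G}

theorem alternating_prod_succ (i j : α) (k : ℕ) :
    ((alternating i j (k + 1)).map s).prod = s i * ((alternating j i k).map s).prod := by
  rw [alternating, List.map_cons, List.prod_cons]

/-- These are the wall reflections along an alternating word: the reflections of the dihedral group
in rotational order. -/
theorem alternating_prod_mul_inv (hi : s i * s i = 1) (hj : s j * s j = 1) (k : ℕ) :
    ((alternating i j (k + 1)).map s).prod * (((alternating i j k).map s).prod)⁻¹ =
      (s i * s j) ^ k * s i := by
  induction k generalizing i j with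
  | zero => simp [alternating]
  | succ k ih =>
    rw [alternating_prod_succ i j (k + 1), alternating_prod_succ i j k, mul_inv_rev, mul_assoc,
      ← mul_assoc _ _ (s i)⁻¹, ih hj hi, inv_eq_of_mul_eq_one_right hi, pow_succ']
    have : s i * (s j * s i) ^ k = (s i * s j) ^ k * s i := by
      have h : SemiconjBy (s i) (s j * s i) (s i * s j) := by
        rw [SemiconjBy, mul_assoc]
      exact h.pow_right k
    rw [← mul_assoc, ← mul_assoc, this]
    have h' : (s i * s j) ^ k * s i * s j = s i * s j * (s i * s j) ^ k := by
      rw [mul_assoc, ← pow_succ, pow_succ']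
    rw [h']

/-- Because `s j` inverts the rotation `s i * s j`, the two alternating words of length `k` differ
by its `k`-th power. A braid relation of length `m` therefore means that this power is trivial for
`k = m`. -/
theorem alternating_prod_eq (hi : s i * s i = 1) (hj : s j * s j = 1) (k : ℕ) :
    ((alternating i j k).map s).prod = (s i * s j) ^ k * ((alternating j i k).map s).prod := by
  have hinv : s j * s i = (s i * s j)⁻¹ := by
    rw [mul_inv_rev, inv_eq_of_mul_eq_one_right hi, inv_eq_of_mul_eq_one_right hj]
  have hc : ∀ k : ℕ, s j * (s i * s j) ^ k = ((s i * s j)⁻¹) ^ k * s j := by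
    intro k
    have h : SemiconjBy (s j) (s i * s j) (s j * s i) := by rw [SemiconjBy, mul_assoc]
    rw [← hinv]
    exact h.pow_right k
  induction k with
  | zero => simp [alternating]
  | succ k ih =>
    rw [alternating_prod_succ, alternating_prod_succ, ih, ← mul_assoc (s j), hc, pow_succ']
    have : s i * s j * (s i * s j) ^ k * ((s i * s j)⁻¹ ^ k * s j *
        ((alternating j i k).map s).prod) =
        s i * (s j * s j) * ((alternating j i k).map s).prod := by
      rw [inv_pow]
      group
    rw [this, hj, mul_one]

theorem mul_pow_eq_one_of_alternating (hi : s i * s i = 1) (hj : s j * s j = 1) {m : ℕ}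
    (h : ((alternating i j m).map s).prod = ((alternating j i m).map s).prod) :
    (s i * s j) ^ m = 1 := by
  have := alternating_prod_eq hi hj m
  rw [h] at this
  exact right_eq_mul.mp this

/-- A word in two involutions has the same product as an alternating word that is not longer. -/
theorem exists_alternating (hi : s i * s i = 1) (hj : s j * s j = 1) {l : List α}
    (hl : ∀ x ∈ l, x = i ∨ x = j) : ∃ m ≤ l.length,
      (l.map s).prod = ((alternating i j m).map s).prod ∨
      (l.map s).prod = ((alternating j i m).map s).prod := by
  induction l with
  | nil => exact ⟨0, le_rfl, Or.inl rfl⟩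
  | cons x l ih =>
    obtain ⟨m, hm, h⟩ := ih fun y hy => hl y (List.mem_cons_of_mem _ hy)
    have key : ∀ {i j : α}, s i * s i = 1 → s j * s j = 1 →
        (l.map s).prod = ((alternating i j m).map s).prod →
        (∃ m' ≤ m + 1, s i * (l.map s).prod = ((alternating j i m').map s).prod ∨
          s i * (l.map s).prod = ((alternating i j m').map s).prod) ∧
        ∃ m' ≤ m + 1, s j * (l.map s).prod = ((alternating j i m').map s).prod := by
      intro i j hi hj h
      refine ⟨?_, m + 1, le_rfl, by rw [h, alternating_prod_succ]⟩
      cases m with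
      | zero => exact ⟨1, le_rfl, Or.inr (by rw [h]; rfl)⟩
      | succ m =>
        exact ⟨m, by omega, Or.inl (by rw [h, alternating_prod_succ, ← mul_assoc, hi, one_mul])⟩
    rw [List.map_cons, List.prod_cons, List.length_cons]
    rcases hl x List.mem_cons_self with rfl | rfl <;> rcases h with h | h
    · obtain ⟨⟨m', h1, h2⟩, -⟩ := key hi hj h
      exact ⟨m', by omega, h2.symm⟩
    · obtain ⟨-, m', h1, h2⟩ := key hj hi h
      exact ⟨m', by omega, Or.inl h2⟩
    · obtain ⟨-, m', h1, h2⟩ := key hi hj h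
      exact ⟨m', by omega, Or.inr h2⟩
    · obtain ⟨⟨m', h1, h2⟩, -⟩ := key hj hi h
      exact ⟨m', by omega, h2⟩

end Alternating

section RootSystem

variable {ι V V' : Type*} [AddCommGroup V] [Module ℝ V] [AddCommGroup V'] [Module ℝ V']
  {P : RootPairing ι ℝ V V'} [Finite ι] [P.IsRootSystem] [P.IsIrreducible] {b : P.Base}
  [P.IsCrystallographic] [P.IsReduced]

/-- A braid move between words in the generators of the affine Weyl group. -/
inductive BraidMove (b : P.Base) : List (Option b.support) → List (Option b.support) → Prop
  | intro (u v : List (Option b.support)) {i j : Option b.support} {m : ℕ}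
      (hij : affineSimple b i ≠ affineSimple b j)
      (h : affineProd b (alternating i j m) = affineProd b (alternating j i m)) :
      BraidMove b (u ++ alternating i j m ++ v) (u ++ alternating j i m ++ v)

theorem BraidMove.symm {w w' : List (Option b.support)} (h : BraidMove b w w') :
    BraidMove b w' w := by
  obtain ⟨u, v, hij, h⟩ := h
  exact ⟨u, v, hij.symm, h.symm⟩

theorem BraidMove.cons (x : Option b.support) {w w' : List (Option b.support)}
    (h : BraidMove b w w') : BraidMove b (x :: w) (x :: w') := by
  obtain ⟨u, v, hij, h⟩ := h
  exact ⟨x :: u, v, hij, h⟩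

theorem BraidMove.length_eq {w w' : List (Option b.support)} (h : BraidMove b w w') :
    w'.length = w.length := by
  obtain ⟨u, v, hij, h⟩ := h
  simp [length_alternating]

theorem BraidMove.affineProd_eq {w w' : List (Option b.support)} (h : BraidMove b w w') :
    affineProd b w' = affineProd b w := by
  obtain ⟨u, v, hij, h⟩ := h
  simp [affineProd_append, h]

theorem IsReducedWord.of_append {u v w : List (Option b.support)}
    (h : IsReducedWord b (u ++ v ++ w)) : IsReducedWord b v := by
  intro l hl
  have := h (u ++ l ++ w) (by rw [affineProd_append, affineProd_append, hl, ← affineProd_append,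
    ← affineProd_append])
  simpa using this

theorem IsReducedWord.length_eq {w w' : List (Option b.support)} (hw : IsReducedWord b w)
    (hw' : IsReducedWord b w') (h : affineProd b w = affineProd b w') : w.length = w'.length :=
  le_antisymm (hw w' h.symm) (hw' w h)

theorem IsReducedWord.of_eq {w w' : List (Option b.support)} (h : IsReducedWord b w)
    (hl : w'.length = w.length) (hw : affineProd b w' = affineProd b w) : IsReducedWord b w' := by
  intro l h'
  rw [hl]
  exact h l (h'.trans hw)

theorem affineProd_alternating_succ (i j : Option b.support) (k : ℕ) :
    affineProd b (alternating i j (k + 1)) = affineSimple b i * affineProd b (alternating j i k) :=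
  affineProd_cons b i _

/-- The generator `s₀` is the only one that moves the origin, and distinct simple roots have
distinct reflections. -/
theorem affineSimple_injective (b : P.Base) : Function.Injective (affineSimple b) := by
  have hsome : ∀ i : b.support, affineSimple b none ≠ affineSimple b (some i) := by
    intro i h
    have := congrArg (fun f : V ≃ᵃ[ℝ] V => f 0) h
    simp only [affineSimple, affineReflection_apply, map_zero] at this
    have hne := P.ne_zero (affineSimpleRoot b none)
    simp at this
    exact hne this
  intro x y hxy
  cases x with
  | none =>
    cases y with
    | none => rfl
    | some j => exact absurd hxy (hsome j)
  | some i =>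
    cases y with
    | none => exact absurd hxy.symm (hsome i)
    | some j =>
      exact congrArg some (Subtype.ext (eq_of_refl_eq (b.isPos_of_mem_support i.2)
        (b.isPos_of_mem_support j.2) (affineReflection_congr hxy)))

/-- Matsumoto's theorem: reduced words of the same element are related by braid moves. -/
theorem exists_braidMoves {w w' : List (Option b.support)} (hw : IsReducedWord b w)
    (hw' : IsReducedWord b w') (h : affineProd b w = affineProd b w') :
    Relation.ReflTransGen (BraidMove b) w w' := by
  induction hn : w.length generalizing w w' with
  | zero =>
    have := hw' w h
    rw [List.length_eq_zero_iff.mp hn, List.length_eq_zero_iff.mp (by omega : w'.length = 0)]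
  | succ n ih =>
    have hcons : ∀ {x : Option b.support} {l l' : List (Option b.support)},
        IsReducedWord b (x :: l) → IsReducedWord b (x :: l') → l.length = n →
        affineProd b (x :: l) = affineProd b (x :: l') →
        Relation.ReflTransGen (BraidMove b) (x :: l) (x :: l') := by
      intro x l l' hl hl' hlen heq
      rw [affineProd_cons, affineProd_cons] at heq
      have h1 : IsReducedWord b l := IsReducedWord.of_append (u := [x]) (w := []) (by simpa using hl)
      have h2 : IsReducedWord b l' :=
        IsReducedWord.of_append (u := [x]) (w := []) (by simpa using hl')
      exact (ih h1 h2 (mul_left_cancel heq) hlen).lift (x :: ·) fun _ _ hm => BraidMove.cons x hm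
    have hsymm : ∀ {l l' : List (Option b.support)}, Relation.ReflTransGen (BraidMove b) l l' →
        Relation.ReflTransGen (BraidMove b) l' l := fun hl => by
      have : Std.Symm (BraidMove b) := ⟨fun _ _ hm => hm.symm⟩
      exact symm hl
    -- The reduced words start with different letters `i` and `j`. The induction lengthens the
    -- initial alternating stretch `j i j ⋯` of the second word; `d` is the number of letters
    -- outside it.
    have key : ∀ d k : ℕ, d + k = n + 1 → ∀ {i j : Option b.support}
        {σ τ : List (Option b.support)}, affineSimple b i ≠ affineSimple b j →
        IsReducedWord b (i :: σ) → IsReducedWord b (alternating j i k ++ τ) → 0 < k →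
        σ.length = n → affineProd b (i :: σ) = affineProd b (alternating j i k ++ τ) →
        Relation.ReflTransGen (BraidMove b) (i :: σ) (alternating j i k ++ τ) := by
      intro d
      induction d using Nat.strong_induction_on with
      | _ d ihd =>
      intro k hk i j σ τ hij hω hω' hk0 hσ heq
      obtain ⟨k', rfl⟩ : ∃ k', k = k' + 1 := ⟨k - 1, by omega⟩
      obtain ⟨l, hl, he⟩ := exists_eraseIdx hω heq.symm
      have hlenA := length_alternating (i := j) (j := i) (k' + 1)
      have hlen := IsReducedWord.length_eq hω hω' heq
      rw [List.length_cons, hσ] at hlen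
      -- If the exchange deletes a letter of the alternating stretch, the rest of the word cancels
      -- and a relation in the two generators remains. By reducedness it must be the braid relation
      -- of length `k' + 1`.
      by_cases hlk : l < k' + 1
      · rw [List.eraseIdx_append_of_lt_length (by omega), affineProd_append, affineProd_append,
          ← mul_assoc, mul_left_inj] at he
        have hA : IsReducedWord b (alternating j i (k' + 1)) :=
          IsReducedWord.of_append (u := []) (by simpa using hω')
        obtain ⟨m, hm, hprod⟩ := exists_alternating (affineSimple_mul_self j)
          (affineSimple_mul_self i) (l := (alternating j i (k' + 1)).eraseIdx l)
          fun x hx => mem_alternating (List.mem_of_mem_eraseIdx hx)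
        rw [List.length_eraseIdx_of_lt (by omega), hlenA] at hm
        have hbraid : affineProd b (alternating i j (k' + 1)) =
            affineProd b (alternating j i (k' + 1)) := by
          rcases hprod with hprod | hprod
          · have h1 : affineProd b (alternating i j (m + 1)) =
                affineProd b (alternating j i (k' + 1)) := by
              change affineProd b _ = affineProd b _ at hprod
              rw [alternating, affineProd_cons, ← hprod, ← he, ← mul_assoc, affineSimple_mul_self,
                one_mul]
            have h2 := hA _ h1
            rw [length_alternating, length_alternating] at h2
            obtain rfl : m = k' := by omega
            exact h1
          · change affineProd b _ = affineProd b _ at hprod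
            rw [hprod] at he
            cases m with
            | zero =>
              have h1 : affineProd b (alternating i j 1) =
                  affineProd b (alternating j i (k' + 1)) := by
                have : affineProd b (alternating i j 1) = affineSimple b i := by
                  simp [alternating, affineProd]
                rw [this]
                exact ((eq_inv_of_mul_eq_one_right he).trans (affineSimple_inv i)).symm
              have h2 := hA _ h1
              rw [length_alternating, length_alternating] at h2
              obtain rfl : k' = 0 := by omega
              exact h1
            | succ m =>
              rw [affineProd_alternating_succ i j, mul_right_inj] at he
              have h2 := hA _ he.symm
              rw [length_alternating, length_alternating] at h2
              omega
        have hmove : BraidMove b (alternating i j (k' + 1) ++ τ) (alternating j i (k' + 1) ++ τ) :=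
          ⟨[], τ, hij, hbraid⟩
        have hred := hω'.of_eq hmove.symm.length_eq hmove.symm.affineProd_eq
        have hprod' := hmove.affineProd_eq
        exact (hcons hω hred hσ (heq.trans hprod')).tail hmove
      -- If it deletes a later letter, the result is a reduced word with a longer alternating
      -- stretch that starts with `i`. It is joined to the first word by induction on the length and
      -- to the second by induction on `d`, with `i` and `j` exchanged.
      · rw [List.eraseIdx_append_of_length_le (by omega)] at he
        set τ' := τ.eraseIdx (l - (alternating j i (k' + 1)).length) with hτ'
        have h1 : affineProd b (alternating i j (k' + 1 + 1) ++ τ') =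
            affineProd b (alternating j i (k' + 1) ++ τ) := by
          rw [alternating, List.cons_append, affineProd_cons, ← he, ← mul_assoc,
            affineSimple_mul_self, one_mul]
        have hlen' : (alternating i j (k' + 1 + 1) ++ τ').length =
            (alternating j i (k' + 1) ++ τ).length := by
          rw [List.length_append, length_alternating, hτ', List.length_eraseIdx_of_lt]
          · simp only [List.length_append] at hl ⊢; omega
          · simp only [List.length_append] at hl ⊢; omega
        have hred := hω'.of_eq hlen' h1
        have hkn : k' + 1 < n + 1 := by
          simp only [List.length_append] at hl hlen; omega
        have h2 := hcons hω hred hσ (heq.trans h1.symm)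
        have h3 := ihd (d - 1) (by omega) (k' + 1 + 1) (by omega) hij.symm hω' hred (by omega)
          (by
            change (alternating i j k' ++ τ).length = n
            rw [List.length_append, length_alternating] at hlen ⊢
            omega) h1.symm
        exact h2.trans (hsymm h3)
    have hlen : w'.length = n + 1 := by
      have h1 := hw w' h.symm
      have h2 := hw' w h
      omega
    cases w with
    | nil => simp at hn
    | cons i σ =>
      cases w' with
      | nil => simp at hlen
      | cons j τ =>
        by_cases hij : affineSimple b i = affineSimple b j
        · obtain rfl := affineSimple_injective b hij
          exact hcons hw hw' (by simpa using hn) h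
        · exact key n 1 rfl hij hw hw' one_pos (by simpa using hn) h

end RootSystem

end AlcovePath

/-! ### Dihedral reflection groups generate rank two subsystems -/

namespace AlcovePath

section RootSystem

variable {ι V V' : Type*} [AddCommGroup V] [Module ℝ V] [AddCommGroup V'] [Module ℝ V']
  {P : RootPairing ι ℝ V V'} [Finite ι] [P.IsRootSystem] [P.IsIrreducible] {b : P.Base}
  [P.IsCrystallographic] [P.IsReduced]

/-- The roots whose reflections are the reflections of a finite dihedral group form a rank two root
system. -/
theorem isRankTwoSubsystem_of_refl {x : ℕ → ι} {m : ℕ} (hm : 2 ≤ m) {c s g : P.weylGroup}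
    (hs : s * s = 1) (hsc : s * c = c⁻¹ * s) (hc : c ^ m = 1)
    (hx : ∀ j < m, refl P (x j) = g * (c ^ j * s) * g⁻¹) (h01 : refl P (x 0) ≠ refl P (x 1)) :
    IsRankTwoSubsystem P {k | ∃ j < m, refl P k = refl P (x j)} := by
  have hsemi : ∀ n : ℤ, s * c ^ n = c ^ (-n) * s := by
    intro n
    have h : SemiconjBy s c c⁻¹ := hsc
    have := h.zpow_right n
    rwa [SemiconjBy, inv_zpow, ← zpow_neg] at this
  -- Conjugating the reflection number `e` by the reflection number `a` gives number `2a - e`, read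
  -- modulo `m` since `c ^ m = 1`.
  have hprod : ∀ a e : ℕ, g * (c ^ a * s) * g⁻¹ * (g * (c ^ e * s) * g⁻¹) *
      (g * (c ^ a * s) * g⁻¹) = g * (c ^ (2 * (a : ℤ) - e) * s) * g⁻¹ := by
    intro a e
    have h1 : c ^ a * s * (c ^ e * s) * (c ^ a * s) = c ^ (2 * (a : ℤ) - e) * s := by
      have e1 := hsemi e
      rw [← zpow_natCast c a, ← zpow_natCast c e]
      calc c ^ (a : ℤ) * s * (c ^ (e : ℤ) * s) * (c ^ (a : ℤ) * s)
          = c ^ (a : ℤ) * (s * c ^ (e : ℤ)) * s * c ^ (a : ℤ) * s := by group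
        _ = c ^ (a : ℤ) * c ^ (-(e : ℤ)) * (s * s) * c ^ (a : ℤ) * s := by rw [e1]; group
        _ = c ^ (2 * (a : ℤ) - e) * s := by rw [hs]; group
    rw [← h1]; group
  refine ⟨?_, ?_⟩
  · rintro i ⟨a, ha, hia⟩ j ⟨e, he, hje⟩
    have hmod : ∃ d < m, c ^ (2 * (a : ℤ) - e) = c ^ d := by
      refine ⟨((2 * (a : ℤ) - e) % m).toNat, ?_, ?_⟩
      · have := Int.emod_lt_of_pos (2 * (a : ℤ) - e) (show (0 : ℤ) < m by omega)
        have := Int.emod_nonneg (2 * (a : ℤ) - e) (show (m : ℤ) ≠ 0 by omega)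
        omega
      · rw [← zpow_natCast c (Int.toNat _),
          Int.toNat_of_nonneg (Int.emod_nonneg _ (by omega))]
        conv_lhs => rw [← Int.emod_add_mul_ediv (2 * (a : ℤ) - e) m]
        rw [zpow_add, zpow_mul, zpow_natCast, hc, one_zpow, mul_one]
    obtain ⟨d, hd, hcd⟩ := hmod
    refine ⟨d, hd, ?_⟩
    change refl P (refl P i • j) = _
    rw [← refl_conj, refl_inv, hia, hje, hx a ha, hx e he, hprod, hcd, ← hx d hd]
  · have hspan : Submodule.span ℝ (P.root '' {k | ∃ j < m, refl P k = refl P (x j)}) =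
        Submodule.span ℝ {P.root (x 0), P.root (x 1)} := by
      apply le_antisymm
      · rw [Submodule.span_le]
        have hmem : ∀ j < m, P.root (x j) ∈
            Submodule.span ℝ {P.root (x 0), P.root (x 1)} := by
          intro j
          induction j using Nat.strong_induction_on with
          | _ j ih =>
          intro hj
          match j, hj, ih with
          | 0, _, _ => exact Submodule.subset_span (by simp)
          | 1, _, _ => exact Submodule.subset_span (by simp)
          | j + 2, hj, ih =>
            have h1 := ih (j + 1) (by omega) (by omega)
            have h0 := ih j (by omega) (by omega)
            -- Up to sign, each root is the reflection of the one two places earlier in its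
            -- predecessor, so the first two span them all.
            have hr : refl P (x (j + 2)) = refl P (refl P (x (j + 1)) • x j) := by
              rw [← refl_conj, refl_inv, hx _ hj, hx j (by omega), hx (j + 1) (by omega), hprod,
                ← zpow_natCast c (j + 2)]
              congr 4
              push_cast; ring
            have h2 : P.root (refl P (x (j + 1)) • x j) ∈
                Submodule.span ℝ {P.root (x 0), P.root (x 1)} := by
              rw [root_smul, refl_smul]
              exact sub_mem h0 (Submodule.smul_mem _ _ h1)
            rcases eq_or_eq_negRoot_of_refl_eq hr with h3 | h3
            · rwa [h3]
            · rw [h3, root_negRoot]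
              exact neg_mem h2
        rintro _ ⟨k, ⟨j, hj, hk⟩, rfl⟩
        rcases eq_or_eq_negRoot_of_refl_eq hk with h3 | h3
        · rw [h3]; exact hmem j hj
        · rw [h3, root_negRoot]; exact neg_mem (hmem j hj)
      · rw [Submodule.span_le]
        rintro _ (rfl | rfl)
        · exact Submodule.subset_span ⟨x 0, ⟨0, by omega, rfl⟩, rfl⟩
        · exact Submodule.subset_span ⟨x 1, ⟨1, by omega, rfl⟩, rfl⟩
    have hli : LinearIndependent ℝ ![P.root (x 0), P.root (x 1)] := by
      have h1 : x 0 ≠ x 1 := fun h => h01 (by rw [h])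
      have h2 : x 0 ≠ negRoot P (x 1) := fun h => h01 (by rw [h, refl_negRoot])
      exact RootPairing.IsReduced.linearIndependent P h1 (root_ne_of_ne h1 h2).2
    rw [hspan]
    have := finrank_span_eq_card hli
    rwa [Fintype.card_fin, Matrix.range_cons, Matrix.range_cons, Matrix.range_empty,
      Set.union_empty, Set.singleton_union] at this

/-- A translation of finite order is trivial. -/
theorem eq_one_of_isLinearPart_one {f : V ≃ᵃ[ℝ] V} (hf : IsLinearPart (1 : P.weylGroup) f) {m : ℕ}
    (hm : m ≠ 0) (h : f ^ m = 1) : f = 1 := by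
  have key : ∀ n : ℕ, (f ^ n) 0 = n • f 0 := by
    intro n
    induction n with
    | zero => simp
    | succ n ih =>
      rw [pow_succ', AffineEquiv.mul_def, AffineEquiv.trans_apply, hf, ih, one_smul, succ_nsmul]
  have h0 := key m
  rw [h] at h0
  have hf0 : f 0 = 0 := by
    have : IsAddTorsionFree V := .of_isTorsionFree ℝ V
    exact (nsmul_eq_zero_iff_right hm).mp h0.symm
  ext x
  rw [hf, hf0, one_smul, add_zero]; rfl

theorem refl_wordRoot {l : List (Option b.support)} {k : ℕ} (hk : k < l.length) :
    refl P (wordRoot b l k) = linearProd b (l.take (k + 1)) * (linearProd b (l.take k))⁻¹ := by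
  rw [wordRoot, ← refl_conj, List.take_add_one, linearProd_append, List.getElem?_eq_getElem hk,
    List.getD_eq_getElem _ _ hk]
  simp [linearProd]

theorem wordRefl_eq_mul_inv {l : List (Option b.support)} {k : ℕ} (hk : k < l.length) :
    wordRefl b l k = affineProd b (l.take (k + 1)) * (affineProd b (l.take k))⁻¹ := by
  rw [wordRefl, List.take_add_one, affineProd_append, List.getElem?_eq_getElem hk,
    List.getD_eq_getElem _ _ hk]
  simp [affineProd]

end RootSystem

end AlcovePath

/-! ### Braid moves between chains are reversals of dihedral segments -/

namespace AlcovePath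

section RootSystem

variable {ι V V' : Type*} [AddCommGroup V] [Module ℝ V] [AddCommGroup V'] [Module ℝ V']
  {P : RootPairing ι ℝ V V'} [Finite ι] [P.IsRootSystem] [P.IsIrreducible] {b : P.Base}
  [P.IsCrystallographic] [P.IsReduced] {u v : List (Option b.support)} {i j : Option b.support}
  {m k : ℕ}

theorem take_append_alternating (hk : k ≤ m) :
    (u ++ alternating i j m ++ v).take (u.length + k) = u ++ alternating i j k := by
  rw [List.append_assoc, List.take_length_add_append, List.take_append_of_le_length
    (by rwa [length_alternating]), take_alternating hk]

theorem refl_wordRoot_alternating (hk : k < m) :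
    refl P (wordRoot b (u ++ alternating i j m ++ v) (u.length + k)) = linearProd b u *
      ((refl P (affineSimpleRoot b i) * refl P (affineSimpleRoot b j)) ^ k *
        refl P (affineSimpleRoot b i)) * (linearProd b u)⁻¹ := by
  rw [refl_wordRoot (by simp only [List.length_append, length_alternating]; omega), add_assoc,
    take_append_alternating hk, take_append_alternating hk.le, linearProd_append, linearProd_append,
    ← alternating_prod_mul_inv (s := fun x => refl P (affineSimpleRoot b x)) (refl_mul_self _)
      (refl_mul_self _) k, mul_inv_rev]
  simp only [linearProd, mul_assoc]

theorem wordRefl_alternating (hk : k < m) :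
    wordRefl b (u ++ alternating i j m ++ v) (u.length + k) = affineProd b u *
      ((affineSimple b i * affineSimple b j) ^ k * affineSimple b i) * (affineProd b u)⁻¹ := by
  rw [wordRefl_eq_mul_inv (by simp only [List.length_append, length_alternating]; omega), add_assoc,
    take_append_alternating hk, take_append_alternating hk.le, affineProd_append, affineProd_append,
    ← alternating_prod_mul_inv (s := affineSimple b) (affineSimple_mul_self _)
      (affineSimple_mul_self _) k, mul_inv_rev]
  simp only [affineProd, mul_assoc]

theorem isLinearPart_affineSimple (b : P.Base) (i : Option b.support) :
    IsLinearPart (refl P (affineSimpleRoot b i)) (affineSimple b i) := by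
  obtain ⟨n, hn⟩ := exists_affineSimple_eq b i
  exact hn ▸ isLinearPart_affineReflection _ n

theorem IsLinearPart.pow {w : P.weylGroup} {f : V ≃ᵃ[ℝ] V} (h : IsLinearPart w f) (n : ℕ) :
    IsLinearPart (w ^ n) (f ^ n) := by
  induction n with
  | zero => exact isLinearPart_one
  | succ n ih => rw [pow_succ, pow_succ]; exact ih.mul h

theorem linearProd_eq_of_affineProd_eq {l l' : List (Option b.support)}
    (h : affineProd b l = affineProd b l') : linearProd b l = linearProd b l' :=
  (isLinearPart_affineProd b l).eq (h ▸ isLinearPart_affineProd b l')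

namespace LambdaChain

variable {lam : V} {Γ Γ' : LambdaChain b lam}

theorem ext_word (h : Γ.word = Γ'.word) : Γ = Γ' := by
  cases Γ; cases Γ'; cases h; rfl

/-- The roots of a chain in a braid segment are distinct. -/
theorem root_injOn_of_alternating (hw : Γ.word = u ++ alternating i j m ++ v)
    (h : affineProd b (alternating i j m) = affineProd b (alternating j i m)) {p r : ℕ}
    (hpr : p < r) (hr : r < m) :
    refl P (Γ.root (u.length + p)) ≠ refl P (Γ.root (u.length + r)) := by
  intro heq
  rw [root_eq_wordRoot, root_eq_wordRoot, hw, refl_wordRoot_alternating (hpr.trans hr),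
    refl_wordRoot_alternating hr, mul_left_inj, mul_right_inj, mul_left_inj] at heq
  obtain ⟨d, rfl⟩ := Nat.exists_eq_add_of_le hpr.le
  rw [pow_add, left_eq_mul] at heq
  -- Equal linear reflections make `(s_i s_j) ^ d` a translation. It has finite order by the braid
  -- relation, so it is trivial, and two walls of a reduced gallery would coincide.
  have hlin := ((isLinearPart_affineSimple b i).mul (isLinearPart_affineSimple b j)).pow d
  rw [heq] at hlin
  have hm := mul_pow_eq_one_of_alternating (s := affineSimple b) (affineSimple_mul_self i)
    (affineSimple_mul_self j) h
  have hone := eq_one_of_isLinearPart_one hlin (m := m) (by omega)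
    (by rw [← pow_mul, mul_comm, pow_mul, hm, one_pow])
  have hred := hw ▸ Γ.isReducedWord
  refine wordRefl_injOn hred (i := u.length + p) (j := u.length + (p + d)) (by omega) ?_ ?_
  · simp only [List.length_append, length_alternating]; omega
  · rw [wordRefl_alternating (hpr.trans hr), wordRefl_alternating hr, pow_add, hone, mul_one]

/-- A braid move between chains reverses a segment formed by the positive roots of a rank two
root system. -/
theorem isReversal_of_alternating (hlam : IsDominantWeight b lam)
    (hw : Γ.word = u ++ alternating i j m ++ v) (hw' : Γ'.word = u ++ alternating j i m ++ v)
    (h : affineProd b (alternating i j m) = affineProd b (alternating j i m)) (hm : 2 ≤ m) :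
    ∃ S, Γ.IsReversal Γ' S u.length m := by
  have hlen : Γ.length = u.length + m + v.length := by
    rw [length, hw]; simp [length_alternating]; omega
  have hlen' : Γ'.length = Γ.length := by
    rw [hlen, length, hw']; simp [length_alternating]; omega
  set s := refl P (affineSimpleRoot b i)
  set s' := refl P (affineSimpleRoot b j)
  have hs : s * s = 1 := refl_mul_self _
  have hs' : s' * s' = 1 := refl_mul_self _
  have hinv : (s * s')⁻¹ = s' * s := by
    rw [mul_inv_rev, inv_eq_of_mul_eq_one_right hs, inv_eq_of_mul_eq_one_right hs']
  have hroot : ∀ k < m, refl P (Γ.root (u.length + k)) =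
      linearProd b u * ((s * s') ^ k * s) * (linearProd b u)⁻¹ := by
    intro k hk
    rw [root_eq_wordRoot, hw, refl_wordRoot_alternating hk]
  have hroot' : ∀ k < m, refl P (Γ'.root (u.length + k)) =
      linearProd b u * ((s' * s) ^ k * s') * (linearProd b u)⁻¹ := by
    intro k hk
    rw [root_eq_wordRoot, hw', refl_wordRoot_alternating hk]
  have hlin := linearProd_eq_of_affineProd_eq h
  have hcm : (s * s') ^ m = 1 :=
    mul_pow_eq_one_of_alternating (s := fun x => refl P (affineSimpleRoot b x)) hs hs' hlin
  have hpos : ∀ k < Γ.length, b.IsPos (Γ.root k) := fun k hk => Γ.isPos_root hlam hk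
  have hpos' : ∀ k < Γ.length, b.IsPos (Γ'.root k) := fun k hk =>
    Γ'.isPos_root hlam (hlen' ▸ hk)
  have hS := isRankTwoSubsystem_of_refl (x := fun k => Γ.root (u.length + k)) hm hs
    (by rw [hinv, ← mul_assoc, hs, one_mul, mul_assoc, hs, mul_one]) hcm hroot
    (root_injOn_of_alternating hw h zero_lt_one (by omega))
  refine ⟨_, ⟨hS, by omega, fun k hk => ?_, fun k hk l hl hkl => ?_, fun r hr => ?_⟩, hlen',
    fun k hk => ?_⟩
  · have h1 := hk.1
    have h2 := hk.2
    exact ⟨⟨k - u.length, by omega, by rw [Nat.add_sub_cancel' h1]⟩, hpos k (by omega)⟩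
  · obtain ⟨p, rfl⟩ := Nat.exists_eq_add_of_le hk.1
    obtain ⟨r, rfl⟩ := Nat.exists_eq_add_of_le hl.1
    have h1 := hk.2
    have h2 := hl.2
    rcases lt_trichotomy p r with hpr | rfl | hpr
    · exact absurd (congrArg (refl P) hkl) (root_injOn_of_alternating hw h hpr (by omega))
    · rfl
    · exact absurd (congrArg (refl P) hkl.symm) (root_injOn_of_alternating hw h hpr (by omega))
  · obtain ⟨⟨k, hk, hkr⟩, hrp⟩ := hr
    exact ⟨u.length + k, ⟨by omega, by omega⟩,
      eq_of_refl_eq (hpos _ (by omega)) hrp hkr.symm⟩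
  · split_ifs with hseg
    · obtain ⟨p, rfl⟩ := Nat.exists_eq_add_of_le hseg.1
      rw [show 2 * u.length + m - 1 - (u.length + p) = u.length + (m - 1 - p) by omega]
      refine eq_of_refl_eq (hpos' _ hk) (hpos _ (by omega)) ?_
      rw [hroot' p (by omega), hroot _ (by omega), ← hinv]
      congr 2
      -- Since the rotation has trivial `m`-th power, reflection number `m - 1 - p` of the first
      -- alternating word is reflection number `p` of the other.
      have h1 : (s * s') ^ (m - 1 - p) = (s * s')⁻¹ ^ p * (s' * s) := by
        rw [← hinv, ← pow_succ, inv_pow, eq_inv_iff_mul_eq_one, ← pow_add,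
          show m - 1 - p + (p + 1) = m by omega, hcm]
      rw [h1, mul_assoc, mul_assoc, hs, mul_one]
    · refine eq_of_refl_eq (hpos' _ hk) (hpos _ hk) ?_
      rw [root_eq_wordRoot, root_eq_wordRoot, refl_wordRoot (show k < Γ.word.length from hk),
        refl_wordRoot (show k < Γ'.word.length from hk.trans_eq hlen'.symm)]
      have htake : ∀ l, l ≤ u.length ∨ u.length + m ≤ l →
          linearProd b (Γ'.word.take l) = linearProd b (Γ.word.take l) := by
        intro l hl
        rw [hw, hw']
        rcases hl with hl | hl
        · rw [List.append_assoc, List.append_assoc, List.take_append_of_le_length hl,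
            List.take_append_of_le_length hl]
        · obtain ⟨d, rfl⟩ := Nat.exists_eq_add_of_le hl
          have e : ∀ i j : Option b.support, (u ++ alternating i j m).length = u.length + m := by
            intro i j; rw [List.length_append, length_alternating]
          rw [← e j i, List.take_length_add_append, e j i, ← e i j, List.take_length_add_append]
          simp only [linearProd_append, hlin]
      rw [htake _ (by omega), htake _ (by omega)]

/-- Any two chains are related by Yang–Baxter moves. -/
theorem exists_isYangBaxterComposite (hlam : IsDominantWeight b lam) (Γ Γ' : LambdaChain b lam) :
    ∃ f, IsYangBaxterComposite Γ Γ' f := by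
  have key : ∀ w, Relation.ReflTransGen (BraidMove b) Γ.word w → ∀ Γ' : LambdaChain b lam,
      Γ'.word = w → ∃ f, IsYangBaxterComposite Γ Γ' f := by
    intro w hw
    induction hw with
    | refl =>
      intro Γ' h
      obtain rfl := ext_word h
      exact ⟨_, .refl⟩
    | @tail w w' _ hmove ih =>
      intro Γ' h
      have h1 : affineProd b w = affineProd b Γ'.word := by rw [h, hmove.affineProd_eq]
      have h2 : IsReducedWord b w := Γ'.isReducedWord.of_eq (by rw [h, hmove.length_eq]) h1
      obtain ⟨Γ₁, hΓ₁⟩ : ∃ Γ₁ : LambdaChain b lam, Γ₁.word = w :=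
        ⟨⟨w, h1 ▸ Γ'.maps_alcove, isReducedWord_iff.mp h2⟩, rfl⟩
      obtain ⟨f, hf⟩ := ih Γ₁ hΓ₁
      obtain @⟨u, v, i, j, m, hij, hprod⟩ := hmove
      by_cases hm : 2 ≤ m
      · obtain ⟨S, hS⟩ := isReversal_of_alternating hlam hΓ₁ h hprod hm
        exact ⟨_, hf.step hS⟩
      -- A braid move of length zero changes nothing, and one of length one would identify two
      -- distinct generators.
      · obtain rfl | rfl : m = 0 ∨ m = 1 := by omega
        · obtain rfl : Γ₁ = Γ' := ext_word (hΓ₁.trans h.symm)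
          exact ⟨f, hf⟩
        · exact absurd (by simpa [alternating, affineProd] using hprod) hij
  exact key _ (exists_braidMoves Γ.isReducedWord Γ'.isReducedWord (Γ.affineProd_word_eq Γ')) Γ' rfl

end LambdaChain

end RootSystem

end AlcovePath

/-! ### The theorem -/

theorem mainTheorem3 {ι V V' : Type*} [Finite ι] [AddCommGroup V] [Module ℝ V]
    [AddCommGroup V'] [Module ℝ V'] (P : RootPairing ι ℝ V V') [P.IsRootSystem]
    [P.IsCrystallographic] [P.IsReduced] [P.IsIrreducible] (b : P.Base)
    (lam : V) (hlam : AlcovePath.IsDominantWeight b lam)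
    (Γ Γ' : AlcovePath.LambdaChain b lam) :
    ∃ e : Γ.Admissible ≃ Γ'.Admissible,
      AlcovePath.LambdaChain.IsGraphIso e ∧
      (∀ e' : Γ.Admissible ≃ Γ'.Admissible, AlcovePath.LambdaChain.IsGraphIso e' → e' = e) ∧
      (∃ f : Finset ℕ → Finset ℕ, AlcovePath.LambdaChain.IsYangBaxterComposite Γ Γ' f) ∧
      ∀ f : Finset ℕ → Finset ℕ, AlcovePath.LambdaChain.IsYangBaxterComposite Γ Γ' f →
        ∀ J : Γ.Admissible, (e J).1 = f J.1 := by
  obtain ⟨f, hf⟩ := AlcovePath.LambdaChain.exists_isYangBaxterComposite hlam Γ Γ'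
  obtain ⟨e, he, -⟩ := hf.exists_isGraphIso hlam
  refine ⟨e, he, fun e' he' => he.unique hlam he', ⟨f, hf⟩, fun f' hf' J => ?_⟩
  -- Every composite of moves is itself an isomorphism, so uniqueness identifies it with `e`.
  obtain ⟨e', he', hef'⟩ := hf'.exists_isGraphIso hlam
  rw [← he.unique hlam he', hef']
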